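/- Let $n\in\{1,2\}$, let $J\subset\mathbb R^+$ and let $g$ be a real-valued $C^2$ function on $(0,\infty)$. Fix a smooth nonnegative even function $\varphi_0$ supported in $[-\frac45,\frac45]$, equal to $1$ on $[-\frac35,\frac35]$ and nonincreasing on $\mathbb R^+$, and put $Q_j(y)=\varphi_0(2^{-j-1}y)-\varphi_0(2^{-j}y)$ for $j\in\mathbb Z$. Let $\mathbb Z_J=\{k\in\mathbb Z:[2^{k-1},2^{k+1}]\subset J\}$. For a function $m$ on $(0,\infty)$, $m(|D|)$ is the Fourier multiplier with symbol $m(|\xi|)$. For a smooth function $P$ on $\mathbb R$ let $$I^0_{t,x,k}=\int_{\Omega_n}e^{ix\cdot\xi}e^{i\frac t\delta g(\delta|\xi|)}P\big(\tfrac{\delta|\xi|}{2^k}\big)\,d\xi,\qquad \Omega_1=(0,\infty),\quad \Omega_2=\mathbb R^2 .$$ For $\sigma\in(0,1]$, a pair $(q,r)\in[2,\infty]^2$ is sharp $\sigma$-admissible if $\frac1q+\frac\sigma r=\frac\sigma2$ and $(q,r,\sigma)\ne(2,\infty,1)$. Write $p'$ for the conjugate exponent of $p$, $L^q_tL^r_x=L^q(\mathbb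 R;L^r(\mathbb R^n))$, and $\|u\|_{\dot B^0_{r,2}}=\big(\sum_{j\in\mathbb Z}\|Q_j(|D|)u\|_{L^r}^2\big)^{1/2}$. Assume that there are $C>0$, $\sigma\in(0,1]$, $\beta,\gamma\in\mathbb R$ and a smooth $P$, supported in $\{\frac12\le|y|\le2\}$ and equal to $1$ on $\{\frac35\le|y|\le\frac85\}$, such that $$\sup_{x\in\mathbb R^n}|I^0_{t,x,k}|\le C\,2^{\gamma k}\,\frac{\delta^\beta}{|t|^\sigma}\qquad\text{for all }t\ne0,\ \delta>0,\ k\in\mathbb Z_J .$$ Below, $f$ is any function in $L^2(\mathbb R^n)$, and $F$ is any measurable function on $\mathbb R\times\mathbb R^n$ such that for almost every $s$ the function $F(s)$ lies in $L^p(\mathbb R^n)$ for some $p\in[1,\infty]$ (for example $F\in L^{q'}_tL^{r'}_x$ or $F\in L^{\tilde q'}_tL^{\tilde r'}_x$). The estimates that involve $F$ are understood for those $F$ for which the right-hand side is finite; the time integrals of the dyadic pieces then converge absolutely at every point. (1) For all sharp $\sigma$-admissible $(q,r)$, $(\tilde q,\tilde r)$ there is $C_1>0$ such that for all $\delta>0$,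 $k\in\mathbb Z_J$, $f$ and $F$ $$\Big\|e^{i\frac t\delta g(\delta|D|)}Q_k(\delta|D|)f\Big\|_{L^q_tL^r_x}\le C_1 2^{\gamma(\frac12-\frac1r)k}\delta^{\beta(\frac12-\frac1r)}\|Q_k(\delta|D|)f\|_{L^2},$$ $$\Big\|\int_{\mathbb R}e^{-i\frac s\delta g(\delta|D|)}Q_k(\delta|D|)F(s)\,ds\Big\|_{L^2}\le C_1 2^{\gamma(\frac12-\frac1r)k}\delta^{\beta(\frac12-\frac1r)}\|Q_k(\delta|D|)F\|_{L^{q'}_tL^{r'}_x},$$ $$\Big\|\int_{\mathbb R}e^{i\frac{t-s}\delta g(\delta|D|)}Q_k(\delta|D|)F(s)\,ds\Big\|_{L^q_tL^r_x}\le C_1 2^{\gamma(1-\frac1r-\frac1{\tilde r})k}\delta^{\beta(1-\frac1r-\frac1{\tilde r})}\|Q_k(\delta|D|)F\|_{L^{\tilde q'}_tL^{\tilde r'}_x},$$ and the last estimate also holds with $\int_{s<t}$ in place of $\int_{\mathbb R}$. (2) Let $\chi$ be a smooth bounded function on $(0,\infty)$ such that $\chi\sum_{k\in\mathbb Z_J}Q_k=\chi$.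 For all sharp $\sigma$-admissible $(q,r)$, $(\tilde q,\tilde r)$ with $r,\tilde r<\infty$ there is $C_2>0$ such that for all $\delta>0$, $f$ and $F$ $$\Big\|e^{i\frac t\delta g(\delta|D|)}\chi(\delta|D|)f\Big\|_{L^q_tL^r_x}\le C_2\,\delta^{(\beta+\gamma)(\frac12-\frac1r)}\big\||D|^{\gamma(\frac12-\frac1r)}\chi(\delta|D|)f\big\|_{L^2},$$ $$\Big\|\int_{\mathbb R}e^{-i\frac s\delta g(\delta|D|)}\chi(\delta|D|)F(s)\,ds\Big\|_{L^2}\le C_2\,\delta^{(\beta+\gamma)(\frac12-\frac1r)}\big\||D|^{\gamma(\frac12-\frac1r)}\chi(\delta|D|)F\big\|_{L^{q'}_tL^{r'}_x},$$ $$\Big\|\int_{\mathbb R}e^{i\frac{t-s}\delta g(\delta|D|)}\chi(\delta|D|)F(s)\,ds\Big\|_{L^q_tL^r_x}\le C_2\,\delta^{(\beta+\gamma)(1-\frac1r-\frac1{\tilde r})}\big\||D|^{\gamma(1-\frac1r-\frac1{\tilde r})}\chi(\delta|D|)F\big\|_{L^{\tilde q'}_tL^{\tilde r'}_x},$$ and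 the last estimate also holds with $\int_{s<t}$ in place of $\int_{\mathbb R}$. The functions in (2) are defined through their dyadic pieces: each operator is composed with $Q_j(|D|)$ for every $j\in\mathbb Z$, and the $L^p$ norm with $p<\infty$ of the result is the norm of the unique $u\in L^p$ with these pieces ($+\infty$ if there is none). (3) The estimates of (2) remain true if $r=\infty$, with $\dot B^0_{\infty,2}$ in place of $L^r$ and $\dot B^0_{1,2}$ in place of $L^{r'}$, and if $\tilde r=\infty$, with $\dot B^0_{1,2}$ in place of $L^{\tilde r'}$. -/

import Mathlib

open MeasureTheory Set
open scoped ENNReal ContDiff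

noncomputable section

namespace Dispersive

/-- The Euclidean space of dimension `n`. -/
abbrev E (n : ℕ) := EuclideanSpace ℝ (Fin n)

/-! ### Littlewood-Paley decomposition -/

/-- The cut-off functions from which a Littlewood-Paley decomposition is built. -/
structure IsBump (φ₀ : ℝ → ℝ) : Prop where
  smooth : ContDiff ℝ ∞ φ₀
  nonneg : ∀ y, 0 ≤ φ₀ y
  even : ∀ y, φ₀ (-y) = φ₀ y
  support_subset : Function.support φ₀ ⊆ Icc (-(4 / 5)) (4 / 5)
  eq_one : ∀ y ∈ Icc (-(3 / 5) : ℝ) (3 / 5), φ₀ y = 1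
  antitone : AntitoneOn φ₀ (Ici 0)

/-- `Q_j(y) = φ₀(2^{-j-1} y) - φ₀(2^{-j} y)`. -/
def Q (φ₀ : ℝ → ℝ) (j : ℤ) (y : ℝ) : ℝ :=
  φ₀ ((2 : ℝ) ^ (-j - 1) * y) - φ₀ ((2 : ℝ) ^ (-j) * y)

/-- `ℤ_J`, the set of the `k ∈ ℤ` such that `[2^{k-1}, 2^{k+1}] ⊆ J`. -/
def ZJ (J : Set ℝ) : Set ℤ :=
  {k | Icc ((2 : ℝ) ^ (k - 1)) ((2 : ℝ) ^ (k + 1)) ⊆ J}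

/-! ### The dyadic oscillatory integrals -/

/-- The symbol `y ↦ exp (i (τ / δ) g(δ y))` of the propagator `exp (i (τ / δ) g(δ|D|))`. -/
def phase (g : ℝ → ℝ) (δ τ : ℝ) (y : ℝ) : ℂ :=
  Complex.exp (Complex.I * ((τ / δ * g (δ * y) : ℝ) : ℂ))

/-- The integral `I^s_{t,x,k}` of `e^{i x·ξ} e^{i (t/δ) g(δ|ξ|)} P(δ|ξ|/2^k) |ξ|^s` with respect
to `ξ`; the domain of integration is the half line `ξ > 0` if `n = 1`, and the whole space
otherwise. -/
def dyadicIntegral (n : ℕ) (g : ℝ → ℝ) (P : ℝ → ℂ) (s δ t : ℝ) (k : ℤ) (x : E n) : ℂ :=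
  ∫ ξ in {ξ : E n | n = 1 → ∀ i, 0 < ξ i},
    Complex.exp (Complex.I * ((inner ℝ x ξ : ℝ) : ℂ)) * phase g δ t ‖ξ‖ *
      P (δ * ‖ξ‖ / (2 : ℝ) ^ k) * ((‖ξ‖ ^ s : ℝ) : ℂ)

/-! ### Fourier multipliers -/

/-- The inverse Fourier transform `(2π)^{-n} ∫ e^{i x·ξ} m(|ξ|) dξ`, that is, the convolution
kernel of `m(|D|)`. It is used below only for continuous symbols `ξ ↦ m(|ξ|)` whose support is
a compact subset of `ℝⁿ ∖ {0}`. -/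
def kernel (n : ℕ) (m : ℝ → ℂ) (x : E n) : ℂ :=
  (((2 * Real.pi) ^ n : ℝ) : ℂ)⁻¹ *
    ∫ ξ : E n, Complex.exp (Complex.I * ((inner ℝ x ξ : ℝ) : ℂ)) * m ‖ξ‖

/-- The function `m(|D|) u`, the convolution of `u` with the kernel of `m(|D|)`. -/
def mul (n : ℕ) (m : ℝ → ℂ) (u : E n → ℂ) : E n → ℂ :=
  convolution (kernel n m) u (ContinuousLinearMap.mul ℝ ℂ) volume

/-- The Littlewood-Paley pieces `Q_j(|D|) m(|D|) u`, `j ∈ ℤ`, of `m(|D|) u`. A symbol `m` that is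
only given on `(0, ∞)`, such as `y^a χ(δ y)`, is allowed here: `m(|D|) u` is described by its
dyadic pieces, each of which is the function with the symbol `m Q_j`. -/
def pieces (n : ℕ) (φ₀ : ℝ → ℝ) (m : ℝ → ℂ) (u : E n → ℂ) (j : ℤ) : E n → ℂ :=
  mul n (fun y => m y * (Q φ₀ j y : ℂ)) u

/-! ### Norms -/

/-- The norm of `L^q_t` applied to a family of norms in `x`. -/
def timeNorm (q : ℝ≥0∞) (N : ℝ → ℝ≥0∞) : ℝ≥0∞ := eLpNorm N q volume

/-- The norm of `L^q_t L^r_x`. -/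
def mixedNorm {n : ℕ} (q r : ℝ≥0∞) (U : ℝ → E n → ℂ) : ℝ≥0∞ :=
  timeNorm q (fun t => eLpNorm (U t) r volume)

/-- The `L^r` norm, `r < ∞`, of the object whose Littlewood-Paley pieces are the `a_j`: the norm of
the function `u ∈ L^r` with `Q_j(|D|) u = a_j` for all `j`, and `∞` if there is none. There is at
most one such `u`, because a function of `L^r`, `r < ∞`, whose pieces all vanish is zero. -/
def lebesgueNorm {n : ℕ} (φ₀ : ℝ → ℝ) (r : ℝ≥0∞) (a : ℤ → E n → ℂ) : ℝ≥0∞ :=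
  ⨅ (u : E n → ℂ) (_ : MemLp u r volume ∧
    ∀ j, mul n (fun y => (Q φ₀ j y : ℂ)) u =ᵐ[volume] a j), eLpNorm u r volume

/-- The homogeneous Besov norm with indices `0`, `r` and `2` of the object whose
Littlewood-Paley pieces are the `a_j`. -/
def besovNorm {n : ℕ} (r : ℝ≥0∞) (a : ℤ → E n → ℂ) : ℝ≥0∞ :=
  (∑' j, eLpNorm (a j) r volume ^ 2) ^ (1 / 2 : ℝ)

/-- The `L^r` norm if `r < ∞`, and the Besov norm with indices `0`, `∞` and `2` if `r = ∞`. -/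
def outNorm {n : ℕ} (φ₀ : ℝ → ℝ) (r : ℝ≥0∞) (a : ℤ → E n → ℂ) : ℝ≥0∞ :=
  open Classical in if r = ⊤ then besovNorm ⊤ a else lebesgueNorm φ₀ r a

/-- The `L^{r'}` norm if `r < ∞`, and the Besov norm with indices `0`, `1` and `2` if `r = ∞`. -/
def inNorm {n : ℕ} (φ₀ : ℝ → ℝ) (r : ℝ≥0∞) (a : ℤ → E n → ℂ) : ℝ≥0∞ :=
  open Classical in
    if r = ⊤ then besovNorm 1 a else lebesgueNorm φ₀ (ENNReal.conjExponent r) a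

/-- The class of the time-dependent functions `F` on which the operators act: `F` is jointly
measurable and almost every `F(s)` lies in some Lebesgue space. It contains all the spaces
`L^a_t L^b_x` with `1 ≤ a, b ≤ ∞`. -/
def IsSource {n : ℕ} (F : ℝ → E n → ℂ) : Prop :=
  AEStronglyMeasurable (Function.uncurry F) (volume.prod volume) ∧
    ∀ᵐ s : ℝ, ∃ p : ℝ≥0∞, 1 ≤ p ∧ MemLp (F s) p volume

/-! ### Admissible pairs -/

/-- Sharp `σ`-admissible pairs. -/
def SharpAdmissible (σ : ℝ) (q r : ℝ≥0∞) : Prop :=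
  2 ≤ q ∧ 2 ≤ r ∧ q⁻¹.toReal + σ * r⁻¹.toReal = σ / 2 ∧ ¬ (q = 2 ∧ r = ⊤ ∧ σ = 1)

/-- The number `1/2 - 1/r`. -/
def gap (r : ℝ≥0∞) : ℝ := 1 / 2 - r⁻¹.toReal

/-! ### Symbols of the operators -/

/-- The symbol of `e^{i (τ/δ) g(δ|D|)} Q_k(δ|D|)`. -/
def blockSym (φ₀ g : ℝ → ℝ) (δ : ℝ) (k : ℤ) (τ y : ℝ) : ℂ :=
  phase g δ τ y * (Q φ₀ k (δ * y) : ℂ)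

/-- The symbol of `Q_k(δ|D|)`. -/
def blockProj (φ₀ : ℝ → ℝ) (δ : ℝ) (k : ℤ) (y : ℝ) : ℂ := (Q φ₀ k (δ * y) : ℂ)

/-- The symbol of `e^{i (τ/δ) g(δ|D|)} χ(δ|D|)`. -/
def cutSym (g : ℝ → ℝ) (χ : ℝ → ℂ) (δ τ y : ℝ) : ℂ := phase g δ τ y * χ (δ * y)

/-- The symbol of `|D|^a χ(δ|D|)`. -/
def weightSym (χ : ℝ → ℂ) (δ a y : ℝ) : ℂ := ((y ^ a : ℝ) : ℂ) * χ (δ * y)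

end Dispersive

end

/-! A block is the propagator cut off to one dyadic annulus by a rescaled copy of `P`. The
dispersive hypothesis bounds its kernel by D |t|^{-σ}, so the block maps L^1 to L^∞ with that norm,
while the unimodular phase keeps it bounded on L^2. Interpolation (`exists_eLpNorm_mul_le_interp`)
gives L^{r'} → L^r with norm D^{1-2/r} |t|^{-2/q}; the power of t is where admissibility enters.
Since σ ≤ 1 and the endpoint is excluded, q > 2, so the TT* method combined with the
Hardy-Littlewood-Sobolev inequality in time (`exists_lintegral_rieszKernel_le`) yields the dual
estimate `exists_dual_le`. The homogeneous estimate is its transpose, and the inhomogeneous one is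
the composition of the two, because the propagator at time t - s factors. The restriction to s < t
is recovered by the Christ-Kiselev lemma `mixedNorm_retarded_le`, which applies because q₂' ≤ 2 < q.
All constants depend on the block only through D, a sup bound and the L^1 norm of a kernel; the last
two do not change under dilation, and D = A 2^{γk} δ^β produces the stated powers.

To have room for these manipulations, the block estimates are proved for symbols containing several
factors `p`, where p = 1 on the support of Q_k(δ·). One factor carries the dispersive estimate, the
others cost only the L^1 norm of their kernels, and all of them disappear when they act on a symbol
supported where p = 1. As `g` is only C^2, the kernels are integrable but not Schwartz; in dimension
at most three, two derivatives of the symbol suffice for that.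

For the summed estimates, a cut-off dyadic piece is a sum of at most four blocks, and on a block the
factor 2^{γk} is traded for the weight |D|^γ and a power of δ (`exists_kernel_weight_le`,
`dispersiveConst_rpow_mul`). This gives a bound for each piece that is uniform in the index. The
pieces are put together by two square function inequalities. For 2 ≤ r < ∞ the norm of a sum is at
most the ℓ^2 norm of the norms of its pieces (`exists_eLpNorm_sum_sq_le`); for 1 < p ≤ 2 the reverse
inequality (`exists_besovNorm_le`) holds by duality. Minkowski's inequality moves the ℓ^2 norm
through the time norm, in the right direction on both sides because q ≥ 2 and q' < 2. When r = ∞ the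
Besov norms are themselves these ℓ^2 norms, so both cases are treated together.

The square function inequality is proved without singular integrals. When a piece of frequency 2^i
is added to a sum S of lower ones, convexity bounds the increase of ‖S‖_r^r by the pairing of the
new piece with |S|^{r-2} S. Only the oscillation of |S|^{r-2} S at scale 2^{-i} contributes to that
pairing, and it is small because S has lower frequency. The resulting increments of ‖S‖_r^2 are
summed by an elementary inequality for geometric averages. -/

noncomputable section

namespace Dispersive
open FourierTransform SchwartzMap

/-! ### Plancherel's identity and integrability of Fourier transforms -/

section Plancherel
variable {V : Type*} [NormedAddCommGroup V] [InnerProductSpace ℝ V] [FiniteDimensional ℝ V]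
  [MeasurableSpace V] [BorelSpace V]

/-- Both transforms have the same integral against every smooth compactly supported `g`: in either
case the transform can be moved onto `g`, by Fubini for the Fourier integral and by the definition
on tempered distributions for the L^2 transform. -/
theorem fourier_ae_eq_fourier_toLp {f : V → ℂ} (h1 : Integrable f) (h2 : MemLp f 2 volume) :
    𝓕 f =ᵐ[volume] (𝓕 (h2.toLp f) : Lp ℂ 2 (volume : Measure V)) := by
  have hc : Continuous (𝓕 f) := VectorFourier.fourierIntegral_continuous
    Real.continuous_fourierChar (innerSL ℝ).continuous₂ h1
  refine ae_eq_of_integral_contDiff_smul_eq hc.locallyIntegrable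
    ((Lp.memLp _).locallyIntegrable (by norm_num)) ?_
  intro g g_smooth g_cpt
  have hg₁ : HasCompactSupport (Complex.ofRealCLM ∘ g) := g_cpt.comp_left rfl
  have hg₂ : ContDiff ℝ ∞ (Complex.ofRealCLM ∘ g) := by fun_prop
  set G : 𝓢(V, ℂ) := hg₁.toSchwartzMap hg₂ with hG
  have hGg : ∀ x, G x = (g x : ℂ) := fun x => rfl
  have e1 : ∫ x, g x • 𝓕 f x = ∫ x, (𝓕 G) x • f x := by
    have := VectorFourier.integral_fourierIntegral_smul_eq_flip (L := innerₗ V)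
      (f := (G : V → ℂ)) (g := f) (μ := volume) (ν := volume) Real.continuous_fourierChar
      (by exact continuous_inner) G.integrable h1
    rw [flip_innerₗ] at this
    rw [SchwartzMap.fourier_coe]
    exact this.symm
  have e2 : ∫ x, g x • (𝓕 (h2.toLp f) : Lp ℂ 2 (volume : Measure V)) x =
      ∫ x, (𝓕 G) x • f x := by
    have h := congrArg (fun T => T G) (Lp.fourier_toTemperedDistribution_eq (h2.toLp f))
    simp only [TemperedDistribution.fourier_apply, Lp.toTemperedDistribution_apply] at h
    refine Eq.trans h.symm ?_
    refine integral_congr_ae ?_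
    filter_upwards [h2.coeFn_toLp] with x hx
    rw [hx]
  rw [e1, e2]

theorem eLpNorm_fourier_eq {f : V → ℂ} (h1 : Integrable f) (h2 : MemLp f 2 volume) :
    eLpNorm (𝓕 f) 2 volume = eLpNorm f 2 volume := by
  rw [eLpNorm_congr_ae (fourier_ae_eq_fourier_toLp h1 h2), ← Lp.enorm_def,
    ← eLpNorm_congr_ae h2.coeFn_toLp, ← Lp.enorm_def]
  rw [← ofReal_norm, ← ofReal_norm, Lp.norm_fourier_eq]

theorem memLp_fourier {f : V → ℂ} (h1 : Integrable f) (h2 : MemLp f 2 volume) :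
    MemLp (𝓕 f) 2 volume :=
  ⟨(VectorFourier.fourierIntegral_continuous
    Real.continuous_fourierChar (innerSL ℝ).continuous₂ h1).aestronglyMeasurable,
    by rw [eLpNorm_fourier_eq h1 h2]; exact h2.2⟩

end Plancherel

theorem memLp_of_continuous_compact {n : ℕ} {p : ℝ≥0∞} {f : E n → ℂ} (hf : Continuous f)
    (hs : HasCompactSupport f) : MemLp f p volume := hf.memLp_of_hasCompactSupport hs

/-- Up to the factor (2πi)^2 this is the transform of the second derivative of `f` in the direction
`i`, which is continuous with compact support and so lies in L^1 and L^2. -/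
theorem memLp_coord_sq_mul_fourier {n : ℕ} {f : E n → ℂ} (hf : ContDiff ℝ 2 f)
    (hs : HasCompactSupport f) (i : Fin n) :
    MemLp (fun x : E n => ((x i ^ 2 : ℝ) : ℂ) * 𝓕 f x) 2 volume := by
  have hf' : ContDiff ℝ ((2 : ℕ∞) : WithTop ℕ∞) f := hf
  have hcont : ∀ k : ℕ, k ≤ 2 → Continuous (iteratedFDeriv ℝ k f) := fun k hk =>
    hf.continuous_iteratedFDeriv (by exact_mod_cast hk)
  have hint : ∀ k : ℕ, (k : ℕ∞) ≤ 2 → Integrable (iteratedFDeriv ℝ k f) := fun k hk =>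
    (hcont k (by exact_mod_cast hk)).integrable_of_hasCompactSupport (hs.iteratedFDeriv k)
  have key := Real.fourier_iteratedFDeriv hf' hint (n := 2) le_rfl
  let e : E n := EuclideanSpace.single i 1
  set d : E n → ℂ := fun x => iteratedFDeriv ℝ 2 f x (fun _ => e) with hd
  have hdc : Continuous d := by
    have := hcont 2 le_rfl
    exact (ContinuousMultilinearMap.apply ℝ (fun _ : Fin 2 => E n) ℂ (fun _ => e)).continuous.comp
      this
  have hds : HasCompactSupport d :=
    (hs.iteratedFDeriv (𝕜 := ℝ) 2).comp_left
      (g := fun L : ContinuousMultilinearMap ℝ (fun _ : Fin 2 => E n) ℂ => L (fun _ => e)) rfl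
  have hF := memLp_fourier (hdc.integrable_of_hasCompactSupport hds)
    (memLp_of_continuous_compact (p := 2) hdc hds)
  have hval : ∀ x, 𝓕 d x = (2 * Real.pi * Complex.I) ^ 2 * (((x i ^ 2 : ℝ) : ℂ) * 𝓕 f x) := by
    intro x
    have h1 := congrFun key x
    have h2 := Real.fourier_continuousMultilinearMap_apply (v := x) (m := fun _ => e)
      (hint 2 le_rfl)
    rw [← h2, h1, VectorFourier.fourierPowSMulRight_apply]
    have h3 : ((innerSL ℝ) x) (EuclideanSpace.single i 1) = x i := by
      rw [innerSL_apply_apply, EuclideanSpace.inner_single_right]; simp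
    simp [e, Finset.prod_const, h3]
  have hne : (2 * Real.pi * Complex.I : ℂ) ^ 2 ≠ 0 := by simp [Real.pi_ne_zero]
  have := hF.const_mul ((2 * Real.pi * Complex.I : ℂ) ^ 2)⁻¹
  refine this.ae_eq (Filter.Eventually.of_forall fun x => ?_)
  simp only [hval]
  rw [inv_mul_cancel_left₀ hne]

/-- Cauchy-Schwarz for the product of (1+|x|^2)^{-1} and (1+|x|^2) times the transform. The first
factor is square integrable exactly when n < 4, which is the origin of the bound on the dimension in
everything that follows. -/
theorem integrable_fourier_of_contDiff_two {n : ℕ} (hn : n ≤ 3) {f : E n → ℂ}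
    (hf : ContDiff ℝ 2 f) (hs : HasCompactSupport f) : Integrable (𝓕 f) := by
  have h0 := memLp_fourier (hf.continuous.integrable_of_hasCompactSupport hs)
    (memLp_of_continuous_compact (p := 2) hf.continuous hs)
  have h1 : MemLp (fun x : E n => ((1 + ‖x‖ ^ 2 : ℝ) : ℂ) * 𝓕 f x) 2 volume := by
    have h2 := memLp_finsetSum' Finset.univ
      (fun i (_ : i ∈ Finset.univ) => memLp_coord_sq_mul_fourier hf hs i)
    refine (h0.add h2).ae_eq (Filter.Eventually.of_forall fun x => ?_)
    simp only [Pi.add_apply, Finset.sum_apply, EuclideanSpace.norm_sq_eq, Real.norm_eq_abs, sq_abs]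
    push_cast
    rw [add_mul, one_mul, Finset.sum_mul]
  have h3 : MemLp (fun x : E n => (((1 + ‖x‖ ^ 2) ^ (-1 : ℝ) : ℝ) : ℂ)) 2 volume := by
    have hc : Continuous (fun x : E n => (((1 + ‖x‖ ^ 2) ^ (-1 : ℝ) : ℝ) : ℂ)) := by
      refine Complex.continuous_ofReal.comp (Continuous.rpow_const (by fun_prop) fun x => Or.inl ?_)
      positivity
    rw [memLp_two_iff_integrable_sq_norm hc.aestronglyMeasurable]
    have := integrable_rpow_neg_one_add_norm_sq (E := E n) (μ := volume) (r := 4)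
      (by simp only [finrank_euclideanSpace, Fintype.card_fin]; exact_mod_cast (by omega : n < 4))
    refine this.congr (Filter.Eventually.of_forall fun x => ?_)
    simp only [Complex.norm_real, Real.norm_eq_abs, sq_abs]
    rw [← Real.rpow_mul_natCast (by positivity)]
    norm_num
  have := h3.integrable_mul h1
  refine this.congr (Filter.Eventually.of_forall fun x => ?_)
  simp only [Pi.mul_apply]
  rw [← mul_assoc, ← Complex.ofReal_mul, Real.rpow_neg_one, inv_mul_cancel₀ (by positivity)]
  simp

/-- From |f|^s ≤ ‖f‖_∞^{s-p} |f|^p. -/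
theorem memLp_of_memLp_of_memLp_top {α F : Type*} [MeasurableSpace α] {μ : Measure α}
    [NormedAddCommGroup F] {f : α → F} {p s : ℝ≥0∞} (hps : p ≤ s) (hp0 : p ≠ 0)
    (hp : MemLp f p μ) (ht : MemLp f ⊤ μ) : MemLp f s μ := by
  rcases eq_or_ne s ⊤ with rfl | hs
  · exact ht
  have hpt : p ≠ ⊤ := ne_top_of_le_ne_top hs hps
  have hs0 : s ≠ 0 := fun h => hp0 (by simpa [h] using hps)
  refine ⟨hp.1, ?_⟩
  rw [eLpNorm_lt_top_iff_lintegral_rpow_enorm_lt_top hs0 hs]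
  have hpr : p.toReal ≤ s.toReal := ENNReal.toReal_mono hs hps
  set M := eLpNorm f ⊤ μ with hM
  have hMt : M ≠ ⊤ := ht.2.ne
  have hae : ∀ᵐ x ∂μ, ‖f x‖ₑ ^ s.toReal ≤ M ^ (s.toReal - p.toReal) * ‖f x‖ₑ ^ p.toReal := by
    have := enorm_ae_le_eLpNormEssSup f μ
    filter_upwards [this] with x hx
    calc ‖f x‖ₑ ^ s.toReal = ‖f x‖ₑ ^ ((s.toReal - p.toReal) + p.toReal) := by ring_nf
      _ = ‖f x‖ₑ ^ (s.toReal - p.toReal) * ‖f x‖ₑ ^ p.toReal :=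
        ENNReal.rpow_add_of_nonneg _ _ (by linarith) ENNReal.toReal_nonneg
      _ ≤ _ := by
        gcongr
        rw [hM, eLpNorm_exponent_top]; exact hx
  refine (lintegral_mono_ae hae).trans_lt ?_
  rw [lintegral_const_mul' _ _ (ENNReal.rpow_ne_top_of_nonneg (by linarith) hMt)]
  exact ENNReal.mul_lt_top (ENNReal.rpow_ne_top_of_nonneg (by linarith) hMt).lt_top
    (lintegral_rpow_enorm_lt_top_of_eLpNorm_lt_top hp0 hpt hp.2)

/-! ### Symbols and kernels -/

/-- Radial symbols of class `C²` supported in a compact subset of the complement of the origin. -/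
structure IsSym (m : ℝ → ℂ) : Prop where
  supp : ∃ a b : ℝ, 0 < a ∧ ∀ y, 0 ≤ y → m y ≠ 0 → a ≤ y ∧ y ≤ b
  contDiffOn : ContDiffOn ℝ 2 m (Ioi 0)

theorem IsSym.mul_right {m₁ m₂ : ℝ → ℂ} (h₁ : IsSym m₁) (h₂ : ContDiffOn ℝ 2 m₂ (Ioi 0)) :
    IsSym (fun y => m₁ y * m₂ y) := by
  obtain ⟨a, b, ha, hab⟩ := h₁.supp
  exact ⟨⟨a, b, ha, fun y hy h => hab y hy (left_ne_zero_of_mul h)⟩, h₁.contDiffOn.mul h₂⟩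

theorem IsSym.mul_left {m₁ m₂ : ℝ → ℂ} (h₁ : ContDiffOn ℝ 2 m₁ (Ioi 0)) (h₂ : IsSym m₂) :
    IsSym (fun y => m₁ y * m₂ y) := by
  simpa only [mul_comm] using h₂.mul_right h₁

theorem IsSym.conj {m : ℝ → ℂ} (h : IsSym m) : IsSym (fun y => starRingEnd ℂ (m y)) := by
  obtain ⟨a, b, ha, hab⟩ := h.supp
  refine ⟨⟨a, b, ha, fun y hy h => hab y hy (by simpa using h)⟩, ?_⟩
  exact Complex.conjCLE.contDiff.comp_contDiffOn h.contDiffOn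

theorem IsSym.dilate {m : ℝ → ℂ} (h : IsSym m) {l : ℝ} (hl : 0 < l) :
    IsSym (fun y => m (l * y)) := by
  obtain ⟨a, b, ha, hab⟩ := h.supp
  refine ⟨⟨a / l, b / l, by positivity, fun y hy h => ?_⟩, ?_⟩
  · have := hab (l * y) (by positivity) h
    constructor
    · rw [div_le_iff₀ hl]; linarith
    · rw [le_div_iff₀ hl]; linarith
  · exact h.contDiffOn.comp (by fun_prop) fun y hy => mul_pos hl hy

/-- The symbol `m(|D|)` in the normalisation of Mathlib's Fourier transform. -/
def rad (n : ℕ) (m : ℝ → ℂ) (η : E n) : ℂ := m (2 * Real.pi * ‖η‖)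

/-- The norm is smooth away from the origin, and near the origin the symbol vanishes. -/
theorem IsSym.contDiff_rad_of {n : ℕ} {m : ℝ → ℂ} (h : IsSym m) {N : WithTop ℕ∞}
    (hs : ContDiffOn ℝ N m (Ioi 0)) : ContDiff ℝ N (rad n m) := by
  obtain ⟨a, b, ha, hab⟩ := h.supp
  rw [contDiff_iff_contDiffAt]
  intro η
  by_cases hη : η = 0
  · subst hη
    have : rad n m =ᶠ[nhds 0] fun _ => 0 := by
      have hlt : ∀ᶠ η : E n in nhds 0, 2 * Real.pi * ‖η‖ < a := by
        have hc : Continuous fun η : E n => 2 * Real.pi * ‖η‖ := by fun_prop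
        exact hc.continuousAt.eventually_lt continuousAt_const (by simpa using ha)
      filter_upwards [hlt] with x hx
      by_contra hne
      exact absurd (hab _ (by positivity) hne).1 (not_le.2 hx)
    exact contDiffAt_const.congr_of_eventuallyEq this
  · have hpos : 0 < 2 * Real.pi * ‖η‖ := by have := norm_pos_iff.2 hη; positivity
    refine ContDiffAt.comp η (hs.contDiffAt (Ioi_mem_nhds hpos)) ?_
    exact contDiffAt_const.mul (contDiffAt_norm ℝ hη)

theorem IsSym.contDiff_rad {n : ℕ} {m : ℝ → ℂ} (h : IsSym m) : ContDiff ℝ 2 (rad n m) :=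
  h.contDiff_rad_of h.contDiffOn

theorem IsSym.hasCompactSupport_rad {n : ℕ} {m : ℝ → ℂ} (h : IsSym m) :
    HasCompactSupport (rad n m) := by
  obtain ⟨a, b, ha, hab⟩ := h.supp
  refine HasCompactSupport.intro (isCompact_closedBall (0 : E n) (b / (2 * Real.pi))) ?_
  intro x hx
  by_contra hne
  apply hx
  have := (hab _ (by positivity) hne).2
  rw [mem_closedBall_zero_iff, le_div_iff₀ (by positivity)]
  linarith

theorem IsSym.integrable_rad {n : ℕ} {m : ℝ → ℂ} (h : IsSym m) : Integrable (rad n m) :=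
  h.contDiff_rad.continuous.integrable_of_hasCompactSupport h.hasCompactSupport_rad

/-- The substitution ξ = 2πη absorbs the factor (2π)^{-n}. -/
theorem kernel_eq_fourierInv (n : ℕ) (m : ℝ → ℂ) : kernel n m = 𝓕⁻ (rad n m) := by
  ext x
  rw [kernel, Real.fourierInv_eq']
  have h := Measure.integral_comp_smul (volume : Measure (E n))
    (fun ξ : E n => Complex.exp (Complex.I * ((inner ℝ x ξ : ℝ) : ℂ)) * m ‖ξ‖) (2 * Real.pi)
  have hpos : (0 : ℝ) < 2 * Real.pi := by positivity
  rw [finrank_euclideanSpace, Fintype.card_fin, abs_of_pos (by positivity),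
    Complex.real_smul, Complex.ofReal_inv] at h
  rw [← h]
  refine integral_congr_ae (Filter.Eventually.of_forall fun ξ => ?_)
  simp only [rad, norm_smul, Real.norm_eq_abs, abs_of_pos hpos, inner_smul_right, smul_eq_mul,
    real_inner_comm]
  congr 2
  push_cast
  ring

/-- A radial symbol is even, so the transform and its inverse coincide on it. The evenness of
kernels, used for transposition, comes from the same fact. -/
theorem kernel_eq_fourier (n : ℕ) (m : ℝ → ℂ) : kernel n m = 𝓕 (rad n m) := by
  rw [kernel_eq_fourierInv, Real.fourierInv_eq_fourier_comp_neg]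
  congr 1
  ext x
  simp [rad]

theorem kernel_neg (n : ℕ) (m : ℝ → ℂ) (x : E n) : kernel n m (-x) = kernel n m x := by
  rw [kernel_eq_fourierInv, Real.fourierInv_eq_fourier_neg, neg_neg, ← kernel_eq_fourier,
    kernel_eq_fourierInv]

theorem kernel_conj (n : ℕ) (m : ℝ → ℂ) (x : E n) :
    kernel n (fun y => starRingEnd ℂ (m y)) x = starRingEnd ℂ (kernel n m x) := by
  rw [← kernel_neg n m x, kernel, kernel, map_mul, ← integral_conj]
  congr 1
  · simp [map_ofNat]
  · refine integral_congr_ae (Filter.Eventually.of_forall fun ξ => ?_)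
    simp only [map_mul, ← Complex.exp_conj, Complex.conj_I, Complex.conj_ofReal, inner_neg_left]
    push_cast
    ring_nf

theorem kernel_dilate (n : ℕ) (m : ℝ → ℂ) {l : ℝ} (hl : 0 < l) (x : E n) :
    kernel n (fun y => m (l * y)) x = ((l ^ n : ℝ) : ℂ)⁻¹ * kernel n m (l⁻¹ • x) := by
  rw [kernel, kernel]
  have h := Measure.integral_comp_smul (volume : Measure (E n))
    (fun ξ : E n => Complex.exp (Complex.I * ((inner ℝ (l⁻¹ • x) ξ : ℝ) : ℂ)) * m ‖ξ‖) l
  rw [finrank_euclideanSpace, Fintype.card_fin, abs_of_pos (by positivity),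
    Complex.real_smul, Complex.ofReal_inv] at h
  rw [mul_left_comm, ← h]
  congr 1
  refine integral_congr_ae (Filter.Eventually.of_forall fun ξ => ?_)
  simp only [norm_smul, Real.norm_eq_abs, abs_of_pos hl, inner_smul_right, inner_smul_left]
  congr 4
  simp only [conj_trivial]
  field_simp

theorem kernel_congr {n : ℕ} {m₁ m₂ : ℝ → ℂ} (h : ∀ y, 0 < y → m₁ y = m₂ y) (h0 : m₁ 0 = m₂ 0) :
    kernel n m₁ = kernel n m₂ := by
  ext x
  rw [kernel, kernel]
  congr 2
  ext ξ
  rcases (norm_nonneg ξ).eq_or_lt with h' | h'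
  · rw [← h', h0]
  · rw [h _ h']

section SmallDim
variable {n : ℕ} {m m₁ m₂ : ℝ → ℂ}

theorem IsSym.apply_zero (h : IsSym m) : m 0 = 0 := by
  obtain ⟨a, b, ha, hab⟩ := h.supp
  by_contra hne
  exact absurd (hab 0 le_rfl hne).1 (not_le.2 ha)

theorem IsSym.continuous_kernel (h : IsSym m) : Continuous (kernel n m) := by
  rw [kernel_eq_fourier]
  exact VectorFourier.fourierIntegral_continuous
    Real.continuous_fourierChar (innerSL ℝ).continuous₂ h.integrable_rad

theorem IsSym.norm_kernel_le (x : E n) : ‖kernel n m x‖ ≤ ∫ η, ‖rad n m η‖ := by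
  rw [kernel_eq_fourier]
  exact VectorFourier.norm_fourierIntegral_le_integral_norm _ _ _ _ _

/-- Multipliers with such symbols are therefore convolutions with L^1 functions, bounded on every
L^p with 1 ≤ p ≤ ∞. -/
theorem IsSym.integrable_kernel (hn : n ≤ 3) (h : IsSym m) : Integrable (kernel n m) := by
  rw [kernel_eq_fourier]
  exact integrable_fourier_of_contDiff_two hn h.contDiff_rad h.hasCompactSupport_rad

theorem IsSym.fourier_kernel (hn : n ≤ 3) (h : IsSym m) : 𝓕 (kernel n m) = rad n m := by
  have h1 := h.integrable_kernel hn
  rw [kernel_eq_fourierInv]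
  refine h.contDiff_rad.continuous.fourier_fourierInv_eq h.integrable_rad ?_
  rwa [← kernel_eq_fourier]

theorem IsSym.memLp_kernel (hn : n ≤ 3) (h : IsSym m) {p : ℝ≥0∞} (hp : 1 ≤ p) :
    MemLp (kernel n m) p volume := by
  have h1 : MemLp (kernel n m) 1 volume := memLp_one_iff_integrable.2 (h.integrable_kernel hn)
  have h2 : MemLp (kernel n m) ⊤ volume := memLp_top_of_bound
    h.continuous_kernel.aestronglyMeasurable _ (Filter.Eventually.of_forall IsSym.norm_kernel_le)
  exact memLp_of_memLp_of_memLp_top hp one_ne_zero h1 h2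

end SmallDim

end Dispersive

namespace Dispersive
open FourierTransform SchwartzMap

/-! ### Hölder's and Young's inequalities -/

theorem lintegral_mul_le_eLpNorm_mul_eLpNorm {α : Type*} [MeasurableSpace α] {μ : Measure α}
    (p q : ℝ≥0∞) [hpq : ENNReal.HolderConjugate p q] {f g : α → ℝ≥0∞} (hf : AEMeasurable f μ)
    (hg : AEMeasurable g μ) : ∫⁻ a, f a * g a ∂μ ≤ eLpNorm f p μ * eLpNorm g q μ := by
  have top_case : ∀ {f g : α → ℝ≥0∞}, AEMeasurable f μ → AEMeasurable g μ →
      ∫⁻ a, f a * g a ∂μ ≤ eLpNorm f ⊤ μ * eLpNorm g 1 μ := by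
    intro f g hf hg
    rw [eLpNorm_one_eq_lintegral_enorm, eLpNorm_exponent_top]
    simp only [enorm_eq_self]
    rw [← lintegral_const_mul'' _ hg]
    refine lintegral_mono_ae ?_
    filter_upwards [enorm_ae_le_eLpNormEssSup f μ] with x hx
    exact mul_le_mul_left hx _
  rcases eq_or_ne p ⊤ with rfl | hp
  · have : q = 1 := by
      have := ENNReal.HolderConjugate.conj_eq (p := ⊤) (q := q)
      simpa using this
    subst this
    exact top_case hf hg
  rcases eq_or_ne q ⊤ with rfl | hq
  · have : p = 1 := by
      have := ENNReal.HolderConjugate.conj_eq (p := ⊤) (q := p) (h := hpq.symm)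
      simpa using this
    subst this
    rw [mul_comm]
    simp only [mul_comm (f _)]
    exact top_case hg hf
  have h := ENNReal.HolderConjugate.toReal_of_ne_top hp hq
  have hp0 : p ≠ 0 := fun h0 => by simp [h0] at h; exact absurd h.pos (by simp)
  have hq0 : q ≠ 0 := fun h0 => by simp [h0] at h; exact absurd h.symm.pos (by simp)
  rw [eLpNorm_eq_lintegral_rpow_enorm_toReal hp0 hp, eLpNorm_eq_lintegral_rpow_enorm_toReal hq0 hq]
  exact ENNReal.lintegral_mul_le_Lp_mul_Lq μ h hf hg

theorem enorm_integral_mul_le {α : Type*} [MeasurableSpace α] {μ : Measure α}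
    (p q : ℝ≥0∞) [hpq : ENNReal.HolderConjugate p q] {f g : α → ℂ} (hf : AEStronglyMeasurable f μ)
    (hg : AEStronglyMeasurable g μ) : ‖∫ a, f a * g a ∂μ‖ₑ ≤ eLpNorm f p μ * eLpNorm g q μ := by
  refine (enorm_integral_le_lintegral_enorm _).trans ?_
  simp only [enorm_mul]
  refine (lintegral_mul_le_eLpNorm_mul_eLpNorm p q hf.enorm hg.enorm).trans_eq ?_
  rw [eLpNorm_enorm, eLpNorm_enorm]

/-- Young's inequality: Hölder for the measure k(t) dt gives (∫ k u)^P ≤ (∫ k)^{P-1} ∫ k u^P, and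
Tonelli's theorem together with translation invariance does the rest. -/
theorem eLpNorm_lconvolution_le {n : ℕ} {k u : E n → ℝ≥0∞} {p : ℝ≥0∞} (hp : 1 ≤ p)
    (hk : AEMeasurable k volume) (hu : AEMeasurable u volume) :
    eLpNorm (fun x => ∫⁻ t, k t * u (x - t)) p volume ≤ (∫⁻ t, k t) * eLpNorm u p volume := by
  rcases eq_or_ne p ⊤ with rfl | hpt
  · rw [eLpNorm_exponent_top, eLpNorm_exponent_top]
    refine eLpNormEssSup_le_of_ae_enorm_bound (Filter.Eventually.of_forall fun x => ?_)
    rw [enorm_eq_self, ← lintegral_mul_const'' _ hk]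
    refine lintegral_mono_ae ?_
    have h1 := enorm_ae_le_eLpNormEssSup u volume
    have h2 := (quasiMeasurePreserving_sub_left (volume : Measure (E n)) x).ae h1
    filter_upwards [h2] with t ht
    exact mul_le_mul_right ht _
  have hp0 : p ≠ 0 := (zero_lt_one.trans_le hp).ne'
  set P := p.toReal with hP
  have hP1 : 1 ≤ P := by rw [hP, ← ENNReal.toReal_one]; exact ENNReal.toReal_mono hpt hp
  have hP0 : 0 < P := by linarith
  have hsub : ∀ x : E n, AEMeasurable (fun t => u (x - t)) volume := fun x =>
    hu.comp_quasiMeasurePreserving (quasiMeasurePreserving_sub_left _ x)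
  have hpt1 : ∀ x : E n, (∫⁻ t, k t * u (x - t)) ^ P ≤
      (∫⁻ t, k t) ^ (P - 1) * ∫⁻ t, k t * u (x - t) ^ P := by
    intro x
    have h := ENNReal.lintegral_mul_norm_pow_le (μ := volume) (f := k)
      (g := fun t => k t * u (x - t) ^ P) hk (hk.mul ((hsub x).pow_const P))
      (p := 1 - 1 / P) (q := 1 / P)
      (by rw [sub_nonneg, div_le_one hP0]; exact hP1) (by positivity) (by ring)
    have e : ∀ t, k t ^ (1 - 1 / P) * (k t * u (x - t) ^ P) ^ (1 / P) = k t * u (x - t) := by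
      intro t
      rw [ENNReal.mul_rpow_of_nonneg _ _ (by positivity), ← mul_assoc,
        ← ENNReal.rpow_add_of_nonneg _ _ (by rw [sub_nonneg, div_le_one hP0]; exact hP1)
          (by positivity), ← ENNReal.rpow_mul]
      simp [hP0.ne']
    simp only [e] at h
    calc _ ≤ ((∫⁻ t, k t) ^ (1 - 1 / P) * (∫⁻ t, k t * u (x - t) ^ P) ^ (1 / P)) ^ P := by
          gcongr
      _ = _ := by
          rw [ENNReal.mul_rpow_of_nonneg _ _ hP0.le, ← ENNReal.rpow_mul, ← ENNReal.rpow_mul]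
          congr 1
          · congr 1; field_simp
          · rw [one_div, inv_mul_cancel₀ hP0.ne', ENNReal.rpow_one]
  have hswap : ∫⁻ x, ∫⁻ t, k t * u (x - t) ^ P = (∫⁻ t, k t) * ∫⁻ x, u x ^ P := by
    rw [lintegral_lintegral_swap]
    · rw [← lintegral_mul_const'' _ hk]
      refine lintegral_congr fun t => ?_
      have hm : AEMeasurable (fun x => u (x - t) ^ P) volume := (hu.comp_quasiMeasurePreserving
        (measurePreserving_sub_right volume t).quasiMeasurePreserving).pow_const P
      rw [lintegral_const_mul'' _ hm]
      congr 1
      exact lintegral_sub_right_eq_self (fun x => u x ^ P) t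
    · refine (hk.comp_quasiMeasurePreserving Measure.quasiMeasurePreserving_snd).mul ?_
      exact (hu.comp_quasiMeasurePreserving
        (quasiMeasurePreserving_sub_of_right_invariant volume volume)).pow_const P
  rw [eLpNorm_eq_lintegral_rpow_enorm_toReal hp0 hpt, eLpNorm_eq_lintegral_rpow_enorm_toReal hp0 hpt]
  simp only [enorm_eq_self]
  rw [← hP, one_div, ENNReal.rpow_inv_le_iff hP0, ENNReal.mul_rpow_of_nonneg _ _ hP0.le,
    ← ENNReal.rpow_mul, inv_mul_cancel₀ hP0.ne', ENNReal.rpow_one]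
  calc ∫⁻ x, (∫⁻ t, k t * u (x - t)) ^ P
      ≤ ∫⁻ x, (∫⁻ t, k t) ^ (P - 1) * ∫⁻ t, k t * u (x - t) ^ P := lintegral_mono hpt1
    _ = (∫⁻ t, k t) ^ (P - 1) * ((∫⁻ t, k t) * ∫⁻ x, u x ^ P) := by
        rw [← hswap]
        refine lintegral_const_mul'' _ ?_
        refine AEMeasurable.lintegral_prod_right' (f := fun z : E n × E n => k z.2 * u (z.1 - z.2) ^ P) ?_
        refine (hk.comp_quasiMeasurePreserving Measure.quasiMeasurePreserving_snd).mul ?_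
        exact (hu.comp_quasiMeasurePreserving
          (quasiMeasurePreserving_sub_of_right_invariant volume volume)).pow_const P
    _ = _ := by
        rw [← mul_assoc]
        congr 1
        nth_rewrite 2 [← ENNReal.rpow_one (∫⁻ t, k t)]
        rw [← ENNReal.rpow_add_of_nonneg _ _ (by linarith) zero_le_one]
        congr 1; ring

/-! ### Fourier multipliers on Lebesgue spaces -/

theorem one_le_conjExponent (p : ℝ≥0∞) : 1 ≤ p.conjExponent := le_add_right le_rfl

theorem mul_apply (n : ℕ) (m : ℝ → ℂ) (u : E n → ℂ) (x : E n) :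
    mul n m u x = ∫ t, kernel n m t * u (x - t) := by
  rw [mul, convolution_def]; rfl

theorem mul_apply' (n : ℕ) (m : ℝ → ℂ) (u : E n → ℂ) (x : E n) :
    mul n m u x = ∫ t, kernel n m (x - t) * u t := by
  rw [mul, convolution_eq_swap]; rfl

theorem memLp_sub_left {n : ℕ} {p : ℝ≥0∞} {u : E n → ℂ} (hu : MemLp u p volume) (x : E n) :
    MemLp (fun t => u (x - t)) p volume :=
  hu.comp_measurePreserving (Measure.measurePreserving_sub_left volume x)

theorem mul_congr_ae {n : ℕ} {m : ℝ → ℂ} {u v : E n → ℂ} (h : u =ᵐ[volume] v) :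
    mul n m u = mul n m v := by
  ext x
  rw [mul_apply', mul_apply']
  exact integral_congr_ae (h.mono fun t ht => by simp only [ht])

section
variable {n : ℕ} {m m₁ m₂ : ℝ → ℂ} {p : ℝ≥0∞} {u v : E n → ℂ}

theorem IsSym.integrable_mul (hn : n ≤ 3) (h : IsSym m) (hp : 1 ≤ p) (hu : MemLp u p volume)
    (x : E n) : Integrable (fun t => kernel n m t * u (x - t)) := by
  have : ENNReal.HolderConjugate p p.conjExponent := .conjExponent hp
  exact MemLp.integrable_mul (h.memLp_kernel hn (one_le_conjExponent p)) (memLp_sub_left hu x)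
    (q := p)

theorem IsSym.integrable_mul' (hn : n ≤ 3) (h : IsSym m) (hp : 1 ≤ p) (hu : MemLp u p volume)
    (x : E n) : Integrable (fun t => kernel n m (x - t) * u t) := by
  have := (h.integrable_mul hn hp hu x).comp_sub_left x
  simpa using this

theorem enorm_mul_le (x : E n) : ‖mul n m u x‖ₑ ≤ ∫⁻ t, ‖kernel n m t‖ₑ * ‖u (x - t)‖ₑ := by
  rw [mul_apply]
  refine (enorm_integral_le_lintegral_enorm _).trans_eq ?_
  simp only [enorm_mul]

theorem IsSym.enorm_mul_le_eLpNorm (h : IsSym m) (hp : 1 ≤ p) (hu : MemLp u p volume)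
    (x : E n) : ‖mul n m u x‖ₑ ≤ eLpNorm (kernel n m) p.conjExponent volume * eLpNorm u p volume := by
  have : ENNReal.HolderConjugate p p.conjExponent := .conjExponent hp
  have hm := h.continuous_kernel.aestronglyMeasurable (μ := (volume : Measure (E n)))
  have h1 := eLpNorm_smul_le_mul_eLpNorm (p := p.conjExponent) (q := p) (r := 1)
    (memLp_sub_left hu x).1 hm
  rw [eLpNorm_one_eq_lintegral_enorm] at h1
  have h2 : eLpNorm (fun t => u (x - t)) p volume = eLpNorm u p volume :=
    eLpNorm_comp_measurePreserving hu.1 (Measure.measurePreserving_sub_left volume x)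
  rw [h2] at h1
  refine (enorm_mul_le x).trans (le_trans (le_of_eq ?_) h1)
  refine lintegral_congr fun t => ?_
  simp

theorem IsSym.aestronglyMeasurable_mul (h : IsSym m) (hu : AEStronglyMeasurable u volume) :
    AEStronglyMeasurable (mul n m u) volume := by
  have := (hu.convolution_integrand (ContinuousLinearMap.mul ℝ ℂ).flip
    (h.continuous_kernel (n := n)).aestronglyMeasurable (μ := volume) (ν := volume)).integral_prod_right'
  refine this.congr (Filter.Eventually.of_forall fun x => ?_)
  simp [mul_apply', mul_comm]

theorem eLpNorm_mul_le (h : IsSym m) (hp : 1 ≤ p) (hu : AEStronglyMeasurable u volume) :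
    eLpNorm (mul n m u) p volume ≤ eLpNorm (kernel n m) 1 volume * eLpNorm u p volume := by
  rw [eLpNorm_one_eq_lintegral_enorm, ← eLpNorm_enorm u]
  refine le_trans ?_ (eLpNorm_lconvolution_le hp (h.continuous_kernel.enorm.aemeasurable) hu.enorm)
  exact eLpNorm_mono_enorm fun x => by rw [enorm_eq_self]; exact enorm_mul_le x

theorem IsSym.memLp_mul (hn : n ≤ 3) (h : IsSym m) (hp : 1 ≤ p) (hu : MemLp u p volume) :
    MemLp (mul n m u) p volume :=
  ⟨h.aestronglyMeasurable_mul hu.1, (eLpNorm_mul_le h hp hu.1).trans_lt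
    (ENNReal.mul_lt_top (h.memLp_kernel hn le_rfl).2 hu.2)⟩

theorem IsSym.memLp_mul_top (hn : n ≤ 3) (h : IsSym m) (hp : 1 ≤ p) (hu : MemLp u p volume) :
    MemLp (mul n m u) ⊤ volume := by
  refine ⟨h.aestronglyMeasurable_mul hu.1, ?_⟩
  rw [eLpNorm_exponent_top]
  exact (eLpNormEssSup_le_of_ae_enorm_bound (Filter.Eventually.of_forall fun x =>
    h.enorm_mul_le_eLpNorm hp hu x)).trans_lt
    (ENNReal.mul_lt_top (h.memLp_kernel hn (one_le_conjExponent p)).2 hu.2)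

theorem IsSym.memLp_mul_of_le (hn : n ≤ 3) (h : IsSym m) (hp : 1 ≤ p) {s : ℝ≥0∞} (hps : p ≤ s)
    (hu : MemLp u p volume) : MemLp (mul n m u) s volume :=
  memLp_of_memLp_of_memLp_top hps (zero_lt_one.trans_le hp).ne' (h.memLp_mul hn hp hu)
    (h.memLp_mul_top hn hp hu)

theorem IsSym.mul_add (hn : n ≤ 3) (h : IsSym m) (hp : 1 ≤ p) {q : ℝ≥0∞} (hq : 1 ≤ q)
    (hu : MemLp u p volume) (hv : MemLp v q volume) :
    mul n m (fun x => u x + v x) = fun x => mul n m u x + mul n m v x := by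
  ext x
  simp only [mul_apply]
  rw [← integral_add (h.integrable_mul hn hp hu x) (h.integrable_mul hn hq hv x)]
  simp only [_root_.mul_add]

theorem mul_zero_fun : mul n m (fun _ => 0) = fun _ => 0 := by
  ext x; simp [mul_apply]

theorem IsSym.mul_sub (hn : n ≤ 3) (h : IsSym m) (hp : 1 ≤ p) {q : ℝ≥0∞} (hq : 1 ≤ q)
    (hu : MemLp u p volume) (hv : MemLp v q volume) :
    mul n m (fun x => u x - v x) = fun x => mul n m u x - mul n m v x := by
  ext x
  simp only [mul_apply]
  rw [← integral_sub (h.integrable_mul hn hp hu x) (h.integrable_mul hn hq hv x)]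
  simp only [_root_.mul_sub]

theorem IsSym.mul_sum (hn : n ≤ 3) (h : IsSym m) (hp : 1 ≤ p) {ι : Type*} (s : Finset ι)
    {w : ι → E n → ℂ} (hw : ∀ i ∈ s, MemLp (w i) p volume) :
    mul n m (fun x => ∑ i ∈ s, w i x) = fun x => ∑ i ∈ s, mul n m (w i) x := by
  ext x
  simp only [mul_apply, Finset.mul_sum]
  rw [integral_finsetSum _ fun i hi => h.integrable_mul hn hp (hw i hi) x]

theorem kernel_sum {ι : Type*} (s : Finset ι) {a : ι → ℝ → ℂ} (ha : ∀ i ∈ s, IsSym (a i)) :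
    kernel n (fun y => ∑ i ∈ s, a i y) = fun x => ∑ i ∈ s, kernel n (a i) x := by
  ext x
  simp only [kernel_eq_fourier, Real.fourier_eq]
  rw [← integral_finsetSum]
  · simp only [rad, Finset.smul_sum]
  · intro i hi
    exact (Real.fourierIntegral_convergent_iff x).2 (ha i hi).integrable_rad

theorem sum_mul_eq (hn : n ≤ 3) (hp : 1 ≤ p) {ι : Type*} (s : Finset ι) {a : ι → ℝ → ℂ}
    (ha : ∀ i ∈ s, IsSym (a i)) (hu : MemLp u p volume) :
    mul n (fun y => ∑ i ∈ s, a i y) u = fun x => ∑ i ∈ s, mul n (a i) u x := by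
  ext x
  simp only [mul_apply, kernel_sum s ha, Finset.sum_mul]
  rw [integral_finsetSum _ fun i hi => (ha i hi).integrable_mul hn hp hu x]

theorem kernel_const_mul (c : ℂ) : kernel n (fun y => c * m y) = fun x => c * kernel n m x := by
  ext x
  simp only [kernel]
  rw [mul_left_comm c, ← integral_const_mul, ← integral_const_mul, ← integral_const_mul]
  congr 1; funext ξ; ring

theorem mul_congr (h : ∀ y, 0 < y → m₁ y = m₂ y) (h0 : m₁ 0 = m₂ 0) :
    mul n m₁ u = mul n m₂ u := by
  rw [mul, kernel_congr h h0, mul]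

theorem conj_mul_apply (x : E n) : starRingEnd ℂ (mul n m u x) =
    mul n (fun y => starRingEnd ℂ (m y)) (fun z => starRingEnd ℂ (u z)) x := by
  simp only [mul_apply, kernel_conj]
  rw [← integral_conj]
  simp only [map_mul]

/-- The two sides have the same integrable Fourier transform; the convolution is continuous and
integrable, so Fourier inversion applies to it. -/
theorem kernel_mul_eq (hn : n ≤ 3) (h₁ : IsSym m₁) (h₂ : IsSym m₂) :
    mul n m₁ (kernel n m₂) = kernel n (fun y => m₁ y * m₂ y) := by
  have i1 := h₁.integrable_kernel hn (n := n)
  have i2 := h₂.integrable_kernel hn (n := n)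
  have hF : 𝓕 (mul n m₁ (kernel n m₂)) = rad n (fun y => m₁ y * m₂ y) := by
    ext ξ
    have := Real.fourier_bilin_convolution_eq (ContinuousLinearMap.mul ℂ ℂ) i1 i2 ξ
    rw [h₁.fourier_kernel hn, h₂.fourier_kernel hn] at this
    exact this
  have hc : Continuous (mul n m₁ (kernel n m₂)) := by
    refine BddAbove.continuous_convolution_right_of_integrable (ContinuousLinearMap.mul ℝ ℂ) ?_ i1
      h₂.continuous_kernel
    exact ⟨_, by rintro _ ⟨x, rfl⟩; exact IsSym.norm_kernel_le x⟩
  have hi : Integrable (mul n m₁ (kernel n m₂)) := i1.integrable_convolution _ i2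
  have h12 : IsSym fun y => m₁ y * m₂ y := h₁.mul_right h₂.contDiffOn
  have := hc.fourierInv_fourier_eq hi (by rw [hF]; exact h12.integrable_rad)
  rw [← this, hF, kernel_eq_fourierInv]

/-- Associativity of convolution, in the form of a calculus of symbols. Young's and Hölder's
inequalities supply the absolute convergence. -/
theorem mul_mul_eq (hn : n ≤ 3) (h₁ : IsSym m₁) (h₂ : IsSym m₂) (hp : 1 ≤ p)
    (hu : MemLp u p volume) : mul n m₁ (mul n m₂ u) = mul n (fun y => m₁ y * m₂ y) u := by
  ext x
  have e : mul n (fun y => m₁ y * m₂ y) u x =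
      convolution (convolution (kernel n m₁) (kernel n m₂) (ContinuousLinearMap.mul ℝ ℂ) volume) u
        (ContinuousLinearMap.mul ℝ ℂ) volume x := by
    rw [mul, ← kernel_mul_eq hn h₁ h₂]; rfl
  have hnu : MemLp (fun t => ‖u t‖) p volume := hu.norm
  have hpc : ENNReal.HolderConjugate p p.conjExponent := .conjExponent hp
  rw [e, convolution_assoc (ContinuousLinearMap.mul ℝ ℂ) (ContinuousLinearMap.mul ℝ ℂ)
    (ContinuousLinearMap.mul ℝ ℂ) (ContinuousLinearMap.mul ℝ ℂ)]
  · rfl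
  · intro a b c; simp [mul_assoc]
  · exact h₁.continuous_kernel.aestronglyMeasurable
  · exact h₂.continuous_kernel.aestronglyMeasurable
  · exact hu.1
  · exact Filter.Eventually.of_forall fun y =>
      h₁.integrable_mul hn le_rfl (h₂.memLp_kernel hn le_rfl) y
  · refine Filter.Eventually.of_forall fun y => ?_
    have := (h₂.integrable_mul hn hp hu y).norm
    refine this.congr (Filter.Eventually.of_forall fun t => ?_)
    simp
  · have hk : MemLp (fun t => ‖kernel n m₁ t‖) p.conjExponent volume :=
      (h₁.memLp_kernel hn (one_le_conjExponent p)).norm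
    set w := convolution (fun x => ‖kernel n m₂ x‖) (fun x => ‖u x‖)
      (ContinuousLinearMap.mul ℝ ℝ) volume with hw
    have hwm : MemLp w p volume := by
      constructor
      · have := (hnu.1.convolution_integrand (ContinuousLinearMap.mul ℝ ℝ).flip
          (h₂.continuous_kernel (n := n)).norm.aestronglyMeasurable (μ := volume)
            (ν := volume)).integral_prod_right'
        refine this.congr (Filter.Eventually.of_forall fun x => ?_)
        rw [hw, convolution_eq_swap]; rfl
      · have h3 := eLpNorm_lconvolution_le hp (k := fun t => ‖kernel n m₂ t‖ₑ)
          (u := fun t => ‖u t‖ₑ) h₂.continuous_kernel.enorm.aemeasurable hu.1.enorm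
        rw [eLpNorm_enorm] at h3
        refine (eLpNorm_mono_enorm fun x => ?_).trans_lt (h3.trans_lt (ENNReal.mul_lt_top ?_ hu.2))
        · rw [enorm_eq_self, hw, convolution_def]
          refine (enorm_integral_le_lintegral_enorm _).trans_eq ?_
          simp
        · have := (h₂.memLp_kernel hn le_rfl (n := n)).2
          rwa [eLpNorm_one_eq_lintegral_enorm] at this
    have h4 : MemLp (fun t => w (x - t)) p volume :=
      hwm.comp_measurePreserving (Measure.measurePreserving_sub_left volume x)
    exact MemLp.integrable_mul hk h4 (q := p)

/-- The pairing is bilinear and the kernel even, so a multiplier is its own transpose, with no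
complex conjugate. -/
theorem integral_mul_mul_comm (hn : n ≤ 3) (h : IsSym m) (hp : 1 ≤ p) (hu : MemLp u p volume)
    {g : E n → ℂ} (hg : MemLp g p.conjExponent volume) :
    ∫ x, mul n m u x * g x = ∫ x, u x * mul n m g x := by
  have hpc : ENNReal.HolderConjugate p p.conjExponent := .conjExponent hp
  have hmeas : AEStronglyMeasurable (fun z : E n × E n => kernel n m (z.1 - z.2) * u z.2 * g z.1)
      (volume.prod volume) := by
    refine AEStronglyMeasurable.mul (AEStronglyMeasurable.mul ?_ ?_) ?_
    · exact (h.continuous_kernel.comp (continuous_fst.sub continuous_snd)).aestronglyMeasurable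
    · exact hu.1.comp_snd
    · exact hg.1.comp_fst
  have hint : Integrable (fun z : E n × E n => kernel n m (z.1 - z.2) * u z.2 * g z.1)
      (volume.prod volume) := by
    refine ⟨hmeas, ?_⟩
    rw [HasFiniteIntegral, lintegral_prod _ hmeas.enorm]
    set w : E n → ℝ≥0∞ := fun x => ∫⁻ t, ‖kernel n m t‖ₑ * ‖u (x - t)‖ₑ with hw
    have h3 := eLpNorm_lconvolution_le hp (k := fun t => ‖kernel n m t‖ₑ)
      (u := fun t => ‖u t‖ₑ) h.continuous_kernel.enorm.aemeasurable hu.1.enorm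
    rw [eLpNorm_enorm] at h3
    have hwm : AEMeasurable w volume := by
      have hm : AEMeasurable (fun z : E n × E n => ‖kernel n m z.2‖ₑ * ‖u (z.1 - z.2)‖ₑ)
          (volume.prod volume) := by
        have a1 : AEMeasurable (fun z : E n × E n => ‖kernel n m z.2‖ₑ) (volume.prod volume) :=
          ((h.continuous_kernel (n := n)).comp continuous_snd).enorm.aemeasurable
        exact a1.mul (hu.1.enorm.comp_quasiMeasurePreserving
            (quasiMeasurePreserving_sub_of_right_invariant volume volume))
      exact AEMeasurable.lintegral_prod_right' hm
    have e : ∀ x, ∫⁻ y, ‖kernel n m (x - y) * u y * g x‖ₑ = w x * ‖g x‖ₑ := by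
      intro x
      simp only [enorm_mul]
      rw [lintegral_mul_const'']
      · congr 1
        rw [← lintegral_sub_left_eq_self _ x]
        simp [hw]
      · exact (h.continuous_kernel.comp (continuous_const.sub continuous_id)).enorm.aemeasurable.mul
          hu.1.enorm
    simp only [e]
    refine (lintegral_mul_le_eLpNorm_mul_eLpNorm p p.conjExponent hwm hg.1.enorm).trans_lt ?_
    rw [eLpNorm_enorm]
    refine ENNReal.mul_lt_top (h3.trans_lt (ENNReal.mul_lt_top ?_ hu.2)) hg.2
    have := (h.memLp_kernel hn le_rfl (n := n)).2
    rwa [eLpNorm_one_eq_lintegral_enorm] at this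
  calc ∫ x, mul n m u x * g x = ∫ x, ∫ y, kernel n m (x - y) * u y * g x := by
        simp only [mul_apply', ← integral_mul_const]
    _ = ∫ y, ∫ x, kernel n m (x - y) * u y * g x := integral_integral_swap hint
    _ = _ := by
        simp only [mul_apply', ← integral_const_mul]
        congr 1; funext y; congr 1; funext x
        rw [← kernel_neg n m (x - y), neg_sub]; ring

/-- Plancherel's identity on L^1 ∩ L^2; the general case follows by truncation to balls and Fatou's
lemma. -/
theorem eLpNorm_mul_two_le (hn : n ≤ 3) (h : IsSym m) {B : ℝ} (hB : ∀ y, 0 ≤ y → ‖m y‖ ≤ B)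
    (hu : MemLp u 2 volume) :
    eLpNorm (mul n m u) 2 volume ≤ ENNReal.ofReal B * eLpNorm u 2 volume := by
  have step : ∀ v : E n → ℂ, MemLp v 1 volume → MemLp v 2 volume →
      eLpNorm (mul n m v) 2 volume ≤ ENNReal.ofReal B * eLpNorm v 2 volume := by
    intro v h1 h2
    have i1 := h.integrable_kernel hn (n := n)
    have hv1 := memLp_one_iff_integrable.1 h1
    rw [← eLpNorm_fourier_eq (memLp_one_iff_integrable.1 (h.memLp_mul hn le_rfl h1))
      (h.memLp_mul hn one_le_two h2), ← eLpNorm_fourier_eq hv1 h2]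
    have hF : 𝓕 (mul n m v) = fun ξ => rad n m ξ * 𝓕 v ξ := by
      ext ξ
      have := Real.fourier_bilin_convolution_eq (ContinuousLinearMap.mul ℂ ℂ) i1 hv1 ξ
      rw [h.fourier_kernel hn] at this
      exact this
    rw [hF]
    have hB0 : 0 ≤ B := (norm_nonneg _).trans (hB 0 le_rfl)
    refine eLpNorm_le_mul_eLpNorm_of_ae_le_mul (Filter.Eventually.of_forall fun ξ => ?_) 2
    rw [norm_mul]
    exact mul_le_mul_of_nonneg_right (hB _ (by positivity)) (norm_nonneg _)
  set v : ℕ → E n → ℂ := fun k => (Metric.closedBall 0 (k : ℝ)).indicator u with hv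
  have hv2 : ∀ k, MemLp (v k) 2 volume := fun k => hu.indicator measurableSet_closedBall
  have hv1 : ∀ k, MemLp (v k) 1 volume := by
    intro k
    rw [hv, memLp_indicator_iff_restrict measurableSet_closedBall]
    have : IsFiniteMeasure (volume.restrict (Metric.closedBall (0 : E n) (k : ℝ))) :=
      ⟨by rw [Measure.restrict_apply_univ]; exact measure_closedBall_lt_top⟩
    exact (hu.restrict _).mono_exponent one_le_two
  have hlim : ∀ x, Filter.Tendsto (fun k => mul n m (v k) x) Filter.atTop (nhds (mul n m u x)) := by
    intro x
    simp only [mul_apply']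
    refine tendsto_integral_of_dominated_convergence (fun t => ‖kernel n m (x - t) * u t‖) ?_
      (h.integrable_mul' hn one_le_two hu x).norm ?_ ?_
    · exact fun k => (h.integrable_mul' hn one_le_two (hv2 k) x).1
    · refine fun k => Filter.Eventually.of_forall fun t => ?_
      rw [norm_mul, norm_mul]
      gcongr
      exact norm_indicator_le_norm_self _ _
    · refine Filter.Eventually.of_forall fun t => ?_
      refine Filter.Tendsto.const_mul _ (tendsto_const_nhds.congr' ?_)
      filter_upwards [Filter.eventually_ge_atTop ⌈‖t‖⌉₊] with k hk
      rw [hv]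
      simp only
      rw [indicator_of_mem]
      rw [mem_closedBall_zero_iff]
      exact (Nat.le_ceil _).trans (by exact_mod_cast hk)
  refine (Lp.eLpNorm_lim_le_liminf_eLpNorm
    (fun k => h.aestronglyMeasurable_mul (hv2 k).1) _ (Filter.Eventually.of_forall hlim)).trans ?_
  refine Filter.liminf_le_of_le (by isBoundedDefault) fun b hb => ?_
  obtain ⟨k, hk⟩ := hb.exists
  refine hk.trans ((step _ (hv1 k) (hv2 k)).trans ?_)
  gcongr
  exact eLpNorm_indicator_le _

end

end Dispersive

namespace Dispersive

/-! ### Distribution functions -/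

theorem lintegral_Ioc_rpow {s L : ℝ} (hs : 0 < s) (hL : 0 ≤ L) :
    ∫⁻ t in Ioc 0 L, ENNReal.ofReal (t ^ (s - 1)) = ENNReal.ofReal (L ^ s / s) := by
  have hi : IntervalIntegrable (fun t : ℝ => t ^ (s - 1)) volume 0 L :=
    intervalIntegral.intervalIntegrable_rpow' (by linarith)
  rw [← ofReal_integral_eq_lintegral_ofReal]
  · rw [← intervalIntegral.integral_of_le hL, integral_rpow (Or.inl (by linarith))]
    congr 1
    rw [Real.zero_rpow (by linarith)]
    simp
  · exact (intervalIntegrable_iff_integrableOn_Ioc_of_le hL).1 hi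
  · filter_upwards [ae_restrict_mem measurableSet_Ioc] with t ht
    exact Real.rpow_nonneg ht.1.le _

/-- Half of the layer-cake formula x^q = ∫_0^x q t^{q-1} dt, valid also for x = ∞. -/
theorem rpow_le_lintegral_Ioi {q : ℝ} (hq : 0 < q) (x : ℝ≥0∞) :
    x ^ q ≤ ∫⁻ t in Ioi (0 : ℝ), ENNReal.ofReal (q * t ^ (q - 1)) *
      {t : ℝ | ENNReal.ofReal t < x}.indicator 1 t := by
  have key : ∀ L : ℝ, 0 ≤ L → ENNReal.ofReal L ≤ x → ENNReal.ofReal (L ^ q) ≤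
      ∫⁻ t in Ioi (0 : ℝ), ENNReal.ofReal (q * t ^ (q - 1)) *
      {t : ℝ | ENNReal.ofReal t < x}.indicator 1 t := by
    intro L hL hLx
    have h1 := lintegral_Ioc_rpow hq hL
    have h2 : ENNReal.ofReal (L ^ q) = ∫⁻ t in Ioo 0 L, ENNReal.ofReal (q * t ^ (q - 1)) := by
      rw [setLIntegral_congr Ioo_ae_eq_Ioc]
      simp only [ENNReal.ofReal_mul hq.le]
      rw [lintegral_const_mul' _ _ ENNReal.ofReal_ne_top, h1, ← ENNReal.ofReal_mul hq.le]
      congr 1; field_simp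
    rw [h2]
    calc _ = ∫⁻ t in Ioo 0 L, ENNReal.ofReal (q * t ^ (q - 1)) *
        {t : ℝ | ENNReal.ofReal t < x}.indicator 1 t := by
          refine setLIntegral_congr_fun measurableSet_Ioo fun t ht => ?_
          have : t ∈ {t : ℝ | ENNReal.ofReal t < x} :=
            ((ENNReal.ofReal_lt_ofReal_iff (ht.1.trans ht.2)).2 ht.2).trans_le hLx
          simp only [indicator_of_mem this, Pi.one_apply, mul_one]
      _ ≤ _ := lintegral_mono_set Ioo_subset_Ioi_self
  rcases eq_or_ne x ⊤ with rfl | hx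
  · rw [ENNReal.top_rpow_of_pos hq, top_le_iff]
    refine ENNReal.eq_top_of_forall_nnreal_le fun r => ?_
    have := key ((r : ℝ) ^ q⁻¹) (by positivity) le_top
    rwa [← Real.rpow_mul (NNReal.coe_nonneg r), inv_mul_cancel₀ hq.ne', Real.rpow_one, ENNReal.ofReal_coe_nnreal]
      at this
  · have := key x.toReal ENNReal.toReal_nonneg (by rw [ENNReal.ofReal_toReal hx])
    rwa [← ENNReal.ofReal_rpow_of_nonneg ENNReal.toReal_nonneg hq.le, ENNReal.ofReal_toReal hx]
      at this

theorem lintegral_rpow_le_lintegral_meas {α : Type*} [MeasurableSpace α] {μ : Measure α} [SFinite μ]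
    {F : α → ℝ≥0∞} (hF : Measurable F) {q : ℝ} (hq : 0 < q) :
    ∫⁻ x, F x ^ q ∂μ ≤ ∫⁻ t in Ioi (0 : ℝ), ENNReal.ofReal (q * t ^ (q - 1)) *
      μ {x | ENNReal.ofReal t < F x} := by
  calc ∫⁻ x, F x ^ q ∂μ ≤ ∫⁻ x, (∫⁻ t in Ioi (0 : ℝ), ENNReal.ofReal (q * t ^ (q - 1)) *
      {t : ℝ | ENNReal.ofReal t < F x}.indicator 1 t) ∂μ :=
        lintegral_mono fun x => rpow_le_lintegral_Ioi hq _
    _ = ∫⁻ t in Ioi (0 : ℝ), (∫⁻ x, ENNReal.ofReal (q * t ^ (q - 1)) *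
      {t : ℝ | ENNReal.ofReal t < F x}.indicator 1 t ∂μ) := by
        rw [lintegral_lintegral_swap]
        refine Measurable.aemeasurable ?_
        have hs : MeasurableSet {z : α × ℝ | ENNReal.ofReal z.2 < F z.1} :=
          measurableSet_lt (by fun_prop) (by fun_prop)
        have : Measurable (fun z : α × ℝ => ENNReal.ofReal (q * z.2 ^ (q - 1)) *
            {z : α × ℝ | ENNReal.ofReal z.2 < F z.1}.indicator 1 z) :=
          Measurable.mul (by fun_prop) (measurable_one.indicator hs)
        exact this
    _ = _ := by
        refine lintegral_congr fun t => ?_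
        rw [lintegral_const_mul' _ _ ENNReal.ofReal_ne_top]
        congr 1
        have hs : MeasurableSet {x | ENNReal.ofReal t < F x} := measurableSet_lt (by fun_prop) hF
        rw [← lintegral_indicator_one hs]
        rfl

/-! ### Interpolation between `L² → L²` and `L¹ → L^∞` -/

/-- The constant of the interpolation inequality. -/
def interpConst (r : ℝ) : ℝ := r * 4 * (2 ^ (r - 2) / (r - 2))

/-- A Marcinkiewicz argument. For each level l, the function is split at a height chosen so that the
L^1 → L^∞ bound makes the image of the large part at most l/2. Then only the small part can produce
values above l, and Chebyshev's inequality with the L^2 bound controls it. -/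
theorem lintegral_mul_rpow_le {n : ℕ} (hn : n ≤ 3) {m : ℝ → ℂ} (h : IsSym m) {B D r p : ℝ}
    (hB : ∀ y, 0 ≤ y → ‖m y‖ ≤ B) (hD0 : 0 < D) (hD : ∀ x : E n, ‖kernel n m x‖ ≤ D)
    (hr : 2 < r) (hpr : p = r / (r - 1)) {u : E n → ℂ} (hum : StronglyMeasurable u)
    {N : ℝ} (hN0 : 0 < N) (hN : ∫⁻ x, ‖u x‖ₑ ^ p = ENNReal.ofReal N) :
    ∫⁻ x, ‖mul n m u x‖ₑ ^ r ≤
      ENNReal.ofReal (interpConst r * B ^ 2 * D ^ (r - 2) * N ^ (r - 1)) := by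
  have hr1 : 0 < r - 1 := by linarith
  have hp1 : p - 1 = 1 / (r - 1) := by rw [hpr]; field_simp; ring
  have hp1' : 0 < p - 1 := by rw [hp1]; positivity
  have hp0 : 0 < p := by linarith
  have hp2 : p < 2 := by rw [hpr, div_lt_iff₀ hr1]; linarith
  have hB0 : 0 ≤ B := (norm_nonneg _).trans (hB 0 le_rfl)
  set P := ENNReal.ofReal p with hP
  have hP0 : P ≠ 0 := by simpa [hP] using hp0
  have hP1 : 1 ≤ P := by rw [hP, ← ENNReal.ofReal_one]; exact ENNReal.ofReal_le_ofReal (by linarith)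
  have hPr : P.toReal = p := ENNReal.toReal_ofReal hp0.le
  have hu : MemLp u P volume := by
    refine ⟨hum.aestronglyMeasurable, ?_⟩
    rw [eLpNorm_lt_top_iff_lintegral_rpow_enorm_lt_top hP0 ENNReal.ofReal_ne_top, hPr, hN]
    exact ENNReal.ofReal_lt_top
  set S : ℝ → Set (E n) := fun l => {x | l * ‖u x‖ ^ (p - 1) ≤ 2 * D * N} with hS
  have hSm : MeasurableSet {z : ℝ × E n | z.1 * ‖u z.2‖ ^ (p - 1) ≤ 2 * D * N} := by
    have := hum.measurable
    exact measurableSet_le (by fun_prop) (by fun_prop)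
  have hSml : ∀ l, MeasurableSet (S l) := fun l => measurable_prodMk_left hSm
  have level : ∀ l : ℝ, 0 < l → volume {x | ENNReal.ofReal l < ‖mul n m u x‖ₑ} ≤
      ENNReal.ofReal (4 * B ^ 2 / l ^ 2) * ∫⁻ x, (S l).indicator (fun x => ‖u x‖ₑ ^ (2 : ℝ)) x := by
    intro l hl
    set us := (S l).indicator u with hus
    set ub := (S l)ᶜ.indicator u with hub
    have husP : MemLp us P volume := hu.indicator (hSml l)
    have hubP : MemLp ub P volume := hu.indicator (hSml l).compl
    have hus2 : MemLp us 2 volume := by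
      refine memLp_of_memLp_of_memLp_top ?_ hP0 husP ?_
      · rw [hP, ← ENNReal.ofReal_ofNat]; exact ENNReal.ofReal_le_ofReal hp2.le
      · refine memLp_top_of_bound husP.1 ((2 * D * N / l) ^ (p - 1)⁻¹)
          (Filter.Eventually.of_forall fun x => ?_)
        by_cases hx : x ∈ S l
        · rw [hus, indicator_of_mem hx]
          have : ‖u x‖ ^ (p - 1) ≤ 2 * D * N / l := by
            rw [le_div_iff₀ hl, mul_comm]; exact hx
          calc ‖u x‖ = (‖u x‖ ^ (p - 1)) ^ (p - 1)⁻¹ := by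
                rw [← Real.rpow_mul (norm_nonneg _), mul_inv_cancel₀ hp1'.ne', Real.rpow_one]
            _ ≤ _ := by gcongr
        · rw [hus, indicator_of_notMem hx, norm_zero]; positivity
    have hsum : mul n m u = fun x => mul n m us x + mul n m ub x := by
      rw [← h.mul_add hn hP1 hP1 husP hubP]
      congr 1
      ext x
      rw [hus, hub, indicator_self_add_compl_apply]
    -- Off `S l` the factor l |u|^{p-1} / (2DN) exceeds 1. Inserting it gives D |u| ≤ (l / 2N) |u|^p
    -- there, and the integral of the right-hand side is l/2.
    have hbig : ∀ x, ‖mul n m ub x‖ₑ ≤ ENNReal.ofReal (l / 2) := by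
      intro x
      refine (enorm_mul_le x).trans ?_
      have e1 : ∀ t, ‖kernel n m t‖ₑ * ‖ub (x - t)‖ₑ ≤
          ENNReal.ofReal (l / (2 * N)) * ‖u (x - t)‖ₑ ^ p := by
        intro t
        by_cases hx : x - t ∈ S l
        · simp [hub, hx]
        · rw [hub, indicator_of_mem (show x - t ∈ (S l)ᶜ from hx)]
          set a := ‖u (x - t)‖ with ha
          have hx' : 2 * D * N < l * a ^ (p - 1) := not_le.1 hx
          have ha0 : 0 < a := by
            rcases (norm_nonneg (u (x - t))).eq_or_lt with h0 | h0
            · rw [ha, ← h0, Real.zero_rpow hp1'.ne', mul_zero] at hx'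
              exact absurd hx' (not_lt.2 (by positivity))
            · exact h0
          rw [← ofReal_norm (u (x - t)), ← ofReal_norm (kernel n m t), ← ha,
            ENNReal.ofReal_rpow_of_nonneg ha0.le hp0.le, ← ENNReal.ofReal_mul (norm_nonneg _),
            ← ENNReal.ofReal_mul (by positivity)]
          refine ENNReal.ofReal_le_ofReal ?_
          calc ‖kernel n m t‖ * a ≤ D * a := by gcongr; exact hD t
            _ = (2 * D * N) / (2 * N) * a := by field_simp
            _ ≤ (l * a ^ (p - 1)) / (2 * N) * a := by gcongr
            _ = l / (2 * N) * (a ^ (p - 1) * a ^ (1 : ℝ)) := by rw [Real.rpow_one]; ring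
            _ = _ := by rw [← Real.rpow_add ha0]; ring_nf
      refine (lintegral_mono e1).trans ?_
      rw [lintegral_const_mul' _ _ ENNReal.ofReal_ne_top,
        lintegral_sub_left_eq_self (fun t => ‖u t‖ₑ ^ p) x, hN, ← ENNReal.ofReal_mul (by positivity)]
      refine ENNReal.ofReal_le_ofReal (le_of_eq ?_)
      field_simp
    have hsub : {x | ENNReal.ofReal l < ‖mul n m u x‖ₑ} ⊆
        {x | ENNReal.ofReal (l / 2) ≤ ‖mul n m us x‖ₑ} := by
      intro x hx
      by_contra hlt
      have hx' : ENNReal.ofReal l < ‖mul n m u x‖ₑ := hx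
      have h2 : ‖mul n m us x‖ₑ < ENNReal.ofReal (l / 2) := not_le.1 hlt
      rw [hsum] at hx'
      have h3 : ‖mul n m us x + mul n m ub x‖ₑ ≤ ENNReal.ofReal (l / 2) + ENNReal.ofReal (l / 2) :=
        (enorm_add_le _ _).trans (add_le_add h2.le (hbig x))
      rw [← ENNReal.ofReal_add (by positivity) (by positivity), add_halves] at h3
      exact absurd hx' (not_lt.2 h3)
    refine (measure_mono hsub).trans ?_
    have hch := meas_ge_le_mul_pow_eLpNorm_enorm (μ := volume) two_ne_zero ENNReal.ofNat_ne_top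
      (h.aestronglyMeasurable_mul hus2.1) (ε := ENNReal.ofReal (l / 2))
      (by simpa using hl) (fun hh => absurd hh ENNReal.ofReal_ne_top)
    refine hch.trans ?_
    have h2 := eLpNorm_mul_two_le hn h hB hus2
    have e2 : eLpNorm us 2 volume ^ (2 : ℝ) =
        ∫⁻ x, (S l).indicator (fun x => ‖u x‖ₑ ^ (2 : ℝ)) x := by
      rw [eLpNorm_eq_lintegral_rpow_enorm_toReal two_ne_zero ENNReal.ofNat_ne_top,
        ← ENNReal.rpow_mul]
      simp only [ENNReal.toReal_ofNat, one_div]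
      rw [inv_mul_cancel₀ two_ne_zero, ENNReal.rpow_one]
      refine lintegral_congr fun x => ?_
      by_cases hx : x ∈ S l
      · simp [hus, hx]
      · simp [hus, hx]
    simp only [ENNReal.toReal_ofNat]
    calc (ENNReal.ofReal (l / 2))⁻¹ ^ (2 : ℝ) * eLpNorm (mul n m us) 2 volume ^ (2 : ℝ)
        ≤ (ENNReal.ofReal (l / 2))⁻¹ ^ (2 : ℝ) *
          (ENNReal.ofReal B * eLpNorm us 2 volume) ^ (2 : ℝ) := by gcongr
      _ = (ENNReal.ofReal (l / 2))⁻¹ ^ (2 : ℝ) * ENNReal.ofReal B ^ (2 : ℝ) *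
          eLpNorm us 2 volume ^ (2 : ℝ) := by
          rw [ENNReal.mul_rpow_of_nonneg _ _ (by norm_num), mul_assoc]
      _ = _ := by
          rw [e2]
          congr 1
          rw [← ENNReal.ofReal_inv_of_pos (by positivity),
            ENNReal.ofReal_rpow_of_nonneg (by positivity) (by norm_num),
            ENNReal.ofReal_rpow_of_nonneg (by positivity) (by norm_num),
            ← ENNReal.ofReal_mul (by positivity)]
          congr 1
          simp only [Real.rpow_ofNat]
          field_simp
          ring
  obtain ⟨w, hwm, hw⟩ : ∃ w : E n → ℂ, StronglyMeasurable w ∧ mul n m u =ᵐ[volume] w :=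
    h.aestronglyMeasurable_mul hu.1
  have hrw : ∫⁻ x, ‖mul n m u x‖ₑ ^ r = ∫⁻ x, ‖w x‖ₑ ^ r :=
    lintegral_congr_ae (hw.mono fun x hx => by simp only [hx])
  rw [hrw]
  refine (lintegral_rpow_le_lintegral_meas (μ := volume) hwm.measurable.enorm
    (by linarith : 0 < r)).trans ?_
  -- For fixed x the set of admissible l is (0, L], on which l^{r-3} integrates to L^{r-2}/(r-2).
  -- The powers of |u(x)| combine to p because 2 - (p-1)(r-2) = p when p = r/(r-1).
  have inner : ∀ x, ∫⁻ l in Ioi (0 : ℝ), ENNReal.ofReal (r * l ^ (r - 1)) *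
      (ENNReal.ofReal (4 * B ^ 2 / l ^ 2) * (S l).indicator (fun x => ‖u x‖ₑ ^ (2 : ℝ)) x) ≤
      ENNReal.ofReal (interpConst r * B ^ 2 * D ^ (r - 2) * N ^ (r - 2)) * ‖u x‖ₑ ^ p := by
    intro x
    set a := ‖u x‖ with ha
    rcases (norm_nonneg (u x)).eq_or_lt with h0 | h0
    · have hu0 : u x = 0 := norm_eq_zero.1 h0.symm
      have : ∀ l, (S l).indicator (fun x => ‖u x‖ₑ ^ (2 : ℝ)) x = 0 := by
        intro l
        by_cases hx : x ∈ S l <;> simp [hx, hu0]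
      simp only [this, mul_zero, lintegral_zero]
      exact zero_le
    rw [← ha] at h0
    set L := 2 * D * N / a ^ (p - 1) with hL
    have hL0 : 0 ≤ L := by positivity
    have e : ∀ l ∈ Ioi (0 : ℝ), ENNReal.ofReal (r * l ^ (r - 1)) *
        (ENNReal.ofReal (4 * B ^ 2 / l ^ 2) * (S l).indicator (fun x => ‖u x‖ₑ ^ (2 : ℝ)) x) =
        (Ioc 0 L).indicator (fun l => ENNReal.ofReal (r * (4 * B ^ 2) * a ^ (2 : ℝ)) *
          ENNReal.ofReal (l ^ (r - 2 - 1))) l := by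
      intro l hl
      have hl' : 0 < l := hl
      have hiff : x ∈ S l ↔ l ≤ L := by
        rw [hL, le_div_iff₀ (Real.rpow_pos_of_pos h0 _)]; rfl
      by_cases hx : l ≤ L
      · rw [indicator_of_mem (hiff.2 hx), indicator_of_mem (show l ∈ Ioc 0 L from ⟨hl, hx⟩),
          ← ofReal_norm (u x), ENNReal.ofReal_rpow_of_nonneg (norm_nonneg _) (by norm_num),
          ← ENNReal.ofReal_mul (by positivity), ← ENNReal.ofReal_mul (by positivity),
          ← ENNReal.ofReal_mul (by positivity)]
        congr 1
        have : l ^ (r - 1) = l ^ (r - 2 - 1) * l ^ 2 := by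
          rw [← Real.rpow_natCast, ← Real.rpow_add hl']; congr 1; push_cast; ring
        rw [this, ha]
        field_simp
      · rw [indicator_of_notMem (fun hh => hx (hiff.1 hh)),
          indicator_of_notMem (fun hh : l ∈ Ioc 0 L => hx hh.2)]
        simp
    rw [setLIntegral_congr_fun measurableSet_Ioi e, lintegral_indicator measurableSet_Ioc,
      Measure.restrict_restrict measurableSet_Ioc, inter_eq_left.2 Ioc_subset_Ioi_self,
      lintegral_const_mul' _ _ ENNReal.ofReal_ne_top, lintegral_Ioc_rpow (by linarith) hL0,
      ← ofReal_norm (u x), ← ha, ENNReal.ofReal_rpow_of_nonneg h0.le hp0.le,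
      ← ENNReal.ofReal_mul (by positivity),
      ← ENNReal.ofReal_mul (by have : 0 < r - 2 := by linarith
                               unfold interpConst; positivity)]
    refine ENNReal.ofReal_le_ofReal (le_of_eq ?_)
    have e3 : L ^ (r - 2) * a ^ (2 : ℝ) = 2 ^ (r - 2) * D ^ (r - 2) * N ^ (r - 2) * a ^ p := by
      rw [hL, Real.div_rpow (by positivity) (by positivity), Real.mul_rpow (by positivity)
        (by positivity), Real.mul_rpow (by positivity) (by positivity), ← Real.rpow_mul h0.le,
        div_mul_eq_mul_div, mul_div_assoc, ← Real.rpow_sub h0]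
      congr 2
      rw [hp1, hpr]; field_simp; ring
    unfold interpConst
    linear_combination (r * (4 * B ^ 2) / (r - 2)) * e3
  calc _ ≤ ∫⁻ l in Ioi (0 : ℝ), ∫⁻ x, ENNReal.ofReal (r * l ^ (r - 1)) *
      (ENNReal.ofReal (4 * B ^ 2 / l ^ 2) * (S l).indicator (fun x => ‖u x‖ₑ ^ (2 : ℝ)) x) := by
        refine setLIntegral_mono_ae' measurableSet_Ioi (Filter.Eventually.of_forall fun l hl => ?_)
        rw [lintegral_const_mul' _ _ ENNReal.ofReal_ne_top,
          lintegral_const_mul' _ _ ENNReal.ofReal_ne_top]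
        refine mul_le_mul_right (le_trans (le_of_eq ?_) (level l hl)) _
        refine measure_congr (hw.mono fun x hx => ?_)
        change (ENNReal.ofReal l < ‖w x‖ₑ) = (ENNReal.ofReal l < ‖mul n m u x‖ₑ)
        rw [hx]
    _ = ∫⁻ x, ∫⁻ l in Ioi (0 : ℝ), ENNReal.ofReal (r * l ^ (r - 1)) *
      (ENNReal.ofReal (4 * B ^ 2 / l ^ 2) * (S l).indicator (fun x => ‖u x‖ₑ ^ (2 : ℝ)) x) := by
        rw [lintegral_lintegral_swap]
        refine Measurable.aemeasurable ?_
        have hum' := hum.measurable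
        have : Measurable (fun z : ℝ × E n => ENNReal.ofReal (r * z.1 ^ (r - 1)) *
            (ENNReal.ofReal (4 * B ^ 2 / z.1 ^ 2) *
            {z : ℝ × E n | z.1 * ‖u z.2‖ ^ (p - 1) ≤ 2 * D * N}.indicator
              (fun z => ‖u z.2‖ₑ ^ (2 : ℝ)) z)) :=
          Measurable.mul (by fun_prop) (Measurable.mul (by fun_prop)
            (Measurable.indicator (by fun_prop) hSm))
        exact this
    _ ≤ ∫⁻ x, ENNReal.ofReal (interpConst r * B ^ 2 * D ^ (r - 2) * N ^ (r - 2)) * ‖u x‖ₑ ^ p :=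
        lintegral_mono inner
    _ = _ := by
        have h4 : 0 < r - 2 := by linarith
        rw [lintegral_const_mul' _ _ ENNReal.ofReal_ne_top, hN, ← ENNReal.ofReal_mul
          (by unfold interpConst; positivity)]
        congr 1
        rw [show r - 1 = (r - 2) + 1 by ring, Real.rpow_add_one hN0.ne']
        ring

theorem conjExponent_two : (2 : ℝ≥0∞).conjExponent = 2 := by
  have : (2 : ℝ≥0∞) - 1 = 1 := by
    rw [← one_add_one_eq_two]; exact ENNReal.add_sub_cancel_right ENNReal.one_ne_top
  rw [ENNReal.conjExponent, this, inv_one, one_add_one_eq_two]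

theorem conjExponent_top : (⊤ : ℝ≥0∞).conjExponent = 1 := by simp [ENNReal.conjExponent]

theorem toReal_conjExponent {r : ℝ≥0∞} (hr : 1 < r) (hrt : r ≠ ⊤) :
    r.conjExponent.toReal = r.toReal / (r.toReal - 1) ∧ r.conjExponent ≠ ⊤ := by
  lift r to NNReal using hrt
  have hr' : 1 < r := by exact_mod_cast hr
  rw [← ENNReal.coe_conjExponent hr']
  refine ⟨?_, ENNReal.coe_ne_top⟩
  simp only [ENNReal.coe_toReal]
  rw [NNReal.conjExponent, NNReal.coe_div, NNReal.coe_sub hr'.le, NNReal.coe_one]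

/-- At r = ∞ and r = 2 the two given bounds suffice; in between, the r-th root of
`lintegral_mul_rpow_le` is taken. The constant depends on r alone, which makes all later estimates
uniform over the blocks. -/
theorem exists_eLpNorm_mul_le_interp {n : ℕ} (hn : n ≤ 3) {r : ℝ≥0∞} (hr : 2 ≤ r) :
    ∃ c : ℝ, 0 < c ∧ ∀ (m : ℝ → ℂ) (B D : ℝ), IsSym m → 0 < B → 0 < D →
      (∀ y, 0 ≤ y → ‖m y‖ ≤ B) → (∀ x : E n, ‖kernel n m x‖ ≤ D) →
      ∀ u : E n → ℂ, MemLp u r.conjExponent volume →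
      eLpNorm (mul n m u) r volume ≤ ENNReal.ofReal (c * B ^ (1 - 2 * gap r) * D ^ (2 * gap r)) *
        eLpNorm u r.conjExponent volume := by
  rcases eq_or_ne r ⊤ with rfl | hrt
  · refine ⟨1, one_pos, fun m B D h hB0 hD0 hB hD u hu => ?_⟩
    have e1 : (1 - 2 * gap ⊤ : ℝ) = 0 := by simp [gap]
    have e2 : (2 * gap ⊤ : ℝ) = 1 := by simp [gap]
    rw [e1, e2, Real.rpow_zero, Real.rpow_one, mul_one, one_mul, conjExponent_top,
      eLpNorm_exponent_top]
    refine eLpNormEssSup_le_of_ae_enorm_bound (Filter.Eventually.of_forall fun x => ?_)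
    rw [conjExponent_top] at hu
    refine (h.enorm_mul_le_eLpNorm le_rfl hu x).trans ?_
    gcongr
    have : (1 : ℝ≥0∞).conjExponent = ⊤ := by simp [ENNReal.conjExponent]
    rw [this, eLpNorm_exponent_top]
    refine eLpNormEssSup_le_of_ae_enorm_bound (Filter.Eventually.of_forall fun x => ?_)
    rw [← ofReal_norm]
    exact ENNReal.ofReal_le_ofReal (hD x)
  rcases hr.eq_or_lt with rfl | hr2
  · refine ⟨1, one_pos, fun m B D h hB0 hD0 hB hD u hu => ?_⟩
    have e2 : gap 2 = 0 := by simp [gap]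
    rw [conjExponent_two] at hu ⊢
    rw [e2]
    simpa using eLpNorm_mul_two_le hn h hB hu
  set R := r.toReal with hR
  have hR2 : 2 < R := by
    rw [hR, ← ENNReal.toReal_ofNat 2]
    exact (ENNReal.toReal_lt_toReal ENNReal.ofNat_ne_top hrt).2 hr2
  have hR0 : 0 < R := by linarith
  obtain ⟨hp, hpt⟩ := toReal_conjExponent (lt_of_lt_of_le (by norm_num : (1 : ℝ≥0∞) < 2) hr) hrt
  rw [← hR] at hp
  have hR20 : 0 < R - 2 := by linarith
  have hR10 : 0 < R - 1 := by linarith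
  have hc0 : 0 < interpConst R := by unfold interpConst; positivity
  refine ⟨interpConst R ^ R⁻¹, Real.rpow_pos_of_pos hc0 _, fun m B D h hB0 hD0 hB hD u hu => ?_⟩
  obtain ⟨v, hvm, hv⟩ := hu.1
  have hvp : MemLp v r.conjExponent volume := (memLp_congr_ae hv).1 hu
  rw [mul_congr_ae hv, eLpNorm_congr_ae hv]
  have hp0 : r.conjExponent ≠ 0 := (zero_lt_one.trans_le (one_le_conjExponent r)).ne'
  have hr0 : r ≠ 0 := (lt_of_lt_of_le (by norm_num : (0 : ℝ≥0∞) < 2) hr).ne'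
  set p := r.conjExponent.toReal with hpdef
  have hp0' : 0 < p := by rw [hp]; positivity
  have hfin := lintegral_rpow_enorm_lt_top_of_eLpNorm_lt_top hp0 hpt hvp.2
  rw [← hpdef] at hfin
  set I := ∫⁻ x, ‖v x‖ₑ ^ p with hI
  by_cases hI0 : I = 0
  · have h0 : v =ᵐ[volume] fun _ => 0 := by
      have := (lintegral_eq_zero_iff (by have := hvm.measurable; fun_prop)).1 hI0
      filter_upwards [this] with x hx
      have hx' : ‖v x‖ₑ ^ p = 0 := hx
      rw [ENNReal.rpow_eq_zero_iff_of_pos hp0'] at hx'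
      simpa using hx'
    rw [mul_congr_ae h0, mul_zero_fun]
    simp
  have hN : I = ENNReal.ofReal I.toReal := (ENNReal.ofReal_toReal hfin.ne).symm
  have hN0 : 0 < I.toReal := ENNReal.toReal_pos hI0 hfin.ne
  have key := lintegral_mul_rpow_le hn h hB hD0 hD hR2 hp hvm hN0 hN
  rw [eLpNorm_eq_lintegral_rpow_enorm_toReal hr0 hrt, eLpNorm_eq_lintegral_rpow_enorm_toReal hp0 hpt,
    ← hR, ← hpdef, ← hI, hN, ENNReal.ofReal_rpow_of_nonneg hN0.le (by positivity),
    ← ENNReal.ofReal_mul (by positivity), one_div, ENNReal.rpow_inv_le_iff hR0,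
    ENNReal.ofReal_rpow_of_nonneg (by positivity) hR0.le]
  refine key.trans (ENNReal.ofReal_le_ofReal (le_of_eq ?_))
  rw [Real.mul_rpow (by positivity) (by positivity), Real.mul_rpow (by positivity) (by positivity),
    Real.mul_rpow (by positivity) (by positivity), ← Real.rpow_mul hc0.le, ← Real.rpow_mul hB0.le,
    ← Real.rpow_mul hD0.le, ← Real.rpow_mul hN0.le, inv_mul_cancel₀ hR0.ne', Real.rpow_one]
  have hg : gap r = 1 / 2 - R⁻¹ := by rw [gap, ENNReal.toReal_inv]
  rw [hg, ← Real.rpow_natCast B 2]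
  congr 3
  · congr 1
    push_cast; field_simp; ring
  · field_simp
  · rw [hp]; field_simp

end Dispersive

namespace Dispersive

/-! ### The Hardy-Littlewood-Sobolev inequality on the line -/

theorem lintegral_comp_abs_le {G : ℝ → ℝ≥0∞} :
    ∫⁻ s, G |s| ≤ 2 * ∫⁻ s in Ioi (0 : ℝ), G s := by
  have h1 : ∫⁻ s in Ioi (0 : ℝ), G |s| = ∫⁻ s in Ioi (0 : ℝ), G s :=
    setLIntegral_congr_fun measurableSet_Ioi fun s hs => by rw [abs_of_pos hs]
  have h2 : ∫⁻ s in Iio (0 : ℝ), G |s| = ∫⁻ s in Ioi (0 : ℝ), G s := by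
    have := (Measure.measurePreserving_neg (volume : Measure ℝ)).setLIntegral_comp_preimage_emb
      (MeasurableEquiv.neg ℝ).measurableEmbedding (fun s => G |s|) (Iio 0)
    rw [← this, ← h1]
    simp
  have h3 : (univ : Set ℝ) = Iio 0 ∪ Ici 0 := by simp
  calc ∫⁻ s, G |s| = ∫⁻ s in Iio 0 ∪ Ici 0, G |s| := by rw [← h3, setLIntegral_univ]
    _ ≤ (∫⁻ s in Iio (0 : ℝ), G |s|) + ∫⁻ s in Ici (0 : ℝ), G |s| := lintegral_union_le _ _ _
    _ = 2 * ∫⁻ s in Ioi (0 : ℝ), G s := by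
        rw [h2, setLIntegral_congr Ioi_ae_eq_Ici.symm, h1, two_mul]

theorem lintegral_rieszKernel_near {α R : ℝ} (hα : α < 1) (hR : 0 ≤ R) :
    ∫⁻ s : ℝ, {s : ℝ | |s| ≤ R}.indicator (fun s => ENNReal.ofReal (|s| ^ (-α))) s ≤
      ENNReal.ofReal (2 * (R ^ (1 - α) / (1 - α))) := by
  have h := lintegral_comp_abs_le (G := (Iic R).indicator fun s => ENNReal.ofReal (s ^ (-α)))
  refine le_trans (le_of_eq (lintegral_congr fun s => ?_)) (h.trans (le_of_eq ?_))
  · by_cases hs : |s| ≤ R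
    · rw [indicator_of_mem (show s ∈ {s : ℝ | |s| ≤ R} from hs),
        indicator_of_mem (show |s| ∈ Iic R from hs)]
    · rw [indicator_of_notMem (show s ∉ {s : ℝ | |s| ≤ R} from hs),
        indicator_of_notMem (show |s| ∉ Iic R from hs)]
  · rw [lintegral_indicator measurableSet_Iic, Measure.restrict_restrict measurableSet_Iic,
      inter_comm, Ioi_inter_Iic]
    have := lintegral_Ioc_rpow (s := 1 - α) (by linarith) hR
    rw [show (1 - α - 1 : ℝ) = -α by ring] at this
    rw [this, ENNReal.ofReal_mul zero_le_two, ENNReal.ofReal_ofNat]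

/-- The q-th power of the kernel is |s|^{-2} whatever q is, and its integral over |s| > R is 2/R. -/
theorem lintegral_rieszKernel_far {q R : ℝ} (hq : 0 < q) (hR : 0 < R) :
    ∫⁻ s : ℝ, {s : ℝ | R < |s|}.indicator (fun s => ENNReal.ofReal (|s| ^ (-(2 / q)))) s ^ q ≤
      ENNReal.ofReal (2 / R) := by
  have h := lintegral_comp_abs_le (G := (Ioi R).indicator fun s => ENNReal.ofReal (s ^ (-2 : ℝ)))
  refine le_trans (le_of_eq (lintegral_congr fun s => ?_)) (h.trans (le_of_eq ?_))
  · by_cases hs : R < |s|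
    · rw [indicator_of_mem (show s ∈ {s : ℝ | R < |s|} from hs),
        indicator_of_mem (show |s| ∈ Ioi R from hs),
        ENNReal.ofReal_rpow_of_nonneg (by positivity) hq.le, ← Real.rpow_mul (abs_nonneg _)]
      congr 2; field_simp
    · rw [indicator_of_notMem (show s ∉ {s : ℝ | R < |s|} from hs),
        indicator_of_notMem (show |s| ∉ Ioi R from hs), ENNReal.zero_rpow_of_pos hq]
  · rw [lintegral_indicator measurableSet_Ioi, Measure.restrict_restrict measurableSet_Ioi,
      inter_eq_left.2 (Ioi_subset_Ioi hR.le), ← ofReal_integral_eq_lintegral_ofReal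
        (integrableOn_Ioi_rpow_of_lt (by norm_num) hR),
      integral_Ioi_rpow_of_lt (by norm_num) hR, show (2 / R : ℝ) = 2 * (1 / R) by ring,
      ENNReal.ofReal_mul zero_le_two, ENNReal.ofReal_ofNat]
    · congr 2
      rw [show (-2 + 1 : ℝ) = -1 by norm_num, Real.rpow_neg_one]
      field_simp
    · filter_upwards [ae_restrict_mem measurableSet_Ioi] with t ht
      exact Real.rpow_nonneg (hR.trans ht).le _

/-- The fractional integral of order `1 - α`. -/
def fracInt (α : ℝ) (f : ℝ → ℝ≥0∞) (t : ℝ) : ℝ≥0∞ :=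
  ∫⁻ s, ENNReal.ofReal (|s| ^ (-α)) * f (t - s)

theorem measurable_fracInt {α : ℝ} {f : ℝ → ℝ≥0∞} (hf : Measurable f) :
    Measurable (fracInt α f) := by
  have : Measurable (fun z : ℝ × ℝ => ENNReal.ofReal (|z.2| ^ (-α)) * f (z.1 - z.2)) := by fun_prop
  exact this.lintegral_prod_right'

/-- Hardy-Littlewood-Sobolev by a direct level set argument for normalised `f`: at level l the
kernel is cut at |s| = R and `f` at height c₁ l^{q-1}. The far kernel and the small values of `f`
contribute at most l/4 each, so only the near kernel acting on the large values can produce more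
than l/2; Chebyshev's inequality in L^1 handles that part. -/
theorem exists_lintegral_fracInt_le {q p : ℝ} (hq : 2 < q) (hp : p = q / (q - 1)) :
    ∃ C : ℝ≥0∞, C ≠ ⊤ ∧ ∀ f : ℝ → ℝ≥0∞, Measurable f → ∫⁻ s, f s ^ p = 1 →
      ∫⁻ t, fracInt (2 / q) f t ^ q ≤ C := by
  have hq0 : 0 < q := by linarith
  have hq1 : 0 < q - 1 := by linarith
  have hp0 : 0 < p := by rw [hp]; positivity
  set α := 2 / q with hα
  have hα1 : α < 1 := by rw [hα, div_lt_one hq0]; exact hq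
  have h1α : 0 < 1 - α := by linarith
  -- `c₁` makes the near kernel acting on values below c₁ l^{q-1} contribute exactly l/4, and `c₂`
  -- is the constant in the Chebyshev bound; both come from the value 2 R^{1-α}/(1-α) that bounds
  -- the integral of the near kernel.
  set c₁ : ℝ := (1 - α) / (8 * (2 * 4 ^ q) ^ (1 - α)) with hc₁
  have hc₁0 : 0 < c₁ := by positivity
  set c₂ : ℝ := 4 * ((2 * 4 ^ q) ^ (1 - α) / (1 - α)) with hc₂
  have hc₂0 : 0 < c₂ := by positivity
  refine ⟨ENNReal.ofReal (q * c₂ * c₁ ^ (-(1 / (q - 1)))), ENNReal.ofReal_ne_top, ?_⟩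
  intro f hf hf1
  set k : ℝ → ℝ≥0∞ := fun s => ENNReal.ofReal (|s| ^ (-α)) with hk
  have hkm : Measurable k := by fun_prop
  have hgm : ∀ l : ℝ, MeasurableSet {s | ENNReal.ofReal (c₁ * l ^ (q - 1)) < f s} := fun l =>
    measurableSet_lt measurable_const hf
  have level : ∀ l : ℝ, 0 < l → volume {t | ENNReal.ofReal l < fracInt α f t} ≤
      ENNReal.ofReal (c₂ * l ^ (-(q - 1))) *
        ∫⁻ s, {s | ENNReal.ofReal (c₁ * l ^ (q - 1)) < f s}.indicator f s := by
    intro l hl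
    -- Chosen so that (2/R)^{1/q} = l/4, the bound for the L^q norm of the far kernel. As α = 2/q,
    -- the power R^{1-α} is a multiple of l^{-(q-2)}.
    set R : ℝ := 2 * (4 / l) ^ q with hR
    have hR0 : 0 < R := by positivity
    have hRα : R ^ (1 - α) = (2 * 4 ^ q) ^ (1 - α) * l ^ (-(q - 2)) := by
      rw [hR, Real.div_rpow (by norm_num) hl.le, ← mul_div_assoc,
        Real.div_rpow (by positivity) (by positivity), ← Real.rpow_mul hl.le, div_eq_mul_inv,
        ← Real.rpow_neg hl.le]
      congr 2; rw [hα]; field_simp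
    set A : Set ℝ := {s | ENNReal.ofReal (c₁ * l ^ (q - 1)) < f s} with hA
    set kn : ℝ → ℝ≥0∞ := {s : ℝ | |s| ≤ R}.indicator k with hkn
    set kf : ℝ → ℝ≥0∞ := {s : ℝ | R < |s|}.indicator k with hkf
    have hknm : Measurable kn := hkm.indicator (measurableSet_le (by fun_prop) (by fun_prop))
    have hkfm : Measurable kf := hkm.indicator (measurableSet_lt (by fun_prop) (by fun_prop))
    have hfb : Measurable (A.indicator f) := hf.indicator (hgm l)
    have split : ∀ t s, k s * f (t - s) ≤ kf s * f (t - s) +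
        kn s * ENNReal.ofReal (c₁ * l ^ (q - 1)) + kn s * A.indicator f (t - s) := by
      intro t s
      by_cases hs : |s| ≤ R
      · have e1 : kn s = k s := indicator_of_mem (show s ∈ {s : ℝ | |s| ≤ R} from hs) _
        rw [e1]
        by_cases ha : t - s ∈ A
        · rw [indicator_of_mem ha]; exact le_add_left le_rfl
        · have : f (t - s) ≤ ENNReal.ofReal (c₁ * l ^ (q - 1)) := not_lt.1 ha
          refine le_trans ?_ (le_add_right le_rfl)
          exact le_trans (mul_le_mul_right this _) (le_add_left le_rfl)
      · have e1 : kf s = k s := indicator_of_mem (show s ∈ {s : ℝ | R < |s|} from not_le.1 hs) _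
        rw [e1]
        exact le_trans (le_add_right le_rfl) (le_add_right le_rfl)
    have far : ∀ t, ∫⁻ s, kf s * f (t - s) ≤ ENNReal.ofReal (l / 4) := by
      intro t
      have hc : q.HolderConjugate p := by
        rw [Real.holderConjugate_iff_eq_conjExponent (by linarith)]; exact hp
      have h := ENNReal.lintegral_mul_le_Lp_mul_Lq volume hc hkfm.aemeasurable
        (g := fun s => f (t - s)) (by fun_prop)
      rw [lintegral_sub_left_eq_self (fun s => f s ^ p) t, hf1, ENNReal.one_rpow, mul_one] at h
      refine h.trans ?_
      have h2 := lintegral_rieszKernel_far hq0 hR0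
      calc (∫⁻ a, kf a ^ q) ^ (1 / q) ≤ ENNReal.ofReal (2 / R) ^ (1 / q) := by gcongr
        _ = ENNReal.ofReal (l / 4) := by
          rw [ENNReal.ofReal_rpow_of_nonneg (by positivity) (by positivity)]
          congr 1
          have : 2 / R = (l / 4) ^ q := by
            rw [hR, Real.div_rpow (by norm_num) hl.le, Real.div_rpow hl.le (by norm_num)]
            field_simp
          rw [this, ← Real.rpow_mul (by positivity), mul_one_div_cancel hq0.ne', Real.rpow_one]
    have near : ∫⁻ s, kn s ≤ ENNReal.ofReal (2 * (R ^ (1 - α) / (1 - α))) :=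
      lintegral_rieszKernel_near hα1 hR0.le
    have small : ∫⁻ s, kn s * ENNReal.ofReal (c₁ * l ^ (q - 1)) ≤ ENNReal.ofReal (l / 4) := by
      rw [lintegral_mul_const' _ _ ENNReal.ofReal_ne_top]
      calc _ ≤ ENNReal.ofReal (2 * (R ^ (1 - α) / (1 - α))) * ENNReal.ofReal (c₁ * l ^ (q - 1)) := by
            gcongr
        _ = ENNReal.ofReal (l / 4) := by
          rw [← ENNReal.ofReal_mul (by positivity)]
          congr 1
          rw [hRα, hc₁]
          have : l ^ (-(q - 2)) * l ^ (q - 1) = l := by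
            rw [← Real.rpow_add hl]; ring_nf; exact Real.rpow_one l
          have h3 : (2 * (4 : ℝ) ^ q) ^ (1 - α) ≠ 0 := by positivity
          field_simp
          linear_combination 8 * this
    have hsub : {t | ENNReal.ofReal l < fracInt α f t} ⊆
        {t | ENNReal.ofReal (l / 2) ≤ ∫⁻ s, kn s * A.indicator f (t - s)} := by
      intro t ht
      by_contra hlt
      have h1 : ENNReal.ofReal l < fracInt α f t := ht
      have h2 : ∫⁻ s, kn s * A.indicator f (t - s) < ENNReal.ofReal (l / 2) := not_le.1 hlt
      have h3 : fracInt α f t ≤ ENNReal.ofReal (l / 4) + ENNReal.ofReal (l / 4) +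
          ENNReal.ofReal (l / 2) := by
        refine (lintegral_mono (split t)).trans ?_
        rw [lintegral_add_right _ (by fun_prop), lintegral_add_right _ (by fun_prop)]
        exact add_le_add (add_le_add (far t) small) h2.le
      rw [← ENNReal.ofReal_add (by positivity) (by positivity),
        ← ENNReal.ofReal_add (by positivity) (by positivity)] at h3
      refine absurd h1 (not_lt.2 (h3.trans (le_of_eq ?_)))
      congr 1; ring
    refine (measure_mono hsub).trans ?_
    have hJ : Measurable fun t => ∫⁻ s, kn s * A.indicator f (t - s) := by
      have : Measurable (fun z : ℝ × ℝ => kn z.2 * A.indicator f (z.1 - z.2)) := by fun_prop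
      exact this.lintegral_prod_right'
    refine (meas_ge_le_lintegral_div hJ.aemeasurable (by simpa using hl)
      ENNReal.ofReal_ne_top).trans ?_
    have hsw : ∫⁻ t, ∫⁻ s, kn s * A.indicator f (t - s) = (∫⁻ s, kn s) * ∫⁻ s, A.indicator f s := by
      rw [lintegral_lintegral_swap (by fun_prop), ← lintegral_mul_const _ hknm]
      refine lintegral_congr fun s => ?_
      rw [lintegral_const_mul _ (by fun_prop)]
      congr 1
      exact lintegral_sub_right_eq_self (fun t => A.indicator f t) s
    rw [hsw, ENNReal.div_eq_inv_mul, ← mul_assoc]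
    gcongr
    calc (ENNReal.ofReal (l / 2))⁻¹ * ∫⁻ s, kn s
        ≤ (ENNReal.ofReal (l / 2))⁻¹ * ENNReal.ofReal (2 * (R ^ (1 - α) / (1 - α))) := by gcongr
      _ = _ := by
        rw [← ENNReal.ofReal_inv_of_pos (by positivity), ← ENNReal.ofReal_mul (by positivity)]
        congr 1
        rw [hRα, hc₂, show -(q - 1) = -(q - 2) - 1 by ring, Real.rpow_sub_one hl.ne']
        field_simp
        ring
  -- The levels l for which c₁ l^{q-1} < f(s) form an interval of length at most
  -- (f(s)/c₁)^{1/(q-1)}, and 1 + 1/(q-1) = p.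
  have pt : ∀ s, ∫⁻ l in Ioi (0 : ℝ), ENNReal.ofReal (q * c₂) *
      {s | ENNReal.ofReal (c₁ * l ^ (q - 1)) < f s}.indicator f s ≤
      ENNReal.ofReal (q * c₂ * c₁ ^ (-(1 / (q - 1)))) * f s ^ p := by
    intro s
    have hp1 : p = 1 + 1 / (q - 1) := by rw [hp]; field_simp; ring
    rcases eq_or_ne (f s) ⊤ with htop | htop
    · rw [htop, ENNReal.top_rpow_of_pos hp0, ENNReal.mul_top]
      · exact le_top
      · simpa using by positivity
    set a := (f s).toReal with ha
    have hfa : f s = ENNReal.ofReal a := (ENNReal.ofReal_toReal htop).symm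
    have ha0 : 0 ≤ a := ENNReal.toReal_nonneg
    calc _ ≤ ∫⁻ l in Ioi (0 : ℝ), (Ioc 0 ((a / c₁) ^ (1 / (q - 1)))).indicator
                (fun _ => ENNReal.ofReal (q * c₂) * f s) l := by
          refine setLIntegral_mono_ae' measurableSet_Ioi
            (Filter.Eventually.of_forall fun l hl => ?_)
          have hl' : 0 < l := hl
          by_cases hx : ENNReal.ofReal (c₁ * l ^ (q - 1)) < f s
          · rw [indicator_of_mem (show s ∈ {s | ENNReal.ofReal (c₁ * l ^ (q - 1)) < f s} from hx)]
            rw [hfa, ENNReal.ofReal_lt_ofReal_iff_of_nonneg (by positivity)] at hx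
            rw [indicator_of_mem]
            refine ⟨hl', ?_⟩
            calc l = (l ^ (q - 1)) ^ (1 / (q - 1)) := by
                  rw [← Real.rpow_mul hl'.le, mul_one_div_cancel hq1.ne', Real.rpow_one]
              _ ≤ _ := by
                  gcongr
                  rw [le_div_iff₀ hc₁0]; linarith
          · rw [indicator_of_notMem
              (show s ∉ {s | ENNReal.ofReal (c₁ * l ^ (q - 1)) < f s} from hx), mul_zero]
            exact zero_le
      _ = ENNReal.ofReal (q * c₂) * f s * ENNReal.ofReal ((a / c₁) ^ (1 / (q - 1))) := by
          rw [lintegral_indicator measurableSet_Ioc, Measure.restrict_restrict measurableSet_Ioc,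
            inter_eq_left.2 Ioc_subset_Ioi_self, lintegral_const, Measure.restrict_apply_univ,
            Real.volume_Ioc, sub_zero]
      _ = _ := by
          rw [hfa, ENNReal.ofReal_rpow_of_nonneg ha0 hp0.le, ← ENNReal.ofReal_mul (by positivity),
            ← ENNReal.ofReal_mul (by positivity), ← ENNReal.ofReal_mul (by positivity)]
          congr 1
          rw [Real.div_rpow ha0 hc₁0.le, Real.rpow_neg hc₁0.le, hp1,
            Real.rpow_one_add' ha0 (by positivity)]
          field_simp
  refine (lintegral_rpow_le_lintegral_meas (measurable_fracInt hf) hq0).trans ?_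
  calc _ ≤ ∫⁻ l in Ioi (0 : ℝ), ∫⁻ s, ENNReal.ofReal (q * c₂) *
        {s | ENNReal.ofReal (c₁ * l ^ (q - 1)) < f s}.indicator f s := by
        refine setLIntegral_mono_ae' measurableSet_Ioi (Filter.Eventually.of_forall fun l hl => ?_)
        have hl' : 0 < l := hl
        rw [lintegral_const_mul' _ _ ENNReal.ofReal_ne_top]
        refine (mul_le_mul_right (level l hl') _).trans (le_of_eq ?_)
        rw [← mul_assoc, ← ENNReal.ofReal_mul (by positivity)]
        congr 2
        have : l ^ (q - 1) * l ^ (-(q - 1)) = 1 := by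
          rw [← Real.rpow_add hl', add_neg_cancel, Real.rpow_zero]
        linear_combination q * c₂ * this
    _ = ∫⁻ s, ∫⁻ l in Ioi (0 : ℝ), ENNReal.ofReal (q * c₂) *
        {s | ENNReal.ofReal (c₁ * l ^ (q - 1)) < f s}.indicator f s := by
        rw [lintegral_lintegral_swap]
        refine Measurable.aemeasurable ?_
        have hs : MeasurableSet {z : ℝ × ℝ | ENNReal.ofReal (c₁ * z.1 ^ (q - 1)) < f z.2} :=
          measurableSet_lt (by fun_prop) (by fun_prop)
        have : Measurable (fun z : ℝ × ℝ => ENNReal.ofReal (q * c₂) *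
            {z : ℝ × ℝ | ENNReal.ofReal (c₁ * z.1 ^ (q - 1)) < f z.2}.indicator
              (fun z => f z.2) z) :=
          Measurable.mul (by fun_prop) (Measurable.indicator (by fun_prop) hs)
        exact this
    _ ≤ ∫⁻ s, ENNReal.ofReal (q * c₂ * c₁ ^ (-(1 / (q - 1)))) * f s ^ p := by
        exact lintegral_mono pt
    _ = _ := by
        rw [lintegral_const_mul' _ _ ENNReal.ofReal_ne_top, hf1, mul_one]

end Dispersive

namespace Dispersive
open FourierTransform

theorem conjExponent_conjExponent {r : ℝ≥0∞} (hr : 1 ≤ r) : r.conjExponent.conjExponent = r := by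
  have : ENNReal.HolderConjugate r r.conjExponent := .conjExponent hr
  exact ENNReal.HolderConjugate.conjExponent_eq (h := this.symm)

/-- The bilinear form that the TT* method produces. For q = ∞ the kernel is 1; otherwise `f` is
normalised and the fractional integral is paired with it by Hölder's inequality. -/
theorem exists_lintegral_rieszKernel_le {q : ℝ≥0∞} (hq : 2 < q) :
    ∃ C : ℝ, 0 < C ∧ ∀ f : ℝ → ℝ≥0∞, Measurable f → eLpNorm f q.conjExponent volume ≠ ⊤ →
      ∫⁻ z : ℝ × ℝ, ENNReal.ofReal (|z.1 - z.2| ^ (-(2 * q⁻¹.toReal))) * (f z.1 * f z.2)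
        ∂(volume.prod volume) ≤ ENNReal.ofReal C * eLpNorm f q.conjExponent volume ^ 2 := by
  rcases eq_or_ne q ⊤ with rfl | hqt
  · refine ⟨1, one_pos, fun f hf _ => ?_⟩
    simp only [ENNReal.inv_top, ENNReal.toReal_zero, mul_zero, neg_zero, Real.rpow_zero,
      ENNReal.ofReal_one, one_mul, conjExponent_top, eLpNorm_one_eq_lintegral_enorm, enorm_eq_self]
    rw [lintegral_prod_mul hf.aemeasurable hf.aemeasurable, sq]
  set Q := q.toReal with hQ
  have hQ2 : 2 < Q := by
    rw [hQ, ← ENNReal.toReal_ofNat 2]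
    exact (ENNReal.toReal_lt_toReal ENNReal.ofNat_ne_top hqt).2 hq
  have hQ0 : 0 < Q := by linarith
  have hQ1 : 0 < Q - 1 := by linarith
  have hq1 : 1 < q := lt_trans (by norm_num) hq
  have hq0 : q ≠ 0 := (lt_trans (by norm_num) hq).ne'
  obtain ⟨hp, hpt⟩ := toReal_conjExponent hq1 hqt
  have hp0 : q.conjExponent ≠ 0 := (zero_lt_one.trans_le (one_le_conjExponent q)).ne'
  obtain ⟨C, hCt, hC⟩ := exists_lintegral_fracInt_le hQ2 hp
  set p := q.conjExponent.toReal with hpd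
  have hp0' : 0 < p := by rw [hp]; positivity
  have : ENNReal.HolderConjugate q q.conjExponent := .conjExponent hq1.le
  refine ⟨(C ^ Q⁻¹).toReal + 1, by positivity, fun f hf hft => ?_⟩
  set N := eLpNorm f q.conjExponent volume with hN
  have hNe : N = (∫⁻ s, f s ^ p) ^ (1 / p) := by
    rw [hN, eLpNorm_eq_lintegral_rpow_enorm_toReal hp0 hpt]
    simp only [enorm_eq_self, ← hpd]
  have hform : ∫⁻ z : ℝ × ℝ, ENNReal.ofReal (|z.1 - z.2| ^ (-(2 * q⁻¹.toReal))) * (f z.1 * f z.2)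
        ∂(volume.prod volume) = ∫⁻ t, fracInt (2 / Q) f t * f t := by
    rw [lintegral_prod _ (by fun_prop)]
    refine lintegral_congr fun t => ?_
    rw [fracInt, ← lintegral_mul_const _ (by fun_prop), ← lintegral_sub_left_eq_self _ t]
    refine lintegral_congr fun s => ?_
    rw [sub_sub_cancel, ENNReal.toReal_inv, ← hQ, ← div_eq_mul_inv]
    ring
  rw [hform]
  by_cases hN0 : N = 0
  · have hf0 : f =ᵐ[volume] 0 := by
      rw [hN] at hN0
      exact (eLpNorm_eq_zero_iff (by fun_prop) hp0).1 hN0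
    have : ∫⁻ t, fracInt (2 / Q) f t * f t = 0 := by
      rw [lintegral_congr_ae (g := fun _ => 0) (hf0.mono fun x hx => by simp [hx])]
      simp
    rw [this]; exact zero_le
  set F : ℝ → ℝ≥0∞ := fun s => N⁻¹ * f s with hF
  have hFm : Measurable F := by fun_prop
  have hF1 : ∫⁻ s, F s ^ p = 1 := by
    have hI : ∫⁻ s, f s ^ p = N ^ p := by
      rw [hNe, ← ENNReal.rpow_mul, one_div_mul_cancel hp0'.ne', ENNReal.rpow_one]
    simp only [hF, ENNReal.mul_rpow_of_nonneg _ _ hp0'.le]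
    rw [lintegral_const_mul _ (by fun_prop), hI, ← ENNReal.mul_rpow_of_nonneg _ _ hp0'.le,
      ENNReal.inv_mul_cancel hN0 hft, ENNReal.one_rpow]
  have hfF : ∀ s, f s = N * F s := fun s => by
    rw [hF, ← mul_assoc, ENNReal.mul_inv_cancel hN0 hft, one_mul]
  have hfrac : ∀ t, fracInt (2 / Q) f t = N * fracInt (2 / Q) F t := by
    intro t
    rw [fracInt, fracInt, ← lintegral_const_mul _ (by fun_prop)]
    refine lintegral_congr fun s => ?_
    rw [hfF]; ring
  have hFn : eLpNorm F q.conjExponent volume = 1 := by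
    rw [eLpNorm_eq_lintegral_rpow_enorm_toReal hp0 hpt]
    simp only [enorm_eq_self, ← hpd, hF1, ENNReal.one_rpow]
  calc ∫⁻ t, fracInt (2 / Q) f t * f t = N ^ 2 * ∫⁻ t, fracInt (2 / Q) F t * F t := by
        have hm : Measurable fun t => fracInt (2 / Q) F t * F t := (measurable_fracInt hFm).mul hFm
        rw [← lintegral_const_mul _ hm]
        refine lintegral_congr fun t => ?_
        rw [hfrac, hfF t]; ring
    _ ≤ N ^ 2 * (eLpNorm (fracInt (2 / Q) F) q volume * eLpNorm F q.conjExponent volume) := by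
        gcongr
        exact lintegral_mul_le_eLpNorm_mul_eLpNorm q q.conjExponent
          (measurable_fracInt hFm).aemeasurable hFm.aemeasurable
    _ ≤ N ^ 2 * (C ^ Q⁻¹) := by
        rw [hFn, mul_one, eLpNorm_eq_lintegral_rpow_enorm_toReal hq0 hqt]
        simp only [enorm_eq_self, ← hQ, one_div]
        gcongr
        exact hC F hFm hF1
    _ ≤ N ^ 2 * ENNReal.ofReal ((C ^ Q⁻¹).toReal + 1) := by
        gcongr
        refine le_trans (ENNReal.ofReal_toReal (ENNReal.rpow_ne_top_of_nonneg (by positivity) hCt)).ge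
          (ENNReal.ofReal_le_ofReal (by linarith))
    _ = _ := mul_comm _ _

/-! ### The phase -/

theorem norm_phase (g : ℝ → ℝ) (δ τ y : ℝ) : ‖phase g δ τ y‖ = 1 := by
  rw [phase, mul_comm, Complex.norm_exp_ofReal_mul_I]

theorem phase_add (g : ℝ → ℝ) (δ τ τ' y : ℝ) :
    phase g δ (τ + τ') y = phase g δ τ y * phase g δ τ' y := by
  rw [phase, phase, phase, ← Complex.exp_add]
  congr 1; push_cast; ring

theorem phase_zero (g : ℝ → ℝ) (δ y : ℝ) : phase g δ 0 y = 1 := by simp [phase]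

theorem conj_phase (g : ℝ → ℝ) (δ τ y : ℝ) :
    starRingEnd ℂ (phase g δ τ y) = phase g δ (-τ) y := by
  rw [phase, phase, ← Complex.exp_conj]
  congr 1
  simp only [map_mul, Complex.conj_I, Complex.conj_ofReal]
  push_cast; ring

theorem contDiffOn_phase {g : ℝ → ℝ} (hg : ContDiffOn ℝ 2 g (Ioi 0)) {δ : ℝ} (hδ : 0 < δ) (τ : ℝ) :
    ContDiffOn ℝ 2 (phase g δ τ) (Ioi 0) := by
  have h1 : ContDiffOn ℝ 2 (fun y => τ / δ * g (δ * y)) (Ioi 0) :=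
    contDiffOn_const.mul (hg.comp (by fun_prop) fun y hy => mul_pos hδ hy)
  have h2 : ContDiffOn ℝ 2 (fun y => ((τ / δ * g (δ * y) : ℝ) : ℂ)) (Ioi 0) :=
    Complex.ofRealCLM.contDiff.comp_contDiffOn h1
  exact (contDiffOn_const.mul h2).cexp

section
variable {n : ℕ} {g : ℝ → ℝ} {δ : ℝ}

theorem IsSym.phase_mul (hg : ContDiffOn ℝ 2 g (Ioi 0)) (hδ : 0 < δ) {m : ℝ → ℂ} (h : IsSym m)
    (τ : ℝ) : IsSym (fun y => phase g δ τ y * m y) :=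
  IsSym.mul_left (contDiffOn_phase hg hδ τ) h

/-- Dominated convergence, since the phase is unimodular. Joint continuity in time and space is the
source of the joint measurability needed for Fubini's theorem. -/
theorem continuous_kernel_phase (hg : ContDiffOn ℝ 2 g (Ioi 0)) (hδ : 0 < δ) {m : ℝ → ℂ}
    (h : IsSym m) :
    Continuous (fun z : ℝ × E n => kernel n (fun y => phase g δ z.1 y * m y) z.2) := by
  simp only [kernel_eq_fourier, Real.fourier_eq]
  have hb : ∀ (z : ℝ × E n) (η : E n), ‖Real.fourierChar (-inner ℝ η z.2) •
      rad n (fun y => phase g δ z.1 y * m y) η‖ = ‖rad n m η‖ := by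
    intro z η
    rw [Circle.norm_smul, rad, norm_mul, norm_phase, one_mul, rad]
  refine continuous_of_dominated (bound := fun η => ‖rad n m η‖) ?_ ?_ h.integrable_rad.norm ?_
  · intro z
    have hc : Continuous fun η : E n => -inner ℝ η z.2 := by fun_prop
    exact ((Real.continuous_fourierChar.comp hc).smul
      (h.phase_mul hg hδ z.1).contDiff_rad.continuous).aestronglyMeasurable
  · exact fun z => Filter.Eventually.of_forall fun η => (hb z η).le
  · refine Filter.Eventually.of_forall fun η => ?_
    have hc : Continuous fun z : ℝ × E n => -inner ℝ η z.2 := by fun_prop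
    refine (Real.continuous_fourierChar.comp hc).smul ?_
    simp only [rad, phase]
    fun_prop

end

/-! ### Quantitative symbols -/

/-- A symbol bounded by `B` whose kernel has `L¹` norm at most `L`. -/
structure SymBd (n : ℕ) (b : ℝ → ℂ) (B L : ℝ) : Prop where
  sym : IsSym b
  pos : 0 < B
  pos' : 0 < L
  bound : ∀ y, 0 ≤ y → ‖b y‖ ≤ B
  l1 : eLpNorm (kernel n b) 1 volume ≤ ENNReal.ofReal L

theorem SymBd.mul {n : ℕ} (hn : n ≤ 3) {b₁ b₂ : ℝ → ℂ} {B₁ L₁ B₂ L₂ : ℝ} (h₁ : SymBd n b₁ B₁ L₁)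
    (h₂ : SymBd n b₂ B₂ L₂) : SymBd n (fun y => b₁ y * b₂ y) (B₁ * B₂) (L₁ * L₂) where
  sym := h₁.sym.mul_right h₂.sym.contDiffOn
  pos := mul_pos h₁.pos h₂.pos
  pos' := mul_pos h₁.pos' h₂.pos'
  bound y hy := by
    rw [norm_mul]
    exact mul_le_mul (h₁.bound y hy) (h₂.bound y hy) (norm_nonneg _) h₁.pos.le
  l1 := by
    rw [← kernel_mul_eq hn h₁.sym h₂.sym, ENNReal.ofReal_mul h₁.pos'.le]
    refine (eLpNorm_mul_le h₁.sym le_rfl (h₂.sym.memLp_kernel hn le_rfl).1).trans ?_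
    gcongr
    · exact h₁.l1
    · exact h₂.l1

theorem SymBd.conj {n : ℕ} {b : ℝ → ℂ} {B L : ℝ} (h : SymBd n b B L) :
    SymBd n (fun y => starRingEnd ℂ (b y)) B L where
  sym := h.sym.conj
  pos := h.pos
  pos' := h.pos'
  bound y hy := by rw [RCLike.norm_conj]; exact h.bound y hy
  l1 := by
    refine le_trans (le_of_eq ?_) h.l1
    refine eLpNorm_congr_norm_ae (Filter.Eventually.of_forall fun x => ?_)
    rw [kernel_conj, RCLike.norm_conj]

/-- A frequency-localised propagator with a dispersive estimate. -/
structure IsBlock (n : ℕ) (g : ℝ → ℝ) (δ : ℝ) (p : ℝ → ℂ) (σ B L D : ℝ) : Prop where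
  dim : n ≤ 3
  reg : ContDiffOn ℝ 2 g (Ioi 0)
  scale : 0 < δ
  bd : SymBd n p B L
  pos : 0 < D
  disp : ∀ τ, τ ≠ 0 → ∀ x : E n, ‖kernel n (fun y => phase g δ τ y * p y) x‖ ≤ D * |τ| ^ (-σ)

end Dispersive

/-! ### Decay of one block, and measurability -/

namespace Dispersive

/-- q = 2 would give σ(1 - 2/r) = 1, which with σ ≤ 1 forces σ = 1 and r = ∞, the excluded endpoint.
The strict inequality is needed for Hardy-Littlewood-Sobolev, for Christ-Kiselev and for Minkowski's
inequality on the source side. -/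
theorem SharpAdmissible.two_lt {σ : ℝ} {q r : ℝ≥0∞} (hσ : σ ∈ Ioc (0 : ℝ) 1)
    (h : SharpAdmissible σ q r) : 2 < q := by
  obtain ⟨hq, hr, he, hne⟩ := h
  refine lt_of_le_of_ne hq fun h2 => ?_
  subst h2
  have h0 : (0 : ℝ) ≤ r⁻¹.toReal := ENNReal.toReal_nonneg
  rw [ENNReal.toReal_inv, ENNReal.toReal_ofNat] at he
  have h1 : σ = 1 := by nlinarith [hσ.1, hσ.2, mul_nonneg hσ.1.le h0]
  have h3 : r⁻¹.toReal = 0 := by rw [h1] at he; linarith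
  refine hne ⟨rfl, ?_, h1⟩
  rcases (ENNReal.toReal_eq_zero_iff _).1 h3 with h | h
  · exact ENNReal.inv_eq_zero.1 h
  · rw [ENNReal.inv_eq_top] at h; simp [h] at hr

theorem SharpAdmissible.exponent {σ : ℝ} {q r : ℝ≥0∞} (h : SharpAdmissible σ q r) :
    σ * (2 * gap r) = 2 * q⁻¹.toReal := by
  have := h.2.2.1
  rw [gap]; linarith

/-- For r = ∞ the essential supremum exceeds c exactly when the section of {‖U‖ > c} has positive
measure, and the measure of a section depends measurably on the parameter. -/
theorem measurable_eLpNorm_prod {α β : Type*} [MeasurableSpace α] [MeasurableSpace β]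
    {μ : Measure β} [SFinite μ] {U : α → β → ℂ} (hU : StronglyMeasurable (Function.uncurry U))
    (r : ℝ≥0∞) : Measurable fun t => eLpNorm (U t) r μ := by
  have hm : Measurable (Function.uncurry U) := hU.measurable
  rcases eq_or_ne r 0 with rfl | h0
  · simp
  rcases eq_or_ne r ⊤ with rfl | ht
  · simp only [eLpNorm_exponent_top]
    refine measurable_of_Ioi fun c => ?_
    have : (fun t => eLpNormEssSup (U t) μ) ⁻¹' Ioi c =
        {t | 0 < μ (Prod.mk t ⁻¹' {z : α × β | c < ‖U z.1 z.2‖ₑ})} := by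
      ext t
      simp only [mem_preimage, mem_Ioi, mem_ofPred_eq, eLpNormEssSup]
      rw [pos_iff_ne_zero, ← not_le, not_iff_not]
      constructor
      · intro h
        have := ae_le_essSup (μ := μ) (f := fun x => ‖U t x‖ₑ)
        refine measure_mono_null ?_ (ae_iff.1 this)
        intro x hx
        simp only [mem_preimage, mem_ofPred_eq, not_le] at hx ⊢
        exact h.trans_lt hx
      · intro h
        refine essSup_le_of_ae_le _ ?_
        refine ae_iff.2 (measure_mono_null ?_ h)
        intro x hx
        simpa using hx
    rw [this]
    have hs : MeasurableSet {z : α × β | c < ‖U z.1 z.2‖ₑ} :=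
      measurableSet_lt measurable_const hm.enorm
    exact measurable_measure_prodMk_left hs measurableSet_Ioi
  · simp only [eLpNorm_eq_lintegral_rpow_enorm_toReal h0 ht]
    refine Measurable.pow_const ?_ _
    exact Measurable.lintegral_prod_right' (f := fun z : α × β => ‖U z.1 z.2‖ₑ ^ r.toReal)
      (hm.enorm.pow_const _)

variable {n : ℕ} {g : ℝ → ℝ} {δ : ℝ}

theorem stronglyMeasurable_mul_of_kernel {α : Type*} [MeasurableSpace α] {m : α → ℝ → ℂ}
    (hm : StronglyMeasurable fun z : α × E n => kernel n (m z.1) z.2) {v : α → E n → ℂ}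
    (hv : StronglyMeasurable (Function.uncurry v)) :
    StronglyMeasurable (Function.uncurry fun a => mul n (m a) (v a)) := by
  have : Function.uncurry (fun a => mul n (m a) (v a)) =
      fun z : α × E n => ∫ t, kernel n (m z.1) t * v z.1 (z.2 - t) := by
    ext z; exact mul_apply n _ _ _
  rw [this]
  refine StronglyMeasurable.integral_prod_right'
    (f := fun y : (α × E n) × E n => kernel n (m y.1.1) y.2 * v y.1.1 (y.1.2 - y.2)) ?_
  refine StronglyMeasurable.mul ?_ ?_
  · exact hm.comp_measurable (g := fun y : (α × E n) × E n => (y.1.1, y.2)) (by fun_prop)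
  · exact hv.comp_measurable (g := fun y : (α × E n) × E n => (y.1.1, y.1.2 - y.2)) (by fun_prop)

theorem IsSym.stronglyMeasurable_mul_phase (hg : ContDiffOn ℝ 2 g (Ioi 0)) (hδ : 0 < δ)
    {m : ℝ → ℂ} (h : IsSym m) {α : Type*} [MeasurableSpace α] {τ : α → ℝ} (hτ : Measurable τ)
    {v : α → E n → ℂ} (hv : StronglyMeasurable (Function.uncurry v)) :
    StronglyMeasurable (Function.uncurry fun a => mul n (fun y => phase g δ (τ a) y * m y) (v a)) :=
  stronglyMeasurable_mul_of_kernel (m := fun a y => phase g δ (τ a) y * m y)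
    ((continuous_kernel_phase hg hδ h).stronglyMeasurable.comp_measurable
      (g := fun z : α × E n => (τ z.1, z.2)) (by fun_prop)) hv

theorem IsSym.stronglyMeasurable_mul {m : ℝ → ℂ} (h : IsSym m) {α : Type*} [MeasurableSpace α]
    {v : α → E n → ℂ} (hv : StronglyMeasurable (Function.uncurry v)) :
    StronglyMeasurable (Function.uncurry fun a => mul n m (v a)) :=
  stronglyMeasurable_mul_of_kernel (m := fun _ => m)
    (h.continuous_kernel.stronglyMeasurable.comp_measurable measurable_snd) hv

theorem one_le_of_two_le {r : ℝ≥0∞} (hr : 2 ≤ r) : 1 ≤ r := le_trans (by norm_num) hr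

/-- The decay constant of a dispersive block. -/
theorem exists_isBlock_decay (n : ℕ) {σ : ℝ} {q r : ℝ≥0∞} (hqr : SharpAdmissible σ q r) {B L : ℝ}
    (hB : 0 < B) :
    ∃ c : ℝ, 0 < c ∧ ∀ {g δ p D}, IsBlock n g δ p σ B L D → ∀ τ, τ ≠ 0 →
      ∀ u : E n → ℂ, MemLp u r.conjExponent volume →
      eLpNorm (mul n (fun y => phase g δ τ y * p y) u) r volume ≤
        ENNReal.ofReal (c * D ^ (2 * gap r) * |τ| ^ (-(2 * q⁻¹.toReal))) *
          eLpNorm u r.conjExponent volume := by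
  by_cases hn : n ≤ 3
  swap
  · exact ⟨1, one_pos, fun h => absurd h.dim hn⟩
  obtain ⟨c, hc, h⟩ := exists_eLpNorm_mul_le_interp hn hqr.2.1
  refine ⟨c * B ^ (1 - 2 * gap r), by positivity, fun {g δ p D} hb τ hτ u hu => ?_⟩
  have hτ' : 0 < |τ| := abs_pos.2 hτ
  have hD := hb.pos
  refine (h _ B (D * |τ| ^ (-σ)) (hb.bd.sym.phase_mul hb.reg hb.scale τ) hB (by positivity)
    (fun y hy => ?_) (hb.disp τ hτ) u hu).trans (le_of_eq ?_)
  · rw [norm_mul, norm_phase, one_mul]; exact hb.bd.bound y hy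
  · rw [Real.mul_rpow hD.le (by positivity), ← Real.rpow_mul hτ'.le, ← hqr.exponent]
    congr 2
    -- Admissibility enters here: 2σ(1/2 - 1/r) = 2/q turns the power of the dispersive decay into
    -- the kernel of the fractional integral.
    rw [show -σ * (2 * gap r) = -(σ * (2 * gap r)) by ring]
    ring

/-- The dispersive hypothesis concerns the symbol `p` alone; any further factor is applied
afterwards and costs the L^1 norm of its kernel. -/
theorem IsBlock.decay_mul {σ B L D : ℝ} {p : ℝ → ℂ} (hb : IsBlock n g δ p σ B L D) {b : ℝ → ℂ}
    (hs : IsSym b) {r : ℝ≥0∞} (hr : 1 ≤ r) {τ : ℝ} {u : E n → ℂ}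
    (hu : MemLp u r.conjExponent volume) :
    eLpNorm (mul n (fun y => phase g δ τ y * (p y * b y)) u) r volume ≤
      eLpNorm (kernel n b) 1 volume * eLpNorm (mul n (fun y => phase g δ τ y * p y) u) r volume := by
  have hp := hb.bd.sym.phase_mul hb.reg hb.scale τ
  have : mul n (fun y => phase g δ τ y * (p y * b y)) u =
      mul n b (mul n (fun y => phase g δ τ y * p y) u) := by
    rw [mul_mul_eq hb.dim hs hp (one_le_conjExponent r) hu]
    refine mul_congr (fun y _ => by ring) ?_
    ring
  rw [this]
  exact eLpNorm_mul_le hs hr (hp.aestronglyMeasurable_mul hu.1)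

theorem conjExponent_le_two {r : ℝ≥0∞} (hr : 2 ≤ r) : r.conjExponent ≤ 2 := by
  have : ENNReal.HolderConjugate r r.conjExponent := .conjExponent (one_le_of_two_le hr)
  rw [← ENNReal.inv_le_inv]
  have h := ENNReal.HolderConjugate.inv_add_inv_eq_one r r.conjExponent
  have h3 : r⁻¹ ≤ 2⁻¹ := ENNReal.inv_le_inv.2 hr
  by_contra hlt
  rw [not_le] at hlt
  have := ENNReal.add_lt_add_of_le_of_lt (ne_top_of_le_ne_top (by simp) h3) h3 hlt
  rw [h, ENNReal.inv_two_add_inv_two] at this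
  exact lt_irrefl _ this

/-- The algebra of TT*: the adjoint of the second multiplier is moved onto the first, the symbols
merge into `m₁` times the conjugate of `m₂`, and Hölder's inequality in the dual pair r', r remains.
-/
theorem enorm_integral_mul_conj_mul_le (hn : n ≤ 3) {m₁ m₂ : ℝ → ℂ} (h₁ : IsSym m₁) (h₂ : IsSym m₂)
    {r : ℝ≥0∞} (hr : 2 ≤ r) {u v : E n → ℂ} (hu : MemLp u r.conjExponent volume)
    (hv : MemLp v r.conjExponent volume) :
    ‖∫ x, mul n m₁ u x * starRingEnd ℂ (mul n m₂ v x)‖ₑ ≤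
      eLpNorm (mul n (fun y => m₁ y * starRingEnd ℂ (m₂ y)) u) r volume *
        eLpNorm v r.conjExponent volume := by
  have hr1 := one_le_of_two_le hr
  have hcc : r.conjExponent.conjExponent = r := conjExponent_conjExponent hr1
  have hr' : r.conjExponent ≤ r := (conjExponent_le_two hr).trans hr
  have hg : MemLp (mul n m₁ u) r.conjExponent.conjExponent volume := by
    rw [hcc]; exact h₁.memLp_mul_of_le hn (one_le_conjExponent r) hr' hu
  have hvc : MemLp (fun x => starRingEnd ℂ (v x)) r.conjExponent volume := hv.star
  have e1 : ∫ x, mul n m₁ u x * starRingEnd ℂ (mul n m₂ v x) =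
      ∫ x, starRingEnd ℂ (v x) * mul n (fun y => m₁ y * starRingEnd ℂ (m₂ y)) u x := by
    have h := integral_mul_mul_comm hn h₂.conj (one_le_conjExponent r) hvc hg
    rw [show (fun y => m₁ y * starRingEnd ℂ (m₂ y)) = fun y => starRingEnd ℂ (m₂ y) * m₁ y by
      ext y; ring, ← mul_mul_eq hn h₂.conj h₁ (one_le_conjExponent r) hu, ← h]
    refine integral_congr_ae (Filter.Eventually.of_forall fun x => ?_)
    simp only [conj_mul_apply]
    ring
  rw [e1]
  have : ENNReal.HolderConjugate r.conjExponent r := (ENNReal.HolderConjugate.conjExponent hr1).symm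
  have hm : AEStronglyMeasurable (mul n (fun y => m₁ y * starRingEnd ℂ (m₂ y)) u) volume :=
    (h₁.mul_right h₂.conj.contDiffOn).aestronglyMeasurable_mul hu.1
  refine (enorm_integral_mul_le r.conjExponent r hvc.1 hm).trans (le_of_eq ?_)
  rw [mul_comm]
  congr 1
  exact eLpNorm_congr_norm_ae (Filter.Eventually.of_forall fun x => by simp)

end Dispersive

/-! ### The TT* inequality and convergence of the time integrals -/

namespace Dispersive

theorem eLpNorm_two_sq {α : Type*} [MeasurableSpace α] {μ : Measure α} (f : α → ℂ) :
    eLpNorm f 2 μ ^ 2 = ∫⁻ x, ‖f x * starRingEnd ℂ (f x)‖ₑ ∂μ := by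
  rw [eLpNorm_eq_lintegral_rpow_enorm_toReal (by norm_num) (by norm_num), ← ENNReal.rpow_natCast,
    ← ENNReal.rpow_mul]
  simp [enorm_mul, sq]

theorem eLpNorm_two_sq_eq_enorm_integral {α : Type*} [MeasurableSpace α] {μ : Measure α} {f : α → ℂ}
    (hf : MemLp f 2 μ) : eLpNorm f 2 μ ^ 2 = ‖∫ x, f x * starRingEnd ℂ (f x) ∂μ‖ₑ := by
  have h1 : ∀ x, f x * starRingEnd ℂ (f x) = ((‖f x‖ ^ 2 : ℝ) : ℂ) := fun x => by
    rw [Complex.mul_conj, Complex.normSq_eq_norm_sq]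
  have hi : Integrable (fun x => ‖f x‖ ^ 2) μ := hf.integrable_norm_pow (by norm_num)
  rw [eLpNorm_two_sq]
  simp only [h1]
  rw [integral_complex_ofReal, ← ofReal_norm, Complex.norm_real,
    Real.norm_of_nonneg (integral_nonneg fun x => by positivity),
    ofReal_integral_eq_lintegral_ofReal hi (Filter.Eventually.of_forall fun x => by positivity)]
  refine lintegral_congr fun x => ?_
  rw [← ofReal_norm, Complex.norm_real, Real.norm_of_nonneg (by positivity)]

/-- The squared L^2 norm is expanded into a double integral of inner products. Integrability in time
of the L^2 norms is what permits Fubini's theorem. -/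
theorem eLpNorm_integral_two_sq_le {α β : Type*} [MeasurableSpace α] [MeasurableSpace β]
    {μ : Measure α} {ν : Measure β} [SFinite μ] [SFinite ν] {V : α → β → ℂ}
    (hV : StronglyMeasurable (Function.uncurry V)) (hfin : ∫⁻ s, eLpNorm (V s) 2 ν ∂μ ≠ ⊤) :
    eLpNorm (fun x => ∫ s, V s x ∂μ) 2 ν ^ 2 ≤
      ∫⁻ z, ‖∫ x, V z.1 x * starRingEnd ℂ (V z.2 x) ∂ν‖ₑ ∂(μ.prod μ) := by
  have : ENNReal.HolderConjugate 2 2 := ⟨by simp [ENNReal.inv_two_add_inv_two]⟩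
  have hVs : ∀ s, StronglyMeasurable (V s) := fun s => hV.comp_measurable measurable_prodMk_left
  set K : (α × α) → β → ℂ := fun z x => V z.1 x * starRingEnd ℂ (V z.2 x) with hK
  have hKm : StronglyMeasurable (Function.uncurry K) := by
    have h1 : StronglyMeasurable fun y : (α × α) × β => V y.1.1 y.2 :=
      hV.comp_measurable (g := fun y : (α × α) × β => (y.1.1, y.2)) (by fun_prop)
    have h2 : StronglyMeasurable fun y : (α × α) × β => V y.1.2 y.2 :=
      hV.comp_measurable (g := fun y : (α × α) × β => (y.1.2, y.2)) (by fun_prop)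
    exact h1.mul (Complex.continuous_conj.comp_stronglyMeasurable h2)
  have hN : Measurable fun s => eLpNorm (V s) 2 ν := measurable_eLpNorm_prod hV 2
  have hKf : ∫⁻ z, ∫⁻ x, ‖K z x‖ₑ ∂ν ∂(μ.prod μ) < ⊤ := by
    refine lt_of_le_of_lt (b := ∫⁻ z, eLpNorm (V z.1) 2 ν * eLpNorm (V z.2) 2 ν ∂(μ.prod μ))
      (lintegral_mono fun z => ?_) ?_
    · have := lintegral_mul_le_eLpNorm_mul_eLpNorm (μ := ν) 2 2 (hVs z.1).aestronglyMeasurable.enorm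
        (hVs z.2).aestronglyMeasurable.enorm
      rw [eLpNorm_enorm, eLpNorm_enorm] at this
      refine le_trans (le_of_eq (lintegral_congr fun x => ?_)) this
      simp [hK, enorm_mul]
    · rw [lintegral_prod_mul hN.aemeasurable hN.aemeasurable]
      exact ENNReal.mul_lt_top hfin.lt_top hfin.lt_top
  have hKi : Integrable (Function.uncurry K) ((μ.prod μ).prod ν) := by
    refine ⟨hKm.aestronglyMeasurable, ?_⟩
    rw [hasFiniteIntegral_iff_enorm, lintegral_prod _ hKm.aestronglyMeasurable.enorm]
    exact hKf
  set H : β → ℂ := fun x => ∫ s, V s x ∂μ with hH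
  have hHK : ∀ x, H x * starRingEnd ℂ (H x) = ∫ z, K z x ∂(μ.prod μ) := fun x => by
    rw [hH, ← integral_conj, ← integral_prod_mul]
  have hHm : StronglyMeasurable H := by
    refine StronglyMeasurable.integral_prod_right' (f := fun y : β × α => V y.2 y.1) ?_
    exact hV.comp_measurable measurable_swap
  have hH2 : MemLp H 2 ν := by
    refine ⟨hHm.aestronglyMeasurable, ?_⟩
    have : eLpNorm H 2 ν ^ 2 < ⊤ := by
      rw [eLpNorm_two_sq]
      simp only [hHK]
      refine lt_of_le_of_lt (lintegral_mono fun x => enorm_integral_le_lintegral_enorm _) ?_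
      rw [lintegral_lintegral_swap]
      · exact hKf
      · exact (hKm.comp_measurable measurable_swap).aestronglyMeasurable.enorm
    exact (ENNReal.pow_lt_top_iff.1 this).resolve_right (by norm_num)
  rw [eLpNorm_two_sq_eq_enorm_integral hH2]
  simp only [hHK]
  rw [← integral_integral_swap (f := K) hKi]
  exact enorm_integral_le_lintegral_enorm _

variable {n : ℕ} {g : ℝ → ℝ} {δ : ℝ}

/-- TT* at a single time: the phases cancel, so the bound does not depend on τ. The constant depends
on `b` through a crude bound for a kernel, so this is used only to establish finiteness and never in
a final constant. -/
theorem exists_eLpNorm_two_mul_phase_le (hn : n ≤ 3) (hg : ContDiffOn ℝ 2 g (Ioi 0)) (hδ : 0 < δ)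
    {b : ℝ → ℂ} {B L : ℝ} (hb : SymBd n b B L) {r : ℝ≥0∞} (hr : 2 ≤ r) :
    ∃ c : ℝ, 0 < c ∧ ∀ τ, ∀ u : E n → ℂ, MemLp u r.conjExponent volume →
      eLpNorm (mul n (fun y => phase g δ τ y * b y) u) 2 volume ≤
        ENNReal.ofReal c * eLpNorm u r.conjExponent volume := by
  obtain ⟨c, hc, h⟩ := exists_eLpNorm_mul_le_interp hn hr
  have hbb := hb.mul hn hb.conj
  set D := (∫ η, ‖rad n (fun y => b y * starRingEnd ℂ (b y)) η‖) + 1 with hD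
  have hD0 : 0 < D := by
    have : 0 ≤ ∫ η, ‖rad n (fun y => b y * starRingEnd ℂ (b y)) η‖ :=
      integral_nonneg fun _ => norm_nonneg _
    linarith
  set c' := c * (B * B) ^ (1 - 2 * gap r) * D ^ (2 * gap r) with hc'
  have hB := hb.pos
  have hc'0 : 0 < c' := by positivity
  refine ⟨√c', Real.sqrt_pos.2 hc'0, fun τ u hu => ?_⟩
  have hs := hb.sym.phase_mul hg hδ τ
  have hr1 := one_le_of_two_le hr
  have hm := hs.memLp_mul_of_le hn (one_le_conjExponent r) (conjExponent_le_two hr) hu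
  have hsym : (fun y => phase g δ τ y * b y * starRingEnd ℂ (phase g δ τ y * b y)) =
      fun y => b y * starRingEnd ℂ (b y) := by
    ext y
    rw [map_mul, mul_mul_mul_comm, conj_phase, ← phase_add, add_neg_cancel, phase_zero, one_mul]
  have h1 := enorm_integral_mul_conj_mul_le hn hs hs hr hu hu
  rw [hsym, ← eLpNorm_two_sq_eq_enorm_integral hm] at h1
  have h2 := h _ (B * B) D hbb.sym hbb.pos hD0 hbb.bound (fun x => by
    refine (IsSym.norm_kernel_le x).trans ?_
    linarith) u hu
  have h3 : eLpNorm (mul n (fun y => phase g δ τ y * b y) u) 2 volume ^ 2 ≤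
      (ENNReal.ofReal √c' * eLpNorm u r.conjExponent volume) ^ 2 := by
    refine h1.trans ((mul_le_mul_left h2 _).trans (le_of_eq ?_))
    rw [mul_pow, ← ENNReal.ofReal_pow (Real.sqrt_nonneg _), Real.sq_sqrt hc'0.le, ← hc']
    ring
  exact (ENNReal.pow_le_pow_left_iff (by norm_num)).1 h3

/-- For |τ| ≤ 1 the bound into L^2 that is uniform in time applies, for |τ| > 1 the decay
|τ|^{-2/q}, whose q-th power is integrable at infinity if q is finite. The factor `b` turns an L^2
or L^r bound into a pointwise one. With Hölder's inequality in time, this makes the time integrals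
converge absolutely at every point. -/
theorem IsBlock.exists_enorm_mul_le {σ B L D : ℝ} {p : ℝ → ℂ} (hb : IsBlock n g δ p σ B L D)
    (hσ : σ ∈ Ioc (0 : ℝ) 1) {q r : ℝ≥0∞} (hqr : SharpAdmissible σ q r) {b : ℝ → ℂ} {B' L' : ℝ}
    (hs : SymBd n b B' L') :
    ∃ h : ℝ → ℝ≥0∞, Measurable h ∧ eLpNorm h q volume ≠ ⊤ ∧
      ∀ τ, ∀ u : E n → ℂ, MemLp u r.conjExponent volume → ∀ x,
        ‖mul n (fun y => phase g δ τ y * (p y * b y)) u x‖ₑ ≤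
          h τ * eLpNorm u r.conjExponent volume := by
  have hn := hb.dim
  have hr1 := one_le_of_two_le hqr.2.1
  have hq2 := hqr.two_lt hσ
  obtain ⟨c, hc, hdec⟩ := exists_isBlock_decay n hqr (B := B) (L := L) hb.bd.pos
  obtain ⟨c₀, hc₀, h2⟩ := exists_eLpNorm_two_mul_phase_le hn hb.reg hb.scale hb.bd hqr.2.1
  have c22 : ENNReal.conjExponent 2 = 2 := conjExponent_two
  set k₁ := eLpNorm (kernel n b) 2 volume * ENNReal.ofReal c₀ with hk₁
  set k₂ := eLpNorm (kernel n b) r.conjExponent volume * ENNReal.ofReal (c * D ^ (2 * gap r)) with hk₂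
  have hk₁t : k₁ ≠ ⊤ := ENNReal.mul_ne_top (hs.sym.memLp_kernel hn (by norm_num)).2.ne (by simp)
  have hk₂t : k₂ ≠ ⊤ :=
    ENNReal.mul_ne_top (hs.sym.memLp_kernel hn (one_le_conjExponent r)).2.ne (by simp)
  have hcomp : ∀ τ u, MemLp u r.conjExponent volume →
      mul n (fun y => phase g δ τ y * (p y * b y)) u =
      mul n b (mul n (fun y => phase g δ τ y * p y) u) := fun τ u hu => by
    rw [mul_mul_eq hn hs.sym (hb.bd.sym.phase_mul hb.reg hb.scale τ) (one_le_conjExponent r) hu]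
    exact mul_congr (fun y _ => by ring) (by ring)
  set h₁ : ℝ → ℝ≥0∞ := fun τ => (Icc (-1) 1).indicator (fun _ => k₁) τ with hh₁
  set h₂ : ℝ → ℝ≥0∞ := fun τ => k₂ * ({τ | 1 < |τ|} : Set ℝ).indicator
    (fun τ => ENNReal.ofReal (|τ| ^ (-(2 * q⁻¹.toReal)))) τ with hh₂
  have hset : MeasurableSet ({τ : ℝ | 1 < |τ|} : Set ℝ) :=
    measurableSet_lt measurable_const (by fun_prop)
  have hm₁ : Measurable h₁ := measurable_const.indicator measurableSet_Icc
  have hm₂' : Measurable (({τ | 1 < |τ|} : Set ℝ).indicator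
    (fun τ => ENNReal.ofReal (|τ| ^ (-(2 * q⁻¹.toReal))))) :=
      Measurable.indicator (by fun_prop) hset
  have hm₂ : Measurable h₂ := measurable_const.mul hm₂'
  have hq0 : q ≠ 0 := (lt_trans (by norm_num) hq2).ne'
  refine ⟨h₁ + h₂, hm₁.add hm₂, ?_, fun τ u hu x => ?_⟩
  · refine ((eLpNorm_add_le hm₁.aestronglyMeasurable hm₂.aestronglyMeasurable
      (one_le_of_two_le hqr.1)).trans_lt (ENNReal.add_lt_top.2 ⟨?_, ?_⟩)).ne
    · refine lt_of_le_of_lt (eLpNorm_indicator_const_le _ q) ?_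
      refine ENNReal.mul_lt_top (by simpa using hk₁t.lt_top) (ENNReal.rpow_lt_top_of_nonneg (by simp) ?_)
      simp
    · refine lt_of_le_of_lt (eLpNorm_le_mul_eLpNorm_of_ae_le_mul'' (c := k₂) q
        hm₂'.aestronglyMeasurable (Filter.Eventually.of_forall fun τ => le_rfl)) ?_
      refine ENNReal.mul_lt_top hk₂t.lt_top ?_
      rcases eq_or_ne q ⊤ with rfl | hqt
      · rw [eLpNorm_exponent_top]
        refine lt_of_le_of_lt (eLpNormEssSup_le_of_ae_enorm_bound (C := 1)
          (Filter.Eventually.of_forall fun τ => ?_)) (by simp)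
        rw [enorm_eq_self, indicator]
        split_ifs <;> simp
      · rw [eLpNorm_eq_lintegral_rpow_enorm_toReal hq0 hqt]
        refine ENNReal.rpow_lt_top_of_nonneg (by simp) ?_
        have := lintegral_rieszKernel_far (q := q.toReal) (R := 1) (ENNReal.toReal_pos hq0 hqt) one_pos
        refine (lt_of_le_of_lt (le_trans (le_of_eq ?_) this) ENNReal.ofReal_lt_top).ne
        refine lintegral_congr fun τ => ?_
        rw [enorm_eq_self]
        congr 1
        simp only [ENNReal.toReal_inv, div_eq_mul_inv]
        try rfl
  · rw [hcomp τ u hu, Pi.add_apply, add_mul]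
    have hp := hb.bd.sym.phase_mul hb.reg hb.scale τ
    by_cases hτ : |τ| ≤ 1
    · refine le_trans ?_ le_self_add
      have : h₁ τ = k₁ := indicator_of_mem (by exact abs_le.1 hτ) _
      rw [this]
      have hv : MemLp (mul n (fun y => phase g δ τ y * p y) u) 2 volume :=
        ⟨hp.aestronglyMeasurable_mul hu.1, (h2 τ u hu).trans_lt
          (ENNReal.mul_lt_top (by simp) hu.2)⟩
      refine (hs.sym.enorm_mul_le_eLpNorm (by norm_num) hv x).trans ?_
      rw [c22, mul_assoc]
      gcongr
      exact h2 τ u hu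
    · refine le_trans ?_ le_add_self
      push Not at hτ
      have : h₂ τ = k₂ * ENNReal.ofReal (|τ| ^ (-(2 * q⁻¹.toReal))) := by
        rw [hh₂]; simp only; rw [indicator_of_mem (by exact hτ)]
      have hτ0 : τ ≠ 0 := by rintro rfl; simp at hτ; linarith
      rw [this]
      have hv : MemLp (mul n (fun y => phase g δ τ y * p y) u) r volume :=
        ⟨hp.aestronglyMeasurable_mul hu.1, (hdec hb τ hτ0 u hu).trans_lt
          (ENNReal.mul_lt_top (by simp) hu.2)⟩
      refine (hs.sym.enorm_mul_le_eLpNorm hr1 hv x).trans ?_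
      rw [hk₂, mul_assoc, mul_assoc]
      gcongr
      refine (hdec hb τ hτ0 u hu).trans (le_of_eq ?_)
      have hD := hb.pos
      rw [ENNReal.ofReal_mul (by positivity), mul_assoc]

end Dispersive

/-! ### The dual estimate for one block -/

namespace Dispersive

/-- An isometry of the time axis. -/
structure IsTimeIso (θ : ℝ → ℝ) : Prop where
  mp : MeasurePreserving θ volume volume
  dist : ∀ s s', |θ s - θ s'| = |s - s'|

theorem isTimeIso_id : IsTimeIso fun s => s := ⟨MeasurePreserving.id _, fun _ _ => rfl⟩

theorem isTimeIso_sub (t : ℝ) : IsTimeIso fun s => t - s :=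
  ⟨Measure.measurePreserving_sub_left _ t, fun s s' => by
    rw [sub_sub_sub_cancel_left, abs_sub_comm]⟩

theorem isTimeIso_neg : IsTimeIso fun s => -s := by simpa using isTimeIso_sub 0

/-- Sources of finite `L^{q'}_t L^{r'}_x` norm, normalised on null sets. -/
structure IsNice {n : ℕ} (q r : ℝ≥0∞) (w : ℝ → E n → ℂ) : Prop where
  meas : StronglyMeasurable (Function.uncurry w)
  mem : ∀ s, MemLp (w s) r.conjExponent volume
  fin : mixedNorm q.conjExponent r.conjExponent w ≠ ⊤

variable {n : ℕ} {g : ℝ → ℝ} {δ : ℝ}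

theorem eLpNorm_indicator_time {p : ℝ≥0∞} (w : ℝ → E n → ℂ) (S : Set ℝ) :
    (fun s => eLpNorm (S.indicator w s) p volume) = S.indicator fun s => eLpNorm (w s) p volume := by
  ext s
  by_cases hs : s ∈ S
  · simp [hs]
  · simp [hs]

theorem mixedNorm_indicator_le {p q : ℝ≥0∞} (w : ℝ → E n → ℂ) (S : Set ℝ) :
    mixedNorm q p (S.indicator w) ≤ mixedNorm q p w := by
  rw [mixedNorm, mixedNorm, timeNorm, timeNorm, eLpNorm_indicator_time]
  exact eLpNorm_indicator_le _

theorem IsNice.indicator {q r : ℝ≥0∞} {w : ℝ → E n → ℂ} (hw : IsNice q r w) {S : Set ℝ}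
    (hS : MeasurableSet S) : IsNice q r (S.indicator w) where
  meas := by
    have : Function.uncurry (S.indicator w) = (Prod.fst ⁻¹' S).indicator (Function.uncurry w) := by
      ext z
      by_cases hz : z.1 ∈ S
      · rw [indicator_of_mem (by exact hz)]; simp [Function.uncurry, hz]
      · rw [indicator_of_notMem (by exact hz)]; simp [Function.uncurry, hz]
    rw [this]
    exact hw.meas.indicator (measurable_fst hS)
  mem s := by
    by_cases hs : s ∈ S
    · rw [indicator_of_mem hs]; exact hw.mem s
    · rw [indicator_of_notMem hs]; exact MemLp.zero
  fin := ne_top_of_le_ne_top hw.fin (mixedNorm_indicator_le w S)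

theorem mul_indicator (m : ℝ → ℝ → ℂ) (w : ℝ → E n → ℂ) (S : Set ℝ) (x : E n) :
    (fun s => mul n (m s) (S.indicator w s) x) = S.indicator fun s => mul n (m s) (w s) x := by
  ext s
  by_cases hs : s ∈ S
  · simp [hs]
  · rw [indicator_of_notMem hs, indicator_of_notMem hs]
    exact congrFun mul_zero_fun x

theorem IsNice.measurable_norm {q r : ℝ≥0∞} {w : ℝ → E n → ℂ} (hw : IsNice q r w) :
    Measurable fun s => eLpNorm (w s) r.conjExponent volume := measurable_eLpNorm_prod hw.meas _

theorem IsBlock.exists_lintegral_enorm_mul_le {σ B L D : ℝ} {p : ℝ → ℂ}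
    (hb : IsBlock n g δ p σ B L D)
    (hσ : σ ∈ Ioc (0 : ℝ) 1) {q r : ℝ≥0∞} (hqr : SharpAdmissible σ q r) {b : ℝ → ℂ} {B' L' : ℝ}
    (hs : SymBd n b B' L') :
    ∃ M : ℝ≥0∞, M ≠ ⊤ ∧ ∀ w : ℝ → E n → ℂ, IsNice q r w → ∀ θ, IsTimeIso θ → ∀ x,
      ∫⁻ s, ‖mul n (fun y => phase g δ (θ s) y * (p y * b y)) (w s) x‖ₑ ≤
        M * mixedNorm q.conjExponent r.conjExponent w := by
  obtain ⟨h, hm, hf, hle⟩ := hb.exists_enorm_mul_le hσ hqr hs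
  refine ⟨_, hf, fun w hw θ hθ x => ?_⟩
  have : ENNReal.HolderConjugate q q.conjExponent := .conjExponent (one_le_of_two_le hqr.1)
  refine (lintegral_mono fun s => hle (θ s) (w s) (hw.mem s) x).trans ?_
  refine (lintegral_mul_le_eLpNorm_mul_eLpNorm q q.conjExponent
    (hm.comp hθ.mp.measurable).aemeasurable hw.measurable_norm.aemeasurable).trans (le_of_eq ?_)
  rw [mixedNorm, timeNorm]
  congr 1
  exact eLpNorm_comp_measurePreserving hm.aestronglyMeasurable hθ.mp

theorem IsBlock.integrable_mul {σ B L D : ℝ} {p : ℝ → ℂ} (hb : IsBlock n g δ p σ B L D)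
    (hσ : σ ∈ Ioc (0 : ℝ) 1) {q r : ℝ≥0∞} (hqr : SharpAdmissible σ q r) {b : ℝ → ℂ} {B' L' : ℝ}
    (hs : SymBd n b B' L') {w : ℝ → E n → ℂ} (hw : IsNice q r w) {θ : ℝ → ℝ} (hθ : IsTimeIso θ)
    (x : E n) :
    Integrable (fun s => mul n (fun y => phase g δ (θ s) y * (p y * b y)) (w s) x) volume := by
  obtain ⟨M, hM, h⟩ := hb.exists_lintegral_enorm_mul_le hσ hqr hs
  refine ⟨?_, (h w hw θ hθ x).trans_lt (ENNReal.mul_lt_top hM.lt_top hw.fin.lt_top)⟩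
  have := (hb.bd.sym.mul_right hs.sym.contDiffOn).stronglyMeasurable_mul_phase hb.reg hb.scale
    hθ.mp.measurable hw.meas
  exact (this.comp_measurable (measurable_prodMk_right (y := x))).aestronglyMeasurable

/-- The truncated integrals converge pointwise by dominated convergence, and Fatou's lemma passes
the bound to the limit. -/
theorem eLpNorm_integral_le_of_truncation {α β : Type*} [MeasurableSpace α] [MeasurableSpace β]
    {μ : Measure α} {ν : Measure β} [SFinite μ] {p : ℝ≥0∞} {V : α → β → ℂ}
    (hV : StronglyMeasurable (Function.uncurry V)) (hi : ∀ x, Integrable (fun s => V s x) μ)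
    {S : ℕ → Set α} (hSm : ∀ k, MeasurableSet (S k)) (hS : ∀ s, ∀ᶠ k in Filter.atTop, s ∈ S k)
    {A : ℝ≥0∞} (h : ∀ k, eLpNorm (fun x => ∫ s, (S k).indicator (fun s => V s x) s ∂μ) p ν ≤ A) :
    eLpNorm (fun x => ∫ s, V s x ∂μ) p ν ≤ A := by
  have hlim : ∀ x, Filter.Tendsto (fun k : ℕ => ∫ s, (S k).indicator (fun s => V s x) s ∂μ)
      Filter.atTop (nhds (∫ s, V s x ∂μ)) := by
    intro x
    refine tendsto_integral_of_dominated_convergence (fun s => ‖V s x‖)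
      (fun k => (hi x).1.indicator (hSm k)) (hi x).norm
      (fun k => Filter.Eventually.of_forall fun s => norm_indicator_le_norm_self _ _)
      (Filter.Eventually.of_forall fun s => ?_)
    refine tendsto_const_nhds.congr' ?_
    filter_upwards [hS s] with k hk
    rw [indicator_of_mem hk]
  refine (Lp.eLpNorm_lim_le_liminf_eLpNorm (fun k => ?_) _ (Filter.Eventually.of_forall hlim)).trans
    (Filter.liminf_le_of_frequently_le' (Filter.Frequently.of_forall h))
  refine (StronglyMeasurable.integral_prod_right' (f := fun z : β × α =>
      (S k).indicator (fun s => V s z.1) z.2) ?_).aestronglyMeasurable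
  have : (fun z : β × α => (S k).indicator (fun s => V s z.1) z.2) =
      (Prod.snd ⁻¹' S k).indicator fun z => V z.2 z.1 := rfl
  rw [this]
  exact (hV.comp_measurable measurable_swap).indicator (measurable_snd (hSm k))

/-- The dual estimate for one block. -/
theorem exists_dual_le (n : ℕ) {σ : ℝ} (hσ : σ ∈ Ioc (0 : ℝ) 1) {q r : ℝ≥0∞}
    (hqr : SharpAdmissible σ q r) {B L : ℝ} (hB : 0 < B) (hL : 0 < L) :
    ∃ c : ℝ, 0 < c ∧ ∀ {g δ p D}, IsBlock n g δ p σ B L D → ∀ w : ℝ → E n → ℂ, IsNice q r w →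
      ∀ θ, IsTimeIso θ →
      eLpNorm (fun x => ∫ s, mul n (fun y => phase g δ (θ s) y * (p y * p y)) (w s) x) 2 volume ≤
        ENNReal.ofReal (c * D ^ gap r) * mixedNorm q.conjExponent r.conjExponent w := by
  obtain ⟨c, hc, hdec⟩ := exists_isBlock_decay n hqr (B := B) (L := L) hB
  obtain ⟨C, hC, hHLS⟩ := exists_lintegral_rieszKernel_le (hqr.two_lt hσ)
  -- Under the root: the kernel norms of the three factors `p` not used for decay, the decay
  -- constant and the Hardy-Littlewood-Sobolev constant.
  refine ⟨√(L * (L * L) * c * C), by positivity, fun {g δ p D} hb w hw θ hθ => ?_⟩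
  have hD := hb.pos
  have hr1 := one_le_of_two_le hqr.2.1
  have hpp := hb.bd.mul hb.dim hb.bd
  have hppp := hb.bd.mul hb.dim hpp.conj
  -- the estimate for sources which are integrable in time
  have key : ∀ w : ℝ → E n → ℂ, IsNice q r w →
      ∫⁻ s, eLpNorm (w s) r.conjExponent volume ≠ ⊤ →
      eLpNorm (fun x => ∫ s, mul n (fun y => phase g δ (θ s) y * (p y * p y)) (w s) x) 2 volume ≤
        ENNReal.ofReal (√(L * (L * L) * c * C) * D ^ gap r) *
          mixedNorm q.conjExponent r.conjExponent w := by
    intro w hw hfin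
    have hV := hpp.sym.stronglyMeasurable_mul_phase hb.reg hb.scale hθ.mp.measurable hw.meas
    obtain ⟨c₀, -, h2⟩ := exists_eLpNorm_two_mul_phase_le hb.dim hb.reg hb.scale hpp hqr.2.1
    have hV2 : ∫⁻ s, eLpNorm (mul n (fun y => phase g δ (θ s) y * (p y * p y)) (w s)) 2 volume ≠ ⊤ := by
      refine ne_top_of_le_ne_top ?_ (lintegral_mono fun s => h2 (θ s) (w s) (hw.mem s))
      rw [lintegral_const_mul _ hw.measurable_norm]
      exact ENNReal.mul_ne_top (by simp) hfin
    have h1 := eLpNorm_integral_two_sq_le hV hV2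
    -- The dispersive bound says nothing at equal times, but the diagonal is a null set.
    have hae : ∀ᵐ z : ℝ × ℝ ∂(volume.prod volume), z.1 ≠ z.2 := by
      have hd : MeasurableSet {z : ℝ × ℝ | z.1 = z.2} := measurableSet_eq_fun measurable_fst measurable_snd
      have : (volume.prod volume : Measure (ℝ × ℝ)) {z : ℝ × ℝ | z.1 = z.2} = 0 := by
        rw [Measure.measure_prod_null hd]
        refine Filter.Eventually.of_forall fun x => ?_
        have : Prod.mk x ⁻¹' {z : ℝ × ℝ | z.1 = z.2} = {x} := by ext y; simp [eq_comm]
        simp [this]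
      rw [ae_iff]
      simpa using this
    have h3 : eLpNorm (fun x => ∫ s, mul n (fun y => phase g δ (θ s) y * (p y * p y)) (w s) x) 2
        volume ^ 2 ≤ ENNReal.ofReal (L * (L * L) * c * D ^ (2 * gap r)) *
        (ENNReal.ofReal C * mixedNorm q.conjExponent r.conjExponent w ^ 2) := by
      refine h1.trans (le_trans ?_ (mul_le_mul_right (hHLS _ hw.measurable_norm hw.fin) _))
      have hN := hw.measurable_norm
      have hm : Measurable fun z : ℝ × ℝ => ENNReal.ofReal (|z.1 - z.2| ^ (-(2 * q⁻¹.toReal))) *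
          (eLpNorm (w z.1) r.conjExponent volume * eLpNorm (w z.2) r.conjExponent volume) :=
        Measurable.mul (by fun_prop) ((hN.comp measurable_fst).mul (hN.comp measurable_snd))
      rw [← lintegral_const_mul _ hm]
      refine lintegral_mono_ae (hae.mono fun z hz => ?_)
      have hz' : θ z.1 - θ z.2 ≠ 0 := by
        rw [← abs_ne_zero, hθ.dist, abs_ne_zero]; exact sub_ne_zero.2 hz
      have hu := hw.mem z.1
      refine (enorm_integral_mul_conj_mul_le hb.dim (hpp.sym.phase_mul hb.reg hb.scale _)
        (hpp.sym.phase_mul hb.reg hb.scale _) hqr.2.1 hu (hw.mem z.2)).trans ?_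
      -- The product has four factors `p` or its conjugate: one carries the decay at time θ(s) -
      -- θ(s'), and the other three have a kernel of L^1 norm at most L^3.
      have hsym : (fun y => phase g δ (θ z.1) y * (p y * p y) *
          starRingEnd ℂ (phase g δ (θ z.2) y * (p y * p y))) =
          fun y => phase g δ (θ z.1 - θ z.2) y * (p y * (p y * starRingEnd ℂ (p y * p y))) := by
        ext y
        rw [map_mul, conj_phase, sub_eq_add_neg, phase_add]; ring
      rw [hsym, ← mul_assoc, ← mul_assoc]
      refine mul_le_mul_left ?_ _
      refine (hb.decay_mul hppp.sym hr1 hu).trans ?_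
      refine (mul_le_mul' hppp.l1 (hdec hb _ hz' _ hu)).trans (le_of_eq ?_)
      rw [hθ.dist, ← mul_assoc, ← ENNReal.ofReal_mul (by positivity),
        ← ENNReal.ofReal_mul (by positivity)]
      congr 2
      ring
    refine (ENNReal.pow_le_pow_left_iff (n := 2) (by norm_num)).1 (h3.trans (le_of_eq ?_))
    rw [mul_pow, ← ENNReal.ofReal_pow (by positivity), mul_pow, Real.sq_sqrt (by positivity),
      ← mul_assoc, ← ENNReal.ofReal_mul (by positivity), ← Real.rpow_natCast, ← Real.rpow_mul hD.le]
    congr 2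
    rw [Nat.cast_ofNat, mul_comm (gap r)]; ring
  -- the general case follows by truncation in time
  set S : ℕ → Set ℝ := fun k => Icc (-(k : ℝ)) k with hS
  have hSm : ∀ k, MeasurableSet (S k) := fun k => measurableSet_Icc
  have hk : ∀ k : ℕ, eLpNorm (fun x => ∫ s, mul n (fun y => phase g δ (θ s) y * (p y * p y))
      ((S k).indicator w s) x) 2 volume ≤ ENNReal.ofReal (√(L * (L * L) * c * C) * D ^ gap r) *
          mixedNorm q.conjExponent r.conjExponent w := by
    intro k
    refine (key _ (hw.indicator (hSm k)) ?_).trans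
      (mul_le_mul_right (mixedNorm_indicator_le w (S k)) _)
    rw [eLpNorm_indicator_time, lintegral_indicator (hSm k)]
    have h1 : MemLp (fun s => eLpNorm (w s) r.conjExponent volume) q.conjExponent
        (volume.restrict (S k)) :=
      MemLp.restrict _ ⟨hw.measurable_norm.aestronglyMeasurable, hw.fin.lt_top⟩
    have : IsFiniteMeasure (volume.restrict (S k)) := ⟨by simp [hS]⟩
    have h2 := h1.mono_exponent (one_le_conjExponent q)
    have h3 := h2.2
    rw [eLpNorm_one_eq_lintegral_enorm] at h3
    simpa using h3.ne
  have hi := fun x => hb.integrable_mul hσ hqr hb.bd hw hθ x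
  have hV := hpp.sym.stronglyMeasurable_mul_phase hb.reg hb.scale hθ.mp.measurable hw.meas
  refine eLpNorm_integral_le_of_truncation hV hi hSm (fun s => ?_) fun k => ?_
  · obtain ⟨N, hN⟩ := exists_nat_ge |s|
    filter_upwards [Filter.eventually_ge_atTop N] with k hk
    exact abs_le.1 (hN.trans (by exact_mod_cast hk))
  · refine le_trans (le_of_eq ?_) (hk k)
    congr 1
    ext x
    rw [mul_indicator (fun s y => phase g δ (θ s) y * (p y * p y))]

end Dispersive

/-! ### Duality in mixed norms -/

namespace Dispersive

/-- A near-extremiser for the L^∞ norm that depends measurably on t: mass on the set where |U|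
exceeds half its essential supremum. That set may have infinite measure, so it is weighted by a
fixed positive integrable density. The factor 2 is the price of using half the supremum. -/
theorem exists_norming_density_top {α β : Type*} [MeasurableSpace α] [MeasurableSpace β]
    {ν : Measure β} [SigmaFinite ν] {U : α → β → ℂ} (hU : StronglyMeasurable (Function.uncurry U)) :
    ∃ h : α → β → ℝ≥0∞, Measurable (Function.uncurry h) ∧ ∀ t, eLpNorm (U t) ⊤ ν ≠ 0 →
      eLpNorm (U t) ⊤ ν ≠ ⊤ → eLpNorm (h t) 1 ν ≤ 1 ∧
      eLpNorm (U t) ⊤ ν ≤ 2 * ∫⁻ x, ‖U t x‖ₑ * h t x ∂ν ∧ ∀ x, h t x ≠ ⊤ := by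
  have hm : Measurable (Function.uncurry U) := hU.measurable
  have hN : Measurable fun t => eLpNorm (U t) ⊤ ν := measurable_eLpNorm_prod hU ⊤
  obtain ⟨ρ', hρ0, hρm, hρ⟩ := exists_pos_lintegral_lt_of_sigmaFinite ν one_ne_zero
  obtain ⟨ρ, hρe⟩ : ∃ ρ : β → ℝ≥0∞, ρ = fun x => (ρ' x : ℝ≥0∞) := ⟨_, rfl⟩
  have hρ1 : Measurable ρ := by rw [hρe]; fun_prop
  have hρ2 : ∀ x, ρ x ≠ 0 := fun x => by rw [hρe]; simpa using (hρ0 x).ne'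
  have hρ3 : ∀ x, ρ x ≠ ⊤ := fun x => by rw [hρe]; simp
  have hρ4 : ∫⁻ x, ρ x ∂ν ≠ ⊤ := by rw [hρe]; exact (hρ.trans_le le_top).ne
  obtain ⟨A, hA⟩ : ∃ A : α → Set β, A = fun t => {x | eLpNorm (U t) ⊤ ν / 2 < ‖U t x‖ₑ} := ⟨_, rfl⟩
  have hAm : MeasurableSet {z : α × β | z.2 ∈ A z.1} := by
    rw [hA]
    exact measurableSet_lt ((hN.comp measurable_fst).div_const 2) hm.enorm
  have hkm : Measurable (Function.uncurry fun t => (A t).indicator ρ) := by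
    have : (Function.uncurry fun t => (A t).indicator ρ) =
        {z : α × β | z.2 ∈ A z.1}.indicator fun z => ρ z.2 := rfl
    rw [this]
    exact (hρ1.comp measurable_snd).indicator hAm
  have hI : Measurable fun t => ∫⁻ x, (A t).indicator ρ x ∂ν := hkm.lintegral_prod_right'
  refine ⟨fun t x => (∫⁻ x, (A t).indicator ρ x ∂ν)⁻¹ * (A t).indicator ρ x,
    (hI.comp measurable_fst).inv.mul hkm, fun t h0 hT => ?_⟩
  have hAt : MeasurableSet (A t) := measurable_prodMk_left hAm
  have hApos : ν (A t) ≠ 0 := by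
    intro h
    have h2 : eLpNorm (U t) ⊤ ν ≤ eLpNorm (U t) ⊤ ν / 2 := by
      conv_lhs => rw [eLpNorm_exponent_top]
      refine essSup_le_of_ae_le _ (ae_iff.2 (measure_mono_null ?_ h))
      intro x hx
      simpa [hA] using hx
    exact absurd h2 (not_le.2 (ENNReal.half_lt_self h0 hT))
  have hkt : Measurable ((A t).indicator ρ) := hρ1.indicator hAt
  obtain ⟨I, hId⟩ : ∃ I, I = ∫⁻ x, (A t).indicator ρ x ∂ν := ⟨_, rfl⟩
  simp only [← hId]
  have hI0 : I ≠ 0 := by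
    rw [hId, lintegral_indicator hAt]
    refine ((setLIntegral_pos_iff hρ1).2 ?_).ne'
    rw [Function.support_eq_univ hρ2, univ_inter]
    exact pos_iff_ne_zero.2 hApos
  have hIT : I ≠ ⊤ :=
    ne_top_of_le_ne_top hρ4 (hId ▸ lintegral_mono fun x => indicator_le_self _ _ _)
  refine ⟨?_, ?_, fun x => ENNReal.mul_ne_top (ENNReal.inv_ne_top.2 hI0) ?_⟩
  · rw [eLpNorm_one_eq_lintegral_enorm]
    simp only [enorm_eq_self]
    rw [lintegral_const_mul _ hkt, ← hId, ENNReal.inv_mul_cancel hI0 hIT]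
  · have h1 : eLpNorm (U t) ⊤ ν / 2 ≤ ∫⁻ x, ‖U t x‖ₑ * (I⁻¹ * (A t).indicator ρ x) ∂ν := by
      calc eLpNorm (U t) ⊤ ν / 2
          = ∫⁻ x, eLpNorm (U t) ⊤ ν / 2 * (I⁻¹ * (A t).indicator ρ x) ∂ν := by
            rw [lintegral_const_mul _ (hkt.const_mul _), lintegral_const_mul _ hkt, ← hId,
              ENNReal.inv_mul_cancel hI0 hIT, mul_one]
        _ ≤ _ := by
            refine lintegral_mono fun x => ?_
            by_cases hx : x ∈ A t
            · refine mul_le_mul_left (le_of_lt ?_) _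
              rw [hA] at hx; exact hx
            · simp [hx]
    calc eLpNorm (U t) ⊤ ν = 2 * (eLpNorm (U t) ⊤ ν / 2) := by
          rw [ENNReal.mul_div_cancel (by norm_num) (by norm_num)]
      _ ≤ _ := by gcongr
  · rw [indicator]; split_ifs
    · exact hρ3 x
    · simp

/-- For finite r the normalised |U|^{r-1} is an exact extremiser; the factor 2 is kept only for
uniformity with r = ∞. -/
theorem exists_norming_density {α β : Type*} [MeasurableSpace α] [MeasurableSpace β]
    {ν : Measure β} [SigmaFinite ν] {U : α → β → ℂ} (hU : StronglyMeasurable (Function.uncurry U))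
    {r : ℝ≥0∞} (hr : 2 ≤ r) :
    ∃ h : α → β → ℝ≥0∞, Measurable (Function.uncurry h) ∧ ∀ t, eLpNorm (U t) r ν ≠ 0 →
      eLpNorm (U t) r ν ≠ ⊤ → eLpNorm (h t) r.conjExponent ν ≤ 1 ∧
      eLpNorm (U t) r ν ≤ 2 * ∫⁻ x, ‖U t x‖ₑ * h t x ∂ν ∧ ∀ x, h t x ≠ ⊤ := by
  rcases eq_or_ne r ⊤ with rfl | ht
  · rw [conjExponent_top]; exact exists_norming_density_top hU
  have hm : Measurable (Function.uncurry U) := hU.measurable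
  have hN : Measurable fun t => eLpNorm (U t) r ν := measurable_eLpNorm_prod hU r
  have hr1 : 1 < r := lt_of_lt_of_le (by norm_num) hr
  have hr0 : r ≠ 0 := (zero_lt_one.trans hr1).ne'
  obtain ⟨hp, hpt⟩ := toReal_conjExponent hr1 ht
  set R := r.toReal with hR
  have hR1 : 1 < R := by
    rw [hR, ← ENNReal.toReal_one]; exact (ENNReal.toReal_lt_toReal (by simp) ht).2 hr1
  have hR0 : 0 < R := by linarith
  have hR10 : 0 < R - 1 := by linarith
  have hp0 : r.conjExponent ≠ 0 := (zero_lt_one.trans_le (one_le_conjExponent r)).ne'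
  refine ⟨fun t x => (eLpNorm (U t) r ν ^ (R - 1))⁻¹ * ‖U t x‖ₑ ^ (R - 1),
    ((hN.comp measurable_fst).pow_const _).inv.mul (hm.enorm.pow_const _), fun t h0 hT => ?_⟩
  have hUt : Measurable (U t) := hm.comp measurable_prodMk_left
  set N := eLpNorm (U t) r ν with hNd
  have hNR : ∫⁻ x, ‖U t x‖ₑ ^ R ∂ν = N ^ R := by
    rw [hNd, eLpNorm_eq_lintegral_rpow_enorm_toReal hr0 ht, ← ENNReal.rpow_mul,
      one_div_mul_cancel hR0.ne', ENNReal.rpow_one]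
  have hk0 : N ^ (R - 1) ≠ 0 := by
    simp only [ne_eq, ENNReal.rpow_eq_zero_iff, not_or, not_and]
    exact ⟨fun h => absurd h h0, fun h => absurd h hT⟩
  have hkT : N ^ (R - 1) ≠ ⊤ := ENNReal.rpow_ne_top_of_nonneg hR10.le hT
  refine ⟨?_, ?_, fun x => ENNReal.mul_ne_top (ENNReal.inv_ne_top.2 hk0)
    (ENNReal.rpow_ne_top_of_nonneg hR10.le (by simp))⟩
  · rw [eLpNorm_eq_lintegral_rpow_enorm_toReal hp0 hpt, hp]
    have : ∫⁻ x, ‖(N ^ (R - 1))⁻¹ * ‖U t x‖ₑ ^ (R - 1)‖ₑ ^ (R / (R - 1)) ∂ν = 1 := by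
      simp only [enorm_eq_self]
      have e : ∀ x, ((N ^ (R - 1))⁻¹ * ‖U t x‖ₑ ^ (R - 1)) ^ (R / (R - 1)) =
          (N ^ R)⁻¹ * ‖U t x‖ₑ ^ R := fun x => by
        rw [ENNReal.mul_rpow_of_nonneg _ _ (by positivity), ENNReal.inv_rpow, ← ENNReal.rpow_mul,
          ← ENNReal.rpow_mul, mul_div_cancel₀ _ hR10.ne']
      simp only [e]
      rw [lintegral_const_mul _ (by fun_prop), hNR, ENNReal.inv_mul_cancel]
      · simp only [ne_eq, ENNReal.rpow_eq_zero_iff, not_or, not_and]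
        exact ⟨fun h => absurd h h0, fun h => absurd h hT⟩
      · exact ENNReal.rpow_ne_top_of_nonneg hR0.le hT
    rw [this, ENNReal.one_rpow]
  · have e : ∀ x, ‖U t x‖ₑ * ((N ^ (R - 1))⁻¹ * ‖U t x‖ₑ ^ (R - 1)) =
        (N ^ (R - 1))⁻¹ * ‖U t x‖ₑ ^ R := fun x => by
      have : ‖U t x‖ₑ ^ R = ‖U t x‖ₑ * ‖U t x‖ₑ ^ (R - 1) := by
        conv_lhs => rw [show R = 1 + (R - 1) by ring, ENNReal.rpow_add_of_nonneg _ _ (by norm_num) hR10.le, ENNReal.rpow_one]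
      rw [this]; ring
    refine le_trans ?_ (le_of_eq (congrArg (2 * ·) (lintegral_congr (μ := ν) e).symm))
    rw [lintegral_const_mul _ (by fun_prop), hNR]
    have : N ^ R = N ^ (R - 1) * N := by
      conv_lhs => rw [show R = (R - 1) + 1 by ring, ENNReal.rpow_add_of_nonneg _ _ hR10.le (by norm_num), ENNReal.rpow_one]
    rw [this, ← mul_assoc (N ^ (R - 1))⁻¹, ENNReal.inv_mul_cancel hk0 hkT, one_mul]
    calc N = 1 * N := (one_mul _).symm
      _ ≤ 2 * N := by gcongr; norm_num

variable {n : ℕ}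

/-- The test function combines the norming density in x, the conjugate phase of `U`, and the weight
N^{q-1} in t, where N(t) is the norm of U(t). Restricting to times where |t| and N(t) are at most i
makes X = ∫ N^q over those times finite, so that X ≤ 2A X^{1-1/q} may be divided by its last factor.
The test functions are also integrable in time, and the hypothesis is required only for such `G`. -/
theorem mixedNorm_le_of_forall_dual {U : ℝ → E n → ℂ} (hU : StronglyMeasurable (Function.uncurry U))
    {q r : ℝ≥0∞} (hq : 1 < q) (hqt : q ≠ ⊤) (hr : 2 ≤ r) (hfin : ∀ t, eLpNorm (U t) r volume ≠ ⊤)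
    {A : ℝ≥0∞} (h : ∀ G : ℝ → E n → ℂ, IsNice q r G →
      ∫⁻ t, eLpNorm (G t) r.conjExponent volume ≠ ⊤ →
      ‖∫ t, ∫ x, U t x * G t x‖ₑ ≤ A * mixedNorm q.conjExponent r.conjExponent G) :
    mixedNorm q r U ≤ 2 * A := by
  obtain ⟨k, hkm, hk⟩ := exists_norming_density (ν := volume) hU hr
  obtain ⟨hp, hpt⟩ := toReal_conjExponent hq hqt
  set Q := q.toReal with hQ
  have hQ1 : 1 < Q := by
    rw [hQ, ← ENNReal.toReal_one]; exact (ENNReal.toReal_lt_toReal (by simp) hqt).2 hq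
  have hQ0 : 0 < Q := by linarith
  have hQ10 : 0 < Q - 1 := by linarith
  have hp0 : q.conjExponent ≠ 0 := (zero_lt_one.trans_le (one_le_conjExponent q)).ne'
  have hq0 : q ≠ 0 := (zero_lt_one.trans hq).ne'
  have hcr : ENNReal.HolderConjugate r r.conjExponent := .conjExponent (one_le_of_two_le hr)
  set N : ℝ → ℝ≥0∞ := fun t => eLpNorm (U t) r volume with hN
  have hNm : Measurable N := measurable_eLpNorm_prod hU r
  set S : ℕ → Set ℝ := fun i => {t | |t| ≤ i ∧ N t ≤ i} with hS
  have hSm : ∀ i, MeasurableSet (S i) := fun i =>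
    (measurableSet_le (f := fun t : ℝ => |t|) (by fun_prop) measurable_const).inter
      (measurableSet_le hNm measurable_const)
  have hSvol : ∀ i, volume (S i) ≠ ⊤ := fun i => by
    refine ((measure_mono (t := Icc (-(i : ℝ)) i) fun t ht => abs_le.1 ht.1).trans_lt ?_).ne
    simp
  have main : ∀ i, ∫⁻ t in S i, N t ^ Q ≤ (2 * A) ^ Q := by
    intro i
    set b : ℝ → ℝ≥0∞ := (S i).indicator fun t => N t ^ (Q - 1) with hb
    have hbm : Measurable b := (hNm.pow_const _).indicator (hSm i)
    have hbi : ∀ t, b t ≤ (S i).indicator (fun _ => (i : ℝ≥0∞) ^ (Q - 1)) t := fun t =>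
      indicator_le_indicator' fun ht => ENNReal.rpow_le_rpow ht.2 hQ10.le
    have hbt : ∀ t, b t ≠ ⊤ := fun t => by
      refine ne_top_of_le_ne_top ?_ (hbi t)
      rw [indicator]; split_ifs <;> simp [hQ1.le]
    have hb0 : ∀ t, N t = 0 → b t = 0 := fun t ht => by
      rw [hb, indicator]; split_ifs <;> simp [ht, hQ10]
    -- Where U(t,x) = 0 the quotient is 0 / 0 = 0, so no case distinction is needed.
    set G : ℝ → E n → ℂ := fun t x => ((b t).toReal : ℂ) *
      (starRingEnd ℂ (U t x) / (‖U t x‖ : ℂ) * ((k t x).toReal : ℂ)) with hG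
    have hUm : Measurable (Function.uncurry U) := hU.measurable
    have hGm : StronglyMeasurable (Function.uncurry G) := by
      have h1 : Measurable fun z : ℝ × E n => U z.1 z.2 := hUm
      have h2 : Measurable fun z : ℝ × E n => k z.1 z.2 := hkm
      have h3 : Measurable fun z : ℝ × E n => starRingEnd ℂ (U z.1 z.2) :=
        Complex.continuous_conj.measurable.comp h1
      exact Measurable.stronglyMeasurable (by
        simp only [hG, Function.uncurry_def]
        fun_prop)
    have hGle : ∀ t x, ‖G t x‖ₑ ≤ b t * k t x := fun t x => by
      rw [hG]
      simp only [enorm_mul]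
      have e1 : ‖((b t).toReal : ℂ)‖ₑ ≤ b t := by
        rw [← ofReal_norm, Complex.norm_real, Real.norm_of_nonneg ENNReal.toReal_nonneg]
        exact ENNReal.ofReal_toReal_le
      have e2 : ‖((k t x).toReal : ℂ)‖ₑ ≤ k t x := by
        rw [← ofReal_norm, Complex.norm_real, Real.norm_of_nonneg ENNReal.toReal_nonneg]
        exact ENNReal.ofReal_toReal_le
      have e3 : ‖starRingEnd ℂ (U t x) / (‖U t x‖ : ℂ)‖ₑ ≤ 1 := by
        rw [← ofReal_norm, norm_div, RCLike.norm_conj, Complex.norm_real, norm_norm,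
          ← ENNReal.ofReal_one]
        exact ENNReal.ofReal_le_ofReal (div_self_le_one _)
      calc _ ≤ b t * (1 * k t x) := by gcongr
        _ = _ := by rw [one_mul]
    have hkt : ∀ t, Measurable (k t) := fun t => hkm.comp measurable_prodMk_left
    have hGn : ∀ t, eLpNorm (G t) r.conjExponent volume ≤ b t := fun t => by
      by_cases h0 : N t = 0
      · have : G t = 0 := by ext x; simp [hG, hb0 t h0]
        simp [this]
      · obtain ⟨h1, -, -⟩ := hk t h0 (hfin t)
        calc eLpNorm (G t) r.conjExponent volume ≤ b t * eLpNorm (k t) r.conjExponent volume :=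
              eLpNorm_le_mul_eLpNorm_of_ae_le_mul'' _ (hkt t).aestronglyMeasurable
                (Filter.Eventually.of_forall fun x => hGle t x)
          _ ≤ b t * 1 := by gcongr
          _ = b t := mul_one _
    set X := ∫⁻ t in S i, N t ^ Q with hX
    have hXt : X ≠ ⊤ := by
      refine ((setLIntegral_mono (g := fun _ => (i : ℝ≥0∞) ^ Q) measurable_const fun t ht =>
        ENNReal.rpow_le_rpow ht.2 hQ0.le).trans_lt ?_).ne
      rw [setLIntegral_const]
      exact ENNReal.mul_lt_top (ENNReal.rpow_lt_top_of_nonneg hQ0.le (by simp)) (hSvol i).lt_top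
    have hbX : eLpNorm b q.conjExponent volume = X ^ ((Q - 1) / Q) := by
      rw [eLpNorm_eq_lintegral_rpow_enorm_toReal hp0 hpt, hp, one_div_div, hX,
        ← lintegral_indicator (hSm i)]
      congr 1
      refine lintegral_congr fun t => ?_
      rw [enorm_eq_self, hb, indicator, indicator]
      split_ifs
      · rw [← ENNReal.rpow_mul, mul_div_cancel₀ _ hQ10.ne']
      · rw [ENNReal.zero_rpow_of_pos (by positivity)]
    have hGX : mixedNorm q.conjExponent r.conjExponent G ≤ X ^ ((Q - 1) / Q) := by
      rw [← hbX]
      exact eLpNorm_mono_enorm fun t => by simpa using hGn t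
    have hnice : IsNice q r G := ⟨hGm, fun t => ⟨(hGm.comp_measurable
      measurable_prodMk_left).aestronglyMeasurable, (hGn t).trans_lt (hbt t).lt_top⟩,
      (hGX.trans_lt (ENNReal.rpow_lt_top_of_nonneg (by positivity) hXt)).ne⟩
    have hbint : ∫⁻ t, b t ≠ ⊤ := by
      refine ((lintegral_mono hbi).trans_lt ?_).ne
      rw [lintegral_indicator (hSm i), setLIntegral_const]
      exact ENNReal.mul_lt_top (ENNReal.rpow_lt_top_of_nonneg hQ10.le (by simp)) (hSvol i).lt_top
    have hGint : ∫⁻ t, eLpNorm (G t) r.conjExponent volume ≠ ⊤ :=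
      ne_top_of_le_ne_top hbint (lintegral_mono hGn)
    set W : ℝ → ℝ≥0∞ := fun t => ∫⁻ x, ‖U t x * G t x‖ₑ with hW
    have hUGm : StronglyMeasurable (Function.uncurry fun t x => U t x * G t x) := hU.mul hGm
    have hWm : Measurable W := hUGm.measurable.enorm.lintegral_prod_right'
    have hUt : ∀ t, AEStronglyMeasurable (U t) volume := fun t =>
      (hU.comp_measurable measurable_prodMk_left).aestronglyMeasurable
    have hWle : ∀ t, W t ≤ N t * b t := fun t => by
      have := lintegral_mul_le_eLpNorm_mul_eLpNorm (μ := volume) r r.conjExponent (hUt t).enorm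
        (hnice.mem t).1.enorm
      rw [eLpNorm_enorm, eLpNorm_enorm] at this
      simp only [hW, enorm_mul]
      exact this.trans (mul_le_mul_right (hGn t) _)
    have hWt : ∀ t, W t < ⊤ := fun t =>
      (hWle t).trans_lt (ENNReal.mul_lt_top (hfin t).lt_top (hbt t).lt_top)
    have hNb : ∀ t, N t * b t = (S i).indicator (fun t => N t ^ Q) t := fun t => by
      rw [hb, indicator, indicator]
      split_ifs
      · conv_rhs => rw [show Q = 1 + (Q - 1) by ring,
          ENNReal.rpow_add_of_nonneg _ _ (by norm_num) hQ10.le, ENNReal.rpow_one]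
      · simp
    have hWint : ∫⁻ t, W t ≠ ⊤ := by
      refine ne_top_of_le_ne_top hXt ((lintegral_mono hWle).trans (le_of_eq ?_))
      simp only [hNb]
      rw [lintegral_indicator (hSm i)]
    have hreal : ∀ t x, U t x * G t x = ((‖U t x * G t x‖ : ℝ) : ℂ) := fun t x => by
      have e : U t x * G t x = (((b t).toReal * ((‖U t x‖ ^ 2 / ‖U t x‖) * (k t x).toReal) : ℝ) : ℂ) := by
        rw [hG]
        push_cast
        rw [← Complex.mul_conj']
        ring
      rw [e, Complex.norm_real, Real.norm_of_nonneg]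
      positivity
    -- As U G ≥ 0, there is no cancellation and the modulus of the double integral is the integral
    -- of the moduli.
    have hint : ‖∫ t, ∫ x, U t x * G t x‖ₑ = ∫⁻ t, W t := by
      have e1 : ∀ t, ∫ x, U t x * G t x = (((W t).toReal : ℝ) : ℂ) := fun t => by
        rw [integral_congr_ae (Filter.Eventually.of_forall (hreal t)), integral_complex_ofReal,
          integral_norm_eq_lintegral_enorm (f := fun x => U t x * G t x)
            ((hUt t).mul (hnice.mem t).1)]
      simp only [e1]
      rw [integral_complex_ofReal, integral_toReal hWm.aemeasurable
        (Filter.Eventually.of_forall hWt), ← ofReal_norm, Complex.norm_real,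
        Real.norm_of_nonneg ENNReal.toReal_nonneg, ENNReal.ofReal_toReal hWint]
    have hlow : X ≤ 2 * ∫⁻ t, W t := by
      rw [← lintegral_const_mul _ hWm, hX, ← lintegral_indicator (hSm i)]
      refine lintegral_mono fun t => ?_
      rw [← hNb]
      by_cases h0 : N t = 0
      · simp [h0]
      · obtain ⟨-, h2, h3⟩ := hk t h0 (hfin t)
        have : W t = b t * ∫⁻ x, ‖U t x‖ₑ * k t x := by
          rw [← lintegral_const_mul _ (by
            have := hkt t
            have := hUm.comp (measurable_prodMk_left (x := t))
            exact this.enorm.mul (hkt t))]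
          refine lintegral_congr fun x => ?_
          have e : U t x * G t x = (((b t).toReal * (‖U t x‖ * (k t x).toReal) : ℝ) : ℂ) := by
            rw [hG]
            have : U t x * starRingEnd ℂ (U t x) / (‖U t x‖ : ℂ) = (‖U t x‖ : ℂ) := by
              rw [Complex.mul_conj', sq]
              by_cases hz : (‖U t x‖ : ℂ) = 0
              · simp [hz]
              · rw [mul_div_cancel_right₀ _ hz]
            push_cast
            calc _ = ((b t).toReal : ℂ) * ((U t x * starRingEnd ℂ (U t x) / (‖U t x‖ : ℂ)) *
                  ((k t x).toReal : ℂ)) := by ring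
              _ = _ := by rw [this]
          rw [e, ← ofReal_norm, Complex.norm_real, Real.norm_of_nonneg (by positivity),
            ENNReal.ofReal_mul ENNReal.toReal_nonneg, ENNReal.ofReal_mul (norm_nonneg _),
            ENNReal.ofReal_toReal (hbt t), ENNReal.ofReal_toReal (h3 x), ofReal_norm]
        rw [this]
        calc N t * b t ≤ (2 * ∫⁻ x, ‖U t x‖ₑ * k t x) * b t := by gcongr
          _ = _ := by ring
    have hfinal : X ≤ 2 * A * X ^ ((Q - 1) / Q) := by
      refine hlow.trans ?_
      rw [← hint, mul_assoc]
      refine mul_le_mul_right ((h G hnice hGint).trans (mul_le_mul_right hGX _)) _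
    by_cases hX0 : X = 0
    · rw [hX0]; exact zero_le
    have hY0 : X ^ ((Q - 1) / Q) ≠ 0 := by
      simp only [ne_eq, ENNReal.rpow_eq_zero_iff, not_or, not_and]
      exact ⟨fun h => absurd h hX0, fun h => absurd h hXt⟩
    have hYt : X ^ ((Q - 1) / Q) ≠ ⊤ := ENNReal.rpow_ne_top_of_nonneg (by positivity) hXt
    have hsplit : X = X ^ (1 / Q) * X ^ ((Q - 1) / Q) := by
      rw [← ENNReal.rpow_add_of_nonneg _ _ (by positivity) (by positivity), ← add_div,
        add_sub_cancel, div_self hQ0.ne', ENNReal.rpow_one]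
    have h4 : X ^ (1 / Q) ≤ 2 * A := by
      rw [hsplit] at hfinal
      rw [← hsplit] at hfinal
      have h5 : X ^ (1 / Q) * X ^ ((Q - 1) / Q) ≤ 2 * A * X ^ ((Q - 1) / Q) := by
        rwa [← hsplit]
      exact (ENNReal.mul_le_mul_iff_left hY0 hYt).1 h5
    calc X = (X ^ (1 / Q)) ^ Q := by
          rw [← ENNReal.rpow_mul, one_div_mul_cancel hQ0.ne', ENNReal.rpow_one]
      _ ≤ _ := ENNReal.rpow_le_rpow h4 hQ0.le
  have hunion : ⋃ i, S i = univ := by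
    refine eq_univ_of_forall fun t => mem_iUnion.2 ?_
    obtain ⟨i, hi⟩ := exists_nat_ge (max |t| (N t).toReal)
    refine ⟨i, (le_max_left _ _).trans hi, ?_⟩
    rw [← ENNReal.ofReal_toReal (show N t ≠ ⊤ from hfin t), ← ENNReal.ofReal_natCast]
    exact ENNReal.ofReal_le_ofReal ((le_max_right _ _).trans hi)
  have hdir : Directed (· ⊆ ·) S := (monotone_nat_of_le_succ fun i t ht => by
    refine ⟨ht.1.trans ?_, ht.2.trans ?_⟩ <;> push_cast
    · linarith
    · exact le_self_add).directed_le
  have htot : ∫⁻ t, N t ^ Q ≤ (2 * A) ^ Q := by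
    rw [← setLIntegral_univ, ← hunion, setLIntegral_iUnion_of_directed _ hdir]
    exact iSup_le main
  rw [mixedNorm, timeNorm, eLpNorm_eq_lintegral_rpow_enorm_toReal hq0 hqt]
  simp only [enorm_eq_self]
  calc (∫⁻ t, N t ^ Q) ^ (1 / Q) ≤ ((2 * A) ^ Q) ^ (1 / Q) :=
        ENNReal.rpow_le_rpow htot (by positivity)
    _ = 2 * A := by rw [← ENNReal.rpow_mul, mul_one_div_cancel hQ0.ne', ENNReal.rpow_one]

end Dispersive

/-! ### Homogeneous and inhomogeneous estimates for one block -/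

namespace Dispersive

variable {n : ℕ} {g : ℝ → ℝ} {δ : ℝ}

theorem SharpAdmissible.eq_two {σ : ℝ} {r : ℝ≥0∞} (hσ : σ ∈ Ioc (0 : ℝ) 1)
    (h : SharpAdmissible σ ⊤ r) : r = 2 := by
  have h1 := h.exponent
  simp only [ENNReal.inv_top, ENNReal.toReal_zero, mul_zero, mul_eq_zero, hσ.1.ne', false_or,
    OfNat.ofNat_ne_zero] at h1
  rw [gap] at h1
  have h2 : r⁻¹.toReal = (2⁻¹ : ℝ≥0∞).toReal := by
    rw [ENNReal.toReal_inv 2, ENNReal.toReal_ofNat]; linarith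
  have h3 := (ENNReal.toReal_eq_toReal_iff' (ENNReal.inv_ne_top.2 (by
    have := h.2.1; rintro rfl; simp at this)) (by simp)).1 h2
  exact inv_injective h3

theorem stronglyMeasurable_integral_swap {α β : Type*} [MeasurableSpace α] [MeasurableSpace β]
    {μ : Measure α} [SFinite μ] {V : α → β → ℂ} (hV : StronglyMeasurable (Function.uncurry V)) :
    StronglyMeasurable fun x => ∫ s, V s x ∂μ :=
  StronglyMeasurable.integral_prod_right' (f := fun z : β × α => V z.2 z.1)
    (hV.comp_measurable measurable_swap)

/-- L^2 and L^{r'} are not dual, so the two factors are moved one at a time: m₂ sends `u` into L^r,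
dual to L^{r'}, and m₁ sends `v` into L^2. -/
theorem integral_mul_mul_comm_two (hn : n ≤ 3) {m₁ m₂ : ℝ → ℂ} (h₁ : IsSym m₁) (h₂ : IsSym m₂)
    {r : ℝ≥0∞} (hr : 2 ≤ r) {u v : E n → ℂ} (hu : MemLp u 2 volume)
    (hv : MemLp v r.conjExponent volume) :
    ∫ x, mul n (fun y => m₁ y * m₂ y) u x * v x =
      ∫ x, u x * mul n (fun y => m₁ y * m₂ y) v x := by
  rw [← mul_mul_eq hn h₁ h₂ (by norm_num) hu,
    integral_mul_mul_comm hn h₁ (one_le_of_two_le hr) (h₂.memLp_mul_of_le hn (by norm_num) hr hu) hv,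
    integral_mul_mul_comm hn h₂ (by norm_num) hu (by
      rw [conjExponent_two]
      exact h₁.memLp_mul_of_le hn (one_le_conjExponent r) (conjExponent_le_two hr) hv),
    mul_mul_eq hn h₂ h₁ (one_le_conjExponent r) hv]
  simp only [mul_comm (m₂ _)]

/-- The homogeneous estimate for one block. -/
theorem exists_homogeneous_le (n : ℕ) {σ : ℝ} (hσ : σ ∈ Ioc (0 : ℝ) 1) {q r : ℝ≥0∞}
    (hqr : SharpAdmissible σ q r) {B L : ℝ} (hB : 0 < B) (hL : 0 < L) :
    ∃ c : ℝ, 0 < c ∧ ∀ {g δ p D}, IsBlock n g δ p σ B L D → ∀ f : E n → ℂ, MemLp f 2 volume →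
      mixedNorm q r (fun t => mul n (fun y => phase g δ t y * (p y * p y)) f) ≤
        ENNReal.ofReal (c * D ^ gap r) * eLpNorm f 2 volume := by
  rcases eq_or_ne q ⊤ with rfl | hqt
  -- Duality in time is available only for q < ∞; for q = ∞ the pair is (∞, 2) and the estimate is
  -- the L^2 bound at each time.
  · have hr := hqr.eq_two hσ
    subst hr
    refine ⟨B * B, by positivity, fun {g δ p D} hb f hf => ?_⟩
    have hg : gap 2 = 0 := by rw [gap]; norm_num
    rw [hg, Real.rpow_zero, mul_one, mixedNorm, timeNorm, eLpNorm_exponent_top]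
    refine eLpNormEssSup_le_of_ae_enorm_bound (Filter.Eventually.of_forall fun t => ?_)
    rw [enorm_eq_self]
    have hpp := hb.bd.mul hb.dim hb.bd
    refine eLpNorm_mul_two_le hb.dim (hpp.sym.phase_mul hb.reg hb.scale t) (fun y hy => ?_) hf
    rw [norm_mul, norm_phase, one_mul]
    exact hpp.bound y hy
  obtain ⟨c, hc, hdual⟩ := exists_dual_le n hσ hqr hB hL
  refine ⟨2 * c, by positivity, fun {g δ p D} hb f hf => ?_⟩
  have hD := hb.pos
  have hpp := hb.bd.mul hb.dim hb.bd
  have hr1 := one_le_of_two_le hqr.2.1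
  have hq1 : 1 < q := lt_of_lt_of_le (by norm_num) hqr.1
  have hU : StronglyMeasurable (Function.uncurry fun t =>
      mul n (fun y => phase g δ t y * (p y * p y)) (hf.1.mk f)) :=
    hpp.sym.stronglyMeasurable_mul_phase (α := ℝ) hb.reg hb.scale (τ := fun t => t) measurable_id
      (v := fun _ => hf.1.mk f) (hf.1.stronglyMeasurable_mk.comp_measurable measurable_snd)
  have he : ∀ m : ℝ → ℂ, mul n m f = mul n m (hf.1.mk f) := fun m => mul_congr_ae hf.1.ae_eq_mk
  simp only [← he] at hU
  have hmem : ∀ t, MemLp (mul n (fun y => phase g δ t y * (p y * p y)) f) r volume := fun t =>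
    (hpp.sym.phase_mul hb.reg hb.scale t).memLp_mul_of_le hb.dim (by norm_num) hqr.2.1 hf
  have key := mixedNorm_le_of_forall_dual hU hq1 hqt hqr.2.1 (fun t => (hmem t).2.ne)
    (A := ENNReal.ofReal (c * D ^ gap r) * eLpNorm f 2 volume) ?_
  · refine key.trans (le_of_eq ?_)
    rw [← mul_assoc, mul_assoc 2 c, ENNReal.ofReal_mul zero_le_two, ENNReal.ofReal_ofNat]
  intro G hG hGi
  -- The propagator is moved onto the test function. Its phase at time t, not -t, remains, because
  -- the pairing is bilinear; the dual estimate admits either sign through `IsTimeIso`.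
  have hsw : ∀ t, ∫ x, mul n (fun y => phase g δ t y * (p y * p y)) f x * G t x =
      ∫ x, f x * mul n (fun y => phase g δ t y * (p y * p y)) (G t) x := fun t => by
    simp only [← mul_assoc (phase g δ t _)]
    exact integral_mul_mul_comm_two hb.dim (hb.bd.sym.phase_mul hb.reg hb.scale t) hb.bd.sym
      hqr.2.1 hf (hG.mem t)
  simp only [hsw]
  have hZ := hpp.sym.stronglyMeasurable_mul_phase hb.reg hb.scale (τ := fun t : ℝ => t) measurable_id
    hG.meas
  obtain ⟨c₀, -, h2⟩ := exists_eLpNorm_two_mul_phase_le hb.dim hb.reg hb.scale hpp hqr.2.1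
  have : ENNReal.HolderConjugate 2 2 := ⟨by simp [ENNReal.inv_two_add_inv_two]⟩
  have hKm : AEStronglyMeasurable (Function.uncurry fun (t : ℝ) x =>
      f x * mul n (fun y => phase g δ t y * (p y * p y)) (G t) x) (volume.prod volume) :=
    (hf.1.comp_snd).mul hZ.aestronglyMeasurable
  have hKi : Integrable (Function.uncurry fun (t : ℝ) x =>
      f x * mul n (fun y => phase g δ t y * (p y * p y)) (G t) x) (volume.prod volume) := by
    refine ⟨hKm, ?_⟩
    rw [hasFiniteIntegral_iff_enorm, lintegral_prod _ hKm.enorm]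
    refine lt_of_le_of_lt (b := ∫⁻ t, (eLpNorm f 2 volume * ENNReal.ofReal c₀) *
      eLpNorm (G t) r.conjExponent volume) (lintegral_mono fun t => ?_) ?_
    · have h1 := lintegral_mul_le_eLpNorm_mul_eLpNorm (μ := volume) 2 2 hf.1.enorm
        (hZ.comp_measurable (measurable_prodMk_left (x := t))).aestronglyMeasurable.enorm
      rw [eLpNorm_enorm, eLpNorm_enorm] at h1
      simp only [Function.uncurry, enorm_mul]
      refine h1.trans ?_
      rw [mul_assoc]
      exact mul_le_mul_right (h2 t (G t) (hG.mem t)) _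
    · rw [lintegral_const_mul _ hG.measurable_norm]
      exact ENNReal.mul_lt_top (ENNReal.mul_lt_top hf.2 (by simp)) hGi.lt_top
  rw [integral_integral_swap hKi]
  simp only [integral_const_mul]
  have hH : AEStronglyMeasurable
      (fun x => ∫ t, mul n (fun y => phase g δ t y * (p y * p y)) (G t) x) volume :=
    (stronglyMeasurable_integral_swap hZ).aestronglyMeasurable
  refine (enorm_integral_mul_le 2 2 hf.1 hH).trans ?_
  refine (mul_le_mul_right (hdual hb G hG _ isTimeIso_id) _).trans (le_of_eq ?_)
  ring

/-- The factorisation of the inhomogeneous operator. -/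
theorem IsBlock.integral_eq_mul {σ B L D : ℝ} {p : ℝ → ℂ} (hb : IsBlock n g δ p σ B L D)
    (hσ : σ ∈ Ioc (0 : ℝ) 1) {q r : ℝ≥0∞} (hqr : SharpAdmissible σ q r) {w : ℝ → E n → ℂ}
    (hw : IsNice q r w) (t : ℝ) (x : E n) :
    ∫ s, mul n (fun y => phase g δ (t - s) y * (p y * (p y * (p y * p y)))) (w s) x =
      mul n (fun y => phase g δ t y * (p y * p y))
        (fun x => ∫ s, mul n (fun y => phase g δ (-s) y * (p y * p y)) (w s) x) x := by
  have hpp := hb.bd.mul hb.dim hb.bd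
  have hs₁ := hpp.sym.phase_mul hb.reg hb.scale t
  have hZ := hpp.sym.stronglyMeasurable_mul_phase hb.reg hb.scale (τ := fun s : ℝ => -s)
    measurable_neg hw.meas
  obtain ⟨M, hM, hle⟩ := hb.exists_lintegral_enorm_mul_le hσ hqr hb.bd
  have e : ∀ s, mul n (fun y => phase g δ (t - s) y * (p y * (p y * (p y * p y)))) (w s) x =
      ∫ z, kernel n (fun y => phase g δ t y * (p y * p y)) z *
        mul n (fun y => phase g δ (-s) y * (p y * p y)) (w s) (x - z) := fun s => by
    -- The propagator at time t - s is the product of those at t and -s, and the fourth power of `p`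
    -- is split into two squares. What remains is to exchange the s-integral with the spatial
    -- convolution.
    rw [← mul_apply, mul_mul_eq hb.dim hs₁ (hpp.sym.phase_mul hb.reg hb.scale (-s))
      (one_le_conjExponent r) (hw.mem s)]
    refine congrFun (mul_congr (fun y _ => ?_) ?_) x <;> rw [sub_eq_add_neg, phase_add] <;> ring
  simp only [e]
  rw [mul_apply, integral_integral_swap]
  · simp only [integral_const_mul]
  · have hm : AEStronglyMeasurable (Function.uncurry fun (s : ℝ) z =>
        kernel n (fun y => phase g δ t y * (p y * p y)) z *
        mul n (fun y => phase g δ (-s) y * (p y * p y)) (w s) (x - z)) (volume.prod volume) :=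
      ((hs₁.continuous_kernel.stronglyMeasurable.comp_measurable measurable_snd).mul
        (hZ.comp_measurable (g := fun z : ℝ × E n => (z.1, x - z.2)) (by fun_prop))).aestronglyMeasurable
    refine ⟨hm, ?_⟩
    rw [hasFiniteIntegral_iff_enorm, lintegral_prod_symm _ hm.enorm]
    refine lt_of_le_of_lt (b := ∫⁻ z : E n, ‖kernel n (fun y => phase g δ t y * (p y * p y)) z‖ₑ *
      (M * mixedNorm q.conjExponent r.conjExponent w)) (lintegral_mono fun z => ?_) ?_
    · simp only [Function.uncurry, enorm_mul]
      rw [lintegral_const_mul' _ _ enorm_ne_top]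
      exact mul_le_mul_right (hle w hw _ isTimeIso_neg _) _
    · rw [lintegral_mul_const' _ _ (ENNReal.mul_ne_top hM hw.fin)]
      exact ENNReal.mul_lt_top (hs₁.integrable_kernel hb.dim).2
        (ENNReal.mul_lt_top hM.lt_top hw.fin.lt_top)

/-- The inhomogeneous estimate for one block. -/
theorem exists_inhomogeneous_le (n : ℕ) {σ : ℝ} (hσ : σ ∈ Ioc (0 : ℝ) 1) {q r q₂ r₂ : ℝ≥0∞}
    (hqr : SharpAdmissible σ q r) (hqr₂ : SharpAdmissible σ q₂ r₂) {B L : ℝ} (hB : 0 < B)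
    (hL : 0 < L) :
    ∃ c : ℝ, 0 < c ∧ ∀ {g δ p D}, IsBlock n g δ p σ B L D → ∀ w : ℝ → E n → ℂ, IsNice q₂ r₂ w →
      mixedNorm q r (fun t x => ∫ s,
        mul n (fun y => phase g δ (t - s) y * (p y * (p y * (p y * p y)))) (w s) x) ≤
        ENNReal.ofReal (c * D ^ (gap r + gap r₂)) *
          mixedNorm q₂.conjExponent r₂.conjExponent w := by
  obtain ⟨c₁, hc₁, h₁⟩ := exists_homogeneous_le n hσ hqr hB hL
  obtain ⟨c₂, hc₂, h₂⟩ := exists_dual_le n hσ hqr₂ hB hL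
  refine ⟨c₁ * c₂, by positivity, fun {g δ p D} hb w hw => ?_⟩
  have hD := hb.pos
  have hpp := hb.bd.mul hb.dim hb.bd
  have hd := h₂ hb w hw _ isTimeIso_neg
  have hZ := hpp.sym.stronglyMeasurable_mul_phase hb.reg hb.scale (τ := fun s : ℝ => -s)
    measurable_neg hw.meas
  have hH : MemLp (fun x => ∫ s, mul n (fun y => phase g δ (-s) y * (p y * p y)) (w s) x) 2 volume :=
    ⟨(stronglyMeasurable_integral_swap hZ).aestronglyMeasurable,
      hd.trans_lt (ENNReal.mul_lt_top (by simp) hw.fin.lt_top)⟩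
  simp only [hb.integral_eq_mul hσ hqr₂ hw]
  refine (h₁ hb _ hH).trans ((mul_le_mul_right hd _).trans (le_of_eq ?_))
  rw [← mul_assoc, ← ENNReal.ofReal_mul (by positivity), Real.rpow_add hD]
  congr 2; ring

end Dispersive

/-! ### The Christ-Kiselev lemma -/

namespace Dispersive

/-- A finite measure whose distribution function is continuous and strictly increasing, and which
controls a given finite density. -/
theorem exists_diffuse_measure {f : ℝ → ℝ≥0∞} {S : ℝ≥0∞}
    (hS : ∫⁻ s, f s = S) (hS0 : S ≠ 0) (hSt : S ≠ ⊤) :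
    ∃ ν : Measure ℝ, IsProbabilityMeasure ν ∧ NullSingletonClass ν ∧ (∀ a b, a < b → 0 < ν (Ico a b)) ∧
      ∀ A, MeasurableSet A → ∫⁻ s in A, f s ≤ 2 * S * ν A := by
  -- The average of the normalised density and a Gaussian: the Gaussian charges every interval, even
  -- where `f` vanishes, and averaging costs the factor 2 in the last property. No inverse of the
  -- distribution function is needed afterwards.
  set γ := ProbabilityTheory.gaussianReal 0 1
  have hγ : NullSingletonClass γ := ProbabilityTheory.nullSingletonClass_gaussianReal one_ne_zero
  have hw : (volume.withDensity f) univ = S := by rw [withDensity_apply _ MeasurableSet.univ]; simpa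
  refine ⟨(2 : ℝ≥0∞)⁻¹ • (S⁻¹ • volume.withDensity f + γ), ⟨?_⟩, ⟨fun x => ?_⟩, fun a b hab => ?_,
    fun A hA => ?_⟩
  · simp only [Measure.smul_apply, Measure.add_apply, smul_eq_mul, hw, measure_univ,
      ENNReal.inv_mul_cancel hS0 hSt]
    rw [show (1 : ℝ≥0∞) + 1 = 2 by norm_num, ENNReal.inv_mul_cancel (by norm_num) (by norm_num)]
  · have : (volume.withDensity f) {x} = 0 := withDensity_absolutelyContinuous _ _ (by simp)
    simp [this, hγ.measure_singleton x]
  · have h1 : γ (Ico a b) ≠ 0 := fun h => by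
      have := ProbabilityTheory.gaussianReal_absolutelyContinuous' 0 one_ne_zero h
      simp at this
      linarith
    simp only [Measure.smul_apply, Measure.add_apply, smul_eq_mul]
    refine ENNReal.mul_pos (by simp) ?_
    simp [h1]
  · simp only [Measure.smul_apply, Measure.add_apply, smul_eq_mul]
    rw [withDensity_apply _ hA]
    calc ∫⁻ s in A, f s = 2 * 2⁻¹ * (S * S⁻¹) * ∫⁻ s in A, f s := by
          rw [ENNReal.mul_inv_cancel hS0 hSt, ENNReal.mul_inv_cancel (by norm_num) (by norm_num)]
          simp
      _ = 2 * S * (2⁻¹ * (S⁻¹ * ∫⁻ s in A, f s)) := by ring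
      _ ≤ _ := by gcongr; exact le_self_add

/-- The distribution function. -/
def cdfReal (ν : Measure ℝ) (t : ℝ) : ℝ := (ν (Iio t)).toReal

/-- The index of the dyadic interval of generation `M` which contains the value of the
distribution function at `t`. -/
def dyadicIdx (ν : Measure ℝ) (M : ℕ) (t : ℝ) : ℕ := ⌊2 ^ M * cdfReal ν t⌋₊

theorem cdfReal_nonneg (ν : Measure ℝ) (t : ℝ) : 0 ≤ cdfReal ν t := ENNReal.toReal_nonneg

/-- Each dyadic interval is contained in its parent, whose index is half as large, rounded down. -/
theorem dyadicIdx_succ_div (ν : Measure ℝ) (M : ℕ) (t : ℝ) : dyadicIdx ν (M + 1) t / 2 = dyadicIdx ν M t := by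
  rw [dyadicIdx, dyadicIdx, ← Nat.floor_div_ofNat]
  congr 1
  rw [pow_succ]
  ring

section cdf
variable {ν : Measure ℝ} [IsProbabilityMeasure ν]

theorem cdfReal_add {a b : ℝ} (hab : a ≤ b) :
    cdfReal ν b = cdfReal ν a + (ν (Ico a b)).toReal := by
  rw [cdfReal, cdfReal, ← ENNReal.toReal_add (measure_ne_top _ _) (measure_ne_top _ _),
    ← measure_union (by
      rw [Set.disjoint_left]; intro x hx hx'; exact absurd hx (not_lt.2 hx'.1)) measurableSet_Ico,
    Iio_union_Ico_eq_Iio hab]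

theorem monotone_cdfReal : Monotone (cdfReal ν) := fun a b hab => by
  rw [cdfReal_add hab]; linarith [ENNReal.toReal_nonneg (a := ν (Ico a b))]

theorem cdfReal_le_one (t : ℝ) : cdfReal ν t ≤ 1 := by
  rw [cdfReal, ← ENNReal.toReal_one]
  exact ENNReal.toReal_mono (by simp) prob_le_one

theorem measurable_dyadicIdx (M : ℕ) : Measurable (dyadicIdx ν M) :=
  Nat.measurable_floor.comp (monotone_cdfReal.measurable.const_mul _)

theorem dyadicIdx_mono (M : ℕ) : Monotone (dyadicIdx ν M) := fun a b hab =>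
  Nat.floor_le_floor (mul_le_mul_of_nonneg_left (monotone_cdfReal hab) (by positivity))

theorem cdfReal_lt (hν : ∀ a b, a < b → 0 < ν (Ico a b)) {a b : ℝ} (hab : a < b) : cdfReal ν a < cdfReal ν b := by
  rw [cdfReal_add hab.le]
  have := ENNReal.toReal_pos (hν a b hab).ne' (measure_ne_top _ _)
  linarith

/-- A strictly increasing distribution function never reaches 1, so the index 2^M does not occur. -/
theorem dyadicIdx_lt (hν : ∀ a b, a < b → 0 < ν (Ico a b)) (M : ℕ) (t : ℝ) : dyadicIdx ν M t < 2 ^ M := by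
  have h : cdfReal ν t < 1 := (cdfReal_lt hν (lt_add_one t)).trans_le (cdfReal_le_one _)
  rw [dyadicIdx, Nat.floor_lt (mul_nonneg (by positivity) (cdfReal_nonneg ν t))]
  push_cast
  calc (2 : ℝ) ^ M * cdfReal ν t < 2 ^ M * 1 := by gcongr
    _ = _ := mul_one _

/-- The two indices differ as soon as 2^M times the difference of the distribution function at `t`
and `s` exceeds 1. -/
theorem eventually_dyadicIdx_lt (hν : ∀ a b, a < b → 0 < ν (Ico a b)) {s t : ℝ} (hst : s < t) :
    ∀ᶠ M in Filter.atTop, dyadicIdx ν M s < dyadicIdx ν M t := by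
  have h := cdfReal_lt hν hst
  obtain ⟨M₀, hM₀⟩ := pow_unbounded_of_one_lt (1 / (cdfReal ν t - cdfReal ν s)) (one_lt_two (α := ℝ))
  filter_upwards [Filter.eventually_ge_atTop M₀] with M hM
  have h1 : 1 / (cdfReal ν t - cdfReal ν s) < (2 : ℝ) ^ M :=
    hM₀.trans_le (pow_le_pow_right₀ one_le_two hM)
  rw [div_lt_iff₀ (by linarith)] at h1
  have h2 : ((dyadicIdx ν M s : ℕ) : ℝ) + 1 ≤ 2 ^ M * cdfReal ν t := by
    have := Nat.floor_le (mul_nonneg (by positivity : (0 : ℝ) ≤ 2 ^ M) (cdfReal_nonneg ν s))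
    rw [dyadicIdx]; linarith
  rw [← Nat.add_one_le_iff]
  conv_rhs => rw [dyadicIdx]
  refine Nat.le_floor ?_
  push_cast
  exact h2


/-- The cell need not contain its endpoints, so inner regularity reduces to compact subsets. Their
least and greatest points lie in the cell, and between them the distribution function grows by at
most 2^{-M}; continuity of the measure makes half-open and closed intervals equivalent. -/
theorem measure_dyadicIdx_eq_le [NullSingletonClass ν] (M i : ℕ) :
    ν {s | dyadicIdx ν M s = i} ≤ (2 ^ M)⁻¹ := by
  have hm : MeasurableSet {s | dyadicIdx ν M s = i} := measurable_dyadicIdx M (measurableSet_singleton i)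
  rw [hm.measure_eq_iSup_isCompact]
  refine iSup_le fun K => iSup_le fun hK => iSup_le fun hc => ?_
  rcases K.eq_empty_or_nonempty with rfl | hne
  · simp
  obtain ⟨a, haK, ha⟩ := hc.exists_isLeast hne
  obtain ⟨b, hbK, hb⟩ := hc.exists_isGreatest hne
  have hab : a ≤ b := ha hbK
  refine (measure_mono (t := Icc a b) fun x hx => ⟨ha hx, hb hx⟩).trans ?_
  rw [← measure_congr (Ico_ae_eq_Icc (μ := ν)), ← ENNReal.ofReal_toReal (measure_ne_top ν _)]
  have h1 := cdfReal_add (ν := ν) hab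
  have e1 : dyadicIdx ν M a = i := hK haK
  have e2 : dyadicIdx ν M b = i := hK hbK
  have hpow : (0 : ℝ) < 2 ^ M := by positivity
  have f1 := Nat.floor_le (mul_nonneg hpow.le (cdfReal_nonneg ν a))
  have f2 := Nat.lt_floor_add_one ((2 : ℝ) ^ M * cdfReal ν b)
  rw [← dyadicIdx, e1] at f1
  rw [← dyadicIdx, e2] at f2
  have h3 : (ν (Ico a b)).toReal ≤ (2 ^ M)⁻¹ := by
    rw [← one_div, le_div_iff₀ hpow]; nlinarith
  refine (ENNReal.ofReal_le_ofReal h3).trans (le_of_eq ?_)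
  rw [ENNReal.ofReal_inv_of_pos hpow, ENNReal.ofReal_pow zero_le_two, ENNReal.ofReal_ofNat]

end cdf

end Dispersive

namespace Dispersive

variable {n : ℕ}

theorem eLpNorm_le_of_ae_le_liminf {α : Type*} [MeasurableSpace α] {μ : Measure α} {q : ℝ≥0∞}
    (hq0 : q ≠ 0) (hqt : q ≠ ⊤) {f : α → ℝ≥0∞} {F : ℕ → α → ℝ≥0∞} (hF : ∀ M, Measurable (F M))
    (h : ∀ x, f x ≤ Filter.liminf (fun M => F M x) Filter.atTop) {A : ℝ≥0∞}
    (hA : ∀ M, eLpNorm (F M) q μ ≤ A) : eLpNorm f q μ ≤ A := by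
  have hQ := ENNReal.toReal_pos hq0 hqt
  have key : ∫⁻ x, f x ^ q.toReal ∂μ ≤ A ^ q.toReal := by
    calc ∫⁻ x, f x ^ q.toReal ∂μ
        ≤ ∫⁻ x, Filter.liminf (fun M => F M x ^ q.toReal) Filter.atTop ∂μ := by
          refine lintegral_mono fun x => ?_
          have := (ENNReal.orderIsoRpow q.toReal hQ).liminf_apply (u := fun M => F M x)
            (f := Filter.atTop)
          simp only [ENNReal.orderIsoRpow_apply] at this
          rw [← this]
          exact ENNReal.rpow_le_rpow (h x) hQ.le
      _ ≤ Filter.liminf (fun M => ∫⁻ x, F M x ^ q.toReal ∂μ) Filter.atTop :=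
          lintegral_liminf_le fun M => (hF M).pow_const _
      _ ≤ A ^ q.toReal := by
          refine Filter.liminf_le_of_frequently_le' (Filter.Frequently.of_forall fun M => ?_)
          have := hA M
          rw [eLpNorm_eq_lintegral_rpow_enorm_toReal hq0 hqt] at this
          simp only [enorm_eq_self] at this
          rw [one_div, ENNReal.rpow_inv_le_iff hQ] at this
          exact this
  rw [eLpNorm_eq_lintegral_rpow_enorm_toReal hq0 hqt]
  simp only [enorm_eq_self]
  rwa [one_div, ENNReal.rpow_inv_le_iff hQ]

/-- The geometric ratio in the Christ-Kiselev argument. -/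
def ckRatio (p q : ℝ≥0∞) : ℝ≥0∞ := 2 ^ (1 / q.toReal - 1 / p.toReal)

/-- The constant in the Christ-Kiselev lemma. -/
def ckConst (p q : ℝ≥0∞) : ℝ≥0∞ :=
  2 ^ (1 / q.toReal) * 2 ^ (1 / p.toReal) * (1 - ckRatio p q)⁻¹

theorem ckConst_ne_top {p q : ℝ≥0∞} (hp : p ≠ 0) (hpq : p < q) (hqt : q ≠ ⊤) :
    ckConst p q ≠ ⊤ := by
  have hP := ENNReal.toReal_pos hp hpq.ne_top
  have hPQ : p.toReal < q.toReal := (ENNReal.toReal_lt_toReal hpq.ne_top hqt).2 hpq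
  have h : 1 / q.toReal < 1 / p.toReal := one_div_lt_one_div_of_lt hP hPQ
  have hr : ckRatio p q < 1 := ENNReal.rpow_lt_one_of_one_lt_of_neg (by norm_num) (by linarith)
  refine ENNReal.mul_ne_top (ENNReal.mul_ne_top ?_ ?_) (ENNReal.inv_ne_top.2 (tsub_pos_of_lt hr).ne')
  · exact ENNReal.rpow_ne_top_of_nonneg (by positivity) (by norm_num)
  · exact ENNReal.rpow_ne_top_of_nonneg (by positivity) (by norm_num)

section
variable {K : ℝ → ℝ → E n → ℂ} {N : ℝ → ℝ≥0∞} {p q r A : ℝ≥0∞} {ν : Measure ℝ}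

theorem stronglyMeasurable_setIntegral
    (hK : StronglyMeasurable fun z : (ℝ × E n) × ℝ => K z.1.1 z.2 z.1.2)
    {S : ℝ → Set ℝ} (hS : MeasurableSet {z : ℝ × ℝ | z.2 ∈ S z.1}) :
    StronglyMeasurable (Function.uncurry fun t x => ∫ s in S t, K t s x) := by
  have hSt : ∀ t, MeasurableSet (S t) := fun t => hS.preimage (measurable_prodMk_left (x := t))
  have : (Function.uncurry fun t x => ∫ s in S t, K t s x) = fun z : ℝ × E n =>
      ∫ s, {y : (ℝ × E n) × ℝ | y.2 ∈ S y.1.1}.indicator (fun y => K y.1.1 y.2 y.1.2) (z, s) := by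
    ext z
    rw [Function.uncurry, ← integral_indicator (hSt z.1)]
    rfl
  rw [this]
  refine StronglyMeasurable.integral_prod_right' (hK.indicator ?_)
  exact hS.preimage (f := fun y : (ℝ × E n) × ℝ => (y.1.1, y.2)) (by fun_prop)

/-- The set of the earlier times which are separated from `t` at generation `M`, but not before. -/
def dyadicPiece (ν : Measure ℝ) (M j : ℕ) : Set ℝ :=
  {s | dyadicIdx ν M s = j / 2 ∧ dyadicIdx ν (M + 1) s < j}

theorem measurableSet_dyadicPiece [IsProbabilityMeasure ν] (M j : ℕ) :
    MeasurableSet (dyadicPiece ν M j) :=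
  (measurable_dyadicIdx M (measurableSet_singleton (j / 2))).inter
    (measurable_dyadicIdx (M + 1) measurableSet_Iio)

theorem measurableSet_dyadicPiece_prod [IsProbabilityMeasure ν] (M : ℕ) :
    MeasurableSet {z : ℝ × ℝ | z.2 ∈ dyadicPiece ν M (dyadicIdx ν (M + 1) z.1)} := by
  have h : ∀ k, Measurable (dyadicIdx ν k) := measurable_dyadicIdx
  have h1 : MeasurableSet {z : ℝ × ℝ | dyadicIdx ν M z.2 = dyadicIdx ν (M + 1) z.1 / 2} := by
    refine measurableSet_eq_fun ((h M).comp measurable_snd) ?_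
    exact (measurable_from_nat (f := fun k => k / 2)).comp ((h (M + 1)).comp measurable_fst)
  exact h1.inter (measurableSet_lt ((h (M + 1)).comp measurable_snd) ((h (M + 1)).comp measurable_fst))

theorem measurableSet_dyadicIdx_lt [IsProbabilityMeasure ν] (M : ℕ) :
    MeasurableSet {z : ℝ × ℝ | z.2 ∈ {s | dyadicIdx ν M s < dyadicIdx ν M z.1}} :=
  measurableSet_lt ((measurable_dyadicIdx M).comp measurable_snd)
    ((measurable_dyadicIdx M).comp measurable_fst)

/-- For each t only the piece with the index of t contributes, so the q-th power of the norm is at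
most the sum over the 2^{M+1} fixed pieces. Each source piece has L^p norm at most (2S
2^{-M})^{1/p}. The q-th root of the sum is of size 2^{M(1/q - 1/p)}, geometric decay because p < q.
-/
theorem eLpNorm_dyadicPiece_le [IsProbabilityMeasure ν] [NullSingletonClass ν]
    (hν : ∀ a b, a < b → 0 < ν (Ico a b)) (hp : p ≠ 0) (hpt : p ≠ ⊤) (hq0 : q ≠ 0) (hqt : q ≠ ⊤)
    {S : ℝ≥0∞} (hN : ∀ A, MeasurableSet A → ∫⁻ s in A, N s ^ p.toReal ≤ 2 * S * ν A)
    (hK : StronglyMeasurable fun z : (ℝ × E n) × ℝ => K z.1.1 z.2 z.1.2)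
    (hA : ∀ S, MeasurableSet S → mixedNorm q r (fun t x => ∫ s in S, K t s x) ≤
      A * eLpNorm (S.indicator N) p volume) (M : ℕ) :
    mixedNorm q r (fun t x => ∫ s in dyadicPiece ν M (dyadicIdx ν (M + 1) t), K t s x) ≤
      2 ^ (1 / q.toReal) * 2 ^ (1 / p.toReal) * (A * S ^ (1 / p.toReal)) * ckRatio p q ^ M := by
  have hP := ENNReal.toReal_pos hp hpt
  have hQ := ENNReal.toReal_pos hq0 hqt
  set T : ℕ → ℝ → ℝ≥0∞ := fun j t => eLpNorm (fun x => ∫ s in dyadicPiece ν M j, K t s x) r volume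
  have hTm : ∀ j, Measurable (T j) := fun j => measurable_eLpNorm_prod
    (stronglyMeasurable_setIntegral hK (S := fun _ => dyadicPiece ν M j)
      ((measurableSet_dyadicPiece M j).preimage measurable_snd)) r
  have hind : ∀ j, eLpNorm ((dyadicPiece ν M j).indicator N) p volume ≤
      (2 * S * (2 ^ M)⁻¹) ^ (1 / p.toReal) := by
    intro j
    rw [eLpNorm_eq_lintegral_rpow_enorm_toReal hp hpt]
    refine ENNReal.rpow_le_rpow ?_ (by positivity)
    have e : ∀ s, ‖(dyadicPiece ν M j).indicator N s‖ₑ ^ p.toReal =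
        (dyadicPiece ν M j).indicator (fun s => N s ^ p.toReal) s := fun s => by
      rw [enorm_eq_self, indicator, indicator]
      split_ifs
      · rfl
      · rw [ENNReal.zero_rpow_of_pos hP]
    simp only [e]
    rw [lintegral_indicator (measurableSet_dyadicPiece M j)]
    refine (hN _ (measurableSet_dyadicPiece M j)).trans (mul_le_mul_right ?_ _)
    exact (measure_mono fun s hs => hs.1).trans (measure_dyadicIdx_eq_le M (j / 2))
  have hTle : ∀ j, ∫⁻ t, T j t ^ q.toReal ≤ (A * (2 * S * (2 ^ M)⁻¹) ^ (1 / p.toReal)) ^ q.toReal := by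
    intro j
    have h1 := (hA _ (measurableSet_dyadicPiece (ν := ν) M j)).trans (mul_le_mul_right (hind j) A)
    rw [mixedNorm, timeNorm, eLpNorm_eq_lintegral_rpow_enorm_toReal hq0 hqt] at h1
    simp only [enorm_eq_self] at h1
    rwa [one_div, ENNReal.rpow_inv_le_iff hQ] at h1
  rw [mixedNorm, timeNorm, eLpNorm_eq_lintegral_rpow_enorm_toReal hq0 hqt, one_div,
    ENNReal.rpow_inv_le_iff hQ]
  simp only [enorm_eq_self]
  calc ∫⁻ t, T (dyadicIdx ν (M + 1) t) t ^ q.toReal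
      ≤ ∫⁻ t, ∑ j ∈ Finset.range (2 ^ (M + 1)), T j t ^ q.toReal := by
        refine lintegral_mono fun t => ?_
        exact Finset.single_le_sum (f := fun j => T j t ^ q.toReal) (fun _ _ => zero_le)
          (Finset.mem_range.2 (dyadicIdx_lt hν (M + 1) t))
    _ = ∑ j ∈ Finset.range (2 ^ (M + 1)), ∫⁻ t, T j t ^ q.toReal :=
        lintegral_finsetSum _ fun j _ => (hTm j).pow_const _
    _ ≤ ∑ j ∈ Finset.range (2 ^ (M + 1)), (A * (2 * S * (2 ^ M)⁻¹) ^ (1 / p.toReal)) ^ q.toReal :=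
        Finset.sum_le_sum fun j _ => hTle j
    _ = 2 ^ (M + 1) * (A * (2 * S * (2 ^ M)⁻¹) ^ (1 / p.toReal)) ^ q.toReal := by
        rw [Finset.sum_const, Finset.card_range, nsmul_eq_mul]; push_cast; rfl
    _ = _ := by
        have h2 : ((2 : ℝ≥0∞) ^ (M + 1)) =
            (2 ^ (1 / q.toReal) * (2 ^ (1 / q.toReal)) ^ M) ^ q.toReal := by
          rw [← pow_succ', ← ENNReal.rpow_natCast, ← ENNReal.rpow_natCast, ← ENNReal.rpow_mul,
            ← ENNReal.rpow_mul]
          congr 1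
          field_simp
        rw [h2, ← ENNReal.mul_rpow_of_nonneg _ _ hQ.le]
        congr 1
        have h3 : ((2 : ℝ≥0∞) ^ M)⁻¹ ^ (1 / p.toReal) = (2 ^ (-(1 / p.toReal))) ^ M := by
          rw [← ENNReal.rpow_natCast, ← ENNReal.rpow_natCast, ← ENNReal.rpow_neg,
            ← ENNReal.rpow_mul, ← ENNReal.rpow_mul]
          congr 1; ring
        rw [ENNReal.mul_rpow_of_nonneg _ _ (by positivity), ENNReal.mul_rpow_of_nonneg _ _ (by positivity),
          h3, ckRatio, sub_eq_add_neg, ENNReal.rpow_add _ _ (by norm_num) (by norm_num), mul_pow]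
        rw [one_div q.toReal]
        ring

/-- The Christ-Kiselev lemma for kernels with values in a Lebesgue space. -/
theorem mixedNorm_retarded_le (hp : 1 ≤ p) (hpq : p < q) (hqt : q ≠ ⊤) (hr : 1 ≤ r)
    (hNm : Measurable N) (hNt : eLpNorm N p volume ≠ ⊤)
    (hK : StronglyMeasurable fun z : (ℝ × E n) × ℝ => K z.1.1 z.2 z.1.2)
    (hi : ∀ t x, Integrable (fun s => K t s x) volume) (hz : ∀ s, N s = 0 → ∀ t x, K t s x = 0)
    (hA : ∀ S, MeasurableSet S → mixedNorm q r (fun t x => ∫ s in S, K t s x) ≤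
      A * eLpNorm (S.indicator N) p volume) :
    mixedNorm q r (fun t x => ∫ s in Iio t, K t s x) ≤
      ckConst p q * A * eLpNorm N p volume := by
  have hp0 : p ≠ 0 := (zero_lt_one.trans_le hp).ne'
  have hpt : p ≠ ⊤ := hpq.ne_top
  have hq0 : q ≠ 0 := (zero_lt_one.trans_le (hp.trans hpq.le)).ne'
  have hq1 : 1 ≤ q := hp.trans hpq.le
  have hP := ENNReal.toReal_pos hp0 hpt
  by_cases h0 : eLpNorm N p volume = 0
  · have hN0 := (eLpNorm_eq_zero_iff hNm.aestronglyMeasurable hp0).1 h0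
    have : ∀ t x, ∫ s in Iio t, K t s x = 0 := fun t x => by
      rw [integral_congr_ae (g := fun _ => 0), integral_zero]
      exact ae_restrict_of_ae (hN0.mono fun s hs => hz s hs t x)
    simp only [this]
    simp [mixedNorm, timeNorm]
  obtain ⟨S, hS⟩ : ∃ S, S = ∫⁻ s, N s ^ p.toReal := ⟨_, rfl⟩
  have hSN : eLpNorm N p volume = S ^ (1 / p.toReal) := by
    rw [eLpNorm_eq_lintegral_rpow_enorm_toReal hp0 hpt, hS]; simp only [enorm_eq_self]
  have hS0 : S ≠ 0 := by
    rintro rfl; rw [hSN, ENNReal.zero_rpow_of_pos (by positivity)] at h0; exact h0 rfl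
  have hSt : S ≠ ⊤ := by
    rintro rfl; rw [hSN, ENNReal.top_rpow_of_pos (by positivity)] at hNt; exact hNt rfl
  obtain ⟨ν, hprob, hatom, hν, hνS⟩ := exists_diffuse_measure hS.symm hS0 hSt
  -- `F M` integrates over the times whose cell of generation M lies strictly before that of t. It
  -- vanishes for M = 0, the step to M + 1 adds exactly one dyadic piece, and as M grows the domain
  -- fills up s < t. Hence the retarded integral is bounded by a geometric series.
  set F : ℕ → ℝ → E n → ℂ := fun M t x => ∫ s in {s | dyadicIdx ν M s < dyadicIdx ν M t}, K t s x
    with hF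
  set a := 2 ^ (1 / q.toReal) * 2 ^ (1 / p.toReal) * (A * S ^ (1 / p.toReal)) with ha
  have hms : ∀ M t, MeasurableSet {s | dyadicIdx ν M s < dyadicIdx ν M t} := fun M t =>
    measurable_dyadicIdx M measurableSet_Iio
  have hFm : ∀ M, StronglyMeasurable (Function.uncurry (F M)) := fun M =>
    stronglyMeasurable_setIntegral hK (measurableSet_dyadicIdx_lt M)
  have hDm : ∀ M, StronglyMeasurable (Function.uncurry fun t x =>
      ∫ s in dyadicPiece ν M (dyadicIdx ν (M + 1) t), K t s x) := fun M =>
    stronglyMeasurable_setIntegral hK (measurableSet_dyadicPiece_prod M)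
  have hstep : ∀ M t, F (M + 1) t =
      F M t + fun x => ∫ s in dyadicPiece ν M (dyadicIdx ν (M + 1) t), K t s x := by
    intro M t
    ext x
    rw [Pi.add_apply]
    simp only [hF]
    rw [← setIntegral_union ?_ (measurableSet_dyadicPiece M _) (hi t x).integrableOn
      (hi t x).integrableOn]
    · congr 2
      ext s
      have e1 := dyadicIdx_succ_div ν M s
      have e2 := dyadicIdx_succ_div ν M t
      -- Comparing indices at generation M + 1: either the parents already differ, or they agree and
      -- the separation takes place exactly now.
      simp only [dyadicPiece, mem_union, mem_ofPred_eq]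
      omega
    · rw [Set.disjoint_left]
      intro s hs hs'
      have e2 := dyadicIdx_succ_div ν M t
      have h1 := hs'.1
      simp only [mem_ofPred_eq] at hs
      omega
  have hbound : ∀ M, mixedNorm q r (F M) ≤ ∑ m ∈ Finset.range M, a * ckRatio p q ^ m := by
    intro M
    induction M with
    | zero =>
      have : ∀ t x, F 0 t x = 0 := fun t x => by
        have e : {s | dyadicIdx ν 0 s < dyadicIdx ν 0 t} = ∅ := by
          ext s
          have := dyadicIdx_lt hν 0 t
          simp only [mem_ofPred_eq, mem_empty_iff_false, iff_false]
          omega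
        simp only [hF, e, setIntegral_empty]
      have h2 : F 0 = fun _ _ => 0 := by ext t x; exact this t x
      rw [h2]; simp [mixedNorm, timeNorm]
    | succ M ih =>
      rw [Finset.sum_range_succ]
      have hFt : ∀ t, AEStronglyMeasurable (F M t) volume := fun t =>
        ((hFm M).comp_measurable measurable_prodMk_left).aestronglyMeasurable
      have hDt : ∀ t, AEStronglyMeasurable (fun x =>
          ∫ s in dyadicPiece ν M (dyadicIdx ν (M + 1) t), K t s x) volume := fun t =>
        ((hDm M).comp_measurable (measurable_prodMk_left (x := t))).aestronglyMeasurable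
      have h1 : mixedNorm q r (F (M + 1)) ≤ mixedNorm q r (F M) + mixedNorm q r (fun t x =>
          ∫ s in dyadicPiece ν M (dyadicIdx ν (M + 1) t), K t s x) := by
        refine le_trans (eLpNorm_mono_enorm (g := (fun t => eLpNorm (F M t) r volume) + fun t =>
          eLpNorm (fun x => ∫ s in dyadicPiece ν M (dyadicIdx ν (M + 1) t), K t s x) r volume)
          fun t => ?_) (eLpNorm_add_le (measurable_eLpNorm_prod (hFm M) r).aestronglyMeasurable
          (measurable_eLpNorm_prod (hDm M) r).aestronglyMeasurable hq1)
        simp only [enorm_eq_self, Pi.add_apply]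
        rw [hstep]
        exact eLpNorm_add_le (hFt t) (hDt t) hr
      exact h1.trans (add_le_add ih
        (eLpNorm_dyadicPiece_le hν hp0 hpt hq0 hqt hνS hK hA M))
  have hsum : ∀ M, mixedNorm q r (F M) ≤ a * (1 - ckRatio p q)⁻¹ := fun M => by
    refine (hbound M).trans ((ENNReal.sum_le_tsum _).trans (le_of_eq ?_))
    rw [ENNReal.tsum_mul_left, ENNReal.tsum_geometric]
  have hlim : ∀ t x, Filter.Tendsto (fun M => F M t x) Filter.atTop
      (nhds (∫ s in Iio t, K t s x)) := by
    intro t x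
    simp only [hF]
    simp only [← integral_indicator (hms _ t)]
    rw [← integral_indicator measurableSet_Iio]
    refine tendsto_integral_of_dominated_convergence (fun s => ‖K t s x‖)
      (fun M => (hi t x).1.indicator (hms M t)) (hi t x).norm
      (fun M => Filter.Eventually.of_forall fun s => norm_indicator_le_norm_self _ _)
      (Filter.Eventually.of_forall fun s => ?_)
    refine tendsto_const_nhds.congr' ?_
    rcases lt_or_ge s t with hst | hst
    · filter_upwards [eventually_dyadicIdx_lt hν hst] with M hM
      rw [indicator_of_mem (show s ∈ Iio t from hst), indicator_of_mem (by exact hM)]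
    · refine Filter.Eventually.of_forall fun M => ?_
      have h1 : s ∉ Iio t := not_lt.2 hst
      have h2 : s ∉ {s | dyadicIdx ν M s < dyadicIdx ν M t} := not_lt.2 (dyadicIdx_mono M hst)
      rw [indicator_of_notMem h1]
      exact (indicator_of_notMem h2 _).symm
  have hfin := eLpNorm_le_of_ae_le_liminf (μ := volume) hq0 hqt
    (f := fun t => eLpNorm (fun x => ∫ s in Iio t, K t s x) r volume)
    (F := fun M t => eLpNorm (F M t) r volume)
    (fun M => measurable_eLpNorm_prod (hFm M) r) (fun t => ?_) hsum
  · refine hfin.trans (le_of_eq ?_)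
    rw [ha, ckConst, hSN]; ring
  · exact Lp.eLpNorm_lim_le_liminf_eLpNorm (fun M =>
      ((hFm M).comp_measurable measurable_prodMk_left).aestronglyMeasurable) _
      (Filter.Eventually.of_forall (hlim t))

end

/-- The retarded estimate for one block. -/
theorem exists_retarded_le (n : ℕ) {σ : ℝ} (hσ : σ ∈ Ioc (0 : ℝ) 1) {q r q₂ r₂ : ℝ≥0∞}
    (hqr : SharpAdmissible σ q r) (hqr₂ : SharpAdmissible σ q₂ r₂) {B L : ℝ} (hB : 0 < B)
    (hL : 0 < L) :
    ∃ c : ℝ, 0 < c ∧ ∀ {g δ p D}, IsBlock n g δ p σ B L D → ∀ w : ℝ → E n → ℂ, IsNice q₂ r₂ w →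
      mixedNorm q r (fun t x => ∫ s in Iio t,
        mul n (fun y => phase g δ (t - s) y * (p y * (p y * (p y * p y)))) (w s) x) ≤
        ENNReal.ofReal (c * D ^ (gap r + gap r₂)) *
          mixedNorm q₂.conjExponent r₂.conjExponent w := by
  have hset : ∀ {g δ p D}, IsBlock n g δ p σ B L D → ∀ w : ℝ → E n → ℂ, IsNice q₂ r₂ w →
      ∀ S : Set ℝ, MeasurableSet S → ∀ t x, ∫ s in S,
        mul n (fun y => phase g δ (t - s) y * (p y * (p y * (p y * p y)))) (w s) x =
      ∫ s, mul n (fun y => phase g δ (t - s) y * (p y * (p y * (p y * p y)))) (S.indicator w s) x := by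
    intro g δ p D hb w hw S hS t x
    rw [← integral_indicator hS,
      ← mul_indicator (fun s y => phase g δ (t - s) y * (p y * (p y * (p y * p y))))]
  rcases eq_or_ne q ⊤ with rfl | hqt
  -- The Christ-Kiselev lemma needs q < ∞. For q = ∞, r = 2 the supremum over t is taken outside, so
  -- the restriction s < t can be absorbed into the source for each fixed t, and the dual estimate
  -- applies.
  · have hr := hqr.eq_two hσ
    subst hr
    obtain ⟨c, hc, hd⟩ := exists_dual_le n hσ hqr₂ hB hL
    refine ⟨(B * B) * c, by positivity, fun {g δ p D} hb w hw => ?_⟩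
    have hD := hb.pos
    have hg : gap 2 = 0 := by rw [gap]; norm_num
    have hpp := hb.bd.mul hb.dim hb.bd
    rw [hg, zero_add, mixedNorm, timeNorm, eLpNorm_exponent_top]
    refine eLpNormEssSup_le_of_ae_enorm_bound (Filter.Eventually.of_forall fun t => ?_)
    rw [enorm_eq_self]
    have hw' := hw.indicator (measurableSet_Iio (a := t))
    simp only [hset hb w hw (Iio t) measurableSet_Iio t, hb.integral_eq_mul hσ hqr₂ hw']
    have hd' := hd hb _ hw' _ isTimeIso_neg
    have hZ := hpp.sym.stronglyMeasurable_mul_phase hb.reg hb.scale (τ := fun s : ℝ => -s)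
      measurable_neg hw'.meas
    refine (eLpNorm_mul_two_le hb.dim (hpp.sym.phase_mul hb.reg hb.scale t) (B := B * B)
      (fun y hy => ?_) ⟨(stronglyMeasurable_integral_swap hZ).aestronglyMeasurable,
        hd'.trans_lt (ENNReal.mul_lt_top (by simp) hw'.fin.lt_top)⟩).trans ?_
    · rw [norm_mul, norm_phase, one_mul]; exact hpp.bound y hy
    · refine (mul_le_mul_right (hd'.trans (mul_le_mul_right (mixedNorm_indicator_le w _) _)) _).trans
        (le_of_eq ?_)
      rw [← mul_assoc, ← ENNReal.ofReal_mul (by positivity), mul_assoc (B * B)]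
  obtain ⟨c, hc, h⟩ := exists_inhomogeneous_le n hσ hqr hqr₂ hB hL
  have hq2 := hqr.two_lt hσ
  have hcq : q₂.conjExponent < q := (conjExponent_le_two hqr₂.1).trans_lt hq2
  have hck := ckConst_ne_top (zero_lt_one.trans_le (one_le_conjExponent q₂)).ne' hcq hqt
  refine ⟨((ckConst q₂.conjExponent q).toReal + 1) * c, by positivity, fun {g δ p D} hb w hw => ?_⟩
  have hD := hb.pos
  have hpp := hb.bd.mul hb.dim hb.bd
  have hp4 := hb.bd.mul hb.dim (hb.bd.mul hb.dim hpp)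
  have hKm : StronglyMeasurable fun z : (ℝ × E n) × ℝ => mul n
      (fun y => phase g δ (z.1.1 - z.2) y * (p y * (p y * (p y * p y)))) (w z.2) z.1.2 := by
    have h1 := hp4.sym.stronglyMeasurable_mul_phase hb.reg hb.scale (α := ℝ × ℝ)
      (τ := fun z => z.1 - z.2) (by fun_prop) (v := fun z => w z.2)
      (hw.meas.comp_measurable (g := fun y : (ℝ × ℝ) × E n => (y.1.2, y.2)) (by fun_prop))
    exact h1.comp_measurable (g := fun z : (ℝ × E n) × ℝ => ((z.1.1, z.2), z.1.2)) (by fun_prop)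
  have key := mixedNorm_retarded_le (n := n) (r := r) (N := fun s => eLpNorm (w s) r₂.conjExponent volume)
    (A := ENNReal.ofReal (c * D ^ (gap r + gap r₂)))
    (K := fun t s x => mul n (fun y => phase g δ (t - s) y * (p y * (p y * (p y * p y)))) (w s) x)
    (one_le_conjExponent q₂) hcq hqt (one_le_of_two_le hqr.2.1) hw.measurable_norm hw.fin hKm
    (fun t x => hb.integrable_mul hσ hqr₂ (hb.bd.mul hb.dim hpp) hw (isTimeIso_sub t) x)
    (fun s hs t x => ?_) (fun S hS => ?_)
  · refine key.trans ?_
    rw [mul_assoc ((ckConst q₂.conjExponent q).toReal + 1) c,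
      ENNReal.ofReal_mul (p := (ckConst q₂.conjExponent q).toReal + 1) (by positivity)]
    have hc' : ckConst q₂.conjExponent q ≤
        ENNReal.ofReal ((ckConst q₂.conjExponent q).toReal + 1) :=
      (ENNReal.ofReal_toReal hck).ge.trans (ENNReal.ofReal_le_ofReal (by linarith))
    exact mul_le_mul' (mul_le_mul' hc' le_rfl) le_rfl
  · have hw0 := (eLpNorm_eq_zero_iff (hw.mem s).1
      (zero_lt_one.trans_le (one_le_conjExponent r₂)).ne').1 hs
    rw [mul_congr_ae hw0]
    exact congrFun mul_zero_fun x
  · simp only [hset hb w hw S hS]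
    refine (h hb _ (hw.indicator hS)).trans (le_of_eq ?_)
    rw [mixedNorm, timeNorm, eLpNorm_indicator_time]

end Dispersive

/-! ### Measurable representatives of sources -/

namespace Dispersive

variable {n : ℕ}

theorem ae_uncurry_eq {F G : ℝ → E n → ℂ} (h : ∀ᵐ s : ℝ, F s = G s) :
    Function.uncurry F =ᵐ[volume.prod volume] Function.uncurry G := by
  have := Measure.quasiMeasurePreserving_fst (μ := (volume : Measure ℝ))
    (ν := (volume : Measure (E n))) |>.ae h
  filter_upwards [this] with z hz
  exact congrFun hz z.2

theorem IsSource.mul (hn : n ≤ 3) {F : ℝ → E n → ℂ} (hF : IsSource F) {m : ℝ → ℂ} (h : IsSym m) :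
    IsSource fun s => mul n m (F s) := by
  obtain ⟨hm, hp⟩ := hF
  refine ⟨?_, hp.mono fun s ⟨p, hp1, hps⟩ => ⟨p, hp1, h.memLp_mul hn hp1 hps⟩⟩
  set G : ℝ → E n → ℂ := fun s x => hm.mk _ (s, x)
  have hG : StronglyMeasurable (Function.uncurry G) := hm.stronglyMeasurable_mk
  refine ⟨_, h.stronglyMeasurable_mul hG, ae_uncurry_eq ?_⟩
  filter_upwards [Measure.ae_ae_of_ae_prod hm.ae_eq_mk] with s hs
  exact mul_congr_ae hs

theorem mixedNorm_congr_ae {p q : ℝ≥0∞} {F G : ℝ → E n → ℂ} (h : ∀ᵐ s : ℝ, F s =ᵐ[volume] G s) :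
    mixedNorm q p F = mixedNorm q p G :=
  eLpNorm_congr_ae (h.mono fun _ hs => eLpNorm_congr_ae hs)

theorem conjExponent_ne_top {q : ℝ≥0∞} (hq : 2 ≤ q) : q.conjExponent ≠ ⊤ :=
  ne_top_of_le_ne_top (by norm_num) (conjExponent_le_two hq)

theorem ae_lt_top_of_eLpNorm_ne_top {α : Type*} [MeasurableSpace α] {μ : Measure α} {q : ℝ≥0∞}
    (hq0 : q ≠ 0) (hqt : q ≠ ⊤) {N : α → ℝ≥0∞} (hN : AEMeasurable N μ) (h : eLpNorm N q μ ≠ ⊤) :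
    ∀ᵐ s ∂μ, N s < ⊤ := by
  have hQ := ENNReal.toReal_pos hq0 hqt
  rw [eLpNorm_eq_lintegral_rpow_enorm_toReal hq0 hqt] at h
  simp only [enorm_eq_self] at h
  have h1 : ∫⁻ x, N x ^ q.toReal ∂μ ≠ ⊤ := fun h2 => by
    rw [h2, ENNReal.top_rpow_of_pos (by positivity)] at h; exact h rfl
  filter_upwards [ae_lt_top' (hN.pow_const _) h1] with s hs
  exact (ENNReal.rpow_lt_top_iff_of_pos hQ).1 hs

/-- As q' is finite, the times at which the spatial norm is infinite form a null set, and the source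
can be set to zero there. -/
theorem IsSource.exists_isNice {q r : ℝ≥0∞} (hq : 2 ≤ q) {w : ℝ → E n → ℂ} (hw : IsSource w)
    (hfin : mixedNorm q.conjExponent r.conjExponent w ≠ ⊤) :
    ∃ w' : ℝ → E n → ℂ, IsNice q r w' ∧ ∀ᵐ s : ℝ, w s =ᵐ[volume] w' s := by
  obtain ⟨hm, -⟩ := hw
  set G : ℝ → E n → ℂ := fun s x => hm.mk _ (s, x)
  have hG : StronglyMeasurable (Function.uncurry G) := hm.stronglyMeasurable_mk
  have hGw : ∀ᵐ s : ℝ, w s =ᵐ[volume] G s := Measure.ae_ae_of_ae_prod hm.ae_eq_mk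
  have hN : Measurable fun s => eLpNorm (G s) r.conjExponent volume := measurable_eLpNorm_prod hG _
  rw [mixedNorm_congr_ae hGw] at hfin
  have hlt := ae_lt_top_of_eLpNorm_ne_top (zero_lt_one.trans_le (one_le_conjExponent q)).ne'
    (conjExponent_ne_top hq) hN.aemeasurable hfin
  set S : Set ℝ := {s | eLpNorm (G s) r.conjExponent volume < ⊤} with hS
  have hSm : MeasurableSet S := measurableSet_lt hN measurable_const
  refine ⟨S.indicator G, ⟨?_, fun s => ?_, ?_⟩, ?_⟩
  · have : Function.uncurry (S.indicator G) = (Prod.fst ⁻¹' S).indicator (Function.uncurry G) := by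
      ext z
      by_cases hz : z.1 ∈ S
      · rw [indicator_of_mem (by exact hz)]; simp [Function.uncurry, hz]
      · rw [indicator_of_notMem (by exact hz)]; simp [Function.uncurry, hz]
    rw [this]
    exact hG.indicator (measurable_fst hSm)
  · by_cases hs : s ∈ S
    · rw [indicator_of_mem hs]
      exact ⟨(hG.comp_measurable measurable_prodMk_left).aestronglyMeasurable, hs⟩
    · rw [indicator_of_notMem hs]; exact MemLp.zero
  · exact ne_top_of_le_ne_top hfin (mixedNorm_indicator_le G S)
  · filter_upwards [hGw, hlt] with s h1 h2
    rwa [indicator_of_mem (by exact h2)]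

/-! ### The Littlewood-Paley symbols -/

theorem IsBump.ne_zero {φ₀ : ℝ → ℝ} (h : IsBump φ₀) {y : ℝ} (hy : φ₀ y ≠ 0) : |y| ≤ 4 / 5 :=
  abs_le.2 (h.support_subset hy)

/-- This annulus is the one on which `P` is assumed to equal 1, so a rescaled `P` is 1 on the
support of Q_k. -/
theorem IsBump.Q_ne_zero {φ₀ : ℝ → ℝ} (h : IsBump φ₀) {k : ℤ} {y : ℝ} (hy : Q φ₀ k y ≠ 0) :
    3 / 5 ≤ |y| / 2 ^ k ∧ |y| / 2 ^ k ≤ 8 / 5 := by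
  have h2 : (0 : ℝ) < 2 ^ k := by positivity
  have e1 : |(2 : ℝ) ^ (-k) * y| = |y| / 2 ^ k := by
    rw [abs_mul, zpow_neg, abs_of_pos (by positivity)]; ring
  have e2 : |(2 : ℝ) ^ (-k - 1) * y| = |y| / 2 ^ k / 2 := by
    rw [abs_mul, abs_of_pos (by positivity), zpow_sub₀ two_ne_zero, zpow_neg]; simp; ring
  have h0 : 0 ≤ |y| / (2 : ℝ) ^ k := by positivity
  constructor
  · by_contra hlt
    push Not at hlt
    refine hy ?_
    rw [Q, h.eq_one _ (abs_le.1 (by rw [e2]; linarith)), h.eq_one _ (abs_le.1 (by rw [e1]; linarith)),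
      sub_self]
  · by_contra hlt
    push Not at hlt
    refine hy ?_
    have z1 : φ₀ ((2 : ℝ) ^ (-k) * y) = 0 := by
      by_contra hz; have := h.ne_zero hz; rw [e1] at this; linarith
    have z2 : φ₀ ((2 : ℝ) ^ (-k - 1) * y) = 0 := by
      by_contra hz; have := h.ne_zero hz; rw [e2] at this; linarith
    rw [Q, z1, z2, sub_self]

theorem IsBump.contDiff_Q {φ₀ : ℝ → ℝ} (h : IsBump φ₀) (k : ℤ) : ContDiff ℝ ∞ (Q φ₀ k) := by
  have := h.smooth
  unfold Q
  fun_prop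

theorem IsBump.isSym_Q {φ₀ : ℝ → ℝ} (h : IsBump φ₀) (k : ℤ) :
    IsSym (fun y => (Q φ₀ k y : ℂ)) where
  supp := by
    have h2 : (0 : ℝ) < 2 ^ k := by positivity
    refine ⟨3 / 5 * 2 ^ k, 8 / 5 * 2 ^ k, by positivity, fun y hy hne => ?_⟩
    have := h.Q_ne_zero (k := k) (y := y) (by simpa using hne)
    rw [abs_of_nonneg hy, le_div_iff₀ h2, div_le_iff₀ h2] at this
    exact this
  contDiffOn := (Complex.ofRealCLM.contDiff.comp
    (contDiff_infty.1 (h.contDiff_Q k) 2)).contDiffOn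

theorem IsBump.isSym_blockProj {φ₀ : ℝ → ℝ} (h : IsBump φ₀) (k : ℤ) {δ : ℝ} (hδ : 0 < δ) :
    IsSym (blockProj φ₀ δ k) := (h.isSym_Q k).dilate hδ

theorem lintegral_comp_inv_smul {l : ℝ} (hl : 0 < l) (G : E n → ℝ≥0∞) :
    ∫⁻ x : E n, G (l⁻¹ • x) = ENNReal.ofReal (l ^ n) * ∫⁻ x, G x := by
  have hl' : l⁻¹ ≠ 0 := inv_ne_zero hl.ne'
  have h1 := (Homeomorph.smulOfNeZero (α := E n) l⁻¹ hl').measurableEmbedding.lintegral_map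
    (μ := volume) G
  have h2 := Measure.map_addHaar_smul (volume : Measure (E n)) hl'
  have h3 : ∫⁻ x : E n, G (l⁻¹ • x) = ∫⁻ x, G x ∂(Measure.map (fun x : E n => l⁻¹ • x) volume) :=
    h1.symm
  rw [h3, h2, lintegral_smul_measure, smul_eq_mul, finrank_euclideanSpace_fin, inv_pow, inv_inv,
    abs_of_pos (pow_pos hl n)]

/-- Dilation of the symbol rescales the kernel and preserves its L^1 norm; hence the bounds are
uniform in δ and in the dyadic index. -/
theorem eLpNorm_one_kernel_dilate (n : ℕ) (m : ℝ → ℂ) {l : ℝ} (hl : 0 < l) :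
    eLpNorm (kernel n fun y => m (l * y)) 1 volume = eLpNorm (kernel n m) 1 volume := by
  rw [eLpNorm_one_eq_lintegral_enorm, eLpNorm_one_eq_lintegral_enorm]
  simp only [kernel_dilate n m hl, enorm_mul]
  rw [lintegral_const_mul' _ _ enorm_ne_top]
  rw [lintegral_comp_inv_smul hl (fun x => ‖kernel n m x‖ₑ), ← mul_assoc]
  convert one_mul _
  rw [← ofReal_norm, ← ENNReal.ofReal_mul (norm_nonneg _), ← ENNReal.ofReal_one]
  congr 1
  rw [norm_inv, Complex.norm_real, Real.norm_of_nonneg (by positivity), inv_mul_cancel₀ (by positivity)]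

end Dispersive

/-! ### Block estimates for symbols supported where the cut-off is one -/

namespace Dispersive

variable {n : ℕ} {g : ℝ → ℝ} {δ : ℝ}

section localized
variable {σ B L D : ℝ} {p m : ℝ → ℂ}

/-- As p m = m, any number of factors `p` may be inserted: two here, for the homogeneous and dual
estimates, and four in the companion lemma, for the Duhamel integrals. -/
theorem IsBlock.mul_phase_eq (hb : IsBlock n g δ p σ B L D) (h : IsSym m)
    (hm : ∀ y, 0 ≤ y → p y * m y = m y) {s : ℝ≥0∞} (hs : 1 ≤ s) {f : E n → ℂ}
    (hf : MemLp f s volume) (τ : ℝ) :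
    mul n (fun y => phase g δ τ y * m y) f =
      mul n (fun y => phase g δ τ y * (p y * p y)) (mul n m f) := by
  have hpp := hb.bd.mul hb.dim hb.bd
  rw [mul_mul_eq hb.dim (hpp.sym.phase_mul hb.reg hb.scale τ) h hs hf]
  have e : ∀ y, 0 ≤ y → phase g δ τ y * m y = phase g δ τ y * (p y * p y) * m y := fun y hy => by
    rw [mul_assoc, mul_assoc, hm y hy, hm y hy]
  exact mul_congr (fun y hy => e y hy.le) (e 0 le_rfl)

theorem IsBlock.mul_phase_eq' (hb : IsBlock n g δ p σ B L D) (h : IsSym m)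
    (hm : ∀ y, 0 ≤ y → p y * m y = m y) {s : ℝ≥0∞} (hs : 1 ≤ s) {f : E n → ℂ}
    (hf : MemLp f s volume) (τ : ℝ) :
    mul n (fun y => phase g δ τ y * m y) f =
      mul n (fun y => phase g δ τ y * (p y * (p y * (p y * p y)))) (mul n m f) := by
  have hp4 := hb.bd.mul hb.dim (hb.bd.mul hb.dim (hb.bd.mul hb.dim hb.bd))
  rw [mul_mul_eq hb.dim (hp4.sym.phase_mul hb.reg hb.scale τ) h hs hf]
  have e : ∀ y, 0 ≤ y → phase g δ τ y * m y =
      phase g δ τ y * (p y * (p y * (p y * p y))) * m y := fun y hy => by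
    rw [mul_assoc, mul_assoc, mul_assoc, mul_assoc, hm y hy, hm y hy, hm y hy, hm y hy]
  exact mul_congr (fun y hy => e y hy.le) (e 0 le_rfl)

theorem IsBlock.exists_isNice (hb : IsBlock n g δ p σ B L D) (h : IsSym m)
    (hm : ∀ y, 0 ≤ y → p y * m y = m y) {q r : ℝ≥0∞} (hq : 2 ≤ q) {F : ℝ → E n → ℂ}
    (hF : IsSource F)
    (hfin : mixedNorm q.conjExponent r.conjExponent (fun s => mul n m (F s)) ≠ ⊤) :
    ∃ w : ℝ → E n → ℂ, IsNice q r w ∧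
      mixedNorm q.conjExponent r.conjExponent (fun s => mul n m (F s)) =
        mixedNorm q.conjExponent r.conjExponent w ∧
      (∀ᵐ s : ℝ, ∀ τ, mul n (fun y => phase g δ τ y * m y) (F s) =
        mul n (fun y => phase g δ τ y * (p y * p y)) (w s)) ∧
      ∀ᵐ s : ℝ, ∀ τ, mul n (fun y => phase g δ τ y * m y) (F s) =
        mul n (fun y => phase g δ τ y * (p y * (p y * (p y * p y)))) (w s) := by
  obtain ⟨w, hw, he⟩ := (hF.mul hb.dim h).exists_isNice hq hfin
  refine ⟨w, hw, mixedNorm_congr_ae he, ?_, ?_⟩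
  · filter_upwards [he, hF.2] with s hs ⟨a, ha, hsF⟩ τ
    rw [hb.mul_phase_eq h hm ha hsF, mul_congr_ae hs]
  · filter_upwards [he, hF.2] with s hs ⟨a, ha, hsF⟩ τ
    rw [hb.mul_phase_eq' h hm ha hsF, mul_congr_ae hs]

theorem IsBlock.integrable_localized (hb : IsBlock n g δ p σ B L D) (hσ : σ ∈ Ioc (0 : ℝ) 1)
    {q r : ℝ≥0∞} (hqr : SharpAdmissible σ q r) (h : IsSym m)
    (hm : ∀ y, 0 ≤ y → p y * m y = m y) {F : ℝ → E n → ℂ} (hF : IsSource F)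
    (hfin : mixedNorm q.conjExponent r.conjExponent (fun s => mul n m (F s)) ≠ ⊤)
    {θ : ℝ → ℝ} (hθ : IsTimeIso θ) (x : E n) :
    Integrable (fun s => mul n (fun y => phase g δ (θ s) y * m y) (F s) x) volume := by
  obtain ⟨w, hw, -, he, -⟩ := hb.exists_isNice h hm hqr.1 hF hfin
  refine (hb.integrable_mul hσ hqr hb.bd hw hθ x).congr ?_
  filter_upwards [he] with s hs
  rw [hs]

end localized

theorem exists_homogeneous_localized_le (n : ℕ) {σ : ℝ} (hσ : σ ∈ Ioc (0 : ℝ) 1) {q r : ℝ≥0∞}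
    (hqr : SharpAdmissible σ q r) {B L : ℝ} (hB : 0 < B) (hL : 0 < L) :
    ∃ c : ℝ, 0 < c ∧ ∀ {g δ p D}, IsBlock n g δ p σ B L D → ∀ m, IsSym m →
      (∀ y, 0 ≤ y → p y * m y = m y) → ∀ f : E n → ℂ, MemLp f 2 volume →
      mixedNorm q r (fun t => mul n (fun y => phase g δ t y * m y) f) ≤
        ENNReal.ofReal (c * D ^ gap r) * eLpNorm (mul n m f) 2 volume := by
  obtain ⟨c, hc, h⟩ := exists_homogeneous_le n hσ hqr hB hL
  refine ⟨c, hc, fun {g δ p D} hb m hs hm f hf => ?_⟩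
  simp only [hb.mul_phase_eq hs hm (by norm_num) hf]
  exact h hb _ (hs.memLp_mul hb.dim (by norm_num) hf)

theorem exists_dual_localized_le (n : ℕ) {σ : ℝ} (hσ : σ ∈ Ioc (0 : ℝ) 1) {q r : ℝ≥0∞}
    (hqr : SharpAdmissible σ q r) {B L : ℝ} (hB : 0 < B) (hL : 0 < L) :
    ∃ c : ℝ, 0 < c ∧ ∀ {g δ p D}, IsBlock n g δ p σ B L D → ∀ m, IsSym m →
      (∀ y, 0 ≤ y → p y * m y = m y) → ∀ F : ℝ → E n → ℂ, IsSource F →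
      eLpNorm (fun x => ∫ s, mul n (fun y => phase g δ (-s) y * m y) (F s) x) 2 volume ≤
        ENNReal.ofReal (c * D ^ gap r) *
          mixedNorm q.conjExponent r.conjExponent (fun s => mul n m (F s)) := by
  obtain ⟨c, hc, h⟩ := exists_dual_le n hσ hqr hB hL
  refine ⟨c, hc, fun {g δ p D} hb m hs hm F hF => ?_⟩
  have hD := hb.pos
  by_cases hfin : mixedNorm q.conjExponent r.conjExponent (fun s => mul n m (F s)) = ⊤
  · rw [hfin, ENNReal.mul_top (by simpa using by positivity)]; exact le_top
  obtain ⟨w, hw, e, he, -⟩ := hb.exists_isNice hs hm hqr.1 hF hfin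
  rw [e]
  refine le_trans (le_of_eq ?_) (h hb w hw _ isTimeIso_neg)
  congr 1
  ext x
  refine integral_congr_ae (he.mono fun s hs' => ?_)
  simp only [hs']

theorem exists_inhomogeneous_localized_le (n : ℕ) {σ : ℝ} (hσ : σ ∈ Ioc (0 : ℝ) 1)
    {q r q₂ r₂ : ℝ≥0∞} (hqr : SharpAdmissible σ q r) (hqr₂ : SharpAdmissible σ q₂ r₂) {B L : ℝ}
    (hB : 0 < B) (hL : 0 < L) :
    ∃ c : ℝ, 0 < c ∧ ∀ {g δ p D}, IsBlock n g δ p σ B L D → ∀ m, IsSym m →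
      (∀ y, 0 ≤ y → p y * m y = m y) → ∀ F : ℝ → E n → ℂ, IsSource F →
      mixedNorm q r (fun t x => ∫ s, mul n (fun y => phase g δ (t - s) y * m y) (F s) x) ≤
        ENNReal.ofReal (c * D ^ (gap r + gap r₂)) *
          mixedNorm q₂.conjExponent r₂.conjExponent (fun s => mul n m (F s)) := by
  obtain ⟨c, hc, h⟩ := exists_inhomogeneous_le n hσ hqr hqr₂ hB hL
  refine ⟨c, hc, fun {g δ p D} hb m hs hm F hF => ?_⟩
  have hD := hb.pos
  by_cases hfin : mixedNorm q₂.conjExponent r₂.conjExponent (fun s => mul n m (F s)) = ⊤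
  · rw [hfin, ENNReal.mul_top (by simpa using by positivity)]; exact le_top
  obtain ⟨w, hw, e, -, he⟩ := hb.exists_isNice hs hm hqr₂.1 hF hfin
  rw [e]
  refine le_trans (le_of_eq ?_) (h hb w hw)
  congr 1
  ext t x
  refine integral_congr_ae (he.mono fun s hs' => ?_)
  simp only [hs']

theorem exists_retarded_localized_le (n : ℕ) {σ : ℝ} (hσ : σ ∈ Ioc (0 : ℝ) 1)
    {q r q₂ r₂ : ℝ≥0∞} (hqr : SharpAdmissible σ q r) (hqr₂ : SharpAdmissible σ q₂ r₂) {B L : ℝ}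
    (hB : 0 < B) (hL : 0 < L) :
    ∃ c : ℝ, 0 < c ∧ ∀ {g δ p D}, IsBlock n g δ p σ B L D → ∀ m, IsSym m →
      (∀ y, 0 ≤ y → p y * m y = m y) → ∀ F : ℝ → E n → ℂ, IsSource F →
      mixedNorm q r (fun t x => ∫ s in Iio t, mul n (fun y => phase g δ (t - s) y * m y) (F s) x) ≤
        ENNReal.ofReal (c * D ^ (gap r + gap r₂)) *
          mixedNorm q₂.conjExponent r₂.conjExponent (fun s => mul n m (F s)) := by
  obtain ⟨c, hc, h⟩ := exists_retarded_le n hσ hqr hqr₂ hB hL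
  refine ⟨c, hc, fun {g δ p D} hb m hs hm F hF => ?_⟩
  have hD := hb.pos
  by_cases hfin : mixedNorm q₂.conjExponent r₂.conjExponent (fun s => mul n m (F s)) = ⊤
  · rw [hfin, ENNReal.mul_top (by simpa using by positivity)]; exact le_top
  obtain ⟨w, hw, e, -, he⟩ := hb.exists_isNice hs hm hqr₂.1 hF hfin
  rw [e]
  refine le_trans (le_of_eq ?_) (h hb w hw)
  congr 1
  ext t x
  refine integral_congr_ae (ae_restrict_of_ae (he.mono fun s hs' => ?_))
  simp only [hs']

/-! ### The blocks of the theorem -/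

theorem isSym_of_support {P : ℝ → ℂ} (hP : ContDiff ℝ ∞ P)
    (hPsupp : Function.support P ⊆ {y | 1 / 2 ≤ |y| ∧ |y| ≤ 2}) : IsSym P where
  supp := ⟨1 / 2, 2, by norm_num, fun y hy hne => by
    have := hPsupp hne
    simpa only [mem_ofPred_eq, abs_of_nonneg hy] using this⟩
  contDiffOn := (contDiff_infty.1 hP 2).contDiffOn

theorem integrable_exp_mul {m : ℝ → ℂ} (h : IsSym m) (x : E n) :
    Integrable fun ξ : E n => Complex.exp (Complex.I * ((inner ℝ x ξ : ℝ) : ℂ)) * m ‖ξ‖ := by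
  have h1 : Integrable (rad n fun y => m ((2 * Real.pi)⁻¹ * y)) :=
    (h.dilate (by positivity)).integrable_rad
  have h2 : (rad n fun y => m ((2 * Real.pi)⁻¹ * y)) = fun ξ => m ‖ξ‖ := by
    ext ξ; rw [rad]; congr 1; field_simp
  rw [h2] at h1
  refine h1.bdd_mul (c := 1) (by fun_prop) (Filter.Eventually.of_forall fun ξ => ?_)
  rw [mul_comm, Complex.norm_exp_ofReal_mul_I]

/-- In dimension one the line is, up to a null set, the half line and its reflection, and ξ ↦ -ξ
turns the second integral into the first one at -x. In other dimensions the domain of integration is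
already the whole space. -/
theorem norm_integral_exp_mul_le {m : ℝ → ℂ} (h : IsSym m) {K : ℝ}
    (hK : ∀ x : E n, ‖∫ ξ in {ξ : E n | n = 1 → ∀ i, 0 < ξ i},
      Complex.exp (Complex.I * ((inner ℝ x ξ : ℝ) : ℂ)) * m ‖ξ‖‖ ≤ K) (x : E n) :
    ‖∫ ξ : E n, Complex.exp (Complex.I * ((inner ℝ x ξ : ℝ) : ℂ)) * m ‖ξ‖‖ ≤ 2 * K := by
  have hK0 : 0 ≤ K := (norm_nonneg _).trans (hK x)
  by_cases hn : n = 1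
  · subst hn
    set f : E 1 → E 1 → ℂ := fun x ξ => Complex.exp (Complex.I * ((inner ℝ x ξ : ℝ) : ℂ)) * m ‖ξ‖
    set S : Set (E 1) := {ξ | (1 : ℕ) = 1 → ∀ i, 0 < ξ i} with hS
    have hSe : S = {ξ | 0 < ξ 0} := by
      ext ξ; simp [hS]
    have hSm : MeasurableSet S := by
      rw [hSe]; exact measurableSet_lt measurable_const (by fun_prop)
    have hae : (Sᶜ : Set (E 1)) =ᵐ[volume] (fun ξ => -ξ) ⁻¹' S := by
      have h0 : ∀ᵐ ξ : E 1, ξ ≠ 0 := by simp [ae_iff]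
      filter_upwards [h0] with ξ hξ
      have : ξ 0 ≠ 0 := fun h => hξ (by ext i; fin_cases i; simpa using h)
      refine propext ?_
      change ¬ (ξ ∈ S) ↔ -ξ ∈ S
      rw [hSe]
      simp only [mem_ofPred_eq, PiLp.neg_apply, not_lt, Left.neg_pos_iff]
      exact ⟨fun h => lt_of_le_of_ne h this, le_of_lt⟩
    have hi := integrable_exp_mul (n := 1) h x
    rw [← integral_add_compl hSm hi, setIntegral_congr_set hae]
    have e : ∫ ξ in (fun ξ => -ξ) ⁻¹' S, f x ξ = ∫ ξ in S, f (-x) ξ := by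
      have h1 := (Measure.measurePreserving_neg (volume : Measure (E 1))).setIntegral_preimage_emb
        (MeasurableEquiv.neg (E 1)).measurableEmbedding (f (-x)) S
      rw [← h1]
      refine setIntegral_congr_fun (hSm.preimage measurable_neg) fun ξ _ => ?_
      simp [f]
    calc _ ≤ ‖∫ ξ in S, f x ξ‖ + ‖∫ ξ in (fun ξ => -ξ) ⁻¹' S, f x ξ‖ := norm_add_le _ _
      _ ≤ K + K := add_le_add (hK x) (e ▸ hK (-x))
      _ = 2 * K := by ring
  · have : {ξ : E n | n = 1 → ∀ i, 0 < ξ i} = univ := eq_univ_of_forall fun ξ h => absurd h hn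
    have h1 := hK x
    rw [this, setIntegral_univ] at h1
    linarith

/-- The frequency-localised propagators of the theorem, with their dispersive estimates. -/
structure BlockFamily (n : ℕ) (φ₀ g : ℝ → ℝ) (J : Set ℝ) (σ β γ : ℝ) (p : ℝ → ℤ → ℝ → ℂ)
    (A B L : ℝ) : Prop where
  posA : 0 < A
  posB : 0 < B
  posL : 0 < L
  block : ∀ δ, 0 < δ → ∀ k ∈ ZJ J,
    IsBlock n g δ (p δ k) σ B L (A * (2 : ℝ) ^ (γ * (k : ℝ)) * δ ^ β)
  one : ∀ δ, 0 < δ → ∀ k y, 0 ≤ y → Q φ₀ k (δ * y) ≠ 0 → p δ k y = 1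

theorem exists_blockFamily (hn : n = 1 ∨ n = 2) {φ₀ : ℝ → ℝ} (hφ₀ : IsBump φ₀)
    (hg : ContDiffOn ℝ 2 g (Ioi 0)) {J : Set ℝ} {C σ β γ : ℝ} (hC : 0 < C)
    {P : ℝ → ℂ} (hP : ContDiff ℝ ∞ P)
    (hPsupp : Function.support P ⊆ {y | 1 / 2 ≤ |y| ∧ |y| ≤ 2})
    (hPone : ∀ y : ℝ, 3 / 5 ≤ |y| → |y| ≤ 8 / 5 → P y = 1)
    (hdisp : ∀ t : ℝ, t ≠ 0 → ∀ δ : ℝ, 0 < δ → ∀ k ∈ ZJ J, ∀ x : E n,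
      ‖dyadicIntegral n g P 0 δ t k x‖ ≤ C * (2 : ℝ) ^ (γ * (k : ℝ)) * (δ ^ β / |t| ^ σ)) :
    ∃ p A B L, BlockFamily n φ₀ g J σ β γ p A B L := by
  have hn3 : n ≤ 3 := by omega
  have hPs := isSym_of_support hP hPsupp
  have hcomp : HasCompactSupport P := by
    refine HasCompactSupport.intro (isCompact_Icc (a := (-2 : ℝ)) (b := 2)) fun y hy => ?_
    by_contra hne
    exact hy (abs_le.1 (hPsupp hne).2)
  obtain ⟨B, hB⟩ := hcomp.exists_bound_of_continuous hP.continuous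
  have hB0 : 0 ≤ B := (norm_nonneg _).trans (hB 0)
  set L := (eLpNorm (kernel n P) 1 volume).toReal with hL
  have hLt : eLpNorm (kernel n P) 1 volume ≠ ⊤ := (hPs.memLp_kernel hn3 le_rfl).2.ne
  -- All cut-offs are dilates of `P`, so `B` and `L` serve every block. The factor 2 in 2C comes
  -- from the half line, and (2π)^{-n} ≤ 1 is discarded; adding 1 only ensures positivity.
  refine ⟨fun δ k y => P (δ / 2 ^ k * y), 2 * C, B + 1, L + 1,
    ⟨by positivity, by positivity, by positivity, fun δ hδ k hk => ?_, fun δ hδ k y hy hQ => ?_⟩⟩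
  · have hl : 0 < δ / (2 : ℝ) ^ k := by positivity
    refine ⟨hn3, hg, hδ, ⟨hPs.dilate hl, by positivity, by positivity, fun y _ => ?_, ?_⟩,
      by positivity, fun τ hτ x => ?_⟩
    · linarith [hB (δ / 2 ^ k * y)]
    · rw [eLpNorm_one_kernel_dilate n P hl]
      exact (ENNReal.ofReal_toReal hLt).ge.trans (ENNReal.ofReal_le_ofReal (by linarith))
    · have hs : IsSym fun y => phase g δ τ y * P (δ / 2 ^ k * y) := (hPs.dilate hl).phase_mul hg hδ τ
      have h1 := norm_integral_exp_mul_le (n := n) hs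
        (K := C * (2 : ℝ) ^ (γ * (k : ℝ)) * (δ ^ β / |τ| ^ σ)) (fun x => ?_) x
      · rw [kernel, norm_mul, norm_inv, Complex.norm_real, Real.norm_of_nonneg (by positivity)]
        have h2 : ((2 * Real.pi) ^ n)⁻¹ ≤ 1 := inv_le_one_of_one_le₀ (one_le_pow₀ (by
          nlinarith [Real.pi_gt_three]))
        calc _ ≤ 1 * (2 * (C * (2 : ℝ) ^ (γ * (k : ℝ)) * (δ ^ β / |τ| ^ σ))) :=
              mul_le_mul h2 h1 (norm_nonneg _) zero_le_one
          _ = _ := by rw [Real.rpow_neg (abs_nonneg τ)]; ring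
      · refine le_trans (le_of_eq ?_) (hdisp τ hτ δ hδ k hk x)
        rw [dyadicIntegral]
        congr 1
        refine integral_congr_ae (Filter.Eventually.of_forall fun ξ => ?_)
        simp only [Real.rpow_zero, Complex.ofReal_one, mul_one]
        rw [div_mul_eq_mul_div, mul_assoc]
  · obtain ⟨h1, h2⟩ := hφ₀.Q_ne_zero hQ
    refine hPone _ ?_ ?_ <;>
    · rw [div_mul_eq_mul_div, abs_div, abs_of_pos (by positivity : (0 : ℝ) < 2 ^ k)]
      assumption

end Dispersive

/-! ### The estimates on dyadic blocks -/

namespace Dispersive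

variable {n : ℕ} {g φ₀ : ℝ → ℝ} {J : Set ℝ} {σ β γ A B L : ℝ} {p : ℝ → ℤ → ℝ → ℂ}

theorem dispersiveConst_rpow (hA : 0 < A) {δ : ℝ} (hδ : 0 < δ) (k : ℤ) (a : ℝ) :
    (A * (2 : ℝ) ^ (γ * (k : ℝ)) * δ ^ β) ^ a =
      A ^ a * ((2 : ℝ) ^ (γ * a * (k : ℝ)) * δ ^ (β * a)) := by
  rw [Real.mul_rpow (by positivity) (by positivity), Real.mul_rpow hA.le (by positivity),
    ← Real.rpow_mul zero_le_two, ← Real.rpow_mul hδ.le, mul_assoc]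
  congr 3; ring

theorem ofReal_const_mul_le {c A a C x : ℝ} (hx : 0 ≤ x) (h : c * A ^ a ≤ C) {y z : ℝ≥0∞}
    (hy : y ≤ ENNReal.ofReal (c * (A ^ a * x)) * z) : y ≤ ENNReal.ofReal (C * x) * z := by
  refine hy.trans (mul_le_mul_left (ENNReal.ofReal_le_ofReal ?_) _)
  rw [← mul_assoc]
  exact mul_le_mul_of_nonneg_right h hx

theorem BlockFamily.block_estimates (hfam : BlockFamily n φ₀ g J σ β γ p A B L)
    (hφ₀ : IsBump φ₀) (hσ : σ ∈ Ioc (0 : ℝ) 1) (q r q₂ r₂ : ℝ≥0∞) (hqr : SharpAdmissible σ q r)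
    (hqr₂ : SharpAdmissible σ q₂ r₂) :
      ∃ C₁ : ℝ, 0 < C₁ ∧ ∀ δ : ℝ, 0 < δ → ∀ k ∈ ZJ J,
        (∀ f : E n → ℂ, MemLp f 2 volume →
          mixedNorm q r (fun t => mul n (blockSym φ₀ g δ k t) f) ≤
            ENNReal.ofReal (C₁ * (2 : ℝ) ^ (γ * gap r * (k : ℝ)) * δ ^ (β * gap r)) *
              eLpNorm (mul n (blockProj φ₀ δ k) f) 2 volume) ∧
        ∀ F : ℝ → E n → ℂ, IsSource F →
          ((mixedNorm q.conjExponent r.conjExponent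
                (fun s => mul n (blockProj φ₀ δ k) (F s)) < ⊤ →
              ∀ x, Integrable (fun s => mul n (blockSym φ₀ g δ k (-s)) (F s) x) volume) ∧
            eLpNorm (fun x => ∫ s, mul n (blockSym φ₀ g δ k (-s)) (F s) x) 2 volume ≤
              ENNReal.ofReal (C₁ * (2 : ℝ) ^ (γ * gap r * (k : ℝ)) * δ ^ (β * gap r)) *
                mixedNorm q.conjExponent r.conjExponent
                  (fun s => mul n (blockProj φ₀ δ k) (F s))) ∧
          (mixedNorm q₂.conjExponent r₂.conjExponent
                (fun s => mul n (blockProj φ₀ δ k) (F s)) < ⊤ →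
              ∀ t x, Integrable (fun s => mul n (blockSym φ₀ g δ k (t - s)) (F s) x) volume) ∧
          mixedNorm q r (fun t x => ∫ s, mul n (blockSym φ₀ g δ k (t - s)) (F s) x) ≤
            ENNReal.ofReal (C₁ * (2 : ℝ) ^ (γ * (gap r + gap r₂) * (k : ℝ)) *
                δ ^ (β * (gap r + gap r₂))) *
              mixedNorm q₂.conjExponent r₂.conjExponent
                (fun s => mul n (blockProj φ₀ δ k) (F s)) ∧
          mixedNorm q r (fun t x => ∫ s in Iio t, mul n (blockSym φ₀ g δ k (t - s)) (F s) x) ≤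
            ENNReal.ofReal (C₁ * (2 : ℝ) ^ (γ * (gap r + gap r₂) * (k : ℝ)) *
                δ ^ (β * (gap r + gap r₂))) *
              mixedNorm q₂.conjExponent r₂.conjExponent
                (fun s => mul n (blockProj φ₀ δ k) (F s)) := by
  have hA := hfam.posA
  obtain ⟨c₁, hc₁, h₁⟩ := exists_homogeneous_localized_le n hσ hqr hfam.posB hfam.posL
  obtain ⟨c₂, hc₂, h₂⟩ := exists_dual_localized_le n hσ hqr hfam.posB hfam.posL
  obtain ⟨c₃, hc₃, h₃⟩ := exists_inhomogeneous_localized_le n hσ hqr hqr₂ hfam.posB hfam.posL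
  obtain ⟨c₄, hc₄, h₄⟩ := exists_retarded_localized_le n hσ hqr hqr₂ hfam.posB hfam.posL
  set a₁ := c₁ * A ^ gap r with ha₁
  set a₂ := c₂ * A ^ gap r with ha₂
  set a₃ := c₃ * A ^ (gap r + gap r₂) with ha₃
  set a₄ := c₄ * A ^ (gap r + gap r₂) with ha₄
  have p₁ : 0 < a₁ := by positivity
  have p₂ : 0 < a₂ := by positivity
  have p₃ : 0 < a₃ := by positivity
  have p₄ : 0 < a₄ := by positivity
  refine ⟨a₁ + a₂ + a₃ + a₄, by positivity, fun δ hδ k hk => ?_⟩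
  have hb := hfam.block δ hδ k hk
  have hs := hφ₀.isSym_blockProj k hδ
  have hm : ∀ y, 0 ≤ y → p δ k y * blockProj φ₀ δ k y = blockProj φ₀ δ k y := fun y hy => by
    by_cases h0 : Q φ₀ k (δ * y) = 0
    · simp [blockProj, h0]
    · rw [hfam.one δ hδ k y hy h0, one_mul]
  have hx : ∀ a, 0 ≤ (2 : ℝ) ^ (γ * a * (k : ℝ)) * δ ^ (β * a) := fun a => by positivity
  simp only [mul_assoc (a₁ + a₂ + a₃ + a₄)]
  refine ⟨fun f hf => ?_, fun F hF => ⟨⟨fun hfin x => ?_, ?_⟩, fun hfin t x => ?_, ?_, ?_⟩⟩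
  · have := h₁ hb _ hs hm f hf
    rw [dispersiveConst_rpow hA hδ] at this
    exact ofReal_const_mul_le (hx _) (by linarith) this
  · exact hb.integrable_localized hσ hqr hs hm hF hfin.ne isTimeIso_neg x
  · have := h₂ hb _ hs hm F hF
    rw [dispersiveConst_rpow hA hδ] at this
    exact ofReal_const_mul_le (hx _) (by linarith) this
  · exact hb.integrable_localized hσ hqr₂ hs hm hF hfin.ne (isTimeIso_sub t) x
  · have := h₃ hb _ hs hm F hF
    rw [dispersiveConst_rpow hA hδ] at this
    exact ofReal_const_mul_le (hx _) (by linarith) this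
  · have := h₄ hb _ hs hm F hF
    rw [dispersiveConst_rpow hA hδ] at this
    exact ofReal_const_mul_le (hx _) (by linarith) this

end Dispersive

/-! ### Translation bounds for smooth kernels -/

namespace Dispersive
open FourierTransform SchwartzMap

variable {n : ℕ}

theorem IsSym.exists_schwartz_kernel {m : ℝ → ℂ} (h : IsSym m) (hs : ContDiffOn ℝ ∞ m (Ioi 0)) :
    ∃ f : 𝓢(E n, ℂ), kernel n m = f := by
  refine ⟨𝓕 (h.hasCompactSupport_rad.toSchwartzMap (h.contDiff_rad_of hs)), ?_⟩
  rw [kernel_eq_fourier, SchwartzMap.fourier_coe]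
  rfl

/-- The fundamental theorem of calculus along the segment from x to x - h, then Tonelli's theorem
and translation invariance. -/
theorem lintegral_enorm_sub_schwartz_le (f : 𝓢(E n, ℂ)) (h : E n) :
    ∫⁻ x, ‖f (x - h) - f x‖ₑ ≤ (∫⁻ x, ‖fderiv ℝ f x‖ₑ) * ‖h‖ₑ := by
  have hd : ∀ x, DifferentiableAt ℝ f x := fun x => f.differentiableAt
  have hc : Continuous fun x => fderiv ℝ f x := (f.smooth 1).continuous_fderiv one_ne_zero
  have key : ∀ x, ‖f (x - h) - f x‖ₑ ≤ ∫⁻ s in Ioc (0 : ℝ) 1, ‖fderiv ℝ f (x - s • h)‖ₑ * ‖h‖ₑ := by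
    intro x
    have hder : ∀ s ∈ uIcc (0 : ℝ) 1, HasDerivAt (fun s : ℝ => f (x - s • h))
        (fderiv ℝ f (x - s • h) (-h)) s := fun s _ => by
      have h1 : HasDerivAt (fun s : ℝ => x - s • h) (-h) s := by
        simpa using ((hasDerivAt_id s).smul_const h).const_sub x
      exact (hd _).hasFDerivAt.comp_hasDerivAt s h1
    have hci : Continuous fun s : ℝ => fderiv ℝ f (x - s • h) (-h) :=
      (hc.comp (by fun_prop)).clm_apply continuous_const
    have hi := intervalIntegral.integral_eq_sub_of_hasDerivAt hder (hci.intervalIntegrable 0 1)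
    simp only [one_smul, zero_smul, sub_zero] at hi
    rw [← hi, intervalIntegral.integral_of_le zero_le_one]
    refine (enorm_integral_le_lintegral_enorm _).trans (lintegral_mono fun s => ?_)
    refine (ContinuousLinearMap.le_opENorm _ _).trans ?_
    rw [enorm_neg]
  have hm : Measurable fun z : E n × ℝ => ‖fderiv ℝ f (z.1 - z.2 • h)‖ₑ * ‖h‖ₑ :=
    ((hc.comp (by fun_prop : Continuous fun z : E n × ℝ => z.1 - z.2 • h)).measurable.enorm).mul_const _
  calc ∫⁻ x, ‖f (x - h) - f x‖ₑ
      ≤ ∫⁻ x, ∫⁻ s in Ioc (0 : ℝ) 1, ‖fderiv ℝ f (x - s • h)‖ₑ * ‖h‖ₑ := lintegral_mono key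
    _ = ∫⁻ s in Ioc (0 : ℝ) 1, ∫⁻ x, ‖fderiv ℝ f (x - s • h)‖ₑ * ‖h‖ₑ :=
        lintegral_lintegral_swap hm.aemeasurable
    _ = ∫⁻ s in Ioc (0 : ℝ) 1, (∫⁻ x, ‖fderiv ℝ f x‖ₑ) * ‖h‖ₑ := by
        refine lintegral_congr fun s => ?_
        rw [lintegral_mul_const' _ _ enorm_ne_top,
          lintegral_sub_right_eq_self (fun x => ‖fderiv ℝ f x‖ₑ) (s • h)]
    _ = _ := by simp

theorem lintegral_enorm_fderiv_schwartz (f : 𝓢(E n, ℂ)) : ∫⁻ x, ‖fderiv ℝ f x‖ₑ ≠ ⊤ := by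
  have h := (f.integrable_pow_mul_iteratedFDeriv volume 0 1).2
  rw [hasFiniteIntegral_iff_enorm] at h
  refine ne_top_of_le_ne_top h.ne (lintegral_mono fun x => ?_)
  simp only [pow_zero, one_mul]
  rw [← ofReal_norm, ← ofReal_norm, norm_norm, norm_iteratedFDeriv_one]

/-- Frequency localisation gives regularity: translation bounds for the kernel. -/
theorem IsSym.exists_kernel_translation_le {m : ℝ → ℂ} (h : IsSym m)
    (hs : ContDiffOn ℝ ∞ m (Ioi 0)) :
    ∃ C : ℝ, 0 < C ∧ (∀ z : E n, ∫⁻ x, ‖kernel n m (x - z) - kernel n m x‖ₑ ≤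
        ENNReal.ofReal C * ‖z‖ₑ) ∧
      ∫⁻ x : E n, ‖kernel n m x‖ₑ * ‖x‖ₑ ≤ ENNReal.ofReal C := by
  obtain ⟨f, hf⟩ := h.exists_schwartz_kernel (n := n) hs
  rw [hf]
  have h1 := (f.integrable_pow_mul volume 1).2
  rw [hasFiniteIntegral_iff_enorm] at h1
  have h2 : ∫⁻ x : E n, ‖f x‖ₑ * ‖x‖ₑ ≠ ⊤ := by
    refine ne_top_of_le_ne_top h1.ne (lintegral_mono fun x => ?_)
    rw [pow_one, enorm_mul, enorm_norm, enorm_norm, mul_comm]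
  have h3 := lintegral_enorm_fderiv_schwartz f
  set A := ∫⁻ x, ‖fderiv ℝ f x‖ₑ
  set B := ∫⁻ x : E n, ‖f x‖ₑ * ‖x‖ₑ
  refine ⟨A.toReal + B.toReal + 1, by positivity, fun z => ?_, ?_⟩
  · refine (lintegral_enorm_sub_schwartz_le f z).trans (mul_le_mul_left ?_ _)
    refine (ENNReal.ofReal_toReal h3).ge.trans (ENNReal.ofReal_le_ofReal ?_)
    linarith [ENNReal.toReal_nonneg (a := B)]
  · refine (ENNReal.ofReal_toReal h2).ge.trans (ENNReal.ofReal_le_ofReal ?_)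
    linarith [ENNReal.toReal_nonneg (a := A)]

/-- The kernel of m(l|D|) lives at the spatial scale l: a translation by z costs |z|/l, and the
first moment is of size l. The product of a translation constant at a low frequency and a first
moment at a high one is what makes different frequencies almost orthogonal. -/
theorem exists_kernel_dilate_translation_le {m : ℝ → ℂ} (h : IsSym m)
    (hs : ContDiffOn ℝ ∞ m (Ioi 0)) :
    ∃ C : ℝ, 0 < C ∧ ∀ l : ℝ, 0 < l → (∀ z : E n,
      ∫⁻ x, ‖kernel n (fun y => m (l * y)) (x - z) - kernel n (fun y => m (l * y)) x‖ₑ ≤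
        ENNReal.ofReal (C / l) * ‖z‖ₑ) ∧
      ∫⁻ x : E n, ‖kernel n (fun y => m (l * y)) x‖ₑ * ‖x‖ₑ ≤ ENNReal.ofReal (C * l) := by
  obtain ⟨C, hC, h1, h2⟩ := h.exists_kernel_translation_le (n := n) hs
  refine ⟨C, hC, fun l hl => ?_⟩
  have hc : ‖((l ^ n : ℝ) : ℂ)⁻¹‖ₑ * ENNReal.ofReal (l ^ n) = 1 := by
    rw [← ofReal_norm, ← ENNReal.ofReal_mul (norm_nonneg _), norm_inv, Complex.norm_real,
      Real.norm_of_nonneg (by positivity), inv_mul_cancel₀ (by positivity), ENNReal.ofReal_one]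
  refine ⟨fun z => ?_, ?_⟩
  · have e : ∀ x, ‖kernel n (fun y => m (l * y)) (x - z) - kernel n (fun y => m (l * y)) x‖ₑ =
        ‖((l ^ n : ℝ) : ℂ)⁻¹‖ₑ * (fun x => ‖kernel n m (x - l⁻¹ • z) - kernel n m x‖ₑ) (l⁻¹ • x) :=
      fun x => by
        rw [kernel_dilate n m hl, kernel_dilate n m hl, ← mul_sub, enorm_mul, smul_sub]
    rw [lintegral_congr e]
    rw [lintegral_const_mul' _ _ enorm_ne_top, lintegral_comp_inv_smul hl
      (fun x => ‖kernel n m (x - l⁻¹ • z) - kernel n m x‖ₑ), ← mul_assoc, hc, one_mul]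
    refine (h1 (l⁻¹ • z)).trans (le_of_eq ?_)
    rw [enorm_smul, ← mul_assoc, ← ofReal_norm, Real.norm_of_nonneg (by positivity),
      ← ENNReal.ofReal_mul hC.le, div_eq_mul_inv]
  · have e : ∀ x : E n, ‖kernel n (fun y => m (l * y)) x‖ₑ * ‖x‖ₑ =
        ‖((l ^ n : ℝ) : ℂ)⁻¹‖ₑ * (fun x => ENNReal.ofReal l * (‖kernel n m x‖ₑ * ‖x‖ₑ)) (l⁻¹ • x) :=
      fun x => by
        have : ENNReal.ofReal l * ‖l⁻¹‖ₑ = 1 := by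
          rw [← ofReal_norm, ← ENNReal.ofReal_mul hl.le, Real.norm_of_nonneg (by positivity),
            mul_inv_cancel₀ hl.ne', ENNReal.ofReal_one]
        rw [kernel_dilate n m hl, enorm_mul]
        simp only [enorm_smul]
        calc _ = 1 * (‖((l ^ n : ℝ) : ℂ)⁻¹‖ₑ * (‖kernel n m (l⁻¹ • x)‖ₑ * ‖x‖ₑ)) := by ring
          _ = _ := by rw [← this]; ring
    rw [lintegral_congr e]
    rw [lintegral_const_mul' _ _ enorm_ne_top, lintegral_comp_inv_smul hl
      (fun x => ENNReal.ofReal l * (‖kernel n m x‖ₑ * ‖x‖ₑ)), ← mul_assoc, hc, one_mul,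
      lintegral_const_mul' _ _ ENNReal.ofReal_ne_top, mul_comm C, ENNReal.ofReal_mul hl.le]
    exact mul_le_mul_right h2 _

end Dispersive

/-! ### Adding one frequency to a sum in L^r -/

namespace Dispersive

/-- The tangent line inequality for the convex function `|z|^r`. -/
theorem norm_rpow_le_add_re {r : ℝ} (hr : 1 ≤ r) (v w : ℂ) :
    ‖v‖ ^ r ≤ ‖v - w‖ ^ r + r * (‖v‖ ^ (r - 2) * (starRingEnd ℂ v * w).re) := by
  rcases eq_or_ne v 0 with rfl | hv
  · simp only [norm_zero, map_zero, zero_mul, Complex.zero_re, mul_zero, add_zero]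
    rw [Real.zero_rpow (by linarith)]
    positivity
  have hA : 0 < ‖v‖ := norm_pos_iff.2 hv
  have hB : 0 ≤ ‖v - w‖ := norm_nonneg _
  have h1 : ‖v‖ ^ 2 - ‖v‖ * ‖v - w‖ ≤ (starRingEnd ℂ v * w).re := by
    have e : starRingEnd ℂ v * w = starRingEnd ℂ v * v - starRingEnd ℂ v * (v - w) := by ring
    have h2 : (starRingEnd ℂ v * (v - w)).re ≤ ‖v‖ * ‖v - w‖ := by
      refine (Complex.re_le_norm _).trans (le_of_eq ?_)
      rw [norm_mul, RCLike.norm_conj]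
    rw [e, Complex.sub_re, Complex.conj_mul', ← Complex.ofReal_pow, Complex.ofReal_re]
    linarith
  -- Bernoulli's inequality for the ratio ‖v - w‖/‖v‖ replaces differentiation of the power.
  have h3 := one_add_mul_self_le_rpow_one_add (s := ‖v - w‖ / ‖v‖ - 1) (by
    have : 0 ≤ ‖v - w‖ / ‖v‖ := by positivity
    linarith) hr
  rw [add_sub_cancel, Real.div_rpow hB hA.le, le_div_iff₀ (by positivity)] at h3
  have h4 : ‖v‖ ^ r = ‖v‖ ^ (r - 2) * ‖v‖ ^ 2 := by
    rw [← Real.rpow_natCast, ← Real.rpow_add hA]; congr 1; push_cast; ring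
  have h5 : r * (‖v‖ ^ (r - 2) * (‖v‖ ^ 2 - ‖v‖ * ‖v - w‖)) ≤
      r * (‖v‖ ^ (r - 2) * (starRingEnd ℂ v * w).re) := by gcongr
  have h6 : (1 + r * (‖v - w‖ / ‖v‖ - 1)) * ‖v‖ ^ r =
      ‖v‖ ^ r - r * (‖v‖ ^ (r - 2) * (‖v‖ ^ 2 - ‖v‖ * ‖v - w‖)) := by
    rw [h4]; field_simp; ring
  linarith

/-- For s < 1 the power is not Lipschitz near zero; the weight b compensates for that. Again this is
Bernoulli's inequality, with exponent s + 1. -/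
theorem rpow_succ_sub_le {s a b : ℝ} (hs : 0 ≤ s) (hb : 0 ≤ b) (hab : b ≤ a) :
    (a ^ s - b ^ s) * b ≤ (s + 1) * a ^ s * (a - b) := by
  rcases hb.eq_or_lt with rfl | hb0
  · simp; positivity
  have ha : 0 < a := hb0.trans_le hab
  have h3 := one_add_mul_self_le_rpow_one_add (s := b / a - 1) (by
    have : 0 ≤ b / a := by positivity
    linarith) (show 1 ≤ s + 1 by linarith)
  rw [add_sub_cancel, Real.div_rpow hb ha.le, le_div_iff₀ (by positivity),
    Real.rpow_add ha, Real.rpow_add hb0, Real.rpow_one, Real.rpow_one] at h3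
  have e : (1 + (s + 1) * (b / a - 1)) * (a ^ s * a) = a ^ s * a + (s + 1) * a ^ s * (b - a) := by
    field_simp
  have h4 : a ^ s * b ≤ a ^ s * a := by gcongr
  nlinarith

/-- Serves with s = r - 2, to transfer translation bounds from S to |S|^{r-2} S. -/
theorem norm_rpow_mul_sub_le {s : ℝ} (hs : 0 ≤ s) (z w : ℂ) :
    ‖((‖z‖ ^ s : ℝ) : ℂ) * z - ((‖w‖ ^ s : ℝ) : ℂ) * w‖ ≤
      (s + 2) * ((‖z‖ ^ s + ‖w‖ ^ s) * ‖z - w‖) := by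
  wlog h : ‖w‖ ≤ ‖z‖ generalizing z w
  · have := this w z (le_of_not_ge h)
    rwa [norm_sub_rev, norm_sub_rev w z, add_comm (‖w‖ ^ s)] at this
  have e : ((‖z‖ ^ s : ℝ) : ℂ) * z - ((‖w‖ ^ s : ℝ) : ℂ) * w =
      ((‖z‖ ^ s : ℝ) : ℂ) * (z - w) + ((‖z‖ ^ s - ‖w‖ ^ s : ℝ) : ℂ) * w := by push_cast; ring
  have h0 : 0 ≤ ‖z‖ ^ s - ‖w‖ ^ s := sub_nonneg.2 (Real.rpow_le_rpow (norm_nonneg _) h hs)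
  have h1 := rpow_succ_sub_le hs (norm_nonneg w) h
  have h2 : ‖z‖ - ‖w‖ ≤ ‖z - w‖ := norm_sub_norm_le z w
  have hz : 0 ≤ ‖z‖ ^ s := by positivity
  have hw : 0 ≤ ‖w‖ ^ s := by positivity
  rw [e]
  refine (norm_add_le _ _).trans ?_
  rw [norm_mul, norm_mul, Complex.norm_real, Complex.norm_real, Real.norm_of_nonneg hz,
    Real.norm_of_nonneg h0]
  have h3 : (s + 1) * ‖z‖ ^ s * (‖z‖ - ‖w‖) ≤ (s + 1) * ‖z‖ ^ s * ‖z - w‖ := by gcongr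
  nlinarith [mul_nonneg (mul_nonneg (by linarith : 0 ≤ s + 2) hw) (norm_nonneg (z - w))]

variable {n : ℕ}

theorem eLpNorm_rpow_toReal {α F : Type*} [MeasurableSpace α] {μ : Measure α} [ENorm F]
    {r : ℝ≥0∞} (hr0 : r ≠ 0) (hrt : r ≠ ⊤) (f : α → F) :
    eLpNorm f r μ ^ r.toReal = ∫⁻ x, ‖f x‖ₑ ^ r.toReal ∂μ := by
  have := ENNReal.toReal_pos hr0 hrt
  rw [eLpNorm_eq_lintegral_rpow_enorm_toReal hr0 hrt, ← ENNReal.rpow_mul,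
    one_div_mul_cancel this.ne', ENNReal.rpow_one]

theorem lintegral_three_holder {α : Type*} [MeasurableSpace α] {μ : Measure α} {r : ℝ≥0∞}
    (hr : 2 ≤ r) (hrt : r ≠ ⊤) {f g h : α → ℂ} (hf : AEStronglyMeasurable f μ)
    (hg : AEStronglyMeasurable g μ) (hh : AEStronglyMeasurable h μ) :
    ∫⁻ x, ‖f x‖ₑ ^ (r.toReal - 2) * (‖g x‖ₑ * ‖h x‖ₑ) ∂μ ≤
      eLpNorm f r μ ^ (r.toReal - 2) * (eLpNorm g r μ * eLpNorm h r μ) := by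
  have hr0 : r ≠ 0 := (lt_of_lt_of_le (by norm_num) hr).ne'
  have hR : 2 ≤ r.toReal := by
    rw [← ENNReal.toReal_ofNat 2]; exact (ENNReal.toReal_le_toReal (by simp) hrt).2 hr
  have hR0 : 0 < r.toReal := by linarith
  set R := r.toReal with hRd
  have key := ENNReal.lintegral_prod_norm_pow_le (μ := μ) (Finset.univ : Finset (Fin 3))
    (f := ![fun x => ‖f x‖ₑ ^ R, fun x => ‖g x‖ₑ ^ R, fun x => ‖h x‖ₑ ^ R]) (by
      intro i _; fin_cases i
      · exact hf.enorm.pow_const _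
      · exact hg.enorm.pow_const _
      · exact hh.enorm.pow_const _) (p := ![(R - 2) / R, 1 / R, 1 / R]) (by
      simp [Fin.sum_univ_three]; field_simp; ring) (by
      intro i _; fin_cases i
      · exact div_nonneg (by linarith) hR0.le
      · exact (one_div_pos.2 hR0).le
      · exact (one_div_pos.2 hR0).le)
  simp only [Fin.prod_univ_three, Matrix.cons_val_zero, Matrix.cons_val_one, Matrix.cons_val,
    ← ENNReal.rpow_mul] at key
  simp only [mul_div_cancel₀ _ hR0.ne', ENNReal.rpow_one] at key
  rw [hRd, ← eLpNorm_rpow_toReal hr0 hrt, ← eLpNorm_rpow_toReal hr0 hrt,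
    ← eLpNorm_rpow_toReal hr0 hrt, ← hRd] at key
  simp only [← ENNReal.rpow_mul, mul_div_cancel₀ _ hR0.ne', ENNReal.rpow_one] at key
  simpa only [mul_assoc] using key

/-- Adding a frequency-localised function to a smoother one. -/
theorem eLpNorm_rpow_le_add (hn : n ≤ 3) {r : ℝ≥0∞} (hr : 2 ≤ r) (hrt : r ≠ ⊤) {ψ : ℝ → ℂ}
    (hψ : IsSym ψ) {S w : E n → ℂ} (hSm : StronglyMeasurable S) (hwm : StronglyMeasurable w)
    (hS : MemLp S r volume) (hw : MemLp w r volume) (hloc : mul n ψ w =ᵐ[volume] w) {Λ M : ℝ≥0∞}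
    (hΛ : ∀ z, eLpNorm (fun x => S (x - z) - S x) r volume ≤ Λ * ‖z‖ₑ)
    (hM : ∫⁻ x, ‖kernel n ψ x‖ₑ * ‖x‖ₑ ≤ M) :
    eLpNorm S r volume ^ r.toReal ≤ eLpNorm (S - w) r volume ^ r.toReal +
      ENNReal.ofReal (2 * r.toReal ^ 2) * eLpNorm S r volume ^ (r.toReal - 2) *
        (eLpNorm w r volume * (Λ * M)) := by
  have hr0 : r ≠ 0 := (lt_of_lt_of_le (by norm_num) hr).ne'
  have hr1 : 1 < r := lt_of_lt_of_le (by norm_num) hr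
  have hR : 2 ≤ r.toReal := by
    rw [← ENNReal.toReal_ofNat 2]; exact (ENNReal.toReal_le_toReal (by simp) hrt).2 hr
  obtain ⟨hcr, hcrt⟩ := toReal_conjExponent hr1 hrt
  set R := r.toReal with hRd
  have hcc : ENNReal.HolderConjugate r r.conjExponent := .conjExponent hr1.le
  have hcc' := conjExponent_conjExponent hr1.le
  -- The conjugate `H` of |S|^{r-2} S is the element of L^{r'} dual to `S`, and the linear term of
  -- the tangent line inequality is its pairing with `w`.
  set G : E n → ℂ := fun x => ((‖S x‖ ^ (R - 2) : ℝ) : ℂ) * S x with hG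
  set H : E n → ℂ := fun x => starRingEnd ℂ (G x) with hH
  have hSM : Measurable S := hSm.measurable
  have hGM : Measurable G := by fun_prop
  have hHM : Measurable H := Complex.continuous_conj.measurable.comp hGM
  have hHn : ∀ x, ‖H x‖ = ‖S x‖ ^ (R - 1) := fun x => by
    rw [hH, RCLike.norm_conj, hG, norm_mul, Complex.norm_real, Real.norm_of_nonneg (by positivity)]
    rcases eq_or_ne (S x) 0 with h0 | h0
    · rw [h0, norm_zero, mul_zero, Real.zero_rpow (by linarith)]
    · have := norm_pos_iff.2 h0
      rw [← Real.rpow_add_one this.ne']; congr 1; ring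
  have hHLp : MemLp H r.conjExponent volume := by
    refine ⟨hHM.aestronglyMeasurable, ?_⟩
    have h1 := hS.2
    rw [eLpNorm_lt_top_iff_lintegral_rpow_enorm_lt_top hr0 hrt] at h1
    rw [eLpNorm_lt_top_iff_lintegral_rpow_enorm_lt_top
      (zero_lt_one.trans_le (one_le_conjExponent r)).ne' hcrt]
    refine lt_of_le_of_lt (le_of_eq (lintegral_congr fun x => ?_)) h1
    rw [← ofReal_norm, ← ofReal_norm, hHn, ENNReal.ofReal_rpow_of_nonneg (by positivity)
      (by rw [hcr]; exact div_nonneg (by linarith) (by linarith)),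
      ENNReal.ofReal_rpow_of_nonneg (by positivity) (by linarith), ← Real.rpow_mul (norm_nonneg _),
      hcr, mul_div_cancel₀ _ (by linarith)]
  have hHw : Integrable (fun x => H x * w x) volume := by
    have := hw.mul (r := 1) hHLp (hpqr := hcc.symm)
    exact memLp_one_iff_integrable.1 this
  -- the tangent line inequality, integrated
  have h1 : ∫⁻ x, ‖S x‖ₑ ^ R ≤
      (∫⁻ x, ‖(S - w) x‖ₑ ^ R) + ENNReal.ofReal R * ‖∫ x, H x * w x‖ₑ := by
    have hi1 := hS.integrable_norm_rpow hr0 hrt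
    have hi2 := (hS.sub hw).integrable_norm_rpow hr0 hrt
    have hre : ∫ x, (H x * w x).re = (∫ x, H x * w x).re := integral_re hHw
    have hreal : ∫ x, ‖S x‖ ^ R ≤ (∫ x, ‖(S - w) x‖ ^ R) + R * ‖∫ x, H x * w x‖ := by
      calc ∫ x, ‖S x‖ ^ R ≤ ∫ x, (‖(S - w) x‖ ^ R + R * (H x * w x).re) := by
            refine integral_mono hi1 (hi2.add (hHw.re.const_mul R)) fun x => ?_
            refine (norm_rpow_le_add_re (by linarith) (S x) (w x)).trans (le_of_eq ?_)
            simp only [Pi.sub_apply, hH, hG, map_mul, Complex.conj_ofReal]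
            rw [mul_assoc (((‖S x‖ ^ (R - 2) : ℝ)) : ℂ), Complex.re_ofReal_mul]
        _ = (∫ x, ‖(S - w) x‖ ^ R) + R * (∫ x, H x * w x).re := by
            rw [← hre, ← integral_const_mul]
            exact integral_add hi2 (hHw.re.const_mul R)
        _ ≤ _ := by gcongr; exact Complex.re_le_norm _
    have e : ∀ f : E n → ℂ, MemLp f r volume →
        ∫⁻ x, ‖f x‖ₑ ^ R = ENNReal.ofReal (∫ x, ‖f x‖ ^ R) := fun f hf => by
      rw [ofReal_integral_eq_lintegral_ofReal (hf.integrable_norm_rpow hr0 hrt)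
        (Filter.Eventually.of_forall fun x => by positivity)]
      refine lintegral_congr fun x => ?_
      rw [← ofReal_norm, ENNReal.ofReal_rpow_of_nonneg (norm_nonneg _) (by linarith)]
    rw [e S hS, e _ (hS.sub hw), ← ofReal_norm, ← ENNReal.ofReal_mul (by linarith),
      ← ENNReal.ofReal_add (integral_nonneg fun x => by positivity) (by positivity)]
    exact ENNReal.ofReal_le_ofReal hreal
  -- cancellation
  have hker0 : ∫ z, kernel n ψ z = 0 := by
    have h2 := congrFun (hψ.fourier_kernel hn (n := n)) 0
    rw [Real.fourier_eq] at h2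
    simpa [rad, hψ.apply_zero] using h2
  -- The symbol vanishes at the origin, so the kernel has integral zero and the convolution sees
  -- only differences of `H`.
  have hmulH : ∀ x, mul n ψ H x = ∫ z, kernel n ψ z * (H (x - z) - H x) := fun x => by
    have hi := hψ.integrable_mul hn (one_le_conjExponent r) hHLp x
    have hi2 : Integrable (fun z => kernel n ψ z * H x) := (hψ.integrable_kernel hn).mul_const _
    simp only [mul_sub]
    rw [integral_sub hi hi2, integral_mul_const, hker0, zero_mul, sub_zero, mul_apply]
  -- `w` reproduces itself under ψ(|D|), so this multiplier may be moved onto `H`.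
  have h2 : ∫ x, H x * w x = ∫ x, mul n ψ H x * w x := by
    rw [integral_mul_mul_comm hn hψ (one_le_conjExponent r) hHLp (by rwa [hcc'])]
    exact integral_congr_ae (hloc.mono fun x hx => by simp only [hx])
  -- Differences of `H` are at most R(|S(x-z)|^{R-2} + |S(x)|^{R-2}) |S(x-z) - S(x)|; Hölder with
  -- exponents R/(R-2), R, R then brings in the translation bound of `S`.
  have hdiff : ∀ z, ∫⁻ x, ‖H (x - z) - H x‖ₑ * ‖w x‖ₑ ≤
      ENNReal.ofReal (2 * R) * eLpNorm S r volume ^ (R - 2) * (Λ * ‖z‖ₑ * eLpNorm w r volume) := by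
    intro z
    have hSz : StronglyMeasurable fun x => S (x - z) := hSm.comp_measurable (by fun_prop)
    have hSzn : eLpNorm (fun x => S (x - z)) r volume = eLpNorm S r volume :=
      eLpNorm_comp_measurePreserving hS.1 (measurePreserving_sub_right volume z)
    have hD : AEStronglyMeasurable (fun x => S (x - z) - S x) volume :=
      (hSz.sub hSm).aestronglyMeasurable
    have hp : ∀ x, ‖H (x - z) - H x‖ₑ ≤ ENNReal.ofReal R *
        ((‖S (x - z)‖ₑ ^ (R - 2) + ‖S x‖ₑ ^ (R - 2)) * ‖S (x - z) - S x‖ₑ) := fun x => by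
      have := norm_rpow_mul_sub_le (s := R - 2) (by linarith) (S (x - z)) (S x)
      rw [sub_add_cancel] at this
      simp only [hH, ← map_sub]
      rw [← ofReal_norm, RCLike.norm_conj]
      refine (ENNReal.ofReal_le_ofReal this).trans (le_of_eq ?_)
      rw [ENNReal.ofReal_mul (by linarith), ENNReal.ofReal_mul (by positivity),
        ENNReal.ofReal_add (by positivity) (by positivity), ofReal_norm,
        ← ENNReal.ofReal_rpow_of_nonneg (norm_nonneg _) (by linarith),
        ← ENNReal.ofReal_rpow_of_nonneg (norm_nonneg _) (by linarith), ofReal_norm, ofReal_norm]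
    calc ∫⁻ x, ‖H (x - z) - H x‖ₑ * ‖w x‖ₑ
        ≤ ∫⁻ x, ENNReal.ofReal R * (‖S (x - z)‖ₑ ^ (R - 2) * (‖S (x - z) - S x‖ₑ * ‖w x‖ₑ) +
            ‖S x‖ₑ ^ (R - 2) * (‖S (x - z) - S x‖ₑ * ‖w x‖ₑ)) := by
          refine lintegral_mono fun x => (mul_le_mul_left (hp x) _).trans (le_of_eq ?_)
          ring
      _ = ENNReal.ofReal R * ((∫⁻ x, ‖S (x - z)‖ₑ ^ (R - 2) * (‖S (x - z) - S x‖ₑ * ‖w x‖ₑ)) +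
            ∫⁻ x, ‖S x‖ₑ ^ (R - 2) * (‖S (x - z) - S x‖ₑ * ‖w x‖ₑ)) := by
          rw [lintegral_const_mul' _ _ ENNReal.ofReal_ne_top, lintegral_add_left]
          exact (hSz.measurable.enorm.pow_const _).mul
            ((hSz.sub hSm).measurable.enorm.mul hwm.measurable.enorm)
      _ ≤ ENNReal.ofReal R * (eLpNorm S r volume ^ (R - 2) * (Λ * ‖z‖ₑ * eLpNorm w r volume) +
            eLpNorm S r volume ^ (R - 2) * (Λ * ‖z‖ₑ * eLpNorm w r volume)) := by
          gcongr
          · refine (lintegral_three_holder hr hrt hSz.aestronglyMeasurable hD hw.1).trans ?_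
            rw [hSzn]
            exact mul_le_mul_right (mul_le_mul_left (hΛ z) _) _
          · refine (lintegral_three_holder hr hrt hS.1 hD hw.1).trans ?_
            exact mul_le_mul_right (mul_le_mul_left (hΛ z) _) _
      _ = _ := by
          rw [ENNReal.ofReal_mul zero_le_two, ENNReal.ofReal_ofNat]; ring
  have h3 : ‖∫ x, H x * w x‖ₑ ≤ ENNReal.ofReal (2 * R) * eLpNorm S r volume ^ (R - 2) *
      (eLpNorm w r volume * (Λ * M)) := by
    rw [h2]
    have hkm := hψ.continuous_kernel (n := n)
    have hm' : Measurable fun z : E n => ‖kernel n ψ z‖ₑ * ‖z‖ₑ :=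
      hkm.measurable.enorm.mul measurable_enorm
    have hm : Measurable fun y : E n × E n =>
        ‖kernel n ψ y.2‖ₑ * ‖H (y.1 - y.2) - H y.1‖ₑ * ‖w y.1‖ₑ := by
      have h4 : Measurable fun y : E n × E n => H (y.1 - y.2) - H y.1 :=
        (hHM.comp (by fun_prop)).sub (hHM.comp measurable_fst)
      exact ((hkm.measurable.comp measurable_snd).enorm.mul h4.enorm).mul
        (hwm.measurable.comp measurable_fst).enorm
    calc ‖∫ x, mul n ψ H x * w x‖ₑ ≤ ∫⁻ x, ‖mul n ψ H x‖ₑ * ‖w x‖ₑ := by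
          refine (enorm_integral_le_lintegral_enorm _).trans (le_of_eq ?_)
          simp only [enorm_mul]
      _ ≤ ∫⁻ x, ∫⁻ z, ‖kernel n ψ z‖ₑ * ‖H (x - z) - H x‖ₑ * ‖w x‖ₑ := by
          refine lintegral_mono fun x => ?_
          rw [hmulH, lintegral_mul_const' _ _ enorm_ne_top]
          refine mul_le_mul_left ((enorm_integral_le_lintegral_enorm _).trans (le_of_eq ?_)) _
          simp only [enorm_mul]
      _ = ∫⁻ z, ∫⁻ x, ‖kernel n ψ z‖ₑ * ‖H (x - z) - H x‖ₑ * ‖w x‖ₑ :=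
          lintegral_lintegral_swap hm.aemeasurable
      _ ≤ ∫⁻ z, (ENNReal.ofReal (2 * R) * eLpNorm S r volume ^ (R - 2) *
            (eLpNorm w r volume * Λ)) * (‖kernel n ψ z‖ₑ * ‖z‖ₑ) := by
          refine lintegral_mono fun z => ?_
          simp only [mul_assoc ‖kernel n ψ z‖ₑ]
          rw [lintegral_const_mul' _ _ enorm_ne_top]
          refine (mul_le_mul_right (hdiff z) _).trans (le_of_eq ?_)
          ring
      _ ≤ _ := by
          rw [lintegral_const_mul _ hm']
          refine (mul_le_mul_right hM _).trans (le_of_eq ?_)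
          ring
  rw [eLpNorm_rpow_toReal hr0 hrt, eLpNorm_rpow_toReal hr0 hrt]
  refine h1.trans (add_le_add le_rfl ((mul_le_mul_right h3 _).trans (le_of_eq ?_)))
  have e : ENNReal.ofReal (2 * R ^ 2) = ENNReal.ofReal R * ENNReal.ofReal (2 * R) := by
    rw [← ENNReal.ofReal_mul (by linarith)]; congr 1; ring
  rw [e]
  ring

end Dispersive

/-! ### The square function estimate for 2 ≤ r < ∞ -/

namespace Dispersive

variable {n : ℕ}

/-- The translation can be put on the kernel, and Young's inequality applies to the difference of
kernels. -/
theorem eLpNorm_translate_mul_le (hn : n ≤ 3) {m : ℝ → ℂ} (h : IsSym m) {p : ℝ≥0∞} (hp : 1 ≤ p)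
    {u : E n → ℂ} (hu : MemLp u p volume) (z : E n) :
    eLpNorm (fun x => mul n m u (x - z) - mul n m u x) p volume ≤
      (∫⁻ x, ‖kernel n m (x - z) - kernel n m x‖ₑ) * eLpNorm u p volume := by
  have hk := h.continuous_kernel (n := n)
  have hkm : Measurable fun t => ‖kernel n m (t - z) - kernel n m t‖ₑ := by
    have : Continuous fun t => kernel n m (t - z) - kernel n m t := by fun_prop
    exact this.measurable.enorm
  have e : ∀ x, mul n m u (x - z) - mul n m u x =
      ∫ t, (kernel n m (t - z) - kernel n m t) * u (x - t) := fun x => by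
    have h1 : mul n m u (x - z) = ∫ t, kernel n m (t - z) * u (x - t) := by
      rw [mul_apply', ← integral_sub_left_eq_self _ volume x]
      refine integral_congr_ae (Filter.Eventually.of_forall fun t => ?_)
      simp only [show x - z - (x - t) = t - z by abel]
    have i1 : Integrable fun t => kernel n m (t - z) * u (x - t) := by
      have := (h.integrable_mul' hn hp hu (x - z)).comp_sub_left x
      refine this.congr (Filter.Eventually.of_forall fun t => ?_)
      simp only [show x - z - (x - t) = t - z by abel]
    rw [h1, mul_apply, ← integral_sub i1 (h.integrable_mul hn hp hu x)]
    simp only [sub_mul]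
  refine le_trans (eLpNorm_mono_enorm fun x => ?_)
    (le_of_le_of_eq (eLpNorm_lconvolution_le hp hkm.aemeasurable hu.1.enorm) (by rw [eLpNorm_enorm]))
  rw [e, enorm_eq_self]
  refine (enorm_integral_le_lintegral_enorm _).trans (le_of_eq ?_)
  simp only [enorm_mul]

/-- `c` is the geometric average of `a`. The term c_M^2 on the left closes the induction: it
decreases by a factor 4 at each step, which leaves room for the mixed product. -/
theorem sum_mul_geometric_le {a c : ℕ → ℝ} (h0 : c 0 = a 0) (hc : ∀ i, c (i + 1) = c i / 2 + a (i + 1))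
    (M : ℕ) : ∑ i ∈ Finset.range (M + 1), a i * c i + c M ^ 2 ≤
      3 * ∑ i ∈ Finset.range (M + 1), a i ^ 2 := by
  induction M with
  | zero => simp [h0]; nlinarith [sq_nonneg (a 0)]
  | succ M ih =>
    rw [Finset.sum_range_succ, Finset.sum_range_succ _ (M + 1), hc]
    nlinarith [sq_nonneg (c M - a (M + 1)), sq_nonneg (a (M + 1)), sq_nonneg (c M)]

/-- If s ≥ t, the inequality can be divided by s^{R-2}, since t^{R-2} ≤ s^{R-2}; otherwise there is
nothing to prove. -/
theorem sq_le_of_rpow_le {s t b : ℝ≥0∞} {R : ℝ} (hR : 2 ≤ R) (hs : s ≠ ⊤)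
    (h : s ^ R ≤ t ^ R + b * s ^ (R - 2)) : s ^ 2 ≤ t ^ 2 + b := by
  rcases le_total s t with hst | hst
  · exact (pow_le_pow_left' hst 2).trans le_self_add
  rcases eq_or_ne s 0 with rfl | hs0
  · simp
  have hsp : ∀ v : ℝ≥0∞, v ^ R = v ^ 2 * v ^ (R - 2) := fun v => by
    conv_lhs => rw [show R = 2 + (R - 2) by ring,
      ENNReal.rpow_add_of_nonneg _ _ zero_le_two (by linarith), ENNReal.rpow_two]
  have hk0 : s ^ (R - 2) ≠ 0 := by
    simp only [ne_eq, ENNReal.rpow_eq_zero_iff, not_or, not_and]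
    exact ⟨fun h => absurd h hs0, fun h => absurd h hs⟩
  have hkT : s ^ (R - 2) ≠ ⊤ := ENNReal.rpow_ne_top_of_nonneg (by linarith) hs
  rw [hsp, hsp] at h
  have h2 : s ^ 2 * s ^ (R - 2) ≤ (t ^ 2 + b) * s ^ (R - 2) := by
    refine h.trans ?_
    rw [add_mul]
    gcongr
  exact (ENNReal.mul_le_mul_iff_left hk0 hkT).1 h2

/-- The square function estimate, for the partial sums of a sequence of frequency-localised
functions. -/
theorem eLpNorm_sum_range_sq_le (hn : n ≤ 3) {r : ℝ≥0∞} (hr : 2 ≤ r) (hrt : r ≠ ⊤)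
    {ψ : ℕ → ℝ → ℂ} (hψ : ∀ i, IsSym (ψ i)) {C l : ℝ} (hC : 0 < C) (hl : 0 < l)
    (hT : ∀ i, ∀ z : E n, ∫⁻ x, ‖kernel n (ψ i) (x - z) - kernel n (ψ i) x‖ₑ ≤
      ENNReal.ofReal (C * l * 2 ^ i) * ‖z‖ₑ)
    (hK : ∀ i, ∫⁻ x : E n, ‖kernel n (ψ i) x‖ₑ * ‖x‖ₑ ≤ ENNReal.ofReal (C * (l * 2 ^ i)⁻¹))
    {a : ℕ → E n → ℂ} (ham : ∀ i, StronglyMeasurable (a i)) (ha : ∀ i, MemLp (a i) r volume)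
    (hloc : ∀ i, mul n (ψ i) (a i) = a i) (M : ℕ) :
    eLpNorm (fun x => ∑ i ∈ Finset.range M, a i x) r volume ^ 2 ≤
      ENNReal.ofReal (6 * r.toReal ^ 2 * C ^ 2 *
        ∑ i ∈ Finset.range M, (eLpNorm (a i) r volume).toReal ^ 2) := by
  have hr1 : 1 ≤ r := one_le_of_two_le hr
  have hR : 2 ≤ r.toReal := by
    rw [← ENNReal.toReal_ofNat 2]; exact (ENNReal.toReal_le_toReal (by simp) hrt).2 hr
  obtain ⟨N, hN⟩ : ∃ N : ℕ → ℝ, N = fun i => (eLpNorm (a i) r volume).toReal := ⟨_, rfl⟩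
  have hN0 : ∀ i, 0 ≤ N i := fun i => by rw [hN]; exact ENNReal.toReal_nonneg
  have hNe : ∀ i, eLpNorm (a i) r volume = ENNReal.ofReal (N i) := fun i => by
    rw [hN, ENNReal.ofReal_toReal (ha i).2.ne]
  -- The partial sum up to frequency i has translation constant ∑ 2^j N_j over j ≤ i, up to a fixed
  -- factor, and the first moment of the kernel at frequency i brings the division by 2^i.
  obtain ⟨c, hc⟩ : ∃ c : ℕ → ℝ, c = fun i => (∑ l ∈ Finset.range (i + 1), 2 ^ l * N l) / 2 ^ i :=
    ⟨_, rfl⟩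
  have hc0 : ∀ i, 0 ≤ c i := fun i => by
    rw [hc]; exact div_nonneg (Finset.sum_nonneg fun l _ => mul_nonneg (by positivity) (hN0 l))
      (by positivity)
  obtain ⟨S, hS⟩ : ∃ S : ℕ → E n → ℂ, S = fun i x => ∑ l ∈ Finset.range i, a l x := ⟨_, rfl⟩
  have hSm : ∀ i, StronglyMeasurable (S i) := fun i => by
    rw [hS]; exact Finset.stronglyMeasurable_fun_sum _ fun l _ => ham l
  have hSp : ∀ i, MemLp (S i) r volume := fun i => by
    rw [hS]; exact memLp_finsetSum _ fun l _ => ha l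
  have hstep : ∀ i, eLpNorm (S (i + 1)) r volume ^ 2 ≤ eLpNorm (S i) r volume ^ 2 +
      ENNReal.ofReal (2 * r.toReal ^ 2 * C ^ 2 * (N i * c i)) := by
    intro i
    have hΛ : ∀ z, eLpNorm (fun x => S (i + 1) (x - z) - S (i + 1) x) r volume ≤
        ENNReal.ofReal (C * l * (2 ^ i * c i)) * ‖z‖ₑ := fun z => by
      have e : (fun x => S (i + 1) (x - z) - S (i + 1) x) = ∑ j ∈ Finset.range (i + 1),
          fun x => mul n (ψ j) (a j) (x - z) - mul n (ψ j) (a j) x := by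
        ext x
        simp only [hS, hloc, Finset.sum_apply, Finset.sum_sub_distrib]
      have hm : ∀ j, AEStronglyMeasurable
          (fun x => mul n (ψ j) (a j) (x - z) - mul n (ψ j) (a j) x) volume := fun j => by
        rw [hloc]
        exact (((ham j).comp_measurable (by fun_prop : Measurable fun x => x - z)).sub
          (ham j)).aestronglyMeasurable
      rw [e]
      refine (eLpNorm_sum_le (fun j _ => hm j) hr1).trans ?_
      calc ∑ j ∈ Finset.range (i + 1), _
          ≤ ∑ j ∈ Finset.range (i + 1), ENNReal.ofReal (C * l * (2 ^ j * N j)) * ‖z‖ₑ := by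
            refine Finset.sum_le_sum fun j _ => ?_
            refine (eLpNorm_translate_mul_le hn (hψ j) hr1 (ha j) z).trans ?_
            refine (mul_le_mul_left (hT j z) _).trans (le_of_eq ?_)
            rw [hNe, mul_right_comm, ← ENNReal.ofReal_mul (by positivity)]
            congr 2; ring
        _ = _ := by
            rw [← Finset.sum_mul, ← ENNReal.ofReal_sum_of_nonneg fun j _ =>
              mul_nonneg (by positivity) (mul_nonneg (by positivity) (hN0 j)), ← Finset.mul_sum, hc]
            congr 3
            field_simp
    have e2 : S (i + 1) - a i = S i := by
      ext x; simp only [hS, Pi.sub_apply, Finset.sum_range_succ, add_sub_cancel_right]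
    have key := eLpNorm_rpow_le_add hn hr hrt (hψ i) (hSm (i + 1)) (ham i) (hSp (i + 1)) (ha i)
      (Filter.Eventually.of_forall fun x => by rw [hloc]) hΛ (hK i)
    rw [e2] at key
    refine sq_le_of_rpow_le hR (hSp (i + 1)).2.ne (key.trans (le_of_eq ?_))
    congr 1
    rw [hNe, mul_right_comm, ← ENNReal.ofReal_mul (mul_nonneg (by positivity)
      (mul_nonneg (by positivity) (hc0 i))), ← ENNReal.ofReal_mul (hN0 i),
      ← ENNReal.ofReal_mul (by positivity)]
    congr 2
    field_simp
  have hsum : ∀ M, eLpNorm (S M) r volume ^ 2 ≤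
      ENNReal.ofReal (2 * r.toReal ^ 2 * C ^ 2 * ∑ i ∈ Finset.range M, N i * c i) := by
    intro M
    induction M with
    | zero =>
      have : S 0 = 0 := by ext x; simp [hS]
      simp [this]
    | succ M ih =>
      refine (hstep M).trans ((add_le_add ih le_rfl).trans (le_of_eq ?_))
      rw [← ENNReal.ofReal_add (mul_nonneg (by positivity)
        (Finset.sum_nonneg fun i _ => mul_nonneg (hN0 i) (hc0 i)))
        (mul_nonneg (by positivity) (mul_nonneg (hN0 M) (hc0 M))), Finset.sum_range_succ]
      congr 1; ring
  have h1 := hsum M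
  rw [hS] at h1
  refine h1.trans (ENNReal.ofReal_le_ofReal ?_)
  have h2 : ∑ i ∈ Finset.range M, N i * c i ≤ 3 * ∑ i ∈ Finset.range M, N i ^ 2 := by
    cases M with
    | zero => simp
    | succ M =>
      have := sum_mul_geometric_le (a := N) (c := c) (by simp [hc]) (fun i => by
        rw [hc]; simp only
        rw [Finset.sum_range_succ _ (i + 1), pow_succ]; field_simp) M
      nlinarith [sq_nonneg (c M)]
  rw [hN] at h2 ⊢
  calc _ ≤ 2 * r.toReal ^ 2 * C ^ 2 * (3 * _) := by gcongr
    _ = _ := by ring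

theorem exists_sum_eq_sum_range (s : Finset ℤ) :
    ∃ N : ℕ, ∀ {A : Type} [AddCommMonoid A] (G : ℤ → A), (∀ j, j ∉ s → G j = 0) →
      ∑ j ∈ s, G j = ∑ i ∈ Finset.range (2 * N + 1), G ((i : ℤ) - N) := by
  refine ⟨s.sup Int.natAbs, fun G hG => ?_⟩
  obtain ⟨N, hN⟩ : ∃ N, N = s.sup Int.natAbs := ⟨_, rfl⟩
  rw [← hN]
  have e := Finset.sum_map (Finset.range (2 * N + 1))
    ⟨fun i : ℕ => (i : ℤ) - N, fun i j hij => by simpa using hij⟩ G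
  refine Eq.trans ?_ e
  refine Finset.sum_subset (fun j hj => ?_) fun j _ hj => hG j hj
  have h1 : j.natAbs ≤ N := hN ▸ Finset.le_sup (f := Int.natAbs) hj
  refine Finset.mem_map.2 ⟨(j + N).toNat, Finset.mem_range.2 (by omega), ?_⟩
  show (((j + N).toNat : ℕ) : ℤ) - N = j
  omega

/-- The square function estimate in `L^r`, `2 ≤ r < ∞`. -/
theorem exists_eLpNorm_sum_sq_le (hn : n ≤ 3) {m : ℝ → ℂ} (h : IsSym m)
    (hs : ContDiffOn ℝ ∞ m (Ioi 0)) {r : ℝ≥0∞} (hr : 2 ≤ r) (hrt : r ≠ ⊤) :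
    ∃ K : ℝ, 0 < K ∧ ∀ a : ℤ → E n → ℂ, (∀ j, MemLp (a j) r volume) →
      (∀ j, mul n (fun y => m ((2 : ℝ) ^ (-j) * y)) (a j) =ᵐ[volume] a j) → ∀ s : Finset ℤ,
      eLpNorm (fun x => ∑ j ∈ s, a j x) r volume ^ 2 ≤
        ENNReal.ofReal K * ∑ j ∈ s, eLpNorm (a j) r volume ^ 2 := by
  obtain ⟨C, hC, hk⟩ := exists_kernel_dilate_translation_le (n := n) h hs
  have hr1 : 1 ≤ r := one_le_of_two_le hr
  have hR : 1 ≤ r.toReal := by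
    rw [← ENNReal.toReal_one]; exact (ENNReal.toReal_le_toReal (by simp) hrt).2 hr1
  refine ⟨6 * r.toReal ^ 2 * C ^ 2, by positivity, fun a ha hloc s => ?_⟩
  have h2 : ∀ j : ℤ, (0 : ℝ) < 2 ^ (-j) := fun j => by positivity
  have hψ : ∀ j : ℤ, IsSym fun y => m ((2 : ℝ) ^ (-j) * y) := fun j => h.dilate (h2 j)
  have hpt : ∀ j, mul n (fun y => m ((2 : ℝ) ^ (-j) * y)) (mul n (fun y => m ((2 : ℝ) ^ (-j) * y))
      (a j)) = mul n (fun y => m ((2 : ℝ) ^ (-j) * y)) (a j) := fun j => mul_congr_ae (hloc j)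
  -- Applying the localising multiplier once more selects representatives for which the localisation
  -- identity holds everywhere, and strong measurability can be arranged.
  obtain ⟨b, hb⟩ : ∃ b : ℤ → E n → ℂ, b = (s : Set ℤ).indicator fun j =>
    mul n (fun y => m ((2 : ℝ) ^ (-j) * y)) (a j) := ⟨_, rfl⟩
  have hbs : ∀ j ∈ s, b j = mul n (fun y => m ((2 : ℝ) ^ (-j) * y)) (a j) := fun j hj => by
    rw [hb, indicator_of_mem (Finset.mem_coe.2 hj)]
  have hb0 : ∀ j, j ∉ s → b j = 0 := fun j hj => by
    rw [hb, indicator_of_notMem (mt Finset.mem_coe.1 hj)]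
  have hbm : ∀ j, StronglyMeasurable (b j) := fun j => by
    by_cases hj : j ∈ s
    · rw [hbs j hj, mul_congr_ae (ha j).1.ae_eq_mk]
      exact ((hψ j).stronglyMeasurable_mul (α := Unit) (v := fun _ => (ha j).1.mk (a j))
        ((ha j).1.stronglyMeasurable_mk.comp_measurable measurable_snd)).comp_measurable
        (g := fun x => ((), x)) (by fun_prop)
    · rw [hb0 j hj]; exact stronglyMeasurable_zero
  have hbp : ∀ j, MemLp (b j) r volume := fun j => by
    by_cases hj : j ∈ s
    · rw [hbs j hj]; exact (hψ j).memLp_mul hn hr1 (ha j)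
    · rw [hb0 j hj]; exact MemLp.zero
  have hbl : ∀ j, mul n (fun y => m ((2 : ℝ) ^ (-j) * y)) (b j) = b j := fun j => by
    by_cases hj : j ∈ s
    · rw [hbs j hj, hpt]
    · rw [hb0 j hj]; exact mul_zero_fun
  obtain ⟨N, hN⟩ := exists_sum_eq_sum_range s
  have e1 : eLpNorm (fun x => ∑ j ∈ s, a j x) r volume =
      eLpNorm (fun x => ∑ i ∈ Finset.range (2 * N + 1), b ((i : ℤ) - N) x) r volume := by
    refine eLpNorm_congr_ae ?_
    filter_upwards [(Finset.eventually_all s).2 fun j _ => hloc j] with x hx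
    rw [← hN (fun j => b j x) fun j hj => by simp only [hb0 j hj, Pi.zero_apply]]
    exact Finset.sum_congr rfl fun j hj => by rw [hbs j hj, hx j hj]
  have e2 : ∑ j ∈ s, eLpNorm (a j) r volume ^ 2 =
      ∑ i ∈ Finset.range (2 * N + 1), eLpNorm (b ((i : ℤ) - N)) r volume ^ 2 := by
    rw [← hN (fun j => eLpNorm (b j) r volume ^ 2) fun j hj => by simp [hb0 j hj]]
    exact Finset.sum_congr rfl fun j hj => by rw [hbs j hj, eLpNorm_congr_ae (hloc j)]
  -- The index j = i - N starts at -N, so the base scale passed below is l = 2^{-N}.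
  have hz : ∀ i : ℕ, (2 : ℝ) ^ (-((i : ℤ) - N)) = ((2 : ℝ) ^ N)  * (2 ^ i)⁻¹ := fun i => by
    rw [neg_sub, zpow_sub₀ two_ne_zero, zpow_natCast, zpow_natCast, div_eq_mul_inv]
  have key := eLpNorm_sum_range_sq_le hn hr hrt (fun i : ℕ => hψ ((i : ℤ) - N)) hC
    (l := ((2 : ℝ) ^ N)⁻¹) (by positivity) (fun i z => ((hk _ (h2 _)).1 z).trans (le_of_eq (by
      rw [hz]; congr 2; field_simp))) (fun i => ((hk _ (h2 _)).2).trans (le_of_eq (by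
      rw [hz]; congr 1; field_simp))) (fun i => hbm _) (fun i => hbp _) (fun i => hbl _) (2 * N + 1)
  rw [e1, e2]
  refine key.trans (le_of_eq ?_)
  rw [ENNReal.ofReal_mul (by positivity), ENNReal.ofReal_sum_of_nonneg fun i _ => by positivity]
  congr 1
  refine Finset.sum_congr rfl fun i _ => ?_
  rw [ENNReal.ofReal_pow ENNReal.toReal_nonneg, ENNReal.ofReal_toReal (hbp _).2.ne]

end Dispersive

/-! ### Functions with prescribed Littlewood-Paley pieces -/

namespace Dispersive

/-- The symbol `Q_{-1} + Q_0 + Q_1`, which is `1` on the support of `Q_0`. -/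
def wideSym (φ₀ : ℝ → ℝ) (y : ℝ) : ℂ := ((φ₀ (4⁻¹ * y) - φ₀ (2 * y) : ℝ) : ℂ)

variable {n : ℕ} {φ₀ : ℝ → ℝ}

theorem contDiff_wideSym (hφ : IsBump φ₀) : ContDiff ℝ ∞ (wideSym φ₀) := by
  have h := hφ.smooth
  have h1 : ContDiff ℝ ∞ fun y : ℝ => φ₀ (4⁻¹ * y) - φ₀ (2 * y) :=
    (h.comp (contDiff_const.mul contDiff_id)).sub (h.comp (contDiff_const.mul contDiff_id))
  exact Complex.ofRealCLM.contDiff.comp h1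

theorem wideSym_ne_zero (hφ : IsBump φ₀) {y : ℝ} (h : wideSym φ₀ y ≠ 0) :
    3 / 10 ≤ |y| ∧ |y| ≤ 16 / 5 := by
  constructor
  · by_contra! hy
    have hy' := abs_lt.1 hy
    rw [wideSym, hφ.eq_one _ ⟨by linarith, by linarith⟩, hφ.eq_one _ ⟨by linarith, by linarith⟩] at h
    simp at h
  · by_contra! hy
    have h1 : φ₀ (4⁻¹ * y) = 0 := by
      by_contra h1
      have := hφ.ne_zero h1
      rw [abs_mul, abs_of_pos (by norm_num : (0 : ℝ) < 4⁻¹)] at this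
      linarith
    have h2 : φ₀ (2 * y) = 0 := by
      by_contra h2
      have := hφ.ne_zero h2
      rw [abs_mul, abs_two] at this
      linarith
    simp [wideSym, h1, h2] at h

theorem isSym_wideSym (hφ : IsBump φ₀) : IsSym (wideSym φ₀) where
  supp := ⟨3 / 10, 16 / 5, by norm_num, fun y hy h => by
    have := wideSym_ne_zero hφ h
    rwa [abs_of_nonneg hy] at this⟩
  contDiffOn := (contDiff_infty.1 (contDiff_wideSym hφ) 2).contDiffOn

theorem wideSym_mul_Q (hφ : IsBump φ₀) (j : ℤ) (y : ℝ) :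
    wideSym φ₀ ((2 : ℝ) ^ (-j) * y) * (Q φ₀ j y : ℂ) = (Q φ₀ j y : ℂ) := by
  by_cases h : Q φ₀ j y = 0
  · rw [h]; simp
  have h1 := hφ.Q_ne_zero h
  have e : |(2 : ℝ) ^ (-j) * y| = |y| / 2 ^ j := by
    rw [abs_mul, abs_of_pos (by positivity), zpow_neg, inv_mul_eq_div]
  have h2 : wideSym φ₀ ((2 : ℝ) ^ (-j) * y) = 1 := by
    rw [← e] at h1
    have h3 := abs_le.1 h1.2
    have h4 : φ₀ (2 * ((2 : ℝ) ^ (-j) * y)) = 0 := by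
      by_contra h2
      have := hφ.ne_zero h2
      rw [abs_mul, abs_two] at this
      linarith
    rw [wideSym, h4, hφ.eq_one _ ⟨by linarith, by linarith⟩]
    simp
  rw [h2, one_mul]

theorem sum_Q_Icc (φ₀ : ℝ → ℝ) (N : ℕ) (y : ℝ) :
    ∑ j ∈ Finset.Icc (-(N : ℤ)) N, Q φ₀ j y =
      φ₀ ((2 : ℝ) ^ (-(N : ℤ) - 1) * y) - φ₀ ((2 : ℝ) ^ (N : ℤ) * y) := by
  induction N with
  | zero => simp [Q]
  | succ N ih =>
    have e : Finset.Icc (-((N + 1 : ℕ) : ℤ)) ((N + 1 : ℕ) : ℤ) =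
        insert (-((N + 1 : ℕ) : ℤ)) (insert ((N + 1 : ℕ) : ℤ) (Finset.Icc (-(N : ℤ)) N)) := by
      ext j; simp only [Finset.mem_Icc, Finset.mem_insert]; omega
    rw [e, Finset.sum_insert, Finset.sum_insert, ih]
    · simp only [Q]
      rw [show -((N + 1 : ℕ) : ℤ) = -(N : ℤ) - 1 by push_cast; ring,
        show -(-(N : ℤ) - 1) - 1 = N by ring,
        show -(-(N : ℤ) - 1) = ((N + 1 : ℕ) : ℤ) by push_cast; ring]
      ring
    · simp only [Finset.mem_Icc]; omega
    · simp only [Finset.mem_Icc, Finset.mem_insert]; omega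

/-- The telescoped sum is 1 on a range of frequencies that, once N ≥ |l| + 3, contains the annulus
from 3/10 to 16/5 times 2^l in which the wide symbol lives. -/
theorem sum_Q_mul_wideSym (hφ : IsBump φ₀) (l : ℤ) {N : ℕ} (hN : l.natAbs + 3 ≤ N) (y : ℝ) :
    ∑ j ∈ Finset.Icc (-(N : ℤ)) N, (Q φ₀ j y : ℂ) * wideSym φ₀ ((2 : ℝ) ^ (-l) * y) =
      wideSym φ₀ ((2 : ℝ) ^ (-l) * y) := by
  rw [← Finset.sum_mul, ← Complex.ofReal_sum, sum_Q_Icc]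
  by_cases h : wideSym φ₀ ((2 : ℝ) ^ (-l) * y) = 0
  · rw [h, mul_zero]
  have h1 := wideSym_ne_zero hφ h
  obtain ⟨v, hv⟩ : ∃ v, v = (2 : ℝ) ^ (-l) * y := ⟨_, rfl⟩
  have hy : y = 2 ^ l * v := by
    rw [hv, ← mul_assoc, ← zpow_add₀ two_ne_zero]; simp
  rw [← hv] at h1
  have h2 : φ₀ ((2 : ℝ) ^ (-(N : ℤ) - 1) * y) = 1 := by
    have : (2 : ℝ) ^ (-(N : ℤ) - 1) * y = 2 ^ (-(N : ℤ) - 1 + l) * v := by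
      rw [hy, ← mul_assoc, ← zpow_add₀ two_ne_zero]
    have h4 : (2 : ℝ) ^ (-(N : ℤ) - 1 + l) ≤ 2 ^ (-4 : ℤ) :=
      zpow_le_zpow_right₀ one_le_two (by omega)
    have h5 : |(2 : ℝ) ^ (-(N : ℤ) - 1) * y| ≤ 3 / 5 := by
      rw [this, abs_mul, abs_of_pos (by positivity)]
      calc _ ≤ (2 : ℝ) ^ (-4 : ℤ) * (16 / 5) := by gcongr; exact h1.2
        _ ≤ 3 / 5 := by norm_num
    exact hφ.eq_one _ (abs_le.1 h5)
  have h3 : φ₀ ((2 : ℝ) ^ (N : ℤ) * y) = 0 := by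
    by_contra h3
    have h5 := hφ.ne_zero h3
    have : (2 : ℝ) ^ (N : ℤ) * y = 2 ^ ((N : ℤ) + l) * v := by
      rw [hy, ← mul_assoc, ← zpow_add₀ two_ne_zero]
    have h4 : (2 : ℝ) ^ (3 : ℤ) ≤ 2 ^ ((N : ℤ) + l) := zpow_le_zpow_right₀ one_le_two (by omega)
    rw [this, abs_mul, abs_of_pos (by positivity)] at h5
    have : (2 : ℝ) ^ (3 : ℤ) * (3 / 10) ≤ 2 ^ ((N : ℤ) + l) * |v| := by gcongr; exact h1.1
    norm_num at this
    linarith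
  rw [h2, h3]; simp

/-- The families of functions that may be the Littlewood-Paley pieces of a function. -/
structure IsPieces (φ₀ : ℝ → ℝ) (a : ℤ → E n → ℂ) : Prop where
  meas : ∀ j, AEStronglyMeasurable (a j) volume
  compat : ∀ l j, mul n (fun y => (Q φ₀ l y : ℂ)) (a j) =ᵐ[volume]
    mul n (fun y => (Q φ₀ j y : ℂ)) (a l)
  loc : ∀ j, mul n (fun y => wideSym φ₀ ((2 : ℝ) ^ (-j) * y)) (a j) =ᵐ[volume] a j

/-- Compatibility exchanges Q_l a_j for Q_j a_l. The sum over j then acts on the single piece a_l,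
where the partial sums of the Q_j are eventually the identity by localisation. -/
theorem IsPieces.sum_mul_Q (hφ : IsBump φ₀) (hn : n ≤ 3) {a : ℤ → E n → ℂ} (ha : IsPieces φ₀ a)
    {r : ℝ≥0∞} (hr : 1 ≤ r) (har : ∀ j, MemLp (a j) r volume) (l : ℤ) {N : ℕ}
    (hN : l.natAbs + 3 ≤ N) :
    mul n (fun y => (Q φ₀ l y : ℂ)) (fun x => ∑ j ∈ Finset.Icc (-(N : ℤ)) N, a j x)
      =ᵐ[volume] a l := by
  have hw := (isSym_wideSym hφ).dilate (l := (2 : ℝ) ^ (-l)) (by positivity)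
  rw [(hφ.isSym_Q l).mul_sum hn hr _ fun j _ => har j]
  have h1 : ∀ j, mul n (fun y => (Q φ₀ j y : ℂ)) (a l) =
      mul n (fun y => (Q φ₀ j y : ℂ) * wideSym φ₀ ((2 : ℝ) ^ (-l) * y)) (a l) := fun j => by
    rw [← mul_mul_eq hn (hφ.isSym_Q j) hw hr (har l)]
    exact (mul_congr_ae (ha.loc l)).symm
  have h2 : (fun x => ∑ j ∈ Finset.Icc (-(N : ℤ)) N, mul n (fun y => (Q φ₀ j y : ℂ)) (a l) x) =
      mul n (fun y => wideSym φ₀ ((2 : ℝ) ^ (-l) * y)) (a l) := by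
    simp only [h1]
    rw [← sum_mul_eq hn hr _ (fun j _ => (hφ.isSym_Q j).mul_right hw.contDiffOn) (har l)]
    simp only [sum_Q_mul_wideSym hφ l hN]
  refine Filter.EventuallyEq.trans ?_ ((Filter.EventuallyEq.of_eq h2).trans (ha.loc l))
  filter_upwards [(Finset.eventually_all (Finset.Icc (-(N : ℤ)) N)).2
    fun j _ => ha.compat l j] with x hx
  exact Finset.sum_congr rfl hx

/-- Functions with given Littlewood-Paley pieces, from the square function estimate. -/
theorem exists_memLp_of_isPieces (hφ : IsBump φ₀) (hn : n ≤ 3) {r : ℝ≥0∞} (hr : 2 ≤ r)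
    (hrt : r ≠ ⊤) : ∃ K : ℝ, 0 < K ∧ ∀ a : ℤ → E n → ℂ, IsPieces φ₀ a →
      lebesgueNorm φ₀ r a ≤ ENNReal.ofReal K * besovNorm r a := by
  have hr1 : 1 ≤ r := one_le_of_two_le hr
  obtain ⟨K, hK, hle⟩ := exists_eLpNorm_sum_sq_le (n := n) hn (isSym_wideSym hφ)
    (contDiff_wideSym hφ).contDiffOn hr hrt
  refine ⟨√K, Real.sqrt_pos.2 hK, fun a ha => ?_⟩
  rcases eq_or_ne (besovNorm r a) ⊤ with ht | ht
  · rw [ht, ENNReal.mul_top (by simpa using hK)]; exact le_top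
  have hT : ∑' j, eLpNorm (a j) r volume ^ 2 ≠ ⊤ := fun h => ht (by
    rw [besovNorm, h, ENNReal.top_rpow_of_pos (by norm_num)])
  have har : ∀ j, MemLp (a j) r volume := fun j => ⟨ha.meas j, by
    have := ENNReal.ne_top_of_tsum_ne_top hT j
    rw [lt_top_iff_ne_top]
    intro h; simp [h] at this⟩
  have : Fact (1 ≤ r) := ⟨hr1⟩
  obtain ⟨X, hX⟩ : ∃ X : ℤ → ℝ, X = fun j => (eLpNorm (a j) r volume).toReal ^ 2 := ⟨_, rfl⟩
  have hX0 : ∀ j, 0 ≤ X j := fun j => by rw [hX]; positivity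
  have hXe : ∀ j, ENNReal.ofReal (X j) = eLpNorm (a j) r volume ^ 2 := fun j => by
    rw [hX, ENNReal.ofReal_pow ENNReal.toReal_nonneg, ENNReal.ofReal_toReal (har j).2.ne]
  have hXs : Summable X := by
    have := ENNReal.summable_toReal hT
    simpa only [hX, ENNReal.toReal_pow] using this
  obtain ⟨f, hf⟩ : ∃ f : ℤ → Lp ℂ r (volume : Measure (E n)), f = fun j => (har j).toLp (a j) :=
    ⟨_, rfl⟩
  have hfa : ∀ s : Finset ℤ, (∑ j ∈ s, f j : Lp ℂ r (volume : Measure (E n))) =ᵐ[volume]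
      fun x => ∑ j ∈ s, a j x := fun s => by
    refine (Lp.coeFn_fun_finsetSum s f).trans ?_
    filter_upwards [(Finset.eventually_all s).2 fun j _ => (har j).coeFn_toLp] with x hx
    exact Finset.sum_congr rfl fun j hj => by rw [hf]; exact hx j hj
  have hfs : ∀ s : Finset ℤ, ‖∑ j ∈ s, f j‖ ^ 2 ≤ K * ∑ j ∈ s, X j := fun s => by
    have h1 := hle a har ha.loc s
    rw [← eLpNorm_congr_ae (hfa s), ← Lp.enorm_def] at h1
    simp only [← hXe] at h1
    rw [← ENNReal.ofReal_sum_of_nonneg fun j _ => hX0 j, ← ENNReal.ofReal_mul hK.le,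
      ← ofReal_norm, ← ENNReal.ofReal_pow (norm_nonneg _)] at h1
    exact (ENNReal.ofReal_le_ofReal_iff (mul_nonneg hK.le (Finset.sum_nonneg fun j _ => hX0 j))).1 h1
  -- The square function estimate on finite sets disjoint from a large one gives the Cauchy
  -- criterion in the complete space L^r.
  have hsum : Summable f := by
    rw [summable_iff_vanishing_norm]
    intro ε hε
    obtain ⟨s, hs⟩ := summable_iff_vanishing_norm.1 hXs (ε ^ 2 / K) (by positivity)
    refine ⟨s, fun t ht => ?_⟩
    have h1 := hs t ht
    rw [Real.norm_of_nonneg (Finset.sum_nonneg fun j _ => hX0 j), lt_div_iff₀ hK] at h1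
    refine lt_of_pow_lt_pow_left₀ 2 hε.le ((hfs t).trans_lt ?_)
    linarith
  have hu := hsum.hasSum
  obtain ⟨u, hud⟩ : ∃ u, u = ∑' j, f j := ⟨_, rfl⟩
  rw [← hud] at hu
  have hu' : Filter.Tendsto (fun s : Finset ℤ => ∑ j ∈ s, f j) Filter.atTop (nhds u) := by
    simpa [HasSum] using hu
  have hun : ‖u‖ ^ 2 ≤ K * ∑' j, X j :=
    le_of_tendsto (hu'.norm.pow 2) (Filter.Eventually.of_forall fun s => (hfs s).trans (by
      gcongr; exact hXs.sum_le_tsum s fun j _ => hX0 j))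
  -- Q_l(|D|) is continuous on L^r and maps all sufficiently long symmetric partial sums to a_l.
  have hpieces : ∀ l, mul n (fun y => (Q φ₀ l y : ℂ)) u =ᵐ[volume] a l := by
    intro l
    have hQ := hφ.isSym_Q l
    have hz : eLpNorm (fun x => mul n (fun y => (Q φ₀ l y : ℂ)) u x - a l x) r volume = 0 := by
      have hlim : Filter.Tendsto (fun N : ℕ => eLpNorm (kernel n fun y => (Q φ₀ l y : ℂ)) 1 volume *
          ‖u - ∑ j ∈ Finset.Icc (-(N : ℤ)) N, f j‖ₑ) Filter.atTop (nhds 0) := by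
        have h1 : Filter.Tendsto (fun N : ℕ => ∑ j ∈ Finset.Icc (-(N : ℤ)) N, f j)
            Filter.atTop (nhds u) := hu'.comp Finset.tendsto_Icc_neg
        have h2 := ((tendsto_const_nhds (x := u)).sub h1).enorm
        rw [sub_self, enorm_zero] at h2
        have h3 := ENNReal.Tendsto.const_mul
          (a := eLpNorm (kernel n fun y => (Q φ₀ l y : ℂ)) 1 volume) h2
          (Or.inr (hQ.memLp_kernel hn le_rfl).2.ne)
        rwa [mul_zero] at h3
      refine le_antisymm (ge_of_tendsto hlim ?_) bot_le
      filter_upwards [Filter.eventually_ge_atTop (l.natAbs + 3)] with N hN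
      have h1 := ha.sum_mul_Q hφ hn hr1 har l hN
      have h2 := hQ.mul_sub hn hr1 hr1 (Lp.memLp u)
        (memLp_finsetSum (Finset.Icc (-(N : ℤ)) N) fun j _ => har j)
      have h3 : (fun x => mul n (fun y => (Q φ₀ l y : ℂ)) u x - a l x) =ᵐ[volume]
          mul n (fun y => (Q φ₀ l y : ℂ))
            (fun x => u x - ∑ j ∈ Finset.Icc (-(N : ℤ)) N, a j x) := by
        rw [h2]
        filter_upwards [h1] with x hx
        rw [hx]
      rw [eLpNorm_congr_ae h3, Lp.enorm_def]
      refine (eLpNorm_mul_le hQ hr1 ((Lp.memLp u).1.sub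
        (memLp_finsetSum (Finset.Icc (-(N : ℤ)) N) fun j _ => har j).1)).trans (le_of_eq ?_)
      congr 1
      refine eLpNorm_congr_ae ?_
      filter_upwards [Lp.coeFn_sub u (∑ j ∈ Finset.Icc (-(N : ℤ)) N, f j),
        hfa (Finset.Icc (-(N : ℤ)) N)] with x hx hx2
      rw [hx]
      exact (congrArg (u x - ·) hx2).symm
    have h0 := (eLpNorm_eq_zero_iff ((hQ.aestronglyMeasurable_mul (Lp.memLp u).1).sub (ha.meas l))
      (zero_lt_one.trans_le hr1).ne').1 hz
    filter_upwards [h0] with x hx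
    exact sub_eq_zero.1 hx
  refine (iInf₂_le (u : E n → ℂ) ⟨Lp.memLp u, hpieces⟩).trans ?_
  have h5 : ∑' j, eLpNorm (a j) r volume ^ 2 = ENNReal.ofReal (∑' j, X j) := by
    rw [ENNReal.ofReal_tsum_of_nonneg hX0 hXs]
    simp only [hXe]
  rw [← Lp.enorm_def, ← ofReal_norm, besovNorm, h5,
    ENNReal.ofReal_rpow_of_nonneg (tsum_nonneg hX0) (by norm_num),
    ← ENNReal.ofReal_mul (Real.sqrt_nonneg K)]
  refine ENNReal.ofReal_le_ofReal ?_
  rw [← Real.sqrt_eq_rpow, ← Real.sqrt_mul hK.le]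
  exact Real.le_sqrt_of_sq_le hun

end Dispersive

/-! ### The square function estimate for 1 < p ≤ 2 -/

namespace Dispersive

/-- The dual function is normalised to have the norm of `u` itself rather than norm 1, so that sums
of such pairings are sums of squares. -/
theorem exists_dual_function {α : Type*} [MeasurableSpace α] {μ : Measure α} {p : ℝ≥0∞}
    (hp : 1 < p) (hpt : p ≠ ⊤) {u : α → ℂ} (hu : MemLp u p μ) :
    ∃ G : α → ℂ, MemLp G p.conjExponent μ ∧ eLpNorm G p.conjExponent μ ≤ eLpNorm u p μ ∧
      ∫ x, u x * G x ∂μ = (((eLpNorm u p μ).toReal ^ 2 : ℝ) : ℂ) := by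
  obtain ⟨N, hN⟩ : ∃ N, N = (eLpNorm u p μ).toReal := ⟨_, rfl⟩
  have hNe : eLpNorm u p μ = ENNReal.ofReal N := by rw [hN, ENNReal.ofReal_toReal hu.2.ne]
  have hN0 : 0 ≤ N := by rw [hN]; exact ENNReal.toReal_nonneg
  rw [← hN]
  rcases hN0.eq_or_lt with h0 | hNpos
  · exact ⟨0, MemLp.zero, by simp, by simp [← h0]⟩
  have hp0 : p ≠ 0 := (zero_lt_one.trans hp).ne'
  obtain ⟨hc, hct⟩ := toReal_conjExponent hp hpt
  have hc0 : p.conjExponent ≠ 0 := (zero_lt_one.trans_le (one_le_conjExponent p)).ne'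
  obtain ⟨R, hR⟩ : ∃ R, R = p.toReal := ⟨_, rfl⟩
  rw [← hR] at hc
  have hR1 : 1 < R := by
    rw [hR, ← ENNReal.toReal_one]; exact (ENNReal.toReal_lt_toReal (by simp) hpt).2 hp
  have hR0 : 0 < R := by linarith
  have hR10 : 0 < R - 1 := by linarith
  have hI : ∫⁻ x, ‖u x‖ₑ ^ R ∂μ = ENNReal.ofReal (N ^ R) := by
    rw [hR, ← eLpNorm_rpow_toReal hp0 hpt, hNe, ENNReal.ofReal_rpow_of_nonneg hN0 (by linarith)]
  obtain ⟨G, hG⟩ : ∃ G : α → ℂ, G = fun x =>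
      ((N ^ (2 - R) * ‖u x‖ ^ (R - 2) : ℝ) : ℂ) * starRingEnd ℂ (u x) := ⟨_, rfl⟩
  have hum := hu.1.aemeasurable
  have hGm : AEStronglyMeasurable G μ := by
    have h3 : AEMeasurable (fun x => starRingEnd ℂ (u x)) μ :=
      Complex.continuous_conj.measurable.comp_aemeasurable hum
    rw [hG]
    exact AEMeasurable.aestronglyMeasurable (by fun_prop)
  have hGn : ∀ x, ‖G x‖ₑ = ENNReal.ofReal (N ^ (2 - R)) * ‖u x‖ₑ ^ (R - 1) := fun x => by
    have e : ‖G x‖ = N ^ (2 - R) * ‖u x‖ ^ (R - 1) := by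
      rw [hG, norm_mul, Complex.norm_real, Real.norm_of_nonneg (by positivity), RCLike.norm_conj,
        mul_assoc]
      congr 1
      rcases eq_or_ne (u x) 0 with h0 | h0
      · rw [h0, norm_zero, mul_zero, Real.zero_rpow (by linarith)]
      · rw [← Real.rpow_add_one (norm_pos_iff.2 h0).ne']; congr 1; ring
    rw [← ofReal_norm, e, ENNReal.ofReal_mul (by positivity), ← ofReal_norm (u x),
      ENNReal.ofReal_rpow_of_nonneg (norm_nonneg _) hR10.le]
  have hGN : eLpNorm G p.conjExponent μ = ENNReal.ofReal N := by
    rw [eLpNorm_eq_lintegral_rpow_enorm_toReal hc0 hct, hc]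
    have e : ∀ x, ‖G x‖ₑ ^ (R / (R - 1)) =
        ENNReal.ofReal ((N ^ (2 - R)) ^ (R / (R - 1))) * ‖u x‖ₑ ^ R := fun x => by
      rw [hGn, ENNReal.mul_rpow_of_nonneg _ _ (by positivity), ← ENNReal.rpow_mul,
        mul_div_cancel₀ _ hR10.ne', ENNReal.ofReal_rpow_of_nonneg (by positivity) (by positivity)]
    simp only [e]
    rw [lintegral_const_mul' _ _ ENNReal.ofReal_ne_top, hI, ← ENNReal.ofReal_mul (by positivity),
      ENNReal.ofReal_rpow_of_nonneg (by positivity) (by positivity)]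
    congr 1
    rw [← Real.rpow_mul hN0, ← Real.rpow_add hNpos, ← Real.rpow_mul hN0]
    conv_rhs => rw [← Real.rpow_one N]
    congr 1
    field_simp
    ring
  refine ⟨G, ⟨hGm, hGN ▸ ENNReal.ofReal_lt_top⟩, by rw [hGN, hNe], ?_⟩
  have e : ∀ x, u x * G x = ((N ^ (2 - R) * ‖u x‖ ^ R : ℝ) : ℂ) := fun x => by
    have : ‖u x‖ ^ R = ‖u x‖ ^ (R - 2) * ‖u x‖ ^ 2 := by
      rcases eq_or_ne (u x) 0 with h0 | h0
      · rw [h0, norm_zero, Real.zero_rpow hR0.ne']; simp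
      · rw [← Real.rpow_natCast, ← Real.rpow_add (norm_pos_iff.2 h0)]; congr 1; push_cast; ring
    rw [this, hG]
    push_cast
    rw [← Complex.mul_conj']
    ring
  simp only [e]
  rw [integral_complex_ofReal, integral_const_mul]
  have h2 : ∫ x, ‖u x‖ ^ R ∂μ = N ^ R := by
    rw [integral_eq_lintegral_of_nonneg_ae (Filter.Eventually.of_forall fun x => by positivity)
      (hum.norm.pow_const _).aestronglyMeasurable]
    have : ∀ x, ENNReal.ofReal (‖u x‖ ^ R) = ‖u x‖ₑ ^ R := fun x => by
      rw [← ofReal_norm, ENNReal.ofReal_rpow_of_nonneg (norm_nonneg _) hR0.le]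
    simp only [this]
    rw [hI, ENNReal.toReal_ofReal (by positivity)]
  rw [h2, ← Real.rpow_add hNpos, sub_add_cancel, Real.rpow_two]

variable {n : ℕ} {φ₀ : ℝ → ℝ}

theorem Q_eq_dilate (φ₀ : ℝ → ℝ) (j : ℤ) (y : ℝ) : Q φ₀ j y = Q φ₀ 0 ((2 : ℝ) ^ (-j) * y) := by
  simp only [Q, ← mul_assoc, ← zpow_add₀ (two_ne_zero (α := ℝ))]
  simp [add_comm, sub_eq_add_neg]

theorem eLpNorm_kernel_Q (n : ℕ) (φ₀ : ℝ → ℝ) (j : ℤ) :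
    eLpNorm (kernel n fun y => (Q φ₀ j y : ℂ)) 1 volume =
      eLpNorm (kernel n fun y => (Q φ₀ 0 y : ℂ)) 1 volume := by
  simp only [Q_eq_dilate φ₀ j]
  exact eLpNorm_one_kernel_dilate n (fun y => (Q φ₀ 0 y : ℂ)) (by positivity)

/-- T^2 ≤ U^2 V^2 ≤ U^2 B T, divided by T; finiteness of T is what allows the division. -/
theorem le_of_sq_le_mul {T U V B : ℝ≥0∞} (hT : T ≠ ⊤) (h1 : T ≤ U * V) (h2 : V ^ 2 ≤ B * T) :
    T ≤ B * U ^ 2 := by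
  rcases eq_or_ne T 0 with rfl | h0
  · simp
  refine (ENNReal.mul_le_mul_iff_left h0 hT).1 ?_
  calc T * T ≤ (U * V) ^ 2 := by rw [sq]; gcongr
    _ = U ^ 2 * V ^ 2 := mul_pow _ _ _
    _ ≤ U ^ 2 * (B * T) := by gcongr
    _ = _ := by ring

/-- The square function estimate in `L^p`, `1 < p ≤ 2`. -/
theorem exists_besovNorm_le (hφ : IsBump φ₀) (hn : n ≤ 3) {p : ℝ≥0∞} (hp : 1 < p) (hp2 : p ≤ 2) :
    ∃ K : ℝ, 0 < K ∧ ∀ a : ℤ → E n → ℂ,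
      besovNorm p a ≤ ENNReal.ofReal K * lebesgueNorm φ₀ p a := by
  have hpt : p ≠ ⊤ := (hp2.trans_lt (by simp)).ne
  have hcc' := conjExponent_conjExponent hp.le
  have hc2 : 2 ≤ p.conjExponent := by
    obtain ⟨hc, hct⟩ := toReal_conjExponent hp hpt
    have hR1 : 1 < p.toReal := by
      rw [← ENNReal.toReal_one]; exact (ENNReal.toReal_lt_toReal (by simp) hpt).2 hp
    have hR2 : p.toReal ≤ 2 := by
      rw [← ENNReal.toReal_ofNat 2]; exact (ENNReal.toReal_le_toReal hpt (by simp)).2 hp2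
    rw [← ENNReal.toReal_le_toReal (by simp) hct, hc, ENNReal.toReal_ofNat,
      le_div_iff₀ (by linarith)]
    linarith
  have hct : p.conjExponent ≠ ⊤ := (toReal_conjExponent hp hpt).2
  have hc1 := one_le_conjExponent p
  obtain ⟨K, hK, hle⟩ := exists_eLpNorm_sum_sq_le (n := n) hn (isSym_wideSym hφ)
    (contDiff_wideSym hφ).contDiffOn hc2 hct
  obtain ⟨c, hc⟩ : ∃ c, c = (eLpNorm (kernel n fun y => (Q φ₀ 0 y : ℂ)) 1 volume).toReal := ⟨_, rfl⟩
  have hc0 : 0 ≤ c := by rw [hc]; exact ENNReal.toReal_nonneg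
  have hcj : ∀ j, eLpNorm (kernel n fun y => (Q φ₀ j y : ℂ)) 1 volume = ENNReal.ofReal c :=
    fun j => by
      rw [eLpNorm_kernel_Q, hc, ENNReal.ofReal_toReal ((hφ.isSym_Q 0).memLp_kernel hn le_rfl).2.ne]
  have hKp : 0 < √(K * (c ^ 2 + 1)) := Real.sqrt_pos.2 (by positivity)
  refine ⟨√(K * (c ^ 2 + 1)), hKp, fun a => ?_⟩
  have hK0 : ENNReal.ofReal √(K * (c ^ 2 + 1)) ≠ 0 := by simpa using hKp
  refine (ENNReal.div_le_iff' hK0 ENNReal.ofReal_ne_top).1 (le_iInf₂ fun u ⟨hu, hpc⟩ =>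
    (ENNReal.div_le_iff' hK0 ENNReal.ofReal_ne_top).2 ?_)
  have hQ := fun j => hφ.isSym_Q j
  have ha : ∀ j, MemLp (a j) p volume := fun j => ((hQ j).memLp_mul hn hp.le hu).ae_eq (hpc j)
  choose G hG hGn hGi using fun j => exists_dual_function hp hpt (ha j)
  -- With G_j dual to a_j, the sum of the ‖a_j‖^2 is the pairing of `u` with ∑ Q_j G_j. The estimate
  -- for the exponent p' ≥ 2 bounds the square of the norm of that sum by a multiple of the same sum
  -- of squares, which cancels.
  have hfin : ∀ s : Finset ℤ, ∑ j ∈ s, eLpNorm (a j) p volume ^ 2 ≤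
      ENNReal.ofReal (K * (c ^ 2 + 1)) * eLpNorm u p volume ^ 2 := by
    intro s
    have hV : MemLp (fun x => ∑ j ∈ s, mul n (fun y => (Q φ₀ j y : ℂ)) (G j) x)
        p.conjExponent volume := memLp_finsetSum _ fun j _ => (hQ j).memLp_mul hn hc1 (hG j)
    refine le_of_sq_le_mul (V := eLpNorm (fun x => ∑ j ∈ s,
      mul n (fun y => (Q φ₀ j y : ℂ)) (G j) x) p.conjExponent volume) ?_ ?_ ?_
    · exact ENNReal.sum_ne_top.2 fun j _ => ENNReal.pow_ne_top (ha j).2.ne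
    · have hcc : ENNReal.HolderConjugate p p.conjExponent := .conjExponent hp.le
      refine le_trans (le_of_eq ?_) (enorm_integral_mul_le p p.conjExponent hu.1 hV.1)
      have e : ∀ j, ∫ x, u x * mul n (fun y => (Q φ₀ j y : ℂ)) (G j) x =
          (((eLpNorm (a j) p volume).toReal ^ 2 : ℝ) : ℂ) := fun j => by
        rw [← integral_mul_mul_comm hn (hQ j) hp.le hu (hG j), ← hGi j]
        refine integral_congr_ae ((hpc j).mono fun x hx => ?_)
        simp only [hx]
      simp only [Finset.mul_sum]
      rw [integral_finsetSum]
      · simp only [e]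
        rw [← Complex.ofReal_sum, ← ofReal_norm, Complex.norm_real, Real.norm_of_nonneg
          (Finset.sum_nonneg fun j _ => by positivity),
          ENNReal.ofReal_sum_of_nonneg fun j _ => by positivity]
        refine Finset.sum_congr rfl fun j _ => ?_
        rw [ENNReal.ofReal_pow ENNReal.toReal_nonneg, ENNReal.ofReal_toReal (ha j).2.ne]
      · intro j _
        exact memLp_one_iff_integrable.1 (((hQ j).memLp_mul hn hc1 (hG j)).mul (r := 1) hu
          (hpqr := hcc))
    · refine (hle _ (fun j => (hQ j).memLp_mul hn hc1 (hG j)) (fun j => ?_) s).trans ?_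
      · rw [mul_mul_eq hn ((isSym_wideSym hφ).dilate (by positivity)) (hQ j) hc1 (hG j)]
        simp only [wideSym_mul_Q hφ]
        rfl
      · rw [ENNReal.ofReal_mul hK.le, mul_assoc]
        refine mul_le_mul_right ?_ _
        rw [Finset.mul_sum]
        refine Finset.sum_le_sum fun j _ => ?_
        calc eLpNorm (mul n (fun y => (Q φ₀ j y : ℂ)) (G j)) p.conjExponent volume ^ 2
            ≤ (ENNReal.ofReal c * eLpNorm (a j) p volume) ^ 2 := by
              gcongr
              refine (eLpNorm_mul_le (hQ j) hc1 (hG j).1).trans ?_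
              rw [hcj]
              gcongr
              exact hGn j
          _ ≤ _ := by
              rw [mul_pow, ← ENNReal.ofReal_pow hc0]
              gcongr
              linarith
  rw [besovNorm, ENNReal.tsum_eq_iSup_sum]
  calc _ ≤ (ENNReal.ofReal (K * (c ^ 2 + 1)) * eLpNorm u p volume ^ 2) ^ (1 / 2 : ℝ) :=
        ENNReal.rpow_le_rpow (iSup_le hfin) (by norm_num)
    _ = _ := by
        rw [ENNReal.mul_rpow_of_nonneg _ _ (by norm_num), ENNReal.ofReal_rpow_of_nonneg
          (by positivity) (by norm_num), ← Real.sqrt_eq_rpow, ← ENNReal.rpow_natCast,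
          ← ENNReal.rpow_mul]
        norm_num

end Dispersive

/-! ### Minkowski's inequality for ℓ^2 and Lebesgue norms in time -/

namespace Dispersive

theorem eLpNorm_tsum_le {α : Type*} [MeasurableSpace α] {μ : Measure α} {q : ℝ≥0∞} (hq : 1 ≤ q)
    {N : ℤ → α → ℝ≥0∞} (hN : ∀ j, Measurable (N j)) :
    eLpNorm (fun t => ∑' j, N j t) q μ ≤ ∑' j, eLpNorm (N j) q μ := by
  rcases eq_or_ne q ⊤ with rfl | hqt
  · simp only [eLpNorm_exponent_top]
    refine essSup_le_of_ae_le _ ?_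
    have : ∀ᵐ t ∂μ, ∀ j, ‖N j t‖ₑ ≤ eLpNormEssSup (N j) μ :=
      ae_all_iff.2 fun j => enorm_ae_le_eLpNormEssSup (N j) μ
    filter_upwards [this] with t ht
    exact ENNReal.tsum_le_tsum ht
  · refine eLpNorm_le_of_ae_le_liminf (zero_lt_one.trans_le hq).ne' hqt
      (F := fun M t => ∑ j ∈ Finset.Icc (-(M : ℤ)) M, N j t)
      (fun M => Finset.measurable_fun_sum _ fun j _ => hN j) (fun t => ?_) fun M => ?_
    · have h1 : Filter.Tendsto (fun s : Finset ℤ => ∑ j ∈ s, N j t) Filter.atTop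
          (nhds (∑' j, N j t)) := by
        simpa [HasSum] using (ENNReal.summable (f := fun j => N j t)).hasSum
      exact (h1.comp Finset.tendsto_Icc_neg).liminf_eq.ge
    · have e : (fun t => ∑ j ∈ Finset.Icc (-(M : ℤ)) M, N j t) =
          ∑ j ∈ Finset.Icc (-(M : ℤ)) M, N j := by ext t; simp
      rw [e]
      exact (eLpNorm_sum_le (fun j _ => (hN j).aestronglyMeasurable) hq).trans
        (ENNReal.sum_le_tsum _)

theorem sq_rpow_half (x : ℝ≥0∞) : (x ^ 2) ^ (1 / 2 : ℝ) = x := by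
  rw [← ENNReal.rpow_natCast, ← ENNReal.rpow_mul]; norm_num

/-- Minkowski's inequality for `ℓ²` inside `L^q`, `2 ≤ q`. -/
theorem eLpNorm_sqrt_tsum_le {α : Type*} [MeasurableSpace α] {μ : Measure α} {q : ℝ≥0∞}
    (hq : 2 ≤ q) {N : ℤ → α → ℝ≥0∞} (hN : ∀ j, Measurable (N j)) :
    eLpNorm (fun t => (∑' j, N j t ^ 2) ^ (1 / 2 : ℝ)) q μ ≤
      (∑' j, eLpNorm (N j) q μ ^ 2) ^ (1 / 2 : ℝ) := by
  -- e = q/2 ≥ 1; the claim is the triangle inequality in L^{q/2} for the squares.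
  obtain ⟨e, he⟩ : ∃ e, e = q * ENNReal.ofReal (1 / 2) := ⟨_, rfl⟩
  have h2 : ENNReal.ofReal (1 / 2) * ENNReal.ofReal 2 = 1 := by
    rw [← ENNReal.ofReal_mul (by norm_num)]; norm_num
  have he2 : e * ENNReal.ofReal 2 = q := by rw [he, mul_assoc, h2, mul_one]
  have he1 : 1 ≤ e := by
    rw [he, ← h2, mul_comm]
    gcongr
    simpa using hq
  have h1 := eLpNorm_enorm_rpow (μ := μ) (p := q) (fun t => ∑' j, N j t ^ 2)
    (by norm_num : (0 : ℝ) < 1 / 2)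
  simp only [enorm_eq_self, ← he] at h1
  rw [h1]
  refine ENNReal.rpow_le_rpow ?_ (by norm_num)
  refine (eLpNorm_tsum_le he1 fun j => (hN j).pow_const 2).trans (le_of_eq ?_)
  refine tsum_congr fun j => ?_
  have h3 := eLpNorm_enorm_rpow (μ := μ) (p := e) (N j) (by norm_num : (0 : ℝ) < 2)
  simpa only [enorm_eq_self, he2, ENNReal.rpow_two] using h3

/-- Minkowski's inequality for `ℓ²` outside `L^p`, `1 ≤ p < 2`. -/
theorem sqrt_tsum_eLpNorm_le {α : Type*} [MeasurableSpace α] {μ : Measure α} {p : ℝ≥0∞}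
    (hp : 1 ≤ p) (hp2 : p < 2) {N : ℤ → α → ℝ≥0∞} (hN : ∀ j, AEMeasurable (N j) μ) :
    (∑' j, eLpNorm (N j) p μ ^ 2) ^ (1 / 2 : ℝ) ≤
      eLpNorm (fun t => (∑' j, N j t ^ 2) ^ (1 / 2 : ℝ)) p μ := by
  have hpt : p ≠ ⊤ := (hp2.trans (by simp)).ne
  have hp0 : p ≠ 0 := (zero_lt_one.trans_le hp).ne'
  obtain ⟨W, hW⟩ : ∃ W, W = eLpNorm (fun t => (∑' j, N j t ^ 2) ^ (1 / 2 : ℝ)) p μ := ⟨_, rfl⟩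
  obtain ⟨R, hR⟩ : ∃ R, R = p.toReal := ⟨_, rfl⟩
  have hR1 : 1 ≤ R := by
    rw [hR, ← ENNReal.toReal_one]; exact (ENNReal.toReal_le_toReal (by simp) hpt).2 hp
  have hR2 : R < 2 := by
    rw [hR, ← ENNReal.toReal_ofNat 2]; exact (ENNReal.toReal_lt_toReal hpt (by simp)).2 hp2
  rw [← hW]
  suffices h : ∀ s : Finset ℤ, ∑ j ∈ s, eLpNorm (N j) p μ ^ 2 ≤ W ^ 2 by
    rw [ENNReal.tsum_eq_iSup_sum]
    exact (ENNReal.rpow_le_rpow (iSup_le h) (by norm_num)).trans (sq_rpow_half W).le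
  intro s
  rcases eq_or_ne W ⊤ with hWt | hWt
  · simp [hWt]
  have hc : ∀ j, eLpNorm (N j) p μ ≠ ⊤ := fun j => by
    refine ne_top_of_le_ne_top hWt (hW ▸ eLpNorm_mono_enorm fun t => ?_)
    simp only [enorm_eq_self]
    conv_lhs => rw [← sq_rpow_half (N j t)]
    exact ENNReal.rpow_le_rpow (ENNReal.le_tsum j) (by norm_num)
  obtain ⟨T, hT⟩ : ∃ T, T = ∑ j ∈ s, eLpNorm (N j) p μ ^ 2 := ⟨_, rfl⟩
  have hTt : T ≠ ⊤ := by rw [hT]; exact ENNReal.sum_ne_top.2 fun j _ => ENNReal.pow_ne_top (hc j)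
  rw [← hT]
  rcases eq_or_ne T 0 with h0 | h0
  · simp [h0]
  have hconj : (2 / (2 - R)).HolderConjugate (2 / R) := by
    rw [Real.holderConjugate_iff]
    constructor
    · rw [lt_div_iff₀ (by linarith)]; linarith
    · rw [inv_div, inv_div]; ring
  -- Each square is written as ‖N_j‖^{2-R} ∫ N_j^R, and Hölder's inequality in j with exponents
  -- 2/(2-R) and 2/R is applied under the integral. Dividing by the power of T gives T^{R/2} ≤ W^R.
  have h1 : T ≤ T ^ (1 - R / 2) * W ^ R := by
    calc T = ∑ j ∈ s, ∫⁻ t, eLpNorm (N j) p μ ^ (2 - R) * N j t ^ R ∂μ := by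
          rw [hT]
          refine Finset.sum_congr rfl fun j _ => ?_
          have h2 := eLpNorm_rpow_toReal (μ := μ) hp0 hpt (N j)
          simp only [enorm_eq_self, ← hR] at h2
          rw [lintegral_const_mul' _ _ (ENNReal.rpow_ne_top_of_nonneg (by linarith) (hc j)), ← h2,
            ← ENNReal.rpow_add_of_nonneg _ _ (by linarith) (by linarith), sub_add_cancel,
            ENNReal.rpow_two]
      _ = ∫⁻ t, ∑ j ∈ s, eLpNorm (N j) p μ ^ (2 - R) * N j t ^ R ∂μ := by
          rw [lintegral_finsetSum' _ fun j _ => ((hN j).pow_const R).const_mul _]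
      _ ≤ ∫⁻ t, T ^ (1 - R / 2) * ((∑' j, N j t ^ 2) ^ (1 / 2 : ℝ)) ^ R ∂μ := by
          refine lintegral_mono fun t => ?_
          refine (ENNReal.inner_le_Lp_mul_Lq s _ _ hconj).trans ?_
          have e1 : ∀ j, (eLpNorm (N j) p μ ^ (2 - R)) ^ (2 / (2 - R)) = eLpNorm (N j) p μ ^ 2 :=
            fun j => by
              rw [← ENNReal.rpow_mul, mul_div_cancel₀ _ (by linarith), ENNReal.rpow_two]
          have e2 : ∀ j, (N j t ^ R) ^ (2 / R) = N j t ^ 2 := fun j => by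
            rw [← ENNReal.rpow_mul, mul_div_cancel₀ _ (by linarith), ENNReal.rpow_two]
          simp only [e1, e2, ← hT, one_div_div]
          rw [← ENNReal.rpow_mul, show (2 - R) / 2 = 1 - R / 2 by ring,
            show (1 / 2 : ℝ) * R = R / 2 by ring]
          gcongr
          exact ENNReal.sum_le_tsum s
      _ = _ := by
          have h2 := eLpNorm_rpow_toReal (μ := μ) hp0 hpt fun t => (∑' j, N j t ^ 2) ^ (1 / 2 : ℝ)
          simp only [enorm_eq_self, ← hR, ← hW] at h2
          rw [lintegral_const_mul' _ _ (ENNReal.rpow_ne_top_of_nonneg (by linarith) hTt), ← h2]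
  have hk0 : T ^ (1 - R / 2) ≠ 0 := by
    simp only [ne_eq, ENNReal.rpow_eq_zero_iff, not_or, not_and]
    exact ⟨fun h => absurd h h0, fun h => absurd h hTt⟩
  have hkT : T ^ (1 - R / 2) ≠ ⊤ := ENNReal.rpow_ne_top_of_nonneg (by linarith) hTt
  have h3 : T ^ (R / 2) ≤ W ^ R := by
    refine (ENNReal.mul_le_mul_iff_right hk0 hkT).1 (le_trans (le_of_eq ?_) h1)
    rw [← ENNReal.rpow_add_of_nonneg _ _ (by linarith) (by linarith), sub_add_cancel,
      ENNReal.rpow_one]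
  have h4 := ENNReal.rpow_le_rpow h3 (by positivity : 0 ≤ 2 / R)
  rw [← ENNReal.rpow_mul, ← ENNReal.rpow_mul, div_mul_div_cancel₀ (by norm_num), div_self (by linarith),
    mul_div_cancel₀ _ (by linarith), ENNReal.rpow_one, ENNReal.rpow_two] at h4
  exact h4

end Dispersive

/-! ### Besov norms, and the pieces of Duhamel integrals -/

namespace Dispersive

variable {n : ℕ} {φ₀ g : ℝ → ℝ} {δ : ℝ}

theorem exists_outNorm_le (hφ : IsBump φ₀) (hn : n ≤ 3) {r : ℝ≥0∞} (hr : 2 ≤ r) :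
    ∃ K : ℝ, 0 < K ∧ ∀ a : ℤ → E n → ℂ, IsPieces φ₀ a →
      outNorm φ₀ r a ≤ ENNReal.ofReal K * besovNorm r a := by
  rcases eq_or_ne r ⊤ with rfl | hrt
  · exact ⟨1, one_pos, fun a _ => by simp [outNorm]⟩
  · simpa only [outNorm, if_neg hrt] using exists_memLp_of_isPieces hφ hn hr hrt

theorem one_lt_conjExponent {r : ℝ≥0∞} (hr : 1 < r) (hrt : r ≠ ⊤) : 1 < r.conjExponent := by
  obtain ⟨hc, hct⟩ := toReal_conjExponent hr hrt
  have hR1 : 1 < r.toReal := by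
    rw [← ENNReal.toReal_one]; exact (ENNReal.toReal_lt_toReal (by simp) hrt).2 hr
  rw [← ENNReal.toReal_lt_toReal (by simp) hct, hc, ENNReal.toReal_one, lt_div_iff₀ (by linarith)]
  linarith

theorem conjExponent_lt_two {q : ℝ≥0∞} (hq : 2 < q) : q.conjExponent < 2 := by
  refine lt_of_le_of_ne (conjExponent_le_two hq.le) fun h => hq.ne' ?_
  rw [← conjExponent_conjExponent (one_le_of_two_le hq.le), h, conjExponent_two]

theorem exists_besovNorm_le_inNorm (hφ : IsBump φ₀) (hn : n ≤ 3) {r : ℝ≥0∞} (hr : 2 ≤ r) :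
    ∃ K : ℝ, 0 < K ∧ ∀ a : ℤ → E n → ℂ,
      besovNorm r.conjExponent a ≤ ENNReal.ofReal K * inNorm φ₀ r a := by
  rcases eq_or_ne r ⊤ with rfl | hrt
  · exact ⟨1, one_pos, fun a => by simp [inNorm, conjExponent_top]⟩
  · simpa only [inNorm, if_neg hrt] using exists_besovNorm_le hφ hn
      (one_lt_conjExponent (lt_of_lt_of_le (by norm_num) hr) hrt) (conjExponent_le_two hr)

theorem timeNorm_le_ofReal_mul {q : ℝ≥0∞} {K : ℝ} {N M : ℝ → ℝ≥0∞}
    (h : ∀ t, N t ≤ ENNReal.ofReal K * M t) : timeNorm q N ≤ ENNReal.ofReal K * timeNorm q M :=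
  eLpNorm_le_mul_eLpNorm_of_ae_le_mul' (c := K.toNNReal) (Filter.Eventually.of_forall h) q

/-- The square function estimate at each time, then Minkowski with q ≥ 2, brings the ℓ^2 norm
outside the time norm. -/
theorem exists_timeNorm_outNorm_le (hφ : IsBump φ₀) (hn : n ≤ 3) {q r : ℝ≥0∞} (hq : 2 ≤ q)
    (hr : 2 ≤ r) : ∃ K : ℝ, 0 < K ∧ ∀ a : ℝ → ℤ → E n → ℂ, (∀ t, IsPieces φ₀ (a t)) →
      (∀ j, Measurable fun t => eLpNorm (a t j) r volume) →
      timeNorm q (fun t => outNorm φ₀ r (a t)) ≤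
        ENNReal.ofReal K * (∑' j, mixedNorm q r (fun t => a t j) ^ 2) ^ (1 / 2 : ℝ) := by
  obtain ⟨K, hK, h⟩ := exists_outNorm_le hφ hn hr
  refine ⟨K, hK, fun a ha hm => ?_⟩
  exact (timeNorm_le_ofReal_mul fun t => h _ (ha t)).trans
    (mul_le_mul_right (eLpNorm_sqrt_tsum_le hq hm) _)

/-- The converse passage for sources: Minkowski with q' < 2 puts the ℓ^2 norm inside the time norm,
and the reverse square function estimate is used at each time. -/
theorem exists_tsum_mixedNorm_le (hφ : IsBump φ₀) (hn : n ≤ 3) {q r : ℝ≥0∞} (hq : 2 < q)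
    (hr : 2 ≤ r) : ∃ K : ℝ, 0 < K ∧ ∀ w : ℝ → ℤ → E n → ℂ,
      (∀ j, AEMeasurable fun s => eLpNorm (w s j) r.conjExponent volume) →
      (∑' j, mixedNorm q.conjExponent r.conjExponent (fun s => w s j) ^ 2) ^ (1 / 2 : ℝ) ≤
        ENNReal.ofReal K * timeNorm q.conjExponent (fun s => inNorm φ₀ r (w s)) := by
  obtain ⟨K, hK, h⟩ := exists_besovNorm_le_inNorm hφ hn hr
  refine ⟨K, hK, fun w hm => ?_⟩
  exact (sqrt_tsum_eLpNorm_le (one_le_conjExponent q) (conjExponent_lt_two hq) hm).trans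
    (timeNorm_le_ofReal_mul fun s => h _)

theorem IsSource.exists_stronglyMeasurable {F : ℝ → E n → ℂ} (hF : IsSource F) :
    ∃ G : ℝ → E n → ℂ, StronglyMeasurable (Function.uncurry G) ∧
      ∀ᵐ s : ℝ, F s =ᵐ[volume] G s :=
  ⟨fun s x => hF.1.mk _ (s, x), hF.1.stronglyMeasurable_mk, Measure.ae_ae_of_ae_prod hF.1.ae_eq_mk⟩

theorem IsSource.aemeasurable_eLpNorm {F : ℝ → E n → ℂ} (hF : IsSource F) (p : ℝ≥0∞) :
    AEMeasurable fun s => eLpNorm (F s) p volume := by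
  obtain ⟨G, hG, he⟩ := hF.exists_stronglyMeasurable
  exact ⟨_, measurable_eLpNorm_prod hG p, he.mono fun s hs => eLpNorm_congr_ae hs⟩

/-- Fourier multipliers commute with integrals over a parameter. -/
theorem mul_integral_eq (hn : n ≤ 3) {b : ℝ → ℂ} (hb : IsSym b) {α : Type*} [MeasurableSpace α]
    {μ : Measure α} [SFinite μ] {V : α → E n → ℂ} (hV : StronglyMeasurable (Function.uncurry V))
    {M : ℝ≥0∞} (hM : M ≠ ⊤) (h : ∀ x, ∫⁻ s, ‖V s x‖ₑ ∂μ ≤ M) (x : E n) :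
    mul n b (fun x => ∫ s, V s x ∂μ) x = ∫ s, mul n b (V s) x ∂μ := by
  simp only [mul_apply]
  rw [integral_integral_swap]
  · simp only [integral_const_mul]
  · have hm : AEStronglyMeasurable (Function.uncurry fun (s : α) z =>
        kernel n b z * V s (x - z)) (μ.prod volume) :=
      ((hb.continuous_kernel.stronglyMeasurable.comp_measurable measurable_snd).mul
        (hV.comp_measurable (g := fun z : α × E n => (z.1, x - z.2)) (by fun_prop))).aestronglyMeasurable
    refine ⟨hm, ?_⟩
    rw [hasFiniteIntegral_iff_enorm, lintegral_prod_symm _ hm.enorm]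
    refine lt_of_le_of_lt (b := ∫⁻ z : E n, ‖kernel n b z‖ₑ * M) (lintegral_mono fun z => ?_) ?_
    · simp only [Function.uncurry, enorm_mul]
      rw [lintegral_const_mul' _ _ enorm_ne_top]
      exact mul_le_mul_right (h _) _
    · rw [lintegral_mul_const' _ _ hM]
      exact ENNReal.mul_lt_top (hb.integrable_kernel hn).2 hM.lt_top

/-- The Duhamel integral over the times `s ∈ S t`. -/
def duhamel (n : ℕ) (g : ℝ → ℝ) (δ : ℝ) (S : ℝ → Set ℝ) (F : ℝ → E n → ℂ) (m : ℝ → ℂ) (t : ℝ)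
    (x : E n) : ℂ :=
  ∫ s in S t, mul n (fun y => phase g δ (t - s) y * m y) (F s) x

theorem duhamel_congr_ae {F G : ℝ → E n → ℂ} (h : ∀ᵐ s : ℝ, F s =ᵐ[volume] G s) (S : ℝ → Set ℝ)
    (m : ℝ → ℂ) : duhamel n g δ S F m = duhamel n g δ S G m := by
  ext t x
  refine integral_congr_ae (ae_restrict_of_ae ?_)
  filter_upwards [h] with s hs
  rw [mul_congr_ae hs]

theorem IsSym.stronglyMeasurable_duhamel (hg : ContDiffOn ℝ 2 g (Ioi 0)) (hδ : 0 < δ) {m : ℝ → ℂ}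
    (h : IsSym m) {S : ℝ → Set ℝ} (hS : MeasurableSet {z : ℝ × ℝ | z.1 ∈ S z.2})
    {F : ℝ → E n → ℂ} (hF : IsSource F) :
    StronglyMeasurable (Function.uncurry (duhamel n g δ S F m)) := by
  obtain ⟨G, hG, he⟩ := hF.exists_stronglyMeasurable
  rw [duhamel_congr_ae he]
  have h1 : StronglyMeasurable fun z : (ℝ × ℝ) × E n =>
      mul n (fun y => phase g δ (z.1.2 - z.1.1) y * m y) (G z.1.1) z.2 :=
    h.stronglyMeasurable_mul_phase hg hδ (τ := fun z : ℝ × ℝ => z.2 - z.1) (by fun_prop)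
      (v := fun z => G z.1)
      (hG.comp_measurable (g := fun z : (ℝ × ℝ) × E n => (z.1.1, z.2)) (by fun_prop))
  have h2 : StronglyMeasurable fun z : ℝ × (ℝ × E n) => {z : ℝ × (ℝ × E n) | z.1 ∈ S z.2.1}.indicator
      (fun z => mul n (fun y => phase g δ (z.2.1 - z.1) y * m y) (G z.1) z.2.2) z :=
    (h1.comp_measurable (g := fun z : ℝ × (ℝ × E n) => ((z.1, z.2.1), z.2.2))
      (by fun_prop)).indicator (hS.preimage (f := fun z : ℝ × (ℝ × E n) => (z.1, z.2.1)) (by fun_prop))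
  have h3 := stronglyMeasurable_integral_swap (μ := volume) (V := fun (s : ℝ) (w : ℝ × E n) =>
    {z : ℝ × (ℝ × E n) | z.1 ∈ S z.2.1}.indicator
      (fun z => mul n (fun y => phase g δ (z.2.1 - z.1) y * m y) (G z.1) z.2.2) (s, w)) h2
  have e : Function.uncurry (duhamel n g δ S G m) = fun w : ℝ × E n => ∫ s : ℝ,
      {z : ℝ × (ℝ × E n) | z.1 ∈ S z.2.1}.indicator
      (fun z => mul n (fun y => phase g δ (z.2.1 - z.1) y * m y) (G z.1) z.2.2) (s, w) := by
    ext ⟨t, x⟩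
    have hSt : MeasurableSet (S t) := hS.preimage (f := fun s : ℝ => (s, t)) (by fun_prop)
    show ∫ s in S t, mul n (fun y => phase g δ (t - s) y * m y) (G s) x = _
    rw [← integral_indicator hSt]
    rfl
  rw [e]
  exact h3

theorem mul_duhamel (hn : n ≤ 3) (hg : ContDiffOn ℝ 2 g (Ioi 0)) (hδ : 0 < δ) {m b : ℝ → ℂ}
    (h : IsSym m) (hb : IsSym b) {S : ℝ → Set ℝ}
    {F : ℝ → E n → ℂ} (hF : IsSource F) {M : ℝ≥0∞} (hM : M ≠ ⊤) (t : ℝ)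
    (hle : ∀ x, ∫⁻ s, ‖mul n (fun y => phase g δ (t - s) y * m y) (F s) x‖ₑ ≤ M) :
    mul n b (duhamel n g δ S F m t) = duhamel n g δ S F (fun y => b y * m y) t := by
  obtain ⟨G, hG, he⟩ := hF.exists_stronglyMeasurable
  have hV := h.stronglyMeasurable_mul_phase hg hδ (τ := fun s : ℝ => t - s) (by fun_prop) hG
  ext x
  rw [duhamel_congr_ae he]
  refine (mul_integral_eq hn hb (μ := volume.restrict (S t)) hV hM (fun x => ?_) x).trans ?_
  · refine (setLIntegral_le_lintegral _ _).trans (le_trans (le_of_eq ?_) (hle x))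
    refine lintegral_congr_ae ?_
    filter_upwards [he] with s hs
    rw [mul_congr_ae hs]
  · refine integral_congr_ae (ae_restrict_of_ae ?_)
    filter_upwards [he, hF.2] with s hs ⟨p, hp, hsF⟩
    rw [mul_mul_eq hn hb (h.phase_mul hg hδ (t - s)) hp (hsF.ae_eq hs)]
    simp only [mul_left_comm, mul_congr_ae hs]

theorem isSym_mul_Q (hφ : IsBump φ₀) {M : ℝ → ℂ} (hM : ContDiffOn ℝ 2 M (Ioi 0)) (j : ℤ) :
    IsSym fun y => M y * (Q φ₀ j y : ℂ) := IsSym.mul_left hM (hφ.isSym_Q j)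

theorem wideSym_mul_mul_Q (hφ : IsBump φ₀) (M : ℝ → ℂ) (j : ℤ) (y : ℝ) :
    wideSym φ₀ ((2 : ℝ) ^ (-j) * y) * (M y * (Q φ₀ j y : ℂ)) = M y * (Q φ₀ j y : ℂ) := by
  rw [mul_left_comm, wideSym_mul_Q hφ]

theorem isPieces_mul (hφ : IsBump φ₀) (hn : n ≤ 3) {M : ℝ → ℂ} (hM : ContDiffOn ℝ 2 M (Ioi 0))
    {p : ℝ≥0∞} (hp : 1 ≤ p) {f : E n → ℂ} (hf : MemLp f p volume) :
    IsPieces φ₀ fun j => mul n (fun y => M y * (Q φ₀ j y : ℂ)) f where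
  meas j := (isSym_mul_Q hφ hM j).aestronglyMeasurable_mul hf.1
  compat l j := by
    rw [mul_mul_eq hn (hφ.isSym_Q l) (isSym_mul_Q hφ hM j) hp hf,
      mul_mul_eq hn (hφ.isSym_Q j) (isSym_mul_Q hφ hM l) hp hf]
    refine Filter.EventuallyEq.of_eq (mul_congr (fun y _ => ?_) ?_) <;> ring
  loc j := by
    rw [mul_mul_eq hn ((isSym_wideSym hφ).dilate (by positivity)) (isSym_mul_Q hφ hM j) hp hf]
    simp only [wideSym_mul_mul_Q hφ]
    rfl

/-- By absolute convergence multipliers pass under the time integral, so compatibility and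
localisation reduce to identities between symbols. -/
theorem isPieces_duhamel (hφ : IsBump φ₀) (hn : n ≤ 3) (hg : ContDiffOn ℝ 2 g (Ioi 0)) (hδ : 0 < δ)
    {M : ℝ → ℂ} (hM : ContDiffOn ℝ 2 M (Ioi 0)) {S : ℝ → Set ℝ}
    (hS : MeasurableSet {z : ℝ × ℝ | z.1 ∈ S z.2}) {F : ℝ → E n → ℂ} (hF : IsSource F) (t : ℝ)
    (hle : ∀ j, ∃ A : ℝ≥0∞, A ≠ ⊤ ∧ ∀ x,
      ∫⁻ s, ‖mul n (fun y => phase g δ (t - s) y * (M y * (Q φ₀ j y : ℂ))) (F s) x‖ₑ ≤ A) :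
    IsPieces φ₀ fun j => duhamel n g δ S F (fun y => M y * (Q φ₀ j y : ℂ)) t where
  meas j := (((isSym_mul_Q hφ hM j).stronglyMeasurable_duhamel hg hδ hS hF).comp_measurable
    measurable_prodMk_left).aestronglyMeasurable
  compat l j := by
    obtain ⟨A, hA, h⟩ := hle j
    obtain ⟨A', hA', h'⟩ := hle l
    rw [mul_duhamel hn hg hδ (isSym_mul_Q hφ hM j) (hφ.isSym_Q l) hF hA t h,
      mul_duhamel hn hg hδ (isSym_mul_Q hφ hM l) (hφ.isSym_Q j) hF hA' t h']
    have e : (fun y => (Q φ₀ l y : ℂ) * (M y * (Q φ₀ j y : ℂ))) =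
        fun y => (Q φ₀ j y : ℂ) * (M y * (Q φ₀ l y : ℂ)) := by ext y; ring
    rw [e]
  loc j := by
    obtain ⟨A, hA, h⟩ := hle j
    rw [mul_duhamel hn hg hδ (isSym_mul_Q hφ hM j) ((isSym_wideSym hφ).dilate (by positivity))
      hF hA t h]
    simp only [wideSym_mul_mul_Q hφ]
    rfl

end Dispersive

/-! ### The cut-off χ and the weight -/

namespace Dispersive

/-- The symbol of `χ(δ|D|) Q_j(|D|)`. -/
def cutDyadic (φ₀ : ℝ → ℝ) (χ : ℝ → ℂ) (δ : ℝ) (j : ℤ) (y : ℝ) : ℂ := χ (δ * y) * (Q φ₀ j y : ℂ)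

/-- The symbol of `Q_k(δ|D|) χ(δ|D|) Q_j(|D|)`. -/
def cutBlock (φ₀ : ℝ → ℝ) (χ : ℝ → ℂ) (δ : ℝ) (j k : ℤ) (y : ℝ) : ℂ :=
  (Q φ₀ k (δ * y) : ℂ) * cutDyadic φ₀ χ δ j y

variable {n : ℕ} {φ₀ g : ℝ → ℝ} {χ : ℝ → ℂ} {J : Set ℝ}

theorem pieces_cutSym (δ τ : ℝ) (u : E n → ℂ) (j : ℤ) :
    pieces n φ₀ (cutSym g χ δ τ) u j = mul n (fun y => phase g δ τ y * cutDyadic φ₀ χ δ j y) u := by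
  simp only [pieces, cutSym, cutDyadic, mul_assoc]

theorem contDiffOn_comp_dilate (hχ : ContDiffOn ℝ ∞ χ (Ioi 0)) {δ : ℝ} (hδ : 0 < δ) :
    ContDiffOn ℝ 2 (fun y => χ (δ * y)) (Ioi 0) :=
  (contDiffOn_infty.1 hχ 2).comp (contDiff_const.mul contDiff_id).contDiffOn
    fun _ hy => mul_pos hδ hy

theorem contDiffOn_ofReal_rpow (a : ℝ) : ContDiffOn ℝ 2 (fun y : ℝ => ((y ^ a : ℝ) : ℂ)) (Ioi 0) :=
  Complex.ofRealCLM.contDiff.comp_contDiffOn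
    (contDiffOn_id.rpow_const_of_ne fun _ hy => (mem_Ioi.1 hy).ne')

theorem isSym_cutDyadic (hφ : IsBump φ₀) (hχ : ContDiffOn ℝ ∞ χ (Ioi 0)) {δ : ℝ} (hδ : 0 < δ)
    (j : ℤ) : IsSym (cutDyadic φ₀ χ δ j) := isSym_mul_Q hφ (contDiffOn_comp_dilate hχ hδ) j

theorem isSym_cutBlock (hφ : IsBump φ₀) (hχ : ContDiffOn ℝ ∞ χ (Ioi 0)) {δ : ℝ} (hδ : 0 < δ)
    (j k : ℤ) : IsSym (cutBlock φ₀ χ δ j k) :=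
  (hφ.isSym_blockProj k hδ).mul_right (isSym_cutDyadic hφ hχ hδ j).contDiffOn

theorem contDiffOn_weightSym (hχ : ContDiffOn ℝ ∞ χ (Ioi 0)) {δ : ℝ} (hδ : 0 < δ) (a : ℝ) :
    ContDiffOn ℝ 2 (weightSym χ δ a) (Ioi 0) :=
  (contDiffOn_ofReal_rpow a).mul (contDiffOn_comp_dilate hχ hδ)

/-- At most four blocks meet a dyadic annulus. -/
theorem exists_finset_tsum_Q_eq (hφ : IsBump φ₀) (J : Set ℝ) {δ : ℝ} (hδ : 0 < δ) (j : ℤ) :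
    ∃ s : Finset ℤ, s.card ≤ 4 ∧ (∀ k ∈ s, k ∈ ZJ J) ∧ ∀ y, 0 < y → Q φ₀ j y ≠ 0 →
      ∑' k : ZJ J, Q φ₀ k (δ * y) = ∑ k ∈ s, Q φ₀ k (δ * y) := by
  classical
  have hY : 0 < δ * 2 ^ j := by positivity
  -- With 2^{k₀} ≤ δ 2^j < 2^{k₀+1}, the dilated support of Q_j lies between 3/5 and 16/5 times
  -- 2^{k₀}; it can meet the support of Q_k, between 3/5 and 8/5 times 2^k, only for k from k₀ - 1
  -- to k₀ + 2.
  obtain ⟨k₀, hk₀⟩ : ∃ k₀, k₀ = Int.log 2 (δ * 2 ^ j) := ⟨_, rfl⟩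
  have h1 : (2 : ℝ) ^ k₀ ≤ δ * 2 ^ j := by
    rw [hk₀]; exact_mod_cast Int.zpow_log_le_self one_lt_two hY
  have h2 : δ * 2 ^ j < (2 : ℝ) ^ (k₀ + 1) := by
    rw [hk₀]; exact_mod_cast Int.lt_zpow_succ_log_self one_lt_two (δ * 2 ^ j)
  refine ⟨(Finset.Icc (k₀ - 1) (k₀ + 2)).filter (· ∈ ZJ J), (Finset.card_filter_le _ _).trans ?_,
    fun k hk => (Finset.mem_filter.1 hk).2, fun y hy hQ => ?_⟩
  · rw [Int.card_Icc]; omega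
  rw [tsum_subtype (ZJ J) fun k => Q φ₀ k (δ * y), Finset.sum_filter,
    tsum_eq_sum (s := Finset.Icc (k₀ - 1) (k₀ + 2))]
  · exact Finset.sum_congr rfl fun k _ => by rw [indicator_apply]
  intro k hk
  rw [indicator_apply_eq_zero]
  intro _
  by_contra h0
  refine hk (Finset.mem_Icc.2 ?_)
  have h3 := hφ.Q_ne_zero hQ
  have h4 := hφ.Q_ne_zero h0
  have hj : (0 : ℝ) < 2 ^ j := by positivity
  have hkp : (0 : ℝ) < 2 ^ k := by positivity
  rw [abs_of_pos hy, le_div_iff₀ hj, div_le_iff₀ hj] at h3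
  rw [abs_of_pos (by positivity), le_div_iff₀ hkp, div_le_iff₀ hkp] at h4
  have h5 := mul_le_mul_of_nonneg_left h3.1 hδ.le
  have h6 := mul_le_mul_of_nonneg_left h3.2 hδ.le
  constructor
  · by_contra hlt
    have h7 : (2 : ℝ) ^ (k + 2) ≤ 2 ^ k₀ := zpow_le_zpow_right₀ one_le_two (by omega)
    rw [zpow_add₀ two_ne_zero] at h7
    norm_num at h7
    nlinarith
  · by_contra hlt
    have h7 : (2 : ℝ) ^ (k₀ + 1) * 2 ^ (2 : ℤ) ≤ 2 ^ k := by
      rw [← zpow_add₀ two_ne_zero]; exact zpow_le_zpow_right₀ one_le_two (by omega)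
    norm_num at h7
    nlinarith

theorem exists_cutDyadic_eq_sum (hφ : IsBump φ₀)
    (hχJ : ∀ y : ℝ, 0 < y → χ y * ((∑' k : ZJ J, Q φ₀ k y : ℝ) : ℂ) = χ y) {δ : ℝ} (hδ : 0 < δ)
    (j : ℤ) : ∃ s : Finset ℤ, s.card ≤ 4 ∧ (∀ k ∈ s, k ∈ ZJ J) ∧ ∀ y, 0 ≤ y →
      cutDyadic φ₀ χ δ j y = ∑ k ∈ s, cutBlock φ₀ χ δ j k y := by
  obtain ⟨s, hs, hsJ, h⟩ := exists_finset_tsum_Q_eq hφ J hδ j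
  refine ⟨s, hs, hsJ, fun y hy => ?_⟩
  simp only [cutBlock]
  rw [← Finset.sum_mul, ← Complex.ofReal_sum]
  by_cases h0 : Q φ₀ j y = 0
  · simp [cutDyadic, h0]
  have hy0 : 0 < y := by
    refine lt_of_le_of_ne hy fun h1 => h0 ?_
    rw [← h1]
    exact_mod_cast (hφ.isSym_Q j).apply_zero
  rw [← h y hy0 h0, cutDyadic, ← mul_assoc, mul_comm _ (χ _), hχJ _ (mul_pos hδ hy0)]

theorem mul_cutDyadic_eq_sum (hφ : IsBump φ₀) (hn : n ≤ 3) (hg : ContDiffOn ℝ 2 g (Ioi 0))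
    (hχ : ContDiffOn ℝ ∞ χ (Ioi 0)) {δ : ℝ} (hδ : 0 < δ) {j : ℤ} {s : Finset ℤ}
    (hs : ∀ y, 0 ≤ y → cutDyadic φ₀ χ δ j y = ∑ k ∈ s, cutBlock φ₀ χ δ j k y) {p : ℝ≥0∞}
    (hp : 1 ≤ p) {u : E n → ℂ} (hu : MemLp u p volume) (τ : ℝ) :
    mul n (fun y => phase g δ τ y * cutDyadic φ₀ χ δ j y) u =
      fun x => ∑ k ∈ s, mul n (fun y => phase g δ τ y * cutBlock φ₀ χ δ j k y) u x := by
  rw [← sum_mul_eq hn hp s (fun k _ => (isSym_cutBlock hφ hχ hδ j k).phase_mul hg hδ τ) hu]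
  refine mul_congr (fun y hy => ?_) ?_
  · rw [hs y hy.le, Finset.mul_sum]
  · rw [hs 0 le_rfl, Finset.mul_sum]

/-- The kernel of `Q_k(δ|D|) |D|^{-a}`. -/
theorem exists_kernel_weight_le (n : ℕ) (hn : n ≤ 3) (hφ : IsBump φ₀) (a : ℝ) :
    ∃ c : ℝ, 0 < c ∧ ∀ δ : ℝ, 0 < δ → ∀ k : ℤ,
      IsSym (fun y => blockProj φ₀ δ k y * ((y ^ (-a) : ℝ) : ℂ)) ∧
      eLpNorm (kernel n fun y => blockProj φ₀ δ k y * ((y ^ (-a) : ℝ) : ℂ)) 1 volume ≤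
        ENNReal.ofReal (c * (δ * 2 ^ (-k)) ^ a) := by
  obtain ⟨b, hb⟩ : ∃ b : ℝ → ℂ, b = fun y => (Q φ₀ 0 y : ℂ) * ((y ^ (-a) : ℝ) : ℂ) := ⟨_, rfl⟩
  have hbs : IsSym b := by
    rw [hb]; exact (hφ.isSym_Q 0).mul_right (contDiffOn_ofReal_rpow (-a))
  obtain ⟨c, hc⟩ : ∃ c, c = (eLpNorm (kernel n b) 1 volume).toReal := ⟨_, rfl⟩
  have hc0 : 0 ≤ c := by rw [hc]; exact ENNReal.toReal_nonneg
  refine ⟨c + 1, by positivity, fun δ hδ k =>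
    ⟨(hφ.isSym_blockProj k hδ).mul_right (contDiffOn_ofReal_rpow (-a)), ?_⟩⟩
  -- Q_k(δy) y^{-a} equals l^a b(l y), so dilation invariance leaves only the factor l^a.
  obtain ⟨l, hl⟩ : ∃ l : ℝ, l = δ * 2 ^ (-k) := ⟨_, rfl⟩
  have hl0 : 0 < l := by rw [hl]; positivity
  rw [← hl]
  have hQ : ∀ y, Q φ₀ k (δ * y) = Q φ₀ 0 (l * y) := fun y => by
    rw [Q_eq_dilate, hl]; congr 1; ring
  have hQ0 : (Q φ₀ 0 0 : ℂ) = 0 := (hφ.isSym_Q 0).apply_zero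
  have e : kernel n (fun y => blockProj φ₀ δ k y * ((y ^ (-a) : ℝ) : ℂ)) =
      fun x => ((l ^ a : ℝ) : ℂ) * kernel n (fun y => b (l * y)) x := by
    rw [← kernel_const_mul]
    refine kernel_congr (fun y hy => ?_) ?_
    · simp only [blockProj, hQ, hb]
      rw [Real.mul_rpow hl0.le hy.le, Real.rpow_neg hl0.le]
      push_cast
      have : ((l ^ a : ℝ) : ℂ) ≠ 0 := by exact_mod_cast (Real.rpow_pos_of_pos hl0 a).ne'
      field_simp
    · have hQk : (Q φ₀ k 0 : ℂ) = 0 := (hφ.isSym_Q k).apply_zero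
      simp only [blockProj, hb, mul_zero, hQ0, hQk, zero_mul]
  have e2 : (fun x : E n => ((l ^ a : ℝ) : ℂ) * kernel n (fun y => b (l * y)) x) =
      ((l ^ a : ℝ) : ℂ) • kernel n fun y => b (l * y) := rfl
  rw [e, e2, eLpNorm_const_smul, eLpNorm_one_kernel_dilate n b hl0, ← ofReal_norm,
    Complex.norm_real, Real.norm_of_nonneg (by positivity),
    ← ENNReal.ofReal_toReal (hbs.memLp_kernel (n := n) hn le_rfl).2.ne, ← hc,
    ← ENNReal.ofReal_mul (by positivity)]
  refine ENNReal.ofReal_le_ofReal ?_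
  have : 0 ≤ l ^ a := by positivity
  nlinarith

/-- The weight |D|^a is inserted and removed by |D|^{-a}; on a single block the latter is a harmless
convolution. -/
theorem mul_cutBlock_eq (hφ : IsBump φ₀) (hn : n ≤ 3) (hχ : ContDiffOn ℝ ∞ χ (Ioi 0)) {δ : ℝ}
    (hδ : 0 < δ) (a : ℝ) (j k : ℤ) {p : ℝ≥0∞} (hp : 1 ≤ p) {u : E n → ℂ} (hu : MemLp u p volume) :
    mul n (cutBlock φ₀ χ δ j k) u = mul n (fun y => blockProj φ₀ δ k y * ((y ^ (-a) : ℝ) : ℂ))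
      (pieces n φ₀ (weightSym χ δ a) u j) := by
  rw [pieces, mul_mul_eq hn ((hφ.isSym_blockProj k hδ).mul_right (contDiffOn_ofReal_rpow (-a)))
    (isSym_mul_Q hφ (contDiffOn_weightSym hχ hδ a) j) hp hu]
  have hQ0 : (Q φ₀ j 0 : ℂ) = 0 := (hφ.isSym_Q j).apply_zero
  refine mul_congr (fun y hy => ?_) ?_
  · have h1 : ((y ^ (-a) : ℝ) : ℂ) * ((y ^ a : ℝ) : ℂ) = 1 := by
      rw [← Complex.ofReal_mul, ← Real.rpow_add hy, neg_add_cancel, Real.rpow_zero, Complex.ofReal_one]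
    simp only [cutBlock, cutDyadic, blockProj, weightSym]
    linear_combination -((Q φ₀ k (δ * y) : ℂ) * (χ (δ * y) * (Q φ₀ j y : ℂ))) * h1
  · simp only [cutBlock, cutDyadic, hQ0, mul_zero]

theorem eLpNorm_mul_cutBlock_le (hφ : IsBump φ₀) (hn : n ≤ 3) (hχ : ContDiffOn ℝ ∞ χ (Ioi 0)) {δ : ℝ}
    (hδ : 0 < δ) {a c : ℝ} {j k : ℤ}
    (hc : eLpNorm (kernel n fun y => blockProj φ₀ δ k y * ((y ^ (-a) : ℝ) : ℂ)) 1 volume ≤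
        ENNReal.ofReal c) {p s : ℝ≥0∞} (hp : 1 ≤ p) (hs : 1 ≤ s) {u : E n → ℂ}
    (hu : MemLp u p volume) : eLpNorm (mul n (cutBlock φ₀ χ δ j k) u) s volume ≤
      ENNReal.ofReal c * eLpNorm (pieces n φ₀ (weightSym χ δ a) u j) s volume := by
  rw [mul_cutBlock_eq hφ hn hχ hδ a j k hp hu]
  refine (eLpNorm_mul_le ((hφ.isSym_blockProj k hδ).mul_right (contDiffOn_ofReal_rpow (-a))) hs
    ((isSym_mul_Q hφ (contDiffOn_weightSym hχ hδ a) j).aestronglyMeasurable_mul hu.1)).trans ?_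
  exact mul_le_mul_left hc _

theorem mixedNorm_mul_cutBlock_le (hφ : IsBump φ₀) (hn : n ≤ 3)
    (hχ : ContDiffOn ℝ ∞ χ (Ioi 0)) {δ : ℝ} (hδ : 0 < δ) {a c : ℝ} {j k : ℤ}
    (hc : eLpNorm (kernel n fun y => blockProj φ₀ δ k y * ((y ^ (-a) : ℝ) : ℂ)) 1 volume ≤
        ENNReal.ofReal c) {q s : ℝ≥0∞} (hs : 1 ≤ s) {F : ℝ → E n → ℂ} (hF : IsSource F) :
    mixedNorm q s (fun t => mul n (cutBlock φ₀ χ δ j k) (F t)) ≤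
      ENNReal.ofReal c * mixedNorm q s (fun t => pieces n φ₀ (weightSym χ δ a) (F t) j) := by
  refine eLpNorm_le_mul_eLpNorm_of_ae_le_mul' (c := c.toNNReal) ?_ q
  filter_upwards [hF.2] with t ⟨p, hp, hu⟩
  exact eLpNorm_mul_cutBlock_le hφ hn hχ hδ hc hp hs hu

/-- The powers of 2^k cancel: removing the weight |D|^{γG} compensates exactly for the growth of the
dispersive constant, and the result is uniform over the blocks. -/
theorem dispersiveConst_rpow_mul {A β γ δ : ℝ} (hA : 0 < A) (hδ : 0 < δ) (k : ℤ) (G : ℝ) :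
    (A * (2 : ℝ) ^ (γ * (k : ℝ)) * δ ^ β) ^ G * (δ * 2 ^ (-k)) ^ (γ * G) =
      A ^ G * δ ^ ((β + γ) * G) := by
  rw [dispersiveConst_rpow hA hδ, Real.mul_rpow hδ.le (by positivity), ← Real.rpow_intCast,
    ← Real.rpow_mul zero_le_two, add_mul, Real.rpow_add hδ]
  have : (2 : ℝ) ^ (γ * G * (k : ℝ)) * 2 ^ (((-k : ℤ) : ℝ) * (γ * G)) = 1 := by
    rw [← Real.rpow_add zero_lt_two]
    push_cast
    rw [show γ * G * (k : ℝ) + -k * (γ * G) = 0 by ring, Real.rpow_zero]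
  linear_combination (A ^ G * δ ^ (β * G) * δ ^ (γ * G)) * this

end Dispersive

/-! ### From blocks to Littlewood-Paley pieces -/

namespace Dispersive

variable {n : ℕ} {φ₀ g : ℝ → ℝ} {χ : ℝ → ℂ} {J : Set ℝ} {σ β γ A B L δ : ℝ} {p : ℝ → ℤ → ℝ → ℂ}

theorem IsBlock.exists_lintegral_localized_le {D : ℝ} {p m : ℝ → ℂ} (hb : IsBlock n g δ p σ B L D)
    (hσ : σ ∈ Ioc (0 : ℝ) 1) {q r : ℝ≥0∞} (hqr : SharpAdmissible σ q r) (h : IsSym m)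
    (hm : ∀ y, 0 ≤ y → p y * m y = m y) {F : ℝ → E n → ℂ} (hF : IsSource F)
    (hfin : mixedNorm q.conjExponent r.conjExponent (fun s => mul n m (F s)) ≠ ⊤) :
    ∃ M : ℝ≥0∞, M ≠ ⊤ ∧ ∀ θ, IsTimeIso θ → ∀ x,
      ∫⁻ s, ‖mul n (fun y => phase g δ (θ s) y * m y) (F s) x‖ₑ ≤ M := by
  obtain ⟨w, hw, -, he, -⟩ := hb.exists_isNice h hm hqr.1 hF hfin
  obtain ⟨M, hM, hle⟩ := hb.exists_lintegral_enorm_mul_le hσ hqr hb.bd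
  refine ⟨_, ENNReal.mul_ne_top hM hw.fin, fun θ hθ x => le_trans (le_of_eq ?_) (hle w hw θ hθ x)⟩
  refine lintegral_congr_ae ?_
  filter_upwards [he] with s hs
  rw [hs]

theorem BlockFamily.mul_cutBlock (hfam : BlockFamily n φ₀ g J σ β γ p A B L) (hδ : 0 < δ) (j k : ℤ)
    (y : ℝ) (hy : 0 ≤ y) : p δ k y * cutBlock φ₀ χ δ j k y = cutBlock φ₀ χ δ j k y := by
  by_cases h0 : Q φ₀ k (δ * y) = 0
  · simp [cutBlock, h0]
  · rw [hfam.one δ hδ k y hy h0, one_mul]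

theorem mixedNorm_cutBlock_ne_top (hφ : IsBump φ₀) (hn : n ≤ 3) (hχ : ContDiffOn ℝ ∞ χ (Ioi 0))
    (hδ : 0 < δ) {a : ℝ} {j : ℤ} (k : ℤ) {q s : ℝ≥0∞} (hs : 1 ≤ s) {F : ℝ → E n → ℂ}
    (hF : IsSource F)
    (hfin : mixedNorm q s (fun t => pieces n φ₀ (weightSym χ δ a) (F t) j) ≠ ⊤) :
    mixedNorm q s (fun t => mul n (cutBlock φ₀ χ δ j k) (F t)) ≠ ⊤ := by
  obtain ⟨c, -, hc⟩ := exists_kernel_weight_le n hn hφ a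
  exact ne_top_of_le_ne_top (ENNReal.mul_ne_top ENNReal.ofReal_ne_top hfin)
    (mixedNorm_mul_cutBlock_le hφ hn hχ hδ (hc δ hδ k).2 hs hF)

/-- A piece is a sum of at most four blocks, each of which converges absolutely with a bound
independent of x and of the time isometry. -/
theorem BlockFamily.exists_lintegral_cutDyadic_le (hfam : BlockFamily n φ₀ g J σ β γ p A B L)
    (hφ : IsBump φ₀) (hn : n ≤ 3) (hg : ContDiffOn ℝ 2 g (Ioi 0)) (hσ : σ ∈ Ioc (0 : ℝ) 1)
    (hχ : ContDiffOn ℝ ∞ χ (Ioi 0))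
    (hχJ : ∀ y : ℝ, 0 < y → χ y * ((∑' k : ZJ J, Q φ₀ k y : ℝ) : ℂ) = χ y) (hδ : 0 < δ)
    {q r : ℝ≥0∞} (hqr : SharpAdmissible σ q r) {a : ℝ} {j : ℤ} {F : ℝ → E n → ℂ} (hF : IsSource F)
    (hfin : mixedNorm q.conjExponent r.conjExponent
      (fun s => pieces n φ₀ (weightSym χ δ a) (F s) j) ≠ ⊤) :
    (∃ M : ℝ≥0∞, M ≠ ⊤ ∧ ∀ θ, IsTimeIso θ → ∀ x,
      ∫⁻ s, ‖mul n (fun y => phase g δ (θ s) y * cutDyadic φ₀ χ δ j y) (F s) x‖ₑ ≤ M) ∧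
    ∀ θ, IsTimeIso θ → ∀ x, Integrable
      (fun s => mul n (fun y => phase g δ (θ s) y * cutDyadic φ₀ χ δ j y) (F s) x) volume := by
  obtain ⟨s, -, hsJ, hs⟩ := exists_cutDyadic_eq_sum hφ hχJ hδ j
  have hf := fun k => mixedNorm_cutBlock_ne_top hφ hn hχ hδ k (one_le_conjExponent r) hF hfin
  have hcs := isSym_cutBlock hφ hχ hδ j
  have hp := fun k => hfam.mul_cutBlock (χ := χ) hδ j k
  have hi : ∀ θ, IsTimeIso θ → ∀ x, ∀ k ∈ s, Integrable
      (fun s => mul n (fun y => phase g δ (θ s) y * cutBlock φ₀ χ δ j k y) (F s) x) volume :=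
    fun θ hθ x k hk => (hfam.block δ hδ k (hsJ k hk)).integrable_localized hσ hqr (hcs k)
      (hp k) hF (hf k) hθ x
  have he : ∀ θ : ℝ → ℝ, ∀ x, (fun s => mul n (fun y => phase g δ (θ s) y * cutDyadic φ₀ χ δ j y)
      (F s) x) =ᵐ[volume] fun t => ∑ k ∈ s, mul n (fun y => phase g δ (θ t) y *
        cutBlock φ₀ χ δ j k y) (F t) x := fun θ x => by
    filter_upwards [hF.2] with t ⟨p, hp, hu⟩
    exact congrFun (mul_cutDyadic_eq_sum hφ hn hg hχ hδ hs hp hu (θ t)) x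
  refine ⟨?_, fun θ hθ x => (integrable_finsetSum s (hi θ hθ x)).congr (he θ x).symm⟩
  have hM : ∀ k, ∃ M : ℝ≥0∞, M ≠ ⊤ ∧ (k ∈ s → ∀ θ, IsTimeIso θ → ∀ x,
      ∫⁻ s, ‖mul n (fun y => phase g δ (θ s) y * cutBlock φ₀ χ δ j k y) (F s) x‖ₑ ≤ M) := fun k => by
    by_cases hk : k ∈ s
    · obtain ⟨M, hM, h⟩ := (hfam.block δ hδ k (hsJ k hk)).exists_lintegral_localized_le hσ hqr
        (hcs k) (hp k) hF (hf k)
      exact ⟨M, hM, fun _ => h⟩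
    · exact ⟨0, by simp, fun h => absurd h hk⟩
  choose M hM hle using hM
  refine ⟨∑ k ∈ s, M k, ENNReal.sum_ne_top.2 fun k _ => hM k, fun θ hθ x => ?_⟩
  calc _ ≤ ∫⁻ t, ∑ k ∈ s, ‖mul n (fun y => phase g δ (θ t) y * cutBlock φ₀ χ δ j k y) (F t) x‖ₑ := by
        refine lintegral_mono_ae ?_
        filter_upwards [he θ x] with t ht
        rw [ht]
        exact enorm_sum_le _ _
    _ = ∑ k ∈ s, ∫⁻ t, ‖mul n (fun y => phase g δ (θ t) y * cutBlock φ₀ χ δ j k y) (F t) x‖ₑ :=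
        lintegral_finsetSum' _ fun k hk => (hi θ hθ x k hk).1.enorm
    _ ≤ _ := Finset.sum_le_sum fun k hk => hle k hk θ hθ x

theorem sum_le_ofReal_four_mul {s : Finset ℤ} (hs : s.card ≤ 4) {f : ℤ → ℝ≥0∞} {K : ℝ} {X : ℝ≥0∞}
    (h : ∀ k ∈ s, f k ≤ ENNReal.ofReal K * X) : ∑ k ∈ s, f k ≤ ENNReal.ofReal (4 * K) * X := by
  calc ∑ k ∈ s, f k ≤ s.card • (ENNReal.ofReal K * X) := Finset.sum_le_card_nsmul _ _ _ h
    _ ≤ 4 • (ENNReal.ofReal K * X) := nsmul_le_nsmul_left bot_le hs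
    _ = _ := by
        rw [ENNReal.ofReal_mul (by norm_num), nsmul_eq_mul, ← mul_assoc]
        norm_num

theorem four_const_mul_le {c c₁ G : ℝ} (hc : 0 ≤ c) (hA : 0 < A) (hδ : 0 < δ) (k : ℤ)
    {x y z : ℝ≥0∞} (h₁ : x ≤ ENNReal.ofReal (c * (A * (2 : ℝ) ^ (γ * (k : ℝ)) * δ ^ β) ^ G) * y)
    (h₂ : y ≤ ENNReal.ofReal (c₁ * (δ * 2 ^ (-k)) ^ (γ * G)) * z) :
    x ≤ ENNReal.ofReal (c * c₁ * A ^ G * δ ^ ((β + γ) * G)) * z := by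
  refine h₁.trans ((mul_le_mul_right h₂ _).trans (le_of_eq ?_))
  rw [← mul_assoc, ← ENNReal.ofReal_mul (by positivity)]
  congr 2
  rw [mul_assoc _ (A ^ G), ← dispersiveConst_rpow_mul hA hδ k]
  ring

/-- From the estimates on the blocks to the estimates on the Littlewood-Paley pieces. -/
theorem BlockFamily.exists_duhamel_cutDyadic_le (hfam : BlockFamily n φ₀ g J σ β γ p A B L)
    (hφ : IsBump φ₀) (hn : n ≤ 3) (hg : ContDiffOn ℝ 2 g (Ioi 0)) (hσ : σ ∈ Ioc (0 : ℝ) 1)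
    (hχ : ContDiffOn ℝ ∞ χ (Ioi 0))
    (hχJ : ∀ y : ℝ, 0 < y → χ y * ((∑' k : ZJ J, Q φ₀ k y : ℝ) : ℂ) = χ y)
    {q r : ℝ≥0∞} (hqr : SharpAdmissible σ q r) {S : ℝ → Set ℝ}
    (hS : MeasurableSet {z : ℝ × ℝ | z.1 ∈ S z.2}) {Φ : (ℝ → E n → ℂ) → ℝ≥0∞}
    (hΦ : ∀ (s : Finset ℤ) (U : ℤ → ℝ → E n → ℂ), (∀ k, StronglyMeasurable (Function.uncurry (U k))) →
      Φ (fun t x => ∑ k ∈ s, U k t x) ≤ ∑ k ∈ s, Φ (U k)) {c G : ℝ} (hc : 0 < c)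
    (hest : ∀ δ, 0 < δ → ∀ k ∈ ZJ J, ∀ m, IsSym m → (∀ y, 0 ≤ y → p δ k y * m y = m y) →
      ∀ F : ℝ → E n → ℂ, IsSource F → Φ (duhamel n g δ S F m) ≤
        ENNReal.ofReal (c * (A * (2 : ℝ) ^ (γ * (k : ℝ)) * δ ^ β) ^ G) *
          mixedNorm q.conjExponent r.conjExponent (fun s => mul n m (F s))) :
    ∃ c' : ℝ, 0 < c' ∧ ∀ δ, 0 < δ → ∀ F : ℝ → E n → ℂ, IsSource F → ∀ j,
      Φ (duhamel n g δ S F (cutDyadic φ₀ χ δ j)) ≤ ENNReal.ofReal (c' * δ ^ ((β + γ) * G)) *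
        mixedNorm q.conjExponent r.conjExponent
          (fun s => pieces n φ₀ (weightSym χ δ (γ * G)) (F s) j) := by
  -- Only finite subadditivity of Φ matters. It is the mixed norm for the Duhamel integrals, and the
  -- L^2 norm of the value at t = 0 for the dual estimate.
  obtain ⟨c₁, hc₁, hk⟩ := exists_kernel_weight_le n hn hφ (γ * G)
  have hA := hfam.posA
  refine ⟨4 * (c * c₁ * A ^ G), by positivity, fun δ hδ F hF j => ?_⟩
  rcases eq_or_ne (mixedNorm q.conjExponent r.conjExponent
      (fun s => pieces n φ₀ (weightSym χ δ (γ * G)) (F s) j)) ⊤ with ht | ht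
  · rw [ht, ENNReal.mul_top]
    · exact le_top
    · rw [ne_eq, ENNReal.ofReal_eq_zero, not_le]; positivity
  obtain ⟨s, hs4, hsJ, hs⟩ := exists_cutDyadic_eq_sum hφ hχJ hδ j
  have hf := fun k => mixedNorm_cutBlock_ne_top hφ hn hχ hδ k (one_le_conjExponent r) hF ht
  have hcs := isSym_cutBlock hφ hχ hδ j
  have hp := fun k => hfam.mul_cutBlock (χ := χ) hδ j k
  have e : duhamel n g δ S F (cutDyadic φ₀ χ δ j) =
      fun t x => ∑ k ∈ s, duhamel n g δ S F (cutBlock φ₀ χ δ j k) t x := by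
    ext t x
    simp only [duhamel]
    rw [← integral_finsetSum]
    · refine integral_congr_ae (ae_restrict_of_ae ?_)
      filter_upwards [hF.2] with s' ⟨p, hp, hu⟩
      exact congrFun (mul_cutDyadic_eq_sum hφ hn hg hχ hδ hs hp hu (t - s')) x
    · exact fun k hk => ((hfam.block δ hδ k (hsJ k hk)).integrable_localized hσ hqr (hcs k)
        (hp k) hF (hf k) (isTimeIso_sub t) x).integrableOn
  rw [e, mul_assoc 4]
  refine (hΦ s _ fun k => (hcs k).stronglyMeasurable_duhamel hg hδ hS hF).trans ?_
  refine sum_le_ofReal_four_mul hs4 fun k hks => ?_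
  exact four_const_mul_le hc.le hA hδ k (hest δ hδ k (hsJ k hks) _ (hcs k) (hp k) F hF)
    (mixedNorm_mul_cutBlock_le hφ hn hχ hδ (hk δ hδ k).2 (one_le_conjExponent r) hF)

theorem mixedNorm_sum_le {q r : ℝ≥0∞} (hq : 1 ≤ q) (hr : 1 ≤ r) (s : Finset ℤ)
    {U : ℤ → ℝ → E n → ℂ} (hU : ∀ k, StronglyMeasurable (Function.uncurry (U k))) :
    mixedNorm q r (fun t x => ∑ k ∈ s, U k t x) ≤ ∑ k ∈ s, mixedNorm q r (U k) := by
  have h1 : mixedNorm q r (fun t x => ∑ k ∈ s, U k t x) ≤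
      eLpNorm (∑ k ∈ s, fun t => eLpNorm (U k t) r volume) q volume := by
    refine eLpNorm_mono_enorm fun t => ?_
    simp only [enorm_eq_self, Finset.sum_apply]
    have e : (fun x => ∑ k ∈ s, U k t x) = ∑ k ∈ s, U k t := by ext x; simp
    rw [e]
    exact eLpNorm_sum_le (fun k _ =>
      ((hU k).comp_measurable measurable_prodMk_left).aestronglyMeasurable) hr
  exact h1.trans (eLpNorm_sum_le (fun k _ =>
    (measurable_eLpNorm_prod (hU k) r).aestronglyMeasurable) hq)

theorem BlockFamily.exists_homogeneous_cutDyadic_le (hfam : BlockFamily n φ₀ g J σ β γ p A B L)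
    (hφ : IsBump φ₀) (hn : n ≤ 3) (hg : ContDiffOn ℝ 2 g (Ioi 0)) (hσ : σ ∈ Ioc (0 : ℝ) 1)
    (hχ : ContDiffOn ℝ ∞ χ (Ioi 0))
    (hχJ : ∀ y : ℝ, 0 < y → χ y * ((∑' k : ZJ J, Q φ₀ k y : ℝ) : ℂ) = χ y)
    {q r : ℝ≥0∞} (hqr : SharpAdmissible σ q r) :
    ∃ c : ℝ, 0 < c ∧ ∀ δ, 0 < δ → ∀ f : E n → ℂ, MemLp f 2 volume → ∀ j,
      mixedNorm q r (fun t => mul n (fun y => phase g δ t y * cutDyadic φ₀ χ δ j y) f) ≤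
        ENNReal.ofReal (c * δ ^ ((β + γ) * gap r)) *
          eLpNorm (pieces n φ₀ (weightSym χ δ (γ * gap r)) f j) 2 volume := by
  obtain ⟨c, hc, hest⟩ := exists_homogeneous_localized_le n hσ hqr hfam.posB hfam.posL
  obtain ⟨c₁, hc₁, hk⟩ := exists_kernel_weight_le n hn hφ (γ * gap r)
  have hA := hfam.posA
  refine ⟨4 * (c * c₁ * A ^ gap r), by positivity, fun δ hδ f hf j => ?_⟩
  obtain ⟨s, hs4, hsJ, hs⟩ := exists_cutDyadic_eq_sum hφ hχJ hδ j
  have hcs := isSym_cutBlock hφ hχ hδ j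
  have hp := fun k => hfam.mul_cutBlock (χ := χ) hδ j k
  simp only [mul_cutDyadic_eq_sum hφ hn hg hχ hδ hs one_le_two hf]
  rw [mul_assoc 4]
  refine (mixedNorm_sum_le (one_le_of_two_le hqr.1) (one_le_of_two_le hqr.2.1) s
    (U := fun k t => mul n (fun y => phase g δ t y * cutBlock φ₀ χ δ j k y) f) fun k => ?_).trans ?_
  · have e : (fun t => mul n (fun y => phase g δ t y * cutBlock φ₀ χ δ j k y) f) =
        fun t => mul n (fun y => phase g δ t y * cutBlock φ₀ χ δ j k y) (hf.1.mk f) := by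
      ext t : 1; exact mul_congr_ae hf.1.ae_eq_mk
    rw [e]
    exact (hcs k).stronglyMeasurable_mul_phase hg hδ (τ := fun t : ℝ => t) measurable_id
      (v := fun _ => hf.1.mk f) (hf.1.stronglyMeasurable_mk.comp_measurable measurable_snd)
  · refine sum_le_ofReal_four_mul hs4 fun k hks => ?_
    exact four_const_mul_le hc.le hA hδ k
      (hest (hfam.block δ hδ k (hsJ k hks)) _ (hcs k) (hp k) f hf)
      (eLpNorm_mul_cutBlock_le hφ hn hχ hδ (hk δ hδ k).2 one_le_two one_le_two hf)

end Dispersive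

/-! ### The summed estimates -/

namespace Dispersive

theorem sqrt_tsum_le_ofReal_mul {K : ℝ} {X Y : ℤ → ℝ≥0∞} (h : ∀ j, Y j ≤ ENNReal.ofReal K * X j) :
    (∑' j, Y j ^ 2) ^ (1 / 2 : ℝ) ≤ ENNReal.ofReal K * (∑' j, X j ^ 2) ^ (1 / 2 : ℝ) := by
  calc _ ≤ (ENNReal.ofReal K ^ 2 * ∑' j, X j ^ 2) ^ (1 / 2 : ℝ) := by
        rw [← ENNReal.tsum_mul_left]
        refine ENNReal.rpow_le_rpow (ENNReal.tsum_le_tsum fun j => ?_) (by norm_num)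
        rw [← mul_pow]
        exact pow_le_pow_left' (h j) 2
    _ = _ := by rw [ENNReal.mul_rpow_of_nonneg _ _ (by norm_num), sq_rpow_half]

theorem le_sqrt_tsum (X : ℤ → ℝ≥0∞) (j : ℤ) : X j ≤ (∑' j, X j ^ 2) ^ (1 / 2 : ℝ) := by
  conv_lhs => rw [← sq_rpow_half (X j)]
  exact ENNReal.rpow_le_rpow (ENNReal.le_tsum j) (by norm_num)

theorem ofReal_mul_three {a b c x : ℝ} (ha : 0 ≤ a) (hb : 0 ≤ b) (hx : 0 ≤ x) (z : ℝ≥0∞) :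
    ENNReal.ofReal a * (ENNReal.ofReal (b * x) * (ENNReal.ofReal c * z)) =
      ENNReal.ofReal (a * b * c * x) * z := by
  rw [← mul_assoc (ENNReal.ofReal (b * x)), ← mul_assoc, ← ENNReal.ofReal_mul (by positivity),
    ← ENNReal.ofReal_mul ha]
  congr 2; ring

variable {n : ℕ} {φ₀ g : ℝ → ℝ} {χ : ℝ → ℂ} {J : Set ℝ} {σ β γ A B L δ : ℝ} {p : ℝ → ℤ → ℝ → ℂ}

theorem duhamel_univ (F : ℝ → E n → ℂ) (m : ℝ → ℂ) (t : ℝ) : duhamel n g δ (fun _ => univ) F m t =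
    fun x => ∫ s, mul n (fun y => phase g δ (t - s) y * m y) (F s) x := by
  ext x; rw [duhamel, Measure.restrict_univ]

theorem duhamel_univ_zero (F : ℝ → E n → ℂ) (m : ℝ → ℂ) : duhamel n g δ (fun _ => univ) F m 0 =
    fun x => ∫ s, mul n (fun y => phase g δ (-s) y * m y) (F s) x := by
  simp only [duhamel_univ, zero_sub]

theorem BlockFamily.isPieces_duhamel (hfam : BlockFamily n φ₀ g J σ β γ p A B L)
    (hφ : IsBump φ₀) (hn : n ≤ 3) (hg : ContDiffOn ℝ 2 g (Ioi 0)) (hσ : σ ∈ Ioc (0 : ℝ) 1)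
    (hχ : ContDiffOn ℝ ∞ χ (Ioi 0))
    (hχJ : ∀ y : ℝ, 0 < y → χ y * ((∑' k : ZJ J, Q φ₀ k y : ℝ) : ℂ) = χ y) (hδ : 0 < δ)
    {q r : ℝ≥0∞} (hqr : SharpAdmissible σ q r) {S : ℝ → Set ℝ}
    (hS : MeasurableSet {z : ℝ × ℝ | z.1 ∈ S z.2}) {a : ℝ} {F : ℝ → E n → ℂ} (hF : IsSource F)
    (hfin : ∀ j, mixedNorm q.conjExponent r.conjExponent
      (fun s => pieces n φ₀ (weightSym χ δ a) (F s) j) ≠ ⊤) (t : ℝ) :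
    IsPieces φ₀ fun j => duhamel n g δ S F (cutDyadic φ₀ χ δ j) t :=
  Dispersive.isPieces_duhamel hφ hn hg hδ (contDiffOn_comp_dilate hχ hδ) hS hF t fun j => by
    obtain ⟨M, hM, h⟩ :=
      (hfam.exists_lintegral_cutDyadic_le hφ hn hg hσ hχ hχJ hδ hqr hF (hfin j)).1
    exact ⟨M, hM, h _ (isTimeIso_sub t)⟩

/-- Three inequalities in a chain: the output norm by the ℓ^2 norm of the pieces, each piece by the
corresponding piece of the source, and the ℓ^2 norm of the latter by the input norm. -/
theorem BlockFamily.exists_timeNorm_duhamel_le (hfam : BlockFamily n φ₀ g J σ β γ p A B L)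
    (hφ : IsBump φ₀) (hn : n ≤ 3) (hg : ContDiffOn ℝ 2 g (Ioi 0)) (hσ : σ ∈ Ioc (0 : ℝ) 1)
    (hχ : ContDiffOn ℝ ∞ χ (Ioi 0))
    (hχJ : ∀ y : ℝ, 0 < y → χ y * ((∑' k : ZJ J, Q φ₀ k y : ℝ) : ℂ) = χ y)
    {q r q₂ r₂ : ℝ≥0∞} (hqr : SharpAdmissible σ q r) (hqr₂ : SharpAdmissible σ q₂ r₂)
    {S : ℝ → Set ℝ} (hS : MeasurableSet {z : ℝ × ℝ | z.1 ∈ S z.2}) {c G : ℝ} (hc : 0 < c)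
    (hest : ∀ δ, 0 < δ → ∀ k ∈ ZJ J, ∀ m, IsSym m → (∀ y, 0 ≤ y → p δ k y * m y = m y) →
      ∀ F : ℝ → E n → ℂ, IsSource F → mixedNorm q r (duhamel n g δ S F m) ≤
        ENNReal.ofReal (c * (A * (2 : ℝ) ^ (γ * (k : ℝ)) * δ ^ β) ^ G) *
          mixedNorm q₂.conjExponent r₂.conjExponent (fun s => mul n m (F s))) :
    ∃ c' : ℝ, 0 < c' ∧ ∀ δ, 0 < δ → ∀ F : ℝ → E n → ℂ, IsSource F →
      timeNorm q (fun t => outNorm φ₀ r fun j => duhamel n g δ S F (cutDyadic φ₀ χ δ j) t) ≤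
        ENNReal.ofReal (c' * δ ^ ((β + γ) * G)) * timeNorm q₂.conjExponent
          (fun s => inNorm φ₀ r₂ (pieces n φ₀ (weightSym χ δ (γ * G)) (F s))) := by
  obtain ⟨c₁, hc₁, h₁⟩ := hfam.exists_duhamel_cutDyadic_le hφ hn hg hσ hχ hχJ hqr₂ hS
    (fun s U hU => mixedNorm_sum_le (one_le_of_two_le hqr.1) (one_le_of_two_le hqr.2.1) s hU) hc hest
  obtain ⟨K, hK, hout⟩ := exists_timeNorm_outNorm_le (n := n) hφ hn hqr.1 hqr.2.1
  obtain ⟨K₂, hK₂, hin⟩ := exists_tsum_mixedNorm_le (n := n) hφ hn (hqr₂.two_lt hσ) hqr₂.2.1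
  refine ⟨K * c₁ * K₂, by positivity, fun δ hδ F hF => ?_⟩
  have hw := fun j => (hF.mul hn
    (isSym_mul_Q hφ (contDiffOn_weightSym hχ hδ (γ * G)) j)).aemeasurable_eLpNorm r₂.conjExponent
  have hin' := hin (fun s => pieces n φ₀ (weightSym χ δ (γ * G)) (F s)) hw
  rcases eq_or_ne (timeNorm q₂.conjExponent
    (fun s => inNorm φ₀ r₂ (pieces n φ₀ (weightSym χ δ (γ * G)) (F s)))) ⊤ with ht | ht
  · rw [ht, ENNReal.mul_top]
    · exact le_top
    · rw [ne_eq, ENNReal.ofReal_eq_zero, not_le]; positivity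
  -- A finite right-hand side makes every weighted piece of the source finite in the mixed norm,
  -- which is what the absolute convergence of the Duhamel integrals requires.
  have hfin := fun j => ne_top_of_le_ne_top
    (ne_top_of_le_ne_top (ENNReal.mul_ne_top ENNReal.ofReal_ne_top ht) hin')
    (le_sqrt_tsum (fun j => mixedNorm q₂.conjExponent r₂.conjExponent
      fun s => pieces n φ₀ (weightSym χ δ (γ * G)) (F s) j) j)
  refine (hout _ (hfam.isPieces_duhamel hφ hn hg hσ hχ hχJ hδ hqr₂ hS hF hfin) fun j =>
    measurable_eLpNorm_prod ((isSym_cutDyadic hφ hχ hδ j).stronglyMeasurable_duhamel hg hδ hS hF)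
      r).trans ?_
  refine (mul_le_mul_right ((sqrt_tsum_le_ofReal_mul fun j => h₁ δ hδ F hF j).trans
    (mul_le_mul_right hin' _)) _).trans (le_of_eq ?_)
  exact ofReal_mul_three hK.le hc₁.le (by positivity) _

/-- The dual operator is the full Duhamel integral evaluated at t = 0, so the same machinery applies
with the L^2 norm at that time. -/
theorem BlockFamily.exists_dual_cut_le (hfam : BlockFamily n φ₀ g J σ β γ p A B L)
    (hφ : IsBump φ₀) (hn : n ≤ 3) (hg : ContDiffOn ℝ 2 g (Ioi 0)) (hσ : σ ∈ Ioc (0 : ℝ) 1)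
    (hχ : ContDiffOn ℝ ∞ χ (Ioi 0))
    (hχJ : ∀ y : ℝ, 0 < y → χ y * ((∑' k : ZJ J, Q φ₀ k y : ℝ) : ℂ) = χ y)
    {q r : ℝ≥0∞} (hqr : SharpAdmissible σ q r) :
    ∃ c : ℝ, 0 < c ∧ ∀ δ, 0 < δ → ∀ F : ℝ → E n → ℂ, IsSource F →
      lebesgueNorm φ₀ 2 (fun j => duhamel n g δ (fun _ => univ) F (cutDyadic φ₀ χ δ j) 0) ≤
        ENNReal.ofReal (c * δ ^ ((β + γ) * gap r)) * timeNorm q.conjExponent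
          (fun s => inNorm φ₀ r (pieces n φ₀ (weightSym χ δ (γ * gap r)) (F s))) := by
  obtain ⟨c, hc, hest⟩ := exists_dual_localized_le n hσ hqr hfam.posB hfam.posL
  obtain ⟨c₁, hc₁, h₁⟩ := hfam.exists_duhamel_cutDyadic_le hφ hn hg hσ hχ hχJ hqr
    (S := fun _ => univ) (by simp) (Φ := fun U => eLpNorm (U 0) 2 volume) (fun s U hU => by
      have e : (fun x => ∑ k ∈ s, U k 0 x) = ∑ k ∈ s, U k 0 := by ext x; simp
      show eLpNorm (fun x => ∑ k ∈ s, U k 0 x) 2 volume ≤ _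
      rw [e]
      exact eLpNorm_sum_le (fun k _ =>
        ((hU k).comp_measurable measurable_prodMk_left).aestronglyMeasurable) one_le_two) hc
    (G := gap r) (fun δ hδ k hk m hm hpm F hF => by
      rw [duhamel_univ_zero]
      exact hest (hfam.block δ hδ k hk) m hm hpm F hF)
  obtain ⟨K, hK, hout⟩ := exists_memLp_of_isPieces (n := n) hφ hn le_rfl (by simp)
  obtain ⟨K₂, hK₂, hin⟩ := exists_tsum_mixedNorm_le (n := n) hφ hn (hqr.two_lt hσ) hqr.2.1
  refine ⟨K * c₁ * K₂, by positivity, fun δ hδ F hF => ?_⟩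
  have hw := fun j => (hF.mul hn
    (isSym_mul_Q hφ (contDiffOn_weightSym hχ hδ (γ * gap r)) j)).aemeasurable_eLpNorm r.conjExponent
  have hin' := hin (fun s => pieces n φ₀ (weightSym χ δ (γ * gap r)) (F s)) hw
  rcases eq_or_ne (timeNorm q.conjExponent
    (fun s => inNorm φ₀ r (pieces n φ₀ (weightSym χ δ (γ * gap r)) (F s)))) ⊤ with ht | ht
  · rw [ht, ENNReal.mul_top]
    · exact le_top
    · rw [ne_eq, ENNReal.ofReal_eq_zero, not_le]; positivity
  have hfin := fun j => ne_top_of_le_ne_top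
    (ne_top_of_le_ne_top (ENNReal.mul_ne_top ENNReal.ofReal_ne_top ht) hin')
    (le_sqrt_tsum (fun j => mixedNorm q.conjExponent r.conjExponent
      fun s => pieces n φ₀ (weightSym χ δ (γ * gap r)) (F s) j) j)
  refine (hout _ (hfam.isPieces_duhamel hφ hn hg hσ hχ hχJ hδ hqr (by simp) hF hfin 0)).trans ?_
  refine (mul_le_mul_right ((sqrt_tsum_le_ofReal_mul fun j => h₁ δ hδ F hF j).trans
    (mul_le_mul_right hin' _)) _).trans (le_of_eq ?_)
  exact ofReal_mul_three hK.le hc₁.le (by positivity) _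

/-- The datum does not depend on time, so on the input side the square function estimate for p = 2
is enough. -/
theorem BlockFamily.exists_homogeneous_cut_le (hfam : BlockFamily n φ₀ g J σ β γ p A B L)
    (hφ : IsBump φ₀) (hn : n ≤ 3) (hg : ContDiffOn ℝ 2 g (Ioi 0)) (hσ : σ ∈ Ioc (0 : ℝ) 1)
    (hχ : ContDiffOn ℝ ∞ χ (Ioi 0))
    (hχJ : ∀ y : ℝ, 0 < y → χ y * ((∑' k : ZJ J, Q φ₀ k y : ℝ) : ℂ) = χ y)
    {q r : ℝ≥0∞} (hqr : SharpAdmissible σ q r) :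
    ∃ c : ℝ, 0 < c ∧ ∀ δ, 0 < δ → ∀ f : E n → ℂ, MemLp f 2 volume →
      timeNorm q (fun t => outNorm φ₀ r (pieces n φ₀ (cutSym g χ δ t) f)) ≤
        ENNReal.ofReal (c * δ ^ ((β + γ) * gap r)) *
          lebesgueNorm φ₀ 2 (pieces n φ₀ (weightSym χ δ (γ * gap r)) f) := by
  obtain ⟨c₁, hc₁, h₁⟩ := hfam.exists_homogeneous_cutDyadic_le hφ hn hg hσ hχ hχJ hqr
  obtain ⟨K, hK, hout⟩ := exists_timeNorm_outNorm_le (n := n) hφ hn hqr.1 hqr.2.1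
  obtain ⟨K₂, hK₂, hin⟩ := exists_besovNorm_le (n := n) hφ hn (by norm_num) le_rfl
  refine ⟨K * c₁ * K₂, by positivity, fun δ hδ f hf => ?_⟩
  have hpc : ∀ t, IsPieces φ₀ (pieces n φ₀ (cutSym g χ δ t) f) := fun t =>
    isPieces_mul hφ hn ((contDiffOn_phase hg hδ t).mul (contDiffOn_comp_dilate hχ hδ)) one_le_two hf
  have hmeas : ∀ j, Measurable fun t =>
      eLpNorm (pieces n φ₀ (cutSym g χ δ t) f j) r volume := fun j => by
    have e : (fun t => pieces n φ₀ (cutSym g χ δ t) f j) =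
        fun t => mul n (fun y => phase g δ t y * cutDyadic φ₀ χ δ j y) (hf.1.mk f) := by
      ext t : 1; rw [pieces_cutSym]; exact mul_congr_ae hf.1.ae_eq_mk
    refine measurable_eLpNorm_prod (U := fun t => pieces n φ₀ (cutSym g χ δ t) f j) ?_ r
    rw [e]
    exact (isSym_cutDyadic hφ hχ hδ j).stronglyMeasurable_mul_phase hg hδ (τ := fun t : ℝ => t)
      measurable_id (v := fun _ => hf.1.mk f)
      (hf.1.stronglyMeasurable_mk.comp_measurable measurable_snd)
  refine (hout _ hpc hmeas).trans ?_
  simp only [pieces_cutSym]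
  refine (mul_le_mul_right ((sqrt_tsum_le_ofReal_mul fun j => h₁ δ hδ f hf j).trans
    (mul_le_mul_right (hin _) _)) _).trans (le_of_eq ?_)
  exact ofReal_mul_three hK.le hc₁.le (by positivity) _

theorem BlockFamily.summed_estimates (hfam : BlockFamily n φ₀ g J σ β γ p A B L)
    (hφ : IsBump φ₀) (hn : n ≤ 3) (hg : ContDiffOn ℝ 2 g (Ioi 0)) (hσ : σ ∈ Ioc (0 : ℝ) 1)
    (hχ : ContDiffOn ℝ ∞ χ (Ioi 0))
    (hχJ : ∀ y : ℝ, 0 < y → χ y * ((∑' k : ZJ J, Q φ₀ k y : ℝ) : ℂ) = χ y)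
    (q r q₂ r₂ : ℝ≥0∞) (hqr : SharpAdmissible σ q r) (hqr₂ : SharpAdmissible σ q₂ r₂) :
    ∃ C₂ : ℝ, 0 < C₂ ∧ ∀ δ : ℝ, 0 < δ →
      (∀ f : E n → ℂ, MemLp f 2 volume →
        timeNorm q (fun t => outNorm φ₀ r (pieces n φ₀ (cutSym g χ δ t) f)) ≤
          ENNReal.ofReal (C₂ * δ ^ ((β + γ) * gap r)) *
            lebesgueNorm φ₀ 2 (pieces n φ₀ (weightSym χ δ (γ * gap r)) f)) ∧
      ∀ F : ℝ → E n → ℂ, IsSource F →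
        ((timeNorm q.conjExponent
              (fun s => inNorm φ₀ r (pieces n φ₀ (weightSym χ δ (γ * gap r)) (F s))) < ⊤ →
            ∀ j x, Integrable (fun s => pieces n φ₀ (cutSym g χ δ (-s)) (F s) j x) volume) ∧
          lebesgueNorm φ₀ 2 (fun j x => ∫ s, pieces n φ₀ (cutSym g χ δ (-s)) (F s) j x) ≤
            ENNReal.ofReal (C₂ * δ ^ ((β + γ) * gap r)) *
              timeNorm q.conjExponent
                (fun s => inNorm φ₀ r (pieces n φ₀ (weightSym χ δ (γ * gap r)) (F s)))) ∧
        (timeNorm q₂.conjExponent (fun s => inNorm φ₀ r₂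
              (pieces n φ₀ (weightSym χ δ (γ * (gap r + gap r₂))) (F s))) < ⊤ →
            ∀ t j x,
              Integrable (fun s => pieces n φ₀ (cutSym g χ δ (t - s)) (F s) j x) volume) ∧
        timeNorm q (fun t => outNorm φ₀ r
            (fun j x => ∫ s, pieces n φ₀ (cutSym g χ δ (t - s)) (F s) j x)) ≤
          ENNReal.ofReal (C₂ * δ ^ ((β + γ) * (gap r + gap r₂))) *
            timeNorm q₂.conjExponent (fun s => inNorm φ₀ r₂
              (pieces n φ₀ (weightSym χ δ (γ * (gap r + gap r₂))) (F s))) ∧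
        timeNorm q (fun t => outNorm φ₀ r
            (fun j x => ∫ s in Iio t, pieces n φ₀ (cutSym g χ δ (t - s)) (F s) j x)) ≤
          ENNReal.ofReal (C₂ * δ ^ ((β + γ) * (gap r + gap r₂))) *
            timeNorm q₂.conjExponent (fun s => inNorm φ₀ r₂
              (pieces n φ₀ (weightSym χ δ (γ * (gap r + gap r₂))) (F s))) := by
  obtain ⟨c₃, hc₃, h₃⟩ := exists_inhomogeneous_localized_le n hσ hqr hqr₂ hfam.posB hfam.posL
  obtain ⟨c₄, hc₄, h₄⟩ := exists_retarded_localized_le n hσ hqr hqr₂ hfam.posB hfam.posL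
  obtain ⟨a₁, ha₁, e₁⟩ := hfam.exists_homogeneous_cut_le hφ hn hg hσ hχ hχJ hqr
  obtain ⟨a₂, ha₂, e₂⟩ := hfam.exists_dual_cut_le hφ hn hg hσ hχ hχJ hqr
  obtain ⟨a₃, ha₃, e₃⟩ := hfam.exists_timeNorm_duhamel_le hφ hn hg hσ hχ hχJ hqr hqr₂
    (S := fun _ => univ) (G := gap r + gap r₂) (by simp) hc₃ fun δ hδ k hk m hm hpm F hF => by
      simp only [mixedNorm, duhamel_univ]
      exact h₃ (hfam.block δ hδ k hk) m hm hpm F hF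
  obtain ⟨a₄, ha₄, e₄⟩ := hfam.exists_timeNorm_duhamel_le hφ hn hg hσ hχ hχJ hqr hqr₂
    (S := fun t => Iio t) (G := gap r + gap r₂) (measurableSet_lt measurable_fst measurable_snd) hc₄
    fun δ hδ k hk m hm hpm F hF => h₄ (hfam.block δ hδ k hk) m hm hpm F hF
  have hmono : ∀ {a x : ℝ} (z : ℝ≥0∞), 0 ≤ x → a ≤ a₁ + a₂ + a₃ + a₄ →
      ENNReal.ofReal (a * x) * z ≤ ENNReal.ofReal ((a₁ + a₂ + a₃ + a₄) * x) * z :=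
    fun z hx h => mul_le_mul_left (ENNReal.ofReal_le_ofReal (mul_le_mul_of_nonneg_right h hx)) z
  -- Absolute convergence of all dyadic time integrals, for both admissible pairs and both time
  -- substitutions s ↦ -s and s ↦ t - s.
  have hint : ∀ {q' r' : ℝ≥0∞}, SharpAdmissible σ q' r' → ∀ {δ a : ℝ}, 0 < δ →
      ∀ F : ℝ → E n → ℂ, IsSource F → timeNorm q'.conjExponent (fun s => inNorm φ₀ r'
        (pieces n φ₀ (weightSym χ δ a) (F s))) < ⊤ → ∀ θ, IsTimeIso θ → ∀ j x,
      Integrable (fun s => mul n (fun y => phase g δ (θ s) y * cutDyadic φ₀ χ δ j y) (F s) x)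
        volume := by
    intro q' r' h' δ a hδ F hF hlt θ hθ j x
    obtain ⟨K₂, -, hin⟩ := exists_tsum_mixedNorm_le (n := n) hφ hn (h'.two_lt hσ) h'.2.1
    have hin' := hin (fun s => pieces n φ₀ (weightSym χ δ a) (F s)) fun j =>
      (hF.mul hn (isSym_mul_Q hφ (contDiffOn_weightSym hχ hδ a) j)).aemeasurable_eLpNorm _
    exact (hfam.exists_lintegral_cutDyadic_le hφ hn hg hσ hχ hχJ hδ h' hF (ne_top_of_le_ne_top
      (ne_top_of_le_ne_top (ENNReal.mul_ne_top ENNReal.ofReal_ne_top hlt.ne) hin')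
      (le_sqrt_tsum (fun j => mixedNorm q'.conjExponent r'.conjExponent
        fun s => pieces n φ₀ (weightSym χ δ a) (F s) j) j))).2 θ hθ x
  refine ⟨a₁ + a₂ + a₃ + a₄, by positivity, fun δ hδ => ⟨fun f hf =>
    (e₁ δ hδ f hf).trans (hmono _ (by positivity) (by linarith)), fun F hF =>
    ⟨⟨fun hlt j x => ?_, ?_⟩, fun hlt t j x => ?_, ?_, ?_⟩⟩⟩
  · simpa only [pieces_cutSym] using hint hqr hδ F hF hlt _ isTimeIso_neg j x
  · have := e₂ δ hδ F hF
    simp only [pieces_cutSym]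
    simp only [duhamel_univ_zero] at this
    exact this.trans (hmono _ (by positivity) (by linarith))
  · simpa only [pieces_cutSym] using hint hqr₂ hδ F hF hlt _ (isTimeIso_sub t) j x
  · have := e₃ δ hδ F hF
    simp only [pieces_cutSym]
    simp only [duhamel_univ] at this
    exact this.trans (hmono _ (by positivity) (by linarith))
  · have := e₄ δ hδ F hF
    simp only [pieces_cutSym]
    exact this.trans (hmono _ (by positivity) (by linarith))

end Dispersive

end

/-! ### The theorem -/

open Dispersive in
theorem mainTheorem2 (n : ℕ) (hn : n = 1 ∨ n = 2)
    (φ₀ : ℝ → ℝ) (hφ₀ : IsBump φ₀)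
    (g : ℝ → ℝ) (hg : ContDiffOn ℝ 2 g (Ioi 0))
    (J : Set ℝ) (hJ : J ⊆ Ici 0)
    (C σ β γ : ℝ) (hC : 0 < C) (hσ : σ ∈ Ioc (0 : ℝ) 1)
    (P : ℝ → ℂ) (hP : ContDiff ℝ ∞ P)
    (hPsupp : Function.support P ⊆ {y | 1 / 2 ≤ |y| ∧ |y| ≤ 2})
    (hPone : ∀ y : ℝ, 3 / 5 ≤ |y| → |y| ≤ 8 / 5 → P y = 1)
    (hdisp : ∀ t : ℝ, t ≠ 0 → ∀ δ : ℝ, 0 < δ → ∀ k ∈ ZJ J, ∀ x : E n,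
      ‖dyadicIntegral n g P 0 δ t k x‖ ≤ C * (2 : ℝ) ^ (γ * (k : ℝ)) * (δ ^ β / |t| ^ σ)) :
    -- estimates on dyadic blocks
    (∀ q r q₂ r₂ : ℝ≥0∞, SharpAdmissible σ q r → SharpAdmissible σ q₂ r₂ →
      ∃ C₁ : ℝ, 0 < C₁ ∧ ∀ δ : ℝ, 0 < δ → ∀ k ∈ ZJ J,
        -- homogeneous
        (∀ f : E n → ℂ, MemLp f 2 volume →
          mixedNorm q r (fun t => mul n (blockSym φ₀ g δ k t) f) ≤
            ENNReal.ofReal (C₁ * (2 : ℝ) ^ (γ * gap r * (k : ℝ)) * δ ^ (β * gap r)) *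
              eLpNorm (mul n (blockProj φ₀ δ k) f) 2 volume) ∧
        ∀ F : ℝ → E n → ℂ, IsSource F →
          -- dual
          ((mixedNorm q.conjExponent r.conjExponent
                (fun s => mul n (blockProj φ₀ δ k) (F s)) < ⊤ →
              ∀ x, Integrable (fun s => mul n (blockSym φ₀ g δ k (-s)) (F s) x) volume) ∧
            eLpNorm (fun x => ∫ s, mul n (blockSym φ₀ g δ k (-s)) (F s) x) 2 volume ≤
              ENNReal.ofReal (C₁ * (2 : ℝ) ^ (γ * gap r * (k : ℝ)) * δ ^ (β * gap r)) *
                mixedNorm q.conjExponent r.conjExponent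
                  (fun s => mul n (blockProj φ₀ δ k) (F s))) ∧
          -- inhomogeneous and retarded
          (mixedNorm q₂.conjExponent r₂.conjExponent
                (fun s => mul n (blockProj φ₀ δ k) (F s)) < ⊤ →
              ∀ t x, Integrable (fun s => mul n (blockSym φ₀ g δ k (t - s)) (F s) x) volume) ∧
          mixedNorm q r (fun t x => ∫ s, mul n (blockSym φ₀ g δ k (t - s)) (F s) x) ≤
            ENNReal.ofReal (C₁ * (2 : ℝ) ^ (γ * (gap r + gap r₂) * (k : ℝ)) *
                δ ^ (β * (gap r + gap r₂))) *
              mixedNorm q₂.conjExponent r₂.conjExponent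
                (fun s => mul n (blockProj φ₀ δ k) (F s)) ∧
          mixedNorm q r (fun t x => ∫ s in Iio t, mul n (blockSym φ₀ g δ k (t - s)) (F s) x) ≤
            ENNReal.ofReal (C₁ * (2 : ℝ) ^ (γ * (gap r + gap r₂) * (k : ℝ)) *
                δ ^ (β * (gap r + gap r₂))) *
              mixedNorm q₂.conjExponent r₂.conjExponent
                (fun s => mul n (blockProj φ₀ δ k) (F s))) ∧
    -- summed estimates
    (∀ χ : ℝ → ℂ, ContDiffOn ℝ ∞ χ (Ioi 0) → (∃ B : ℝ, ∀ y : ℝ, 0 < y → ‖χ y‖ ≤ B) →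
      (∀ y : ℝ, 0 < y → χ y * ((∑' k : ZJ J, Q φ₀ k y : ℝ) : ℂ) = χ y) →
      ∀ q r q₂ r₂ : ℝ≥0∞, SharpAdmissible σ q r → SharpAdmissible σ q₂ r₂ →
      ∃ C₂ : ℝ, 0 < C₂ ∧ ∀ δ : ℝ, 0 < δ →
        -- homogeneous
        (∀ f : E n → ℂ, MemLp f 2 volume →
          timeNorm q (fun t => outNorm φ₀ r (pieces n φ₀ (cutSym g χ δ t) f)) ≤
            ENNReal.ofReal (C₂ * δ ^ ((β + γ) * gap r)) *
              lebesgueNorm φ₀ 2 (pieces n φ₀ (weightSym χ δ (γ * gap r)) f)) ∧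
        ∀ F : ℝ → E n → ℂ, IsSource F →
          -- dual
          ((timeNorm q.conjExponent
                (fun s => inNorm φ₀ r (pieces n φ₀ (weightSym χ δ (γ * gap r)) (F s))) < ⊤ →
              ∀ j x, Integrable (fun s => pieces n φ₀ (cutSym g χ δ (-s)) (F s) j x) volume) ∧
            lebesgueNorm φ₀ 2 (fun j x => ∫ s, pieces n φ₀ (cutSym g χ δ (-s)) (F s) j x) ≤
              ENNReal.ofReal (C₂ * δ ^ ((β + γ) * gap r)) *
                timeNorm q.conjExponent
                  (fun s => inNorm φ₀ r (pieces n φ₀ (weightSym χ δ (γ * gap r)) (F s)))) ∧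
          -- inhomogeneous and retarded
          (timeNorm q₂.conjExponent (fun s => inNorm φ₀ r₂
                (pieces n φ₀ (weightSym χ δ (γ * (gap r + gap r₂))) (F s))) < ⊤ →
              ∀ t j x,
                Integrable (fun s => pieces n φ₀ (cutSym g χ δ (t - s)) (F s) j x) volume) ∧
          timeNorm q (fun t => outNorm φ₀ r
              (fun j x => ∫ s, pieces n φ₀ (cutSym g χ δ (t - s)) (F s) j x)) ≤
            ENNReal.ofReal (C₂ * δ ^ ((β + γ) * (gap r + gap r₂))) *
              timeNorm q₂.conjExponent (fun s => inNorm φ₀ r₂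
                (pieces n φ₀ (weightSym χ δ (γ * (gap r + gap r₂))) (F s))) ∧
          timeNorm q (fun t => outNorm φ₀ r
              (fun j x => ∫ s in Iio t, pieces n φ₀ (cutSym g χ δ (t - s)) (F s) j x)) ≤
            ENNReal.ofReal (C₂ * δ ^ ((β + γ) * (gap r + gap r₂))) *
              timeNorm q₂.conjExponent (fun s => inNorm φ₀ r₂
                (pieces n φ₀ (weightSym χ δ (γ * (gap r + gap r₂))) (F s)))) := by
  obtain ⟨p, A, B, L, hfam⟩ := exists_blockFamily hn hφ₀ hg hC hP hPsupp hPone hdisp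
  have hn3 : n ≤ 3 := by omega
  exact ⟨hfam.block_estimates hφ₀ hσ, fun χ hχ _ hχJ =>
    hfam.summed_estimates hφ₀ hn3 hg hσ hχ hχJ⟩
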